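/- **Lattice paths.** For $n\ge 0$ and $k_1,\dots,k_n,l\ge 0$, a marked lattice path in the hypercube $[k_1+1]\times\cdots\times[k_n+1]$ is a path from $(0,\dots,0)$ to $(k_1+1,\dots,k_n+1)$ by unit steps in the coordinate directions, each of whose points $x$ carries a marking $\mu(x)\in\{0,1,2,\dots\}$, with $\sum_x\mu(x)=l$. Equivalently, it is an endpoint-preserving functor $\varphi$ from the ordinal $[l+1]$ to the category $[k_1+1]\otimes\cdots\otimes[k_n+1]$ freely generated by the oriented grid. An angle of a path is a point at which it changes its direction, and the complexity of a path is the maximum, over $i<j$, of the number of angles of its projection to the $(i,j)$-th face ($0$ if $n\le 1$). Let $\mathrm{Lat}_c(k_1,\dots,k_n;l)$ be the set of marked lattice paths of complexity at most $c$ ($c\in\{0,1,2,\dots\}\cup\{\infty\}$), and also the free abelian group on it. Composition of functors makes $\mathrm{Lat}_c$ an operad with set of colours $\{0,1,2,\dots\}$, and makes $\mathrm{Lat}_c(\bullet,\dots,\bullet;\bullet)$ an $n$-simplicial cosimplicial abelian group: the simplicial faces collapse a step, adding the markings of its ends; the simplicial degeneracies subdivide a step by an unmarked point; the cofaces increase the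 marking of a point $\varphi(i)$ by $1$ and the codegeneracies decrease it by $1$. **Four dg-operads.** All dg-operads are symmetric, cohomologically graded, over $\mathbb Z$, with arities $n\ge 0$. * $|\mathrm{Lat}_c|(n)^p=\prod_{l\ge 0}\bigoplus_{l-(k_1+\cdots+k_n)=p}\mathrm{Lat}_c(k_1,\dots,k_n;l)$, with the differential that is the sum of the simplicial differential $\partial=\sum_r(-1)^{k_1+\cdots+k_{r-1}}\sum_i(-1)^i\partial^r_i$ and $-(-1)^p\sum_i(-1)^i\delta^i$. For $f$ of arity $n$ and $g$ of arity $m$, the part of $f\circ_i g$ with $l$ marks is $\sum \pm\, f_{k_1,\dots,k_n;l}\circ_i g_{j_1,\dots,j_m;k_i}$, with sign $(-1)^{|g|(|f|+k_1+\cdots+k_{i-1})}$; permutations act by relabelling the directions, with the Koszul sign of the permutation of objects of degrees $k_1,\dots,k_n$; the unit is the sum over $l$ of the identities of $l$. * $\mathrm{Br}_c(n)^p=\bigoplus_{-(k_1+\cdots+k_n)=p}\mathrm{Lat}_c(k_1,\dots,k_n;0)$, with the differential $\partial$, the above action of permutations, the path with one step as the unit, and $f\circ_i g:=f\circ_i w(g)$,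 where on the right is the composition of $|\mathrm{Lat}_c|$ and $w$ is the whiskering below. * $N(\mathrm{Br}_c)(n)$ is the quotient of $\mathrm{Br}_c(n)$ by the images of all simplicial degeneracies, with the induced structure. * $|N(\mathrm{Lat}_c)|(n)$ is the normalized cosimplicial totalization of the simplicial normalization of $\mathrm{Lat}_c$: one divides $|\mathrm{Lat}_c|(n)$ by the images of the simplicial degeneracies and takes in the quotient the intersection of the kernels of all codegeneracies, with the induced structure. The whiskering is $w(v)=\sum_{l\ge0}w_l(v)$, where $w_l(v)$ is the signed sum of all marked paths obtained from the unmarked path $v$ by inserting $l$ new distinct internal points (points that are neither angles nor end points), each marked by $1$. If $v$ has the steps $v_1,\dots,v_N$ in the directions $a_1,\dots,a_N$, if $s_t$ new points are inserted into the step $v_t$, and if $\epsilon_t$ is $0$ when $v_t$ is the last step in its direction and $1$ otherwise, then the sign is $(-1)^e$ with $$e=\sum_t \epsilon_t(s_1+\cdots+s_t)+\sum_{t<t',\ a_t>a_{t'}}(s_ts_{t'}+s_t\epsilon_{t'}+\epsilon_ts_{t'}).$$ **Theorem.** For every complexity $c\ge 0$ (with $c=\infty$ allowed), the above are well defined dg-operads,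 and $$|\mathrm{Lat}_c|\xleftarrow{\ w\ }\mathrm{Br}_c\xrightarrow{\ \pi\ }N(\mathrm{Br}_c)\xrightarrow{\ w\ }|N(\mathrm{Lat}_c)|,$$ where both maps $w$ are given by the whiskering and $\pi$ is the projection to the quotient, is a chain of morphisms of dg-operads which are weak equivalences, that is, which induce isomorphisms of homology in each arity $n\ge 0$. -/

import Mathlib

open CategoryTheory

noncomputable section

namespace LatticePaths

/-! ## Differential graded operads -/

/-- The position of the `a`-th input of `f` (where `a ≠ i`) among the inputs of `f ∘ᵢ g`, when `g`
has `m` inputs; all inputs are numbered from `0`. The `b`-th input of `g` gets the position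
`i + b`. -/
def slot (m i a : ℕ) : ℕ := if a < i then a else a + m - 1

/-- A symmetric unital operad in the category of (cohomologically graded) cochain complexes of
abelian groups, in terms of partial compositions. `perm σ f` is `f` with its inputs relabelled: the
`a`-th input of `f` becomes the `σ a`-th input of `perm σ f`. -/
structure DGOperad where
  cpx : ℕ → CochainComplex AddCommGrpCat.{0} ℤ
  one : (cpx 1).X 0
  comp : ∀ {n m r : ℕ} {p q s : ℤ} (_ : Fin n) (_ : n + m = r + 1) (_ : p + q = s),
    (cpx n).X p →+ (cpx m).X q →+ (cpx r).X s
  perm : ∀ {n : ℕ} (_ : Equiv.Perm (Fin n)), cpx n ⟶ cpx n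
  d_one : (cpx 1).d 0 1 one = 0
  d_comp : ∀ {n m r : ℕ} {p q s : ℤ} (i : Fin n) (hr : n + m = r + 1) (hs : p + q = s)
    (f : (cpx n).X p) (g : (cpx m).X q),
    (cpx r).d s (s + 1) (comp i hr hs f g) =
      comp i hr (by omega) ((cpx n).d p (p + 1) f) g +
        p.negOnePow • comp i hr (by omega) f ((cpx m).d q (q + 1) g)
  one_comp : ∀ {m : ℕ} {q : ℤ} (g : (cpx m).X q),
    comp (0 : Fin 1) (Nat.add_comm 1 m) (zero_add q) one g = g
  comp_one : ∀ {n : ℕ} {p : ℤ} (i : Fin n) (f : (cpx n).X p),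
    comp i rfl (add_zero p) f one = f
  assoc_seq : ∀ {n m k r r' u : ℕ} {p q t s s' v : ℤ} (i : Fin n) (j : Fin m) (x : Fin r)
    (_ : (x : ℕ) = i + j)
    (hr : n + m = r + 1) (hs : p + q = s) (hr' : m + k = r' + 1) (hs' : q + t = s')
    (hu : r + k = u + 1) (hv : s + t = v) (hu' : n + r' = u + 1) (hv' : p + s' = v)
    (f : (cpx n).X p) (g : (cpx m).X q) (h : (cpx k).X t),
    comp x hu hv (comp i hr hs f g) h = comp i hu' hv' f (comp j hr' hs' g h)
  assoc_par : ∀ {n m k r r' u : ℕ} {p q t s s' v : ℤ} (i j : Fin n) (_ : i < j)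
    (x : Fin r) (_ : (x : ℕ) + 1 = j + m) (y : Fin r') (_ : (y : ℕ) = i)
    (hr : n + m = r + 1) (hs : p + q = s) (hr' : n + k = r' + 1) (hs' : p + t = s')
    (hu : r + k = u + 1) (hv : s + t = v) (hu' : r' + m = u + 1) (hv' : s' + q = v)
    (f : (cpx n).X p) (g : (cpx m).X q) (h : (cpx k).X t),
    comp x hu hv (comp i hr hs f g) h =
      (q * t).negOnePow • comp y hu' hv' (comp j hr' hs' f h) g
  perm_one : ∀ (n : ℕ), perm (1 : Equiv.Perm (Fin n)) = 𝟙 (cpx n)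
  perm_mul : ∀ {n : ℕ} (σ τ : Equiv.Perm (Fin n)), perm (σ * τ) = perm τ ≫ perm σ
  /-- Here `ρ` is the block permutation determined by `σ` and `τ`. -/
  perm_comp : ∀ {n m r : ℕ} {p q s : ℤ} (i : Fin n) (hr : n + m = r + 1) (hs : p + q = s)
    (σ : Equiv.Perm (Fin n)) (τ : Equiv.Perm (Fin m)) (ρ : Equiv.Perm (Fin r))
    (_ : ∀ (a : Fin n) (x y : Fin r), a ≠ i → (x : ℕ) = slot m i a →
      (y : ℕ) = slot m (σ i) (σ a) → ρ x = y)
    (_ : ∀ (b : Fin m) (x y : Fin r), (x : ℕ) = i + b → (y : ℕ) = σ i + τ b → ρ x = y)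
    (f : (cpx n).X p) (g : (cpx m).X q),
    comp (σ i) hr hs ((perm σ).f p f) ((perm τ).f q g) = (perm ρ).f s (comp i hr hs f g)

/-- Morphisms of dg-operads. -/
structure DGOperad.Hom (P Q : DGOperad) where
  app : ∀ n : ℕ, P.cpx n ⟶ Q.cpx n
  map_one : (app 1).f 0 P.one = Q.one
  map_comp : ∀ {n m r : ℕ} {p q s : ℤ} (i : Fin n) (hr : n + m = r + 1) (hs : p + q = s)
    (f : (P.cpx n).X p) (g : (P.cpx m).X q),
    (app r).f s (P.comp i hr hs f g) = Q.comp i hr hs ((app n).f p f) ((app m).f q g)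
  map_perm : ∀ {n : ℕ} (σ : Equiv.Perm (Fin n)), P.perm σ ≫ app n = app n ≫ Q.perm σ

/-- A weak equivalence of dg-operads: a homology isomorphism in each arity. -/
def DGOperad.Hom.IsWeakEquivalence {P Q : DGOperad} (φ : P.Hom Q) : Prop :=
  ∀ n : ℕ, QuasiIso (φ.app n)

/-- Explicit data for a dg-operad whose part of arity `n` and degree `p` is the subquotient
`Z n p / (Z n p ∩ B n p)` of a fixed abelian group `U`, with structure operations given by formulas
on representatives. (`d n`, `comp n m i` and `perm n` are the formulas for the differential in
arity `n`, for `∘ᵢ` of an element of arity `n` with one of arity `m`, and for the action of the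
`n`-th symmetric group.) That these formulas do induce a dg-operad is the content of
`OperadData.Realization`. -/
structure OperadData (U : Type) [AddCommGroup U] where
  Z : ℕ → ℤ → Submodule ℤ U
  B : ℕ → ℤ → Submodule ℤ U
  d : ℕ → U → U
  one : U
  comp : ℕ → ℕ → ℕ → U → U → U
  perm : ∀ n : ℕ, Equiv.Perm (Fin n) → U → U

/-- `D.Realization P`: the formulas of `D` are well defined on the subquotients `Z n p / B n p`, and
`P` is the resulting dg-operad; `cls` sends a representative to its class. -/
structure OperadData.Realization {U : Type} [AddCommGroup U] (D : OperadData U)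
    (P : DGOperad) where
  cls : ∀ (n : ℕ) (p : ℤ), D.Z n p →+ (P.cpx n).X p
  cls_surjective : ∀ (n : ℕ) (p : ℤ), Function.Surjective (cls n p)
  cls_eq_zero_iff : ∀ (n : ℕ) (p : ℤ) (x : D.Z n p), cls n p x = 0 ↔ (x : U) ∈ D.B n p
  d_cls : ∀ (n : ℕ) (p : ℤ) (x : D.Z n p), ∃ h : D.d n x ∈ D.Z n (p + 1),
    (P.cpx n).d p (p + 1) (cls n p x) = cls n (p + 1) ⟨D.d n x, h⟩
  one_cls : ∃ h : D.one ∈ D.Z 1 0, P.one = cls 1 0 ⟨D.one, h⟩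
  comp_cls : ∀ {n m r : ℕ} {p q s : ℤ} (i : Fin n) (hr : n + m = r + 1) (hs : p + q = s)
    (x : D.Z n p) (y : D.Z m q), ∃ h : D.comp n m i x y ∈ D.Z r s,
    P.comp i hr hs (cls n p x) (cls m q y) = cls r s ⟨D.comp n m i x y, h⟩
  perm_cls : ∀ {n : ℕ} (p : ℤ) (σ : Equiv.Perm (Fin n)) (x : D.Z n p),
    ∃ h : D.perm n σ x ∈ D.Z n p, (P.perm σ).f p (cls n p x) = cls n p ⟨D.perm n σ x, h⟩

/-- The morphism `φ` of dg-operads is given on representatives by the formula `w`. -/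
def DGOperad.Hom.IsInducedBy {U : Type} [AddCommGroup U] {D E : OperadData U} {P Q : DGOperad}
    (φ : P.Hom Q) (hP : D.Realization P) (hQ : E.Realization Q) (w : U → U) : Prop :=
  ∀ (n : ℕ) (p : ℤ) (x : D.Z n p), ∃ h : w x ∈ E.Z n p,
    (φ.app n).f p (hP.cls n p x) = hQ.cls n p ⟨w x, h⟩

/-! ## Marked lattice paths -/

/-- A marked lattice path in a hypercube `[k₀+1] × ⋯ × [kₙ₋₁+1]` is written as a word: the letter
`some a` is a unit step in the direction `a`, and the letter `none` is a mark put on the current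
lattice point. So the path starts at the origin, `some a` occurs `k_a + 1` times, and the marking of
a lattice point is the number of letters `none` between the step into this point and the step out of
it. As a functor `φ : [l+1] → [k₀+1] ⊗ ⋯ ⊗ [kₙ₋₁+1]`, where `l` is the number of marks, the word
sends `t - 1 → t` to the part of the path between the `(t-1)`-st and the `t`-th mark, the ends of
the word counting as the `0`-th and the `(l+1)`-st mark. -/
abbrev Word : Type := List (Option ℕ)

/-- The number `l` of marks. -/
def marks (v : Word) : ℕ := v.count none

/-- The number `k_a`, where `k_a + 1` is the length of the hypercube in the direction `a`. -/
def dim (v : Word) (a : ℕ) : ℕ := v.count (some a) - 1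

/-- The sum `k₀ + ⋯ + kₙ₋₁`. -/
def total (n : ℕ) (v : Word) : ℕ := ∑ a ∈ Finset.range n, dim v a

/-- `v` is a marked path in an `n`-dimensional hypercube with sides of lengths `k_a + 1 ≥ 1`. -/
def IsPath (n : ℕ) (v : Word) : Prop := ∀ a : ℕ, some a ∈ v ↔ a < n

/-- The number of changes of direction of a path without marks. -/
def changes : Word → ℕ
  | x :: y :: t => (if x = y then 0 else 1) + changes (y :: t)
  | _ => 0

/-- The number of angles of the projection of a path to the face in the directions `a`, `b`. -/
def angles (a b : ℕ) (v : Word) : ℕ := changes (v.filter fun x => x = some a ∨ x = some b)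

/-- The `n`-dimensional marked path `v` has complexity at most `c`. -/
def ComplexityLE (c : ℕ∞) (n : ℕ) (v : Word) : Prop :=
  ∀ a b : ℕ, a < b → b < n → (angles a b v : ℕ∞) ≤ c

/-- The union of the sets `Lat_c(k₀, …, kₙ₋₁; l)` with `l - (k₀ + ⋯ + kₙ₋₁) = p`. -/
def lat (c : ℕ∞) (n l : ℕ) (p : ℤ) : Set Word :=
  {v | IsPath n v ∧ marks v = l ∧ ComplexityLE c n v ∧ (l : ℤ) - total n v = p}

/-- Delete the `i`-th occurrence (from `0`) of the letter `x`. -/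
def eraseNth : ℕ → Option ℕ → Word → Word
  | _, _, [] => []
  | i, x, y :: t =>
    if y = x then
      match i with
      | 0 => t
      | i + 1 => y :: eraseNth i x t
    else y :: eraseNth i x t

/-- Double the `i`-th occurrence (from `0`) of the letter `x`. -/
def doubleNth : ℕ → Option ℕ → Word → Word
  | _, _, [] => []
  | i, x, y :: t =>
    if y = x then
      match i with
      | 0 => y :: y :: t
      | i + 1 => y :: doubleNth i x t
    else y :: doubleNth i x t

/-- The simplicial face `∂^r_i`: collapse the `i`-th step in the direction `r`, adding the markings
of its two ends. -/
def face (r i : ℕ) (v : Word) : Word := eraseNth i (some r) v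

/-- The simplicial degeneracy `σ^r_i`: subdivide the `i`-th step in the direction `r` by an unmarked
internal point. -/
def degeneracy (r i : ℕ) (v : Word) : Word := doubleNth i (some r) v

/-- The cosimplicial coface `δ^i`, `0 ≤ i ≤ l + 1`, where `l` is the number of marks: add a mark at
the lattice point `φ(i)`, which is the initial point for `i = 0`, the final one for `i = l + 1`, and
otherwise the one that carries the `i`-th mark, counted from `1`. -/
def coface (i : ℕ) (v : Word) : Word :=
  if i = 0 then none :: v
  else if i ≤ marks v then doubleNth (i - 1) none v
  else v ++ [none]

/-- The cosimplicial codegeneracy `s^i`: remove one mark, the `i`-th counted from `0`. -/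
def codegeneracy (i : ℕ) (v : Word) : Word := eraseNth i none v

/-- Composition in the coloured operad of lattice paths: the `t`-th step of `v` in the direction `i`
is replaced by the part of the path `u` between its `(t-1)`-st and `t`-th mark. The second word
argument is given as the list of these parts; `m` is the dimension of `u`. -/
def substAux (m i : ℕ) : Word → List Word → Word
  | [], _ => []
  | none :: v, S => none :: substAux m i v S
  | some a :: v, S =>
    if a = i then S.headI.map (Option.map (i + ·)) ++ substAux m i v S.tail
    else some (slot m i a) :: substAux m i v S

/-- The composition `v ∘ᵢ u` of words. -/
def subst (m i : ℕ) (v u : Word) : Word := substAux m i v (u.splitOn none)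

/-! ## Linear operations

An element of `Cochain` is a family, indexed by the number `l` of marks, of finite linear
combinations of words. -/

/-- The group `∏ₗ ⊕ ℤ·v`, the sum being over all words `v`. -/
abbrev Cochain : Type := ℕ → (Word →₀ ℤ)

/-- The linear extension of a map from words to linear combinations of words. -/
def extend (φ : Word → (Word →₀ ℤ)) (x : Word →₀ ℤ) : Word →₀ ℤ := x.sum fun v a => a • φ v

/-- The parity of the degree `l - (k₀ + ⋯ + kₙ₋₁)` of `v`. -/
def parity (n : ℕ) (v : Word) : ℕ := marks v + total n v

/-- The simplicial differential `∂ = ∂⁰ + ⋯ + ∂ⁿ⁻¹` of a single path, where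
`∂^r = (-1)^(k₀ + ⋯ + k_{r-1}) ∑ᵢ (-1)^i ∂^r_i` on paths with `k_r ≥ 1`, and `∂^r = 0` on paths with
`k_r = 0`. -/
def bdryWord (n : ℕ) (v : Word) : Word →₀ ℤ :=
  ∑ r ∈ Finset.range n, if dim v r = 0 then 0 else
    ∑ i ∈ Finset.range (dim v r + 1), Finsupp.single (face r i v) ((-1) ^ (total r v + i))

/-- The cosimplicial differential `∑ᵢ (-1)^i δ^i` of a single path. -/
def cobdryWord (v : Word) : Word →₀ ℤ :=
  ∑ i ∈ Finset.range (marks v + 2), Finsupp.single (coface i v) ((-1) ^ i)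

/-- The simplicial differential. -/
def bdry (n : ℕ) (f : Cochain) : Cochain := fun l => extend (bdryWord n) (f l)

/-- The cosimplicial differential, with the sign of the differential of a `Hom`-complex: it sends
`f` of degree `p` to `-(-1)^p ∑ᵢ (-1)^i δ^i f`. -/
def cobdry (n : ℕ) (f : Cochain) : Cochain
  | 0 => 0
  | l + 1 => extend (fun v => -(-1 : ℤ) ^ parity n v • cobdryWord v) (f l)

/-- `f ∘ᵢ g` for `f` of arity `n` and `g` of arity `m`, for the operad of maps
`N(Δˡ) → ⨁ Lat(k₀, …, kₙ₋₁; l) ⊗ N(Δ^k₀) ⊗ ⋯ ⊗ N(Δ^kₙ₋₁)` natural in `l`. A path `v` in `f` is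
combined with those paths `u` in `g` that have as many marks as `k_i(v)`; the Koszul sign comes from
moving `g` past `f` and past the simplices of dimensions `k₀, …, k_{i-1}`. -/
def comp (n m i : ℕ) (f g : Cochain) : Cochain := fun l =>
  extend (fun v => extend (fun u => Finsupp.single (subst m i v u)
    ((-1) ^ (parity m u * (parity n v + total i v)))) (g (dim v i))) (f l)

/-- Relabelling of the directions. -/
def permWord {n : ℕ} (σ : Equiv.Perm (Fin n)) (v : Word) : Word :=
  v.map (Option.map fun a => if h : a < n then (σ ⟨a, h⟩ : ℕ) else a)

/-- The action of the symmetric group on cochains of arity `n`, with the Koszul sign of the induced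
permutation of simplices of dimensions `k₀, …, kₙ₋₁`. -/
def perm (n : ℕ) (σ : Equiv.Perm (Fin n)) (f : Cochain) : Cochain := fun l =>
  extend (fun v => Finsupp.single (permWord σ v)
    ((-1) ^ ∑ a : Fin n, ∑ b : Fin n, if a < b ∧ σ b < σ a then dim v a * dim v b else 0)) (f l)

/-- The operadic unit of the lattice paths: the sum of the paths `0 • 0 • ⋯ • 0` with `l` marks `•`
and `l + 1` steps in the only direction `0`, over all `l`; they represent the identities of the
ordinals. -/
def unit : Cochain := fun l =>
  Finsupp.single (some 0 :: (List.replicate l [none, some 0]).flatten) 1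

/-- The operadic unit of the brace operad: the unmarked path with one step. -/
def braceUnit : Cochain
  | 0 => Finsupp.single [some 0] 1
  | _ + 1 => 0

/-! ## Whiskering -/

/-- Divide the `t`-th step of the unmarked path `v`, for each `t`, by `s t` new internal points
marked by `1`. -/
def insertPoints (v : Word) (s : Fin v.length → ℕ) : Word :=
  (List.ofFn fun t => v.get t :: (List.replicate (s t) [none, v.get t]).flatten).flatten

/-- `0` if the `t`-th step of `v` is the last one in its direction, and `1` otherwise. -/
def inner (v : Word) (t : Fin v.length) : ℕ := if ∃ t', t < t' ∧ v.get t' = v.get t then 1 else 0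

/-- The exponent of the sign with which `insertPoints v s` occurs in the whiskering of `v`. The
first sum is the position sign, the second one comes from permuting the steps. -/
def whiskerExponent (v : Word) (s : Fin v.length → ℕ) : ℕ :=
  (∑ t, inner v t * ∑ t' ∈ Finset.Iic t, s t') +
  ∑ t, ∑ t', if t < t' ∧ (v.get t').getD 0 < (v.get t).getD 0 then
    s t * s t' + s t * inner v t' + inner v t * s t' else 0

/-- The part `w_l` of the whiskering: the signed sum of all paths obtained from the unmarked path `v`
by inserting `l` new internal points marked by `1`. -/
def whiskerWord (l : ℕ) (v : Word) : Word →₀ ℤ :=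
  ∑ s ∈ Finset.Nat.antidiagonalTuple v.length l,
    Finsupp.single (insertPoints v s) ((-1) ^ whiskerExponent v s)

/-- The whiskering of a linear combination of unmarked paths. -/
def whisker (f : Cochain) : Cochain := fun l => extend (whiskerWord l) (f 0)

/-! ## The four operads -/

/-- The un-normalized totalization
`|Lat_c|(n)^p = ∏ₗ ⨁_{l - (k₀ + ⋯ + kₙ₋₁) = p} ℤ Lat_c(k₀, …, kₙ₋₁; l)`. -/
def latCochains (c : ℕ∞) (n : ℕ) (p : ℤ) : Submodule ℤ Cochain :=
  Submodule.pi Set.univ fun l => Finsupp.supported ℤ ℤ (lat c n l p)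

/-- The elements concentrated in `l = 0`, that is,
`Br_c(n)^p = ⨁_{-(k₀ + ⋯ + kₙ₋₁) = p} ℤ Lat_c(k₀, …, kₙ₋₁; 0)`. -/
def braceCochains (c : ℕ∞) (n : ℕ) (p : ℤ) : Submodule ℤ Cochain :=
  latCochains c n p ⊓ Submodule.pi {l | l ≠ 0} fun _ => ⊥

/-- The paths in the image of some simplicial degeneracy. -/
def degenerateWords : Set Word :=
  {v | ∃ (u : Word) (r i : ℕ), i < u.count (some r) ∧ v = degeneracy r i u}

/-- The span of the images of the simplicial degeneracies, for each `l`. -/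
def degenerate : Submodule ℤ Cochain :=
  Submodule.pi Set.univ fun _ => Finsupp.supported ℤ ℤ degenerateWords

/-- The elements that all codegeneracies `s^i`, `0 ≤ i ≤ l`, from `l + 1` to `l` marks send to zero
modulo the images of the simplicial degeneracies. -/
def conormal : Submodule ℤ Cochain :=
  ⨅ (l : ℕ) (i : ℕ) (_ : i ≤ l), (Finsupp.supported ℤ ℤ degenerateWords).comap
    (Finsupp.lmapDomain ℤ ℤ (codegeneracy i) ∘ₗ LinearMap.proj (l + 1))

/-- The operad `|Lat_c|`. -/
def latOperad (c : ℕ∞) : OperadData Cochain where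
  Z := latCochains c
  B _ _ := ⊥
  d n f := bdry n f + cobdry n f
  one := unit
  comp := comp
  perm := perm

/-- The operad `Br_c`, with `f ∘ᵢ g = f ∘ᵢ w(g)`, where the composition on the right is that of
lattice paths. -/
def braceOperad (c : ℕ∞) : OperadData Cochain where
  Z := braceCochains c
  B _ _ := ⊥
  d := bdry
  one := braceUnit
  comp n m i f g := comp n m i f (whisker g)
  perm := perm

/-- The simplicial normalization `N(Br_c)`. -/
def normalizedBraceOperad (c : ℕ∞) : OperadData Cochain :=
  { braceOperad c with B := fun _ _ => degenerate }

/-- The operad `|N(Lat_c)|`: the simplicial normalization followed by the cosimplicial one. -/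
def normalizedLatOperad (c : ℕ∞) : OperadData Cochain :=
  { latOperad c with
    Z := fun n p => latCochains c n p ⊓ conormal
    B := fun _ _ => degenerate }

end LatticePaths

end

/-!
A dg-operad is first built from any formulas on representatives that satisfy the axioms up to
negligible elements (`OperadData.toDGOperad`), and quasi-isomorphisms are tested on representatives
of cycles (`OperadData.toHom_isWeakEquivalence`). The axioms for `Br_c` follow from those for
`|Lat_c|` by `OperadData.Laws.pullback` along the whiskering, which is injective and preserves all
operations; those for the normalized operads follow by restriction and passage to the quotient, as
soon as degenerate elements form an ideal among the conormal ones (`compWord_mem_degSpan_left`,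
`Fits.isDegenerate_subst`).

*The operad `|Lat_c|`.* The composite `v ∘ᵢ u` of words is computed by a recursion on both words,
which gives associativity, the counts of letters, and the bound for the complexity (`angles_subst`).
The differential is the commutator with an element `diffElt` of arity one, the alternating sum of
the cofaces of the identities, whose square is zero; the Leibniz rule and the compatibility with
permutations are thus consequences of the axioms of a graded operad.

*Signs.* Marks, and steps that are not the last ones in their direction, are odd symbols of a word.
Multiplying each word by the sign `twist` of the permutation that sorts its odd symbols, one gets
"path-ordered" formulas, in which all signs come from moving an operation along the word past odd
symbols. In particular the whiskering has no signs there (`whiskerExponent_eq`), a relabelling of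
the directions has none (`permSign_eq`), and all operations satisfy short recursions along the word.
The identities `whisker_comp`, `whisker_perm` and `bdry_whisker` are proved by these recursions.

*The whiskerings are weak equivalences.* For path-ordered words with marks there is a homotopy
`pathHomotopy` that contracts the simplicial differential to the words beginning with a mark
(`bdry_homotopy`), and removal of the first mark, `dropMark`, anticommutes with the simplicial
differential and, up to the same words, with the cosimplicial one (`cobdry_dropMark`). Together they
contract the total differential on families that begin with one mark, up to an obstruction that
raises the number of marks; a geometric series, which converges in the product, removes it
(`exists_boundary_of_closed`). So a cocycle is cohomologous to the whiskering of its part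
without marks. All of this preserves degenerate and conormal elements, so that the same argument
applies to the normalized operads.

*The projection to `N(Br_c)` is a weak equivalence.* Repeating a doubled step contracts the
degenerate subcomplex up to paths with an earlier doubled step (`bdry_triple`), so that degenerate
cycles bound degenerate elements.
-/

noncomputable section

namespace LatticePaths

/-! ### Quasi-isomorphisms in terms of elements -/

section QuasiIso

variable {K L : CochainComplex AddCommGrpCat.{0} ℤ}

theorem exists_cycle (K : CochainComplex AddCommGrpCat.{0} ℤ) (i : ℤ) (x : K.X i)
    (hx : K.d i (i + 1) x = 0) : ∃ c : K.cycles i, K.iCycles i c = x := by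
  have h := ShortComplex.exact_of_f_is_kernel
    (ShortComplex.mk (K.iCycles i) (K.d i (i + 1)) (K.iCycles_d i (i + 1)))
    (K.cyclesIsKernel i (i + 1) (CochainComplex.next ℤ i))
  exact (ShortComplex.ab_exact_iff _).1 h x hx

theorem exists_boundary (K : CochainComplex AddCommGrpCat.{0} ℤ) (j : ℤ)
    (c : K.cycles (j + 1)) (hc : K.homologyπ (j + 1) c = 0) :
    ∃ z : K.X j, K.toCycles j (j + 1) z = c := by
  have h := ShortComplex.exact_of_g_is_cokernel
    (ShortComplex.mk (K.toCycles j (j + 1)) (K.homologyπ (j + 1))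
      (K.toCycles_comp_homologyπ j (j + 1)))
    (K.homologyIsCokernel j (j + 1) (by rw [CochainComplex.prev]; omega))
  exact (ShortComplex.ab_exact_iff _).1 h c hc

theorem iCycles_injective (K : CochainComplex AddCommGrpCat.{0} ℤ) (i : ℤ) :
    Function.Injective (K.iCycles i) :=
  (AddCommGrpCat.mono_iff_injective _).1 inferInstance

/-- A chain map is a quasi-isomorphism if every cycle of the target is homologous to the image of a
cycle, and cycles of the source bound as soon as their images do. -/
theorem quasiIso_of_cycles (φ : K ⟶ L)
    (hinj : ∀ (j : ℤ) (x : K.X (j + 1)) (z : L.X j), K.d (j + 1) (j + 1 + 1) x = 0 →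
      φ.f (j + 1) x = L.d j (j + 1) z → ∃ w : K.X j, K.d j (j + 1) w = x)
    (hsurj : ∀ (j : ℤ) (y : L.X (j + 1)), L.d (j + 1) (j + 1 + 1) y = 0 →
      ∃ (x : K.X (j + 1)) (z : L.X j), K.d (j + 1) (j + 1 + 1) x = 0 ∧
        φ.f (j + 1) x = y + L.d j (j + 1) z) : QuasiIso φ := by
  rw [quasiIso_iff]
  intro i
  obtain ⟨j, rfl⟩ : ∃ j : ℤ, i = j + 1 := ⟨i - 1, by omega⟩
  have hd : ∀ (M : CochainComplex AddCommGrpCat.{0} ℤ) (c : M.cycles (j + 1)),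
      M.d (j + 1) (j + 1 + 1) (M.iCycles (j + 1) c) = 0 := fun M c =>
    ConcreteCategory.congr_hom (M.iCycles_d (j + 1) (j + 1 + 1)) c
  have hφ : ∀ c : K.cycles (j + 1), L.iCycles (j + 1) (HomologicalComplex.cyclesMap φ (j + 1) c) =
      φ.f (j + 1) (K.iCycles (j + 1) c) := fun c =>
    ConcreteCategory.congr_hom (HomologicalComplex.cyclesMap_i φ (j + 1)) c
  have hπ : ∀ c : K.cycles (j + 1), HomologicalComplex.homologyMap φ (j + 1)
      (K.homologyπ (j + 1) c) = L.homologyπ (j + 1) (HomologicalComplex.cyclesMap φ (j + 1) c) :=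
    fun c => ConcreteCategory.congr_hom (HomologicalComplex.homologyπ_naturality φ (j + 1)) c
  have hti : ∀ (M : CochainComplex AddCommGrpCat.{0} ℤ) (z : M.X j),
      M.iCycles (j + 1) (M.toCycles j (j + 1) z) = M.d j (j + 1) z := fun M z =>
    ConcreteCategory.congr_hom (M.toCycles_i j (j + 1)) z
  have htπ : ∀ (M : CochainComplex AddCommGrpCat.{0} ℤ) (z : M.X j),
      M.homologyπ (j + 1) (M.toCycles j (j + 1) z) = 0 := fun M z =>
    ConcreteCategory.congr_hom (M.toCycles_comp_homologyπ j (j + 1)) z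
  have hsπ : ∀ M : CochainComplex AddCommGrpCat.{0} ℤ,
      Function.Surjective (M.homologyπ (j + 1)) := fun M =>
    (AddCommGrpCat.epi_iff_surjective _).1 inferInstance
  rw [quasiIsoAt_iff_isIso_homologyMap, ConcreteCategory.isIso_iff_bijective]
  constructor
  · rw [injective_iff_map_eq_zero]
    intro a ha
    obtain ⟨c, rfl⟩ := hsπ K a
    rw [hπ] at ha
    obtain ⟨z, hz⟩ := exists_boundary L j _ ha
    obtain ⟨w, hw⟩ := hinj j (K.iCycles (j + 1) c) z (hd K c) (by rw [← hφ, ← hz, hti])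
    have : K.toCycles j (j + 1) w = c := iCycles_injective K _ (by rw [hti, hw])
    rw [← this, htπ]
  · intro b
    obtain ⟨c, rfl⟩ := hsπ L b
    obtain ⟨x, z, hx, hxz⟩ := hsurj j (L.iCycles (j + 1) c) (hd L c)
    obtain ⟨c', rfl⟩ := exists_cycle K _ x hx
    refine ⟨K.homologyπ (j + 1) c', ?_⟩
    have : HomologicalComplex.cyclesMap φ (j + 1) c' = c + L.toCycles j (j + 1) z :=
      iCycles_injective L _ (by rw [hφ, map_add, hti, hxz])
    rw [hπ, this, map_add, htπ, add_zero]

end QuasiIso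

/-! ### Differential graded operads from formulas on representatives -/

namespace OperadData

variable {U : Type} [AddCommGroup U]

/-- The formulas of `D` are additive, they preserve the subgroups `Z` of representatives, and the
subgroups `B` of negligible elements form an ideal. -/
structure Closed (D : OperadData U) : Prop where
  d_add : ∀ n x y, D.d n (x + y) = D.d n x + D.d n y
  comp_add_left : ∀ n m i x y z, D.comp n m i (x + y) z = D.comp n m i x z + D.comp n m i y z
  comp_add_right : ∀ n m i x y z, D.comp n m i x (y + z) = D.comp n m i x y + D.comp n m i x z
  perm_add : ∀ n σ x y, D.perm n σ (x + y) = D.perm n σ x + D.perm n σ y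
  one_mem : D.one ∈ D.Z 1 0
  d_mem : ∀ {n p x}, x ∈ D.Z n p → D.d n x ∈ D.Z n (p + 1)
  d_null : ∀ {n p x}, x ∈ D.Z n p → x ∈ D.B n p → D.d n x ∈ D.B n (p + 1)
  comp_mem : ∀ {n m r : ℕ} {p q s : ℤ} (i : Fin n) (_ : n + m = r + 1) (_ : p + q = s) {x y : U},
    x ∈ D.Z n p → y ∈ D.Z m q → D.comp n m i x y ∈ D.Z r s
  comp_null_left : ∀ {n m r : ℕ} {p q s : ℤ} (i : Fin n) (_ : n + m = r + 1) (_ : p + q = s)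
    {x y : U}, x ∈ D.Z n p → y ∈ D.Z m q → x ∈ D.B n p → D.comp n m i x y ∈ D.B r s
  comp_null_right : ∀ {n m r : ℕ} {p q s : ℤ} (i : Fin n) (_ : n + m = r + 1) (_ : p + q = s)
    {x y : U}, x ∈ D.Z n p → y ∈ D.Z m q → y ∈ D.B m q → D.comp n m i x y ∈ D.B r s
  perm_mem : ∀ {n p x} (σ : Equiv.Perm (Fin n)), x ∈ D.Z n p → D.perm n σ x ∈ D.Z n p
  perm_null : ∀ {n p x} (σ : Equiv.Perm (Fin n)), x ∈ D.Z n p → x ∈ D.B n p →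
    D.perm n σ x ∈ D.B n p

/-- The formulas of `D` satisfy the axioms of a dg-operad up to negligible elements. -/
structure Laws (D : OperadData U) : Prop where
  d_d : ∀ {n p x}, x ∈ D.Z n p → D.d n (D.d n x) ∈ D.B n (p + 1 + 1)
  d_perm : ∀ {n p x} (σ : Equiv.Perm (Fin n)), x ∈ D.Z n p →
    D.d n (D.perm n σ x) - D.perm n σ (D.d n x) ∈ D.B n (p + 1)
  d_one : D.d 1 D.one ∈ D.B 1 1
  d_comp : ∀ {n m r : ℕ} {p q s : ℤ} (i : Fin n) (_ : n + m = r + 1) (_ : p + q = s) {f g : U},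
    f ∈ D.Z n p → g ∈ D.Z m q → D.d r (D.comp n m i f g) -
      (D.comp n m i (D.d n f) g + p.negOnePow • D.comp n m i f (D.d m g)) ∈ D.B r (s + 1)
  one_comp : ∀ {m : ℕ} {q : ℤ} {g : U}, g ∈ D.Z m q → D.comp 1 m 0 D.one g - g ∈ D.B m q
  comp_one : ∀ {n : ℕ} {p : ℤ} (i : Fin n) {f : U}, f ∈ D.Z n p →
    D.comp n 1 i f D.one - f ∈ D.B n p
  assoc_seq : ∀ {n m k r r' u : ℕ} {p q t s v : ℤ} (i : Fin n) (j : Fin m) (_ : n + m = r + 1)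
    (_ : p + q = s) (_ : m + k = r' + 1) (_ : r + k = u + 1) (_ : s + t = v) {f g h : U},
    f ∈ D.Z n p → g ∈ D.Z m q → h ∈ D.Z k t →
    D.comp r k (i + j) (D.comp n m i f g) h - D.comp n r' i f (D.comp m k j g h) ∈ D.B u v
  assoc_par : ∀ {n m k r r' u : ℕ} {p q t s v : ℤ} (i j : Fin n) (_ : i < j) (x : ℕ)
    (_ : x + 1 = j + m) (_ : n + m = r + 1) (_ : p + q = s) (_ : n + k = r' + 1)
    (_ : r + k = u + 1) (_ : s + t = v) {f g h : U},
    f ∈ D.Z n p → g ∈ D.Z m q → h ∈ D.Z k t →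
    D.comp r k x (D.comp n m i f g) h -
      (q * t).negOnePow • D.comp r' m i (D.comp n k j f h) g ∈ D.B u v
  perm_one : ∀ {n p x}, x ∈ D.Z n p → D.perm n 1 x - x ∈ D.B n p
  perm_mul : ∀ {n p x} (σ τ : Equiv.Perm (Fin n)), x ∈ D.Z n p →
    D.perm n (σ * τ) x - D.perm n σ (D.perm n τ x) ∈ D.B n p
  perm_comp : ∀ {n m r : ℕ} {p q s : ℤ} (i : Fin n) (_ : n + m = r + 1) (_ : p + q = s)
    (σ : Equiv.Perm (Fin n)) (τ : Equiv.Perm (Fin m)) (ρ : Equiv.Perm (Fin r))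
    (_ : ∀ (a : Fin n) (x y : Fin r), a ≠ i → (x : ℕ) = slot m i a →
      (y : ℕ) = slot m (σ i) (σ a) → ρ x = y)
    (_ : ∀ (b : Fin m) (x y : Fin r), (x : ℕ) = i + b → (y : ℕ) = σ i + τ b → ρ x = y)
    {f g : U}, f ∈ D.Z n p → g ∈ D.Z m q →
    D.comp n m (σ i) (D.perm n σ f) (D.perm m τ g) - D.perm r ρ (D.comp n m i f g) ∈ D.B r s

/-- A formula `w` sends representatives of `D` to representatives of `E`, compatibly with the
structure up to negligible elements. -/
structure Compatible (D E : OperadData U) (w : U → U) : Prop where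
  map_add : ∀ x y, w (x + y) = w x + w y
  mem : ∀ {n p x}, x ∈ D.Z n p → w x ∈ E.Z n p
  null : ∀ {n p x}, x ∈ D.Z n p → x ∈ D.B n p → w x ∈ E.B n p
  map_d : ∀ {n p x}, x ∈ D.Z n p → w (D.d n x) - E.d n (w x) ∈ E.B n (p + 1)
  map_one : w D.one - E.one ∈ E.B 1 0
  map_comp : ∀ {n m r : ℕ} {p q s : ℤ} (i : Fin n) (_ : n + m = r + 1) (_ : p + q = s) {f g : U},
    f ∈ D.Z n p → g ∈ D.Z m q →
    w (D.comp n m i f g) - E.comp n m i (w f) (w g) ∈ E.B r s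
  map_perm : ∀ {n p x} (σ : Equiv.Perm (Fin n)), x ∈ D.Z n p →
    w (D.perm n σ x) - E.perm n σ (w x) ∈ E.B n p

section Quotient

variable (D : OperadData U)

/-- The subquotient of arity `n` and degree `p`. -/
abbrev Quot (n : ℕ) (p : ℤ) : Type := D.Z n p ⧸ (D.B n p).comap (D.Z n p).subtype

variable {D}

/-- The class of a representative. -/
def cl {n : ℕ} {p : ℤ} (x : U) (hx : x ∈ D.Z n p) : D.Quot n p := Submodule.Quotient.mk ⟨x, hx⟩

theorem cl_surj {n : ℕ} {p : ℤ} (a : D.Quot n p) : ∃ x hx, a = cl x hx := by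
  obtain ⟨⟨x, hx⟩, rfl⟩ := Submodule.Quotient.mk_surjective _ a
  exact ⟨x, hx, rfl⟩

theorem cl_eq_cl {n : ℕ} {p : ℤ} {x y : U} {hx : x ∈ D.Z n p} {hy : y ∈ D.Z n p} :
    cl x hx = cl y hy ↔ x - y ∈ D.B n p :=
  Submodule.Quotient.eq _

theorem cl_eq_zero {n : ℕ} {p : ℤ} {x : U} {hx : x ∈ D.Z n p} :
    cl x hx = 0 ↔ x ∈ D.B n p :=
  Submodule.Quotient.mk_eq_zero _

theorem cl_add {n : ℕ} {p : ℤ} {x y : U} {hx : x ∈ D.Z n p} {hy : y ∈ D.Z n p} :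
    cl x hx + cl y hy = cl (x + y) (add_mem hx hy) := rfl

/-- The map of subquotients given by an additive formula on representatives. -/
def mapQuot {D E : OperadData U} {n n' : ℕ} {p p' : ℤ} (f : U → U)
    (hadd : ∀ x y, f (x + y) = f x + f y) (hmem : ∀ x ∈ D.Z n p, f x ∈ E.Z n' p')
    (hnull : ∀ x ∈ D.Z n p, x ∈ D.B n p → f x ∈ E.B n' p') : D.Quot n p →+ E.Quot n' p' :=
  (Submodule.liftQ _ (AddMonoidHom.mk' (fun x : D.Z n p => (cl (f x) (hmem x x.2) : E.Quot n' p'))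
    (fun x y => by
      rw [cl_add, cl_eq_cl]
      simp [hadd])).toIntLinearMap
    (fun x hx => cl_eq_zero.2 (hnull x x.2 hx))).toAddMonoidHom

@[simp]
theorem mapQuot_cl {D E : OperadData U} {n n' : ℕ} {p p' : ℤ} (f : U → U)
    (hadd : ∀ x y, f (x + y) = f x + f y) (hmem : ∀ x ∈ D.Z n p, f x ∈ E.Z n' p')
    (hnull : ∀ x ∈ D.Z n p, x ∈ D.B n p → f x ∈ E.B n' p') (x : U) (hx : x ∈ D.Z n p) :
    mapQuot f hadd hmem hnull (cl x hx) = cl (f x) (hmem x hx) := rfl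

/-- The partial composition on subquotients. -/
def compQuot (hc : D.Closed) {n m r : ℕ} {p q s : ℤ} (i : Fin n) (hr : n + m = r + 1)
    (hs : p + q = s) : D.Quot n p →+ D.Quot m q →+ D.Quot r s :=
  (Submodule.liftQ _ (AddMonoidHom.mk' (fun x : D.Z n p =>
      (mapQuot (D.comp n m i x) (hc.comp_add_right n m i x)
        (fun _ hy => hc.comp_mem i hr hs x.2 hy)
        (fun _ hy hy' => hc.comp_null_right i hr hs x.2 hy hy') : D.Quot m q →+ D.Quot r s))
    (fun x y => by
      ext a
      obtain ⟨z, hz, rfl⟩ := cl_surj a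
      rw [AddMonoidHom.add_apply, mapQuot_cl, mapQuot_cl, mapQuot_cl, cl_add, cl_eq_cl]
      simp [hc.comp_add_left])).toIntLinearMap
    (fun x hx => by
      rw [LinearMap.mem_ker]
      refine AddMonoidHom.ext fun a => ?_
      obtain ⟨z, hz, rfl⟩ := cl_surj a
      exact cl_eq_zero.2 (hc.comp_null_left i hr hs x.2 hz hx))).toAddMonoidHom

/-- The differential on subquotients. -/
def dQuot (hc : D.Closed) (n : ℕ) (p : ℤ) : D.Quot n p →+ D.Quot n (p + 1) :=
  mapQuot (D.d n) (hc.d_add n) (fun _ hx => hc.d_mem hx) (fun _ hx hx' => hc.d_null hx hx')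

/-- The complex of subquotients of arity `n`. -/
def quotComplex (hc : D.Closed) (hl : D.Laws) (n : ℕ) : CochainComplex AddCommGrpCat.{0} ℤ :=
  CochainComplex.of (fun p => AddCommGrpCat.of (D.Quot n p))
    (fun p => AddCommGrpCat.ofHom (dQuot hc n p)) (fun p => by
      ext a
      obtain ⟨x, hx, rfl⟩ := cl_surj a
      exact cl_eq_zero.2 (hl.d_d hx))

theorem quotComplex_d (hc : D.Closed) (hl : D.Laws) (n : ℕ) (p : ℤ) (x : U) (hx : x ∈ D.Z n p) :
    (quotComplex hc hl n).d p (p + 1) (cl x hx : D.Quot n p) =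
      (cl (D.d n x) (hc.d_mem hx) : D.Quot n (p + 1)) :=
  ConcreteCategory.congr_hom (CochainComplex.of_d (fun p => AddCommGrpCat.of (D.Quot n p))
    (fun p => AddCommGrpCat.ofHom (dQuot hc n p)) p) (cl x hx)

/-- The chain map of complexes of subquotients given by an additive formula. -/
def quotMap {D E : OperadData U} (hc : D.Closed) (hl : D.Laws) (hc' : E.Closed) (hl' : E.Laws)
    (n : ℕ) (f : U → U) (hadd : ∀ x y, f (x + y) = f x + f y)
    (hmem : ∀ p, ∀ x ∈ D.Z n p, f x ∈ E.Z n p)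
    (hnull : ∀ p, ∀ x ∈ D.Z n p, x ∈ D.B n p → f x ∈ E.B n p)
    (hd : ∀ p, ∀ x ∈ D.Z n p, E.d n (f x) - f (D.d n x) ∈ E.B n (p + 1)) :
    quotComplex hc hl n ⟶ quotComplex hc' hl' n where
  f p := AddCommGrpCat.ofHom (mapQuot f hadd (hmem p) (hnull p))
  comm' p q hpq := by
    obtain rfl : p + 1 = q := hpq
    ext a
    obtain ⟨x, hx, rfl⟩ := cl_surj (D := D) a
    have h : (quotComplex hc' hl' n).d p (p + 1) (cl (f x) (hmem p x hx) : E.Quot n p) =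
        mapQuot f hadd (hmem (p + 1)) (hnull (p + 1)) (cl (D.d n x) (hc.d_mem hx)) :=
      (quotComplex_d hc' hl' n p _ (hmem p x hx)).trans (cl_eq_cl.2 (hd p x hx))
    refine h.trans ?_
    exact congrArg _ (quotComplex_d hc hl n p x hx).symm

/-- The dg-operad of subquotients. -/
def toDGOperad (hc : D.Closed) (hl : D.Laws) : DGOperad where
  cpx := quotComplex hc hl
  one := (cl D.one hc.one_mem : D.Quot 1 0)
  comp i hr hs := compQuot hc i hr hs
  perm {n} σ := quotMap hc hl hc hl n (D.perm n σ) (hc.perm_add n σ)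
    (fun _ _ hx => hc.perm_mem σ hx) (fun _ _ hx hx' => hc.perm_null σ hx hx')
    (fun _ _ hx => hl.d_perm σ hx)
  d_one := (quotComplex_d hc hl 1 0 _ _).trans (cl_eq_zero.2 hl.d_one)
  d_comp {n m r p q s} i hr hs f g := by
    obtain ⟨x, hx, rfl⟩ := cl_surj (D := D) f
    obtain ⟨y, hy, rfl⟩ := cl_surj (D := D) g
    have h₁ := hc.comp_mem i hr (by omega : p + 1 + q = s + 1) (hc.d_mem hx) hy
    have h₂ := hc.comp_mem i hr (by omega : p + (q + 1) = s + 1) hx (hc.d_mem hy)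
    have h₃ : (cl (D.d r (D.comp n m i x y)) (hc.d_mem (hc.comp_mem i hr hs hx hy)) :
        D.Quot r (s + 1)) = cl _ h₁ + p.negOnePow • cl _ h₂ :=
      cl_eq_cl.2 (hl.d_comp i hr hs hx hy)
    refine ((quotComplex_d hc hl r s _ (hc.comp_mem i hr hs hx hy)).trans h₃).trans ?_
    exact congrArg₂ (fun (a : D.Quot n (p + 1)) (b : D.Quot m (q + 1)) =>
      (compQuot hc i hr (by omega) a (cl y hy : D.Quot m q) : D.Quot r (s + 1)) +
        p.negOnePow • compQuot hc i hr (by omega) (cl x hx : D.Quot n p) b)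
      (quotComplex_d hc hl n p x hx).symm (quotComplex_d hc hl m q y hy).symm
  one_comp g := by
    obtain ⟨x, hx, rfl⟩ := cl_surj (D := D) g
    exact cl_eq_cl.2 (hl.one_comp hx)
  comp_one i f := by
    obtain ⟨x, hx, rfl⟩ := cl_surj (D := D) f
    exact cl_eq_cl.2 (hl.comp_one i hx)
  assoc_seq i j x hx hr hs hr' hs' hu hv hu' hv' f g h := by
    obtain ⟨f, hf, rfl⟩ := cl_surj (D := D) f
    obtain ⟨g, hg, rfl⟩ := cl_surj (D := D) g
    obtain ⟨h, hh, rfl⟩ := cl_surj (D := D) h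
    refine cl_eq_cl.2 ?_
    rw [hx]
    exact hl.assoc_seq i j hr hs hr' hu hv hf hg hh
  assoc_par i j hij x hx y hy hr hs hr' hs' hu hv hu' hv' f g h := by
    obtain ⟨f, hf, rfl⟩ := cl_surj (D := D) f
    obtain ⟨g, hg, rfl⟩ := cl_surj (D := D) g
    obtain ⟨h, hh, rfl⟩ := cl_surj (D := D) h
    have e := hl.assoc_par i j hij x hx hr hs hr' hu hv hf hg hh
    nth_rewrite 2 [← hy] at e
    exact cl_eq_cl.2 e
  perm_one n := by
    ext p a
    obtain ⟨x, hx, rfl⟩ := cl_surj (D := D) a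
    exact cl_eq_cl.2 (hl.perm_one hx)
  perm_mul σ τ := by
    ext p a
    obtain ⟨x, hx, rfl⟩ := cl_surj (D := D) a
    exact cl_eq_cl.2 (hl.perm_mul σ τ hx)
  perm_comp i hr hs σ τ ρ h₁ h₂ f g := by
    obtain ⟨f, hf, rfl⟩ := cl_surj (D := D) f
    obtain ⟨g, hg, rfl⟩ := cl_surj (D := D) g
    exact cl_eq_cl.2 (hl.perm_comp i hr hs σ τ ρ h₁ h₂ hf hg)

/-- The dg-operad of subquotients realizes the formulas it is made from. -/
def realization (hc : D.Closed) (hl : D.Laws) : D.Realization (toDGOperad hc hl) where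
  cls n p := AddMonoidHom.mk' (fun x => (cl x.1 x.2 : D.Quot n p)) (fun _ _ => rfl)
  cls_surjective _ _ := Submodule.Quotient.mk_surjective _
  cls_eq_zero_iff _ _ _ := cl_eq_zero
  d_cls n p x := ⟨hc.d_mem x.2, quotComplex_d hc hl n p x.1 x.2⟩
  one_cls := ⟨hc.one_mem, rfl⟩
  comp_cls i hr hs x y := ⟨hc.comp_mem i hr hs x.2 y.2, rfl⟩
  perm_cls _ σ x := ⟨hc.perm_mem σ x.2, rfl⟩

/-- The morphism of dg-operads of subquotients given by a compatible formula. -/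
def toHom {D E : OperadData U} (hc : D.Closed) (hl : D.Laws) (hc' : E.Closed) (hl' : E.Laws)
    {w : U → U} (hw : D.Compatible E w) : (toDGOperad hc hl).Hom (toDGOperad hc' hl') where
  app n := quotMap hc hl hc' hl' n w hw.map_add (fun _ _ hx => hw.mem hx)
    (fun _ _ hx hx' => hw.null hx hx') (fun p x hx => by
      have h := neg_mem (hw.map_d hx)
      rwa [neg_sub] at h)
  map_one := cl_eq_cl.2 hw.map_one
  map_comp i hr hs f g := by
    obtain ⟨f, hf, rfl⟩ := cl_surj (D := D) f
    obtain ⟨g, hg, rfl⟩ := cl_surj (D := D) g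
    exact cl_eq_cl.2 (hw.map_comp i hr hs hf hg)
  map_perm σ := by
    ext p a
    obtain ⟨x, hx, rfl⟩ := cl_surj (D := D) a
    exact cl_eq_cl.2 (hw.map_perm σ hx)

theorem toHom_isInducedBy {D E : OperadData U} (hc : D.Closed) (hl : D.Laws) (hc' : E.Closed)
    (hl' : E.Laws) {w : U → U} (hw : D.Compatible E w) :
    (toHom hc hl hc' hl' hw).IsInducedBy (realization hc hl) (realization hc' hl') w :=
  fun _ _ x => ⟨hw.mem x.2, rfl⟩

theorem toHom_isWeakEquivalence {D E : OperadData U} (hc : D.Closed) (hl : D.Laws)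
    (hc' : E.Closed) (hl' : E.Laws) {w : U → U} (hw : D.Compatible E w)
    (hinj : ∀ (n : ℕ) (j : ℤ) (x z : U), x ∈ D.Z n (j + 1) → z ∈ E.Z n j →
      D.d n x ∈ D.B n (j + 1 + 1) → w x - E.d n z ∈ E.B n (j + 1) →
      ∃ y ∈ D.Z n j, D.d n y - x ∈ D.B n (j + 1))
    (hsurj : ∀ (n : ℕ) (j : ℤ) (y : U), y ∈ E.Z n (j + 1) → E.d n y ∈ E.B n (j + 1 + 1) →
      ∃ x ∈ D.Z n (j + 1), ∃ z ∈ E.Z n j, D.d n x ∈ D.B n (j + 1 + 1) ∧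
        w x - (y + E.d n z) ∈ E.B n (j + 1)) :
    (toHom hc hl hc' hl' hw).IsWeakEquivalence := by
  intro n
  refine quasiIso_of_cycles _ ?_ ?_
  · intro j a b ha hab
    obtain ⟨x, hx, rfl⟩ := cl_surj (D := D) a
    obtain ⟨z, hz, rfl⟩ := cl_surj (D := E) b
    have h₁ := cl_eq_zero.1 ((quotComplex_d hc hl n _ x hx).symm.trans ha)
    have h₂ := cl_eq_cl.1 (hab.trans (quotComplex_d hc' hl' n _ z hz))
    obtain ⟨y, hy, hxy⟩ := hinj n j x z hx hz h₁ h₂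
    exact ⟨(cl y hy : D.Quot n j), (quotComplex_d hc hl n _ y hy).trans (cl_eq_cl.2 hxy)⟩
  · intro j b hb
    obtain ⟨y, hy, rfl⟩ := cl_surj (D := E) b
    have h₁ := cl_eq_zero.1 ((quotComplex_d hc' hl' n _ y hy).symm.trans hb)
    obtain ⟨x, hx, z, hz, hdx, hxy⟩ := hsurj n j y hy h₁
    refine ⟨(cl x hx : D.Quot n (j + 1)), (cl z hz : E.Quot n j),
      (quotComplex_d hc hl n _ x hx).trans (cl_eq_zero.2 hdx), ?_⟩
    have h₂ := quotComplex_d hc' hl' n _ z hz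
    exact (cl_eq_cl.2 hxy : cl (w x) (hw.mem hx) =
      cl (y + E.d n z) (add_mem hy (hc'.d_mem hz))).trans
      (congrArg (fun c => (cl y hy : E.Quot n (j + 1)) + c) h₂.symm)

end Quotient

/-- The axioms of a dg-operad can be checked after applying a formula that strictly preserves the
structure and reflects negligible elements. -/
theorem Laws.pullback {D E : OperadData U} (hc : D.Closed) (hl : E.Laws) (w : U →+ U)
    (mem : ∀ {n p x}, x ∈ D.Z n p → w x ∈ E.Z n p)
    (null : ∀ {n p x}, x ∈ D.Z n p → w x ∈ E.B n p → x ∈ D.B n p)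
    (map_d : ∀ {n p x}, x ∈ D.Z n p → w (D.d n x) = E.d n (w x))
    (map_one : w D.one = E.one)
    (map_comp : ∀ {n m r : ℕ} {p q s : ℤ} (i : Fin n) (_ : n + m = r + 1) (_ : p + q = s)
      {f g : U}, f ∈ D.Z n p → g ∈ D.Z m q →
      w (D.comp n m i f g) = E.comp n m i (w f) (w g))
    (map_perm : ∀ {n p x} (σ : Equiv.Perm (Fin n)), x ∈ D.Z n p →
      w (D.perm n σ x) = E.perm n σ (w x)) : D.Laws where
  d_d hx := by
    refine null (hc.d_mem (hc.d_mem hx)) ?_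
    rw [map_d (hc.d_mem hx), map_d hx]
    exact hl.d_d (mem hx)
  d_perm σ hx := by
    refine null (sub_mem (hc.d_mem (hc.perm_mem σ hx)) (hc.perm_mem σ (hc.d_mem hx))) ?_
    rw [map_sub, map_d (hc.perm_mem σ hx), map_perm σ hx, map_perm σ (hc.d_mem hx), map_d hx]
    exact hl.d_perm σ (mem hx)
  d_one := by
    refine null (hc.d_mem hc.one_mem) ?_
    rw [map_d hc.one_mem, map_one]
    exact hl.d_one
  d_comp {n m r p q s} i hr hs f g hf hg := by
    have h₁ := hc.comp_mem i hr (by omega : p + 1 + q = s + 1) (hc.d_mem hf) hg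
    have h₂ := hc.comp_mem i hr (by omega : p + (q + 1) = s + 1) hf (hc.d_mem hg)
    refine null (sub_mem (hc.d_mem (hc.comp_mem i hr hs hf hg)) (add_mem h₁
      ((D.Z _ _).smul_mem (p.negOnePow : ℤ) h₂))) ?_
    rw [map_sub, map_add, Units.smul_def, map_zsmul, map_d (hc.comp_mem i hr hs hf hg),
      map_comp i hr hs hf hg, map_comp i hr (by omega : p + 1 + q = s + 1) (hc.d_mem hf) hg,
      map_comp i hr (by omega : p + (q + 1) = s + 1) hf (hc.d_mem hg), map_d hf, map_d hg]
    exact hl.d_comp i hr hs (mem hf) (mem hg)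
  one_comp {m q g} hg := by
    have h := hc.comp_mem (0 : Fin 1) (Nat.add_comm 1 m) (zero_add q) hc.one_mem hg
    refine null (sub_mem h hg) ?_
    have e := map_comp (0 : Fin 1) (Nat.add_comm 1 m) (zero_add q) hc.one_mem hg
    rw [Fin.val_zero] at e
    rw [map_sub, e, map_one]
    exact hl.one_comp (mem hg)
  comp_one {n p} i f hf := by
    refine null (sub_mem (hc.comp_mem i rfl (add_zero p) hf hc.one_mem) hf) ?_
    rw [map_sub, map_comp i rfl (add_zero p) hf hc.one_mem, map_one]
    exact hl.comp_one i (mem hf)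
  assoc_seq {n m k r r' u p q t s v} i j hr hs hr' hu hv f g h hf hg hh := by
    have h₁ := hc.comp_mem i hr hs hf hg
    have h₂ := hc.comp_mem j hr' rfl hg hh
    have hj := j.2
    have hx : (i : ℕ) + j < r := by omega
    have h₃ := hc.comp_mem (⟨i + j, hx⟩ : Fin r) hu hv h₁ hh
    have h₄ := hc.comp_mem i (by omega : n + r' = u + 1) (by omega : p + (q + t) = v) hf h₂
    refine null (sub_mem h₃ h₄) ?_
    have e := map_comp (⟨i + j, hx⟩ : Fin r) hu hv h₁ hh
    rw [map_sub, map_comp i (by omega : n + r' = u + 1) (by omega : p + (q + t) = v) hf h₂,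
      map_comp j hr' rfl hg hh]
    simp only at e
    rw [e, map_comp i hr hs hf hg]
    exact hl.assoc_seq i j hr hs hr' hu hv (mem hf) (mem hg) (mem hh)
  assoc_par {n m k r r' u p q t s v} i j hij x hx hr hs hr' hu hv f g h hf hg hh := by
    have hi := Fin.lt_def.1 hij
    have hj := j.2
    have hx' : x < r := by omega
    have hi' : (i : ℕ) < r' := by omega
    have h₁ := hc.comp_mem i hr hs hf hg
    have h₂ := hc.comp_mem j hr' rfl hf hh
    have h₃ := hc.comp_mem (⟨x, hx'⟩ : Fin r) hu hv h₁ hh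
    have h₄ := hc.comp_mem (⟨i, hi'⟩ : Fin r') (by omega : r' + m = u + 1)
      (by omega : (p + t) + q = v) h₂ hg
    have e₃ := map_comp (⟨x, hx'⟩ : Fin r) hu hv h₁ hh
    have e₄ := map_comp (⟨i, hi'⟩ : Fin r') (by omega : r' + m = u + 1)
      (by omega : (p + t) + q = v) h₂ hg
    simp only at h₃ h₄ e₃ e₄
    refine null (sub_mem h₃ ((D.Z _ _).smul_mem ((q * t).negOnePow : ℤ) h₄)) ?_
    rw [map_sub, Units.smul_def, map_zsmul, e₃, e₄, map_comp i hr hs hf hg,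
      map_comp j hr' rfl hf hh]
    exact hl.assoc_par i j hij x hx hr hs hr' hu hv (mem hf) (mem hg) (mem hh)
  perm_one {n p x} hx := by
    refine null (sub_mem (hc.perm_mem 1 hx) hx) ?_
    rw [map_sub, map_perm 1 hx]
    exact hl.perm_one (mem hx)
  perm_mul σ τ hx := by
    refine null (sub_mem (hc.perm_mem _ hx) (hc.perm_mem σ (hc.perm_mem τ hx))) ?_
    rw [map_sub, map_perm _ hx, map_perm _ (hc.perm_mem τ hx), map_perm _ hx]
    exact hl.perm_mul σ τ (mem hx)
  perm_comp {n m r p q s} i hr hs σ τ ρ h₁ h₂ f g hf hg := by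
    refine null (sub_mem (hc.comp_mem (σ i) hr hs (hc.perm_mem σ hf) (hc.perm_mem τ hg))
      (hc.perm_mem ρ (hc.comp_mem i hr hs hf hg))) ?_
    rw [map_sub, map_comp (σ i) hr hs (hc.perm_mem σ hf) (hc.perm_mem τ hg), map_perm σ hf,
      map_perm τ hg, map_perm ρ (hc.comp_mem i hr hs hf hg), map_comp i hr hs hf hg]
    exact hl.perm_comp i hr hs σ τ ρ h₁ h₂ (mem hf) (mem hg)

end OperadData

/-! ### Composition of words -/

section Subst

variable (m i : ℕ)

theorem substAux_nil_right (v : Word) : substAux m i v [] = substAux m i v [[]] := by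
  induction v with
  | nil => rfl
  | cons x v ih =>
    cases x with
    | none => simp [substAux, ih]
    | some a =>
      by_cases h : a = i
      · simp only [substAux, h, if_true, ih, List.tail]
        rfl
      · simp [substAux, ih, h]

@[simp]
theorem subst_nil (u : Word) : subst m i [] u = [] := rfl

@[simp]
theorem subst_none (v u : Word) : subst m i (none :: v) u = none :: subst m i v u := rfl

theorem subst_some_ne {a : ℕ} (h : a ≠ i) (v u : Word) :
    subst m i (some a :: v) u = some (slot m i a) :: subst m i v u := by
  simp [subst, substAux, h]

@[simp]
theorem subst_some_nil (v : Word) : subst m i (some i :: v) [] = subst m i v [] := by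
  simp [subst, substAux, substAux_nil_right]

@[simp]
theorem subst_some_none (v u : Word) :
    subst m i (some i :: v) (none :: u) = subst m i v u := by
  simp [subst, substAux, List.splitOn_cons_eq_if_modifyHead]

@[simp]
theorem subst_some_some (b : ℕ) (v u : Word) :
    subst m i (some i :: v) (some b :: u) = some (i + b) :: subst m i (some i :: v) u := by
  have h := List.splitOn_ne_nil (none : Option ℕ) u
  simp only [subst, List.splitOn_cons_eq_if_modifyHead]
  cases hu : u.splitOn none with
  | nil => exact absurd hu h
  | cons p S => simp [substAux]

end Subst

/-- Induction along the composition of two words: the second word is consumed while the first one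
stands at a step in the direction `i`. -/
theorem subst_induction (i : ℕ) {P : Word → Word → Prop} (nil : ∀ u, P [] u)
    (none : ∀ v u, P v u → P (none :: v) u)
    (some_ne : ∀ a v u, a ≠ i → P v u → P (some a :: v) u)
    (some_nil : ∀ v, P v [] → P (some i :: v) [])
    (some_none : ∀ v u, P v u → P (some i :: v) (Option.none :: u))
    (some_some : ∀ b v u, P (some i :: v) u → P (some i :: v) (some b :: u)) (v u : Word) :
    P v u := by
  induction v generalizing u with
  | nil => exact nil u
  | cons x v ih =>
    cases x with
    | none => exact none v u (ih u)
    | some a =>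
      by_cases h : a = i
      · subst h
        induction u with
        | nil => exact some_nil v (ih [])
        | cons y u ihu =>
          cases y with
          | none => exact some_none v u (ih u)
          | some b => exact some_some b v u ihu
      · exact some_ne a v u h (ih u)

theorem slot_ne {m i a j : ℕ} (ha : a ≠ i) (hj : j < m) : slot m i a ≠ i + j := by
  unfold slot
  split_ifs <;> omega

theorem subst_assoc_seq (m k i j : ℕ) (hj : j < m) (v u t : Word) :
    subst k (i + j) (subst m i v u) t = subst (m + k - 1) i v (subst k j u t) := by
  induction v, u using subst_induction i generalizing t with
  | nil u => simp
  | none v u ih => simp [ih]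
  | some_ne a v u ha ih =>
    rw [subst_some_ne _ _ ha, subst_some_ne _ _ (slot_ne ha hj), subst_some_ne _ _ ha, ih]
    congr 2
    unfold slot
    split_ifs <;> omega
  | some_nil v ih => rw [subst_some_nil, subst_nil, subst_some_nil, ih, subst_nil]
  | some_none v u ih => simp [ih]
  | some_some b v u ih =>
    rw [subst_some_some]
    by_cases hb : b = j
    · subst hb
      induction t with
      | nil => simp [ih]
      | cons y t iht =>
        cases y with
        | none => simp [ih]
        | some c => simp [iht, add_assoc]
    · rw [subst_some_ne _ _ (by omega), subst_some_ne _ _ hb, subst_some_some, ih]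
      congr 2
      unfold slot
      split_ifs <;> omega

theorem subst_assoc_par (m k i j : ℕ) (hij : i < j) (x : ℕ) (hx : x + 1 = j + m) (v u t : Word)
    (hu : ∀ b, some b ∈ u → b < m) :
    subst k x (subst m i v u) t = subst m i (subst k j v t) u := by
  have hsj : slot m i j = x := by unfold slot; split_ifs <;> omega
  have hsi : slot k j i = i := by unfold slot; split_ifs; omega
  induction v generalizing u t with
  | nil => simp
  | cons y v ih =>
    cases y with
    | none => simp [ih u t hu]
    | some a =>
      by_cases hai : a = i
      · subst hai
        rw [subst_some_ne k j (by omega) v t, hsi]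
        induction u with
        | nil => simp [ih [] t]
        | cons z u ihu =>
          cases z with
          | none =>
            simp only [subst_some_none]
            exact ih u t fun b hb => hu b (List.mem_cons_of_mem _ hb)
          | some b =>
            have hb := hu b List.mem_cons_self
            simp only [subst_some_some]
            rw [subst_some_ne _ _ (by omega), ihu fun b hb => hu b (List.mem_cons_of_mem _ hb)]
            congr 2
            unfold slot
            split_ifs <;> omega
      · rw [subst_some_ne _ _ hai]
        by_cases haj : a = j
        · subst haj
          rw [hsj]
          induction t with
          | nil => simp [ih u [] hu]
          | cons z t iht =>
            cases z with
            | none => simp [ih u t hu]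
            | some c =>
              simp only [subst_some_some]
              rw [subst_some_ne m i (a := a + c) (by omega), iht]
              congr 2
              unfold slot
              split_ifs <;> omega
        · have h₁ : slot m i a ≠ x := by unfold slot; split_ifs <;> omega
          have h₂ : slot k j a ≠ i := by unfold slot; split_ifs <;> omega
          rw [subst_some_ne _ _ haj, subst_some_ne _ _ h₁, subst_some_ne _ _ h₂, ih u t hu]
          congr 2
          unfold slot
          split_ifs <;> omega

/-! ### Counting letters -/

/-- The part of a path `u` that remains to be inserted fits to the part of `v` that remains to
receive it: the steps of `v` in the direction `i` are as many as the pieces of `u`. -/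
def Fits (i : ℕ) (v u : Word) : Prop :=
  v.count (some i) = marks u + 1 ∨ (v.count (some i) = 0 ∧ u = [])

theorem fits_nil {i : ℕ} {u : Word} (h : Fits i [] u) : u = [] := by
  rcases h with h | h
  · simp at h
  · exact h.2

theorem marks_none (v : Word) : marks (none :: v) = marks v + 1 := by simp [marks]

theorem marks_some (a : ℕ) (v : Word) : marks (some a :: v) = marks v := by simp [marks]

/-- Induction along the composition of two fitting words. -/
theorem fits_induction (i : ℕ) {P : ∀ v u : Word, Fits i v u → Prop}
    (nil : P [] [] (Or.inr ⟨rfl, rfl⟩))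
    (none : ∀ v u (h : Fits i v u), P v u h → P (none :: v) u (by simpa [Fits] using h))
    (some_ne : ∀ a v u (ha : a ≠ i) (h : Fits i v u), P v u h →
      P (some a :: v) u (by simpa [Fits, ha] using h))
    (some_nil : ∀ v (hv : some i ∉ v), P v [] (Or.inr ⟨List.count_eq_zero.2 hv, rfl⟩) →
      P (some i :: v) [] (Or.inl (by simp [List.count_eq_zero.2 hv, marks])))
    (some_none : ∀ v u (h : v.count (some i) = marks u + 1), P v u (Or.inl h) →
      P (some i :: v) (Option.none :: u) (Or.inl (by simp [h, marks])))
    (some_some : ∀ b v u (h : v.count (some i) = marks u),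
      P (some i :: v) u (Or.inl (by simp [h])) →
      P (some i :: v) (some b :: u) (Or.inl (by simp [h, marks]))) (v u : Word)
    (h : Fits i v u) : P v u h := by
  induction v, u using subst_induction i with
  | nil u => obtain rfl := fits_nil h; exact nil
  | none v u ih =>
    have h' : Fits i v u := by simpa [Fits] using h
    exact none v u h' (ih h')
  | some_ne a v u ha ih =>
    have h' : Fits i v u := by simpa [Fits, ha] using h
    exact some_ne a v u ha h' (ih h')
  | some_nil v ih =>
    have h' : v.count (some i) = 0 := by simpa [Fits, marks] using h
    exact some_nil v (List.count_eq_zero.1 h') (ih (Or.inr ⟨h', rfl⟩))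
  | some_none v u ih =>
    have h' : v.count (some i) = marks u + 1 := by simpa [Fits, marks] using h
    exact some_none v u h' (ih (Or.inl h'))
  | some_some b v u ih =>
    have h' : v.count (some i) = marks u := by simpa [Fits, marks] using h
    exact some_some b v u h' (ih (Or.inl (by simp [h'])))

theorem slot_inj {m i a b : ℕ} (ha : a ≠ i) (hb : b ≠ i) : slot m i a = slot m i b ↔ a = b := by
  unfold slot
  split_ifs <;> omega

theorem marks_subst {m i : ℕ} {v u : Word} : marks (subst m i v u) = marks v := by
  induction v, u using subst_induction i with
  | nil u => rfl
  | none v u ih => simp [marks_none, ih]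
  | some_ne a v u ha ih => simp [subst_some_ne _ _ ha, marks_some, ih]
  | some_nil v ih => simp [marks_some, ih]
  | some_none v u ih => simp [marks_some, ih]
  | some_some b v u ih => simpa [marks_some] using ih

theorem count_subst_slot {m i : ℕ} {v u : Word} (h : Fits i v u)
    (hu : ∀ b, some b ∈ u → b < m) {a : ℕ} (ha : a ≠ i) :
    (subst m i v u).count (some (slot m i a)) = v.count (some a) := by
  induction v, u, h using fits_induction i with
  | nil => rfl
  | none v u _ ih => simp [ih hu]
  | some_ne a' v u ha' _ ih =>
    rw [subst_some_ne _ _ ha']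
    simp [List.count_cons, ih hu, slot_inj ha' ha]
  | some_nil v _ ih => simp [ih hu, ha.symm]
  | some_none v u _ ih =>
    simp [ih fun b hb => hu b (List.mem_cons_of_mem _ hb), ha.symm]
  | some_some b v u _ ih =>
    have := slot_ne ha (hu b List.mem_cons_self)
    simpa [List.count_cons, this.symm] using ih fun b hb => hu b (List.mem_cons_of_mem _ hb)

theorem count_subst_add {m i : ℕ} {v u : Word} (h : Fits i v u)
    {b : ℕ} (hb : b < m) :
    (subst m i v u).count (some (i + b)) = u.count (some b) := by
  induction v, u, h using fits_induction i with
  | nil => rfl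
  | none v u _ ih => simp [ih]
  | some_ne a v u ha _ ih =>
    rw [subst_some_ne _ _ ha]
    simp [ih, slot_ne ha hb]
  | some_nil v _ ih => simp [ih]
  | some_none v u _ ih => simp [ih]
  | some_some b' v u _ ih => simp [List.count_cons, ih]

theorem dim_subst_slot {m i : ℕ} {v u : Word} (h : Fits i v u)
    (hu : ∀ b, some b ∈ u → b < m) {a : ℕ} (ha : a ≠ i) :
    dim (subst m i v u) (slot m i a) = dim v a := by
  rw [dim, dim, count_subst_slot h hu ha]

theorem dim_subst_add {m i : ℕ} {v u : Word} (h : Fits i v u) {b : ℕ} (hb : b < m) :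
    dim (subst m i v u) (i + b) = dim u b := by
  rw [dim, dim, count_subst_add h hb]

theorem total_subst_lt {m i : ℕ} {v u : Word} (h : Fits i v u)
    (hu : ∀ b, some b ∈ u → b < m) {a : ℕ} (ha : a ≤ i) :
    total a (subst m i v u) = total a v := by
  refine Finset.sum_congr rfl fun b hb => ?_
  have hb := Finset.mem_range.1 hb
  have e := dim_subst_slot h hu (a := b) (by omega)
  rwa [show slot m i b = b from if_pos (by omega)] at e

theorem total_subst_add {m i : ℕ} {v u : Word} (h : Fits i v u)
    (hu : ∀ b, some b ∈ u → b < m) {b : ℕ} (hb : b ≤ m) :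
    total (i + b) (subst m i v u) = total i v + total b u := by
  rw [total, Finset.sum_range_add, ← total, total_subst_lt h hu le_rfl]
  congr 1
  exact Finset.sum_congr rfl fun c hc => dim_subst_add h (by have := Finset.mem_range.1 hc; omega)

theorem total_succ (a : ℕ) (v : Word) : total (a + 1) v = total a v + dim v a :=
  Finset.sum_range_succ _ _

/-- The total dimension of a composite, in the directions below the `a`-th one of `v`. -/
theorem total_subst_gt {m i : ℕ} {v u : Word} (h : Fits i v u)
    (hu : ∀ b, some b ∈ u → b < m) {a r : ℕ} (ha : i < a) (hr : a + m = r + 1) :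
    total r (subst m i v u) + dim v i = total a v + total m u := by
  obtain ⟨e, rfl⟩ : ∃ e, a = i + 1 + e := ⟨a - (i + 1), by omega⟩
  obtain rfl : r = i + m + e := by omega
  have e₁ : total (i + m + e) (subst m i v u) = total (i + m) (subst m i v u) +
      ∑ x ∈ Finset.range e, dim (subst m i v u) (i + m + x) := Finset.sum_range_add _ _ _
  have e₂ : total (i + 1 + e) v = total (i + 1) v + ∑ x ∈ Finset.range e, dim v (i + 1 + x) :=
    Finset.sum_range_add _ _ _
  rw [total_subst_add h hu le_rfl] at e₁
  rw [total_succ] at e₂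
  have : ∑ x ∈ Finset.range e, dim (subst m i v u) (i + m + x) =
      ∑ x ∈ Finset.range e, dim v (i + 1 + x) := Finset.sum_congr rfl fun x _ => by
    have e := dim_subst_slot h hu (a := i + 1 + x) (by omega)
    rwa [show slot m i (i + 1 + x) = i + m + x by unfold slot; split_ifs <;> omega] at e
  omega

theorem dim_cons (v : Word) (a b : ℕ) :
    dim (some a :: v) b = dim v b + if b = a ∧ some a ∈ v then 1 else 0 := by
  by_cases h : b = a
  · subst h
    by_cases h' : some b ∈ v
    · have := List.count_pos_iff.2 h'
      simp only [dim, List.count_cons_self, h', and_self, if_true]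
      omega
    · simp [dim, h', List.count_eq_zero.2 h']
  · simp [dim, h, Ne.symm h]

theorem dim_none (v : Word) (b : ℕ) : dim (none :: v) b = dim v b := by simp [dim]

theorem total_cons (n : ℕ) (v : Word) (a : ℕ) :
    total n (some a :: v) = total n v + if a < n ∧ some a ∈ v then 1 else 0 := by
  simp only [total, dim_cons, Finset.sum_add_distrib]
  congr 1
  by_cases h : some a ∈ v <;> simp [h]

theorem total_none (n : ℕ) (v : Word) : total n (none :: v) = total n v := by
  simp [total, dim_none]

theorem mem_subst {m i : ℕ} {v u : Word} (h : Fits i v u) {x : ℕ} (hx : some x ∈ subst m i v u) :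
    (∃ a ≠ i, some a ∈ v ∧ x = slot m i a) ∨ ∃ b, some b ∈ u ∧ x = i + b := by
  induction v, u, h using fits_induction i with
  | nil => simp at hx
  | none v u _ ih => simpa using ih (by simpa using hx)
  | some_ne a v u ha _ ih =>
    rw [subst_some_ne _ _ ha, List.mem_cons] at hx
    rcases hx with hx | hx
    · exact Or.inl ⟨a, ha, by simp, by simpa using hx⟩
    · rcases ih hx with ⟨a', h₁, h₂, h₃⟩ | h
      · exact Or.inl ⟨a', h₁, List.mem_cons_of_mem _ h₂, h₃⟩
      · exact Or.inr h
  | some_nil v _ ih =>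
    rcases ih (by simpa using hx) with ⟨a', h₁, h₂, h₃⟩ | h
    · exact Or.inl ⟨a', h₁, List.mem_cons_of_mem _ h₂, h₃⟩
    · exact Or.inr h
  | some_none v u _ ih =>
    rcases ih (by simpa using hx) with ⟨a', h₁, h₂, h₃⟩ | ⟨b, hb, e⟩
    · exact Or.inl ⟨a', h₁, List.mem_cons_of_mem _ h₂, h₃⟩
    · exact Or.inr ⟨b, List.mem_cons_of_mem _ hb, e⟩
  | some_some b v u _ ih =>
    rw [subst_some_some, List.mem_cons] at hx
    rcases hx with hx | hx
    · exact Or.inr ⟨b, by simp, by simpa using hx⟩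
    · rcases ih hx with h | ⟨b, hb, e⟩
      · exact Or.inl h
      · exact Or.inr ⟨b, List.mem_cons_of_mem _ hb, e⟩

theorem IsPath.fits {n i : ℕ} {v u : Word} (hv : IsPath n v) (hi : i < n)
    (h : marks u = dim v i) : Fits i v u := by
  have := List.count_pos_iff.2 ((hv i).2 hi)
  left
  rw [h, dim]
  omega

theorem IsPath.subst {n m r i : ℕ} {v u : Word} (hv : IsPath n v) (hu : IsPath m u) (hi : i < n)
    (hr : n + m = r + 1) (h : marks u = dim v i) : IsPath r (subst m i v u) := by
  have hf := hv.fits hi h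
  have hu' : ∀ b, some b ∈ u → b < m := fun b hb => (hu b).1 hb
  intro x
  constructor
  · intro hx
    rcases mem_subst hf hx with ⟨a, ha, hav, rfl⟩ | ⟨b, hb, rfl⟩
    · have := (hv a).1 hav
      unfold slot
      split_ifs <;> omega
    · have := hu' b hb
      omega
  · intro hx
    rw [← List.count_pos_iff]
    by_cases h₁ : i ≤ x ∧ x < i + m
    · obtain ⟨b, rfl⟩ := Nat.exists_eq_add_of_le h₁.1
      rw [count_subst_add hf (by omega), List.count_pos_iff, hu]
      omega
    · obtain ⟨a, ha, hn, rfl⟩ : ∃ a ≠ i, a < n ∧ slot m i a = x := by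
        by_cases h₂ : x < i
        · exact ⟨x, by omega, by omega, if_pos h₂⟩
        · exact ⟨x + 1 - m, by omega, by omega, by unfold slot; split_ifs <;> omega⟩
      rw [count_subst_slot hf hu' ha, List.count_pos_iff, hv]
      exact hn

/-! ### Complexity -/

theorem changes_cons_cons (p x : Option ℕ) (w : Word) :
    changes (p :: x :: w) = (if p = x then 0 else 1) + changes (x :: w) := rfl

theorem changes_le_cons (p : Option ℕ) (w : Word) : changes w ≤ changes (p :: w) := by
  cases w with
  | nil => exact Nat.zero_le _
  | cons x w => rw [changes_cons_cons]; omega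

theorem changes_insert (p q : Option ℕ) (w : Word) :
    changes (p :: w) ≤ changes (p :: q :: w) := by
  cases w with
  | nil => exact Nat.zero_le _
  | cons x w =>
    simp only [changes_cons_cons]
    by_cases h : p = q
    · simp [h]
    · simp only [h, if_false]
      split_ifs <;> omega

theorem changes_sublist {w v : Word} (h : w.Sublist v) (p : Option ℕ) :
    changes (p :: w) ≤ changes (p :: v) := by
  induction h generalizing p with
  | slnil => exact le_rfl
  | cons q _ ih => exact (ih p).trans (changes_insert p q _)
  | cons_cons q _ ih => simp only [changes_cons_cons]; have := ih q; omega

/-- The projection of a path to the face in the directions `a`, `b`. -/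
abbrev proj (a b : ℕ) (v : Word) : Word := v.filter fun x => x = some a ∨ x = some b

/-- `w` runs through the same directions as `v`, and its projections to the faces have at most as
many angles as those of `v`, even if the paths are continued to the left. -/
structure Dominated (w v : Word) : Prop where
  mem : ∀ a, some a ∈ w ↔ some a ∈ v
  changes_le : ∀ a b p, changes (p :: proj a b w) ≤ changes (p :: proj a b v)

namespace Dominated

theorem refl (v : Word) : Dominated v v := ⟨fun _ => Iff.rfl, fun _ _ _ => le_rfl⟩

theorem trans {w v u : Word} (h : Dominated w v) (h' : Dominated v u) : Dominated w u :=
  ⟨fun a => (h.mem a).trans (h'.mem a),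
    fun a b p => (h.changes_le a b p).trans (h'.changes_le a b p)⟩

theorem angles_le {w v : Word} (h : Dominated w v) (a b : ℕ) : angles a b w ≤ angles a b v := by
  have h' := h.changes_le a b
  unfold angles
  change changes (proj a b w) ≤ changes (proj a b v)
  cases hv : proj a b v with
  | nil =>
    rw [hv] at h'
    exact (changes_le_cons none _).trans (h' none)
  | cons x t =>
    rw [hv] at h'
    refine (changes_le_cons x _).trans ((h' x).trans ?_)
    simp [changes_cons_cons]

theorem cons_none {w v : Word} (h : Dominated w v) : Dominated (none :: w) (none :: v) :=
  ⟨fun a => by simp [h.mem a], fun a b p => by simpa [proj] using h.changes_le a b p⟩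

theorem none_cons {w v : Word} (h : Dominated w v) : Dominated (none :: w) v :=
  ⟨fun a => by simp [h.mem a], fun a b p => by simpa [proj] using h.changes_le a b p⟩

theorem cons_some {w v : Word} (h : Dominated w v) (c : ℕ) :
    Dominated (some c :: w) (some c :: v) :=
  ⟨fun a => by simp [h.mem a], fun a b p => by
    by_cases hc : c = a ∨ c = b
    · simp only [proj, List.filter_cons, Option.some.injEq, hc, decide_true, if_true,
        changes_cons_cons]
      have := h.changes_le a b (some c)
      simp only [proj] at this
      omega
    · simpa [proj, List.filter_cons, hc] using h.changes_le a b p⟩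

theorem cons {w v : Word} (h : Dominated w v) (x : Option ℕ) : Dominated (x :: w) (x :: v) := by
  cases x with
  | none => exact h.cons_none
  | some a => exact h.cons_some a

theorem double (c : ℕ) (v : Word) : Dominated (some c :: some c :: v) (some c :: v) :=
  ⟨fun a => by simp, fun a b p => by
    by_cases hc : c = a ∨ c = b <;> simp [proj, hc, changes_cons_cons]⟩

theorem of_sublist {w v : Word} (h : w.Sublist v) (hm : ∀ a, some a ∈ v → some a ∈ w) :
    Dominated w v :=
  ⟨fun a => ⟨fun h' => h.subset h', hm a⟩,
    fun _ _ p => changes_sublist (h.filter _) p⟩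

theorem isPath {w v : Word} (h : Dominated w v) {n : ℕ} (hv : IsPath n v) : IsPath n w :=
  fun a => (h.mem a).trans (hv a)

theorem complexityLE {w v : Word} (h : Dominated w v) {c : ℕ∞} {n : ℕ}
    (hv : ComplexityLE c n v) : ComplexityLE c n w :=
  fun a b hab hb => le_trans (by exact_mod_cast h.angles_le a b) (hv a b hab hb)

end Dominated

theorem changes_map (f : Option ℕ → Option ℕ) (w : Word) : changes (w.map f) ≤ changes w := by
  induction w with
  | nil => exact le_rfl
  | cons x w ih =>
    cases w with
    | nil => exact le_rfl
    | cons y w =>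
      simp only [List.map_cons, changes_cons_cons] at ih ⊢
      by_cases h : x = y
      · simpa [h] using ih
      · simp only [h, if_false]
        split_ifs <;> omega

theorem angles_comm (a b : ℕ) (v : Word) : angles a b v = angles b a v := by
  unfold angles
  simp only [or_comm]

theorem proj_subst_slot {m i : ℕ} {v u : Word} (h : Fits i v u)
    (hu : ∀ b, some b ∈ u → b < m) {a a' : ℕ} (ha : a ≠ i) (ha' : a' ≠ i) :
    proj (slot m i a) (slot m i a') (subst m i v u) =
      (proj a a' v).map (Option.map (slot m i)) := by
  induction v, u, h using fits_induction i with
  | nil => rfl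
  | none v u _ ih => simpa [proj] using ih hu
  | some_ne c v u hc _ ih =>
    rw [subst_some_ne _ _ hc]
    by_cases h : c = a ∨ c = a'
    · simpa [proj, slot_inj hc ha, slot_inj hc ha', h] using ih hu
    · simpa [proj, slot_inj hc ha, slot_inj hc ha', h] using ih hu
  | some_nil v _ ih => simpa [proj, ha.symm, ha'.symm] using ih hu
  | some_none v u _ ih =>
    simpa [proj, ha.symm, ha'.symm] using ih fun b hb => hu b (List.mem_cons_of_mem _ hb)
  | some_some b v u _ ih =>
    have h₁ := slot_ne ha (hu b List.mem_cons_self)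
    have h₂ := slot_ne ha' (hu b List.mem_cons_self)
    simpa [proj, ha.symm, ha'.symm, h₁.symm, h₂.symm] using
      ih fun b hb => hu b (List.mem_cons_of_mem _ hb)

theorem proj_subst_add {m i : ℕ} {v u : Word} (h : Fits i v u)
    {b b' : ℕ} (hb : b < m) (hb' : b' < m) :
    proj (i + b) (i + b') (subst m i v u) = (proj b b' u).map (Option.map (i + ·)) := by
  induction v, u, h using fits_induction i with
  | nil => rfl
  | none v u _ ih => simpa [proj] using ih
  | some_ne a v u ha _ ih =>
    rw [subst_some_ne _ _ ha]
    simpa [proj, slot_ne ha hb, slot_ne ha hb'] using ih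
  | some_nil v _ ih => simpa [proj] using ih
  | some_none v u _ ih => simpa [proj] using ih
  | some_some c v u _ ih =>
    by_cases h : c = b ∨ c = b'
    · simpa [proj, h] using ih
    · simpa [proj, h] using ih

/-- Replacing each step in one of two directions by some steps in a single direction, possibly by
none, creates no angles. -/
theorem changes_proj_subst {m i : ℕ} {v u : Word} (h : Fits i v u)
    (hu : ∀ b, some b ∈ u → b < m) {a b : ℕ} (ha : a ≠ i) (hb : b < m) (p : Option ℕ) :
    changes ((if p = some i then some (i + b) else some (slot m i a)) ::
      proj (slot m i a) (i + b) (subst m i v u)) ≤ changes (p :: proj a i v) := by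
  induction v, u, h using fits_induction i generalizing p with
  | nil => exact le_rfl
  | none v u _ ih => simpa [proj] using ih hu p
  | some_ne c v u hc _ ih =>
    rw [subst_some_ne _ _ hc]
    by_cases h : c = a
    · subst h
      have := ih hu (some c)
      simp only [Option.some.injEq, hc, if_false] at this
      simp only [proj, List.filter_cons, true_or, decide_true, if_true, changes_cons_cons]
      refine Nat.add_le_add ?_ this
      by_cases hp : p = some c
      · simp [hp, hc]
      · simp only [hp, if_false]
        split_ifs <;> omega
    · simpa [proj, List.filter_cons, slot_inj hc ha, h, hc, slot_ne hc hb] using ih hu p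
  | some_nil v _ ih =>
    rw [subst_some_nil]
    refine (ih hu p).trans (changes_sublist (List.Sublist.filter _ ?_) p)
    exact List.sublist_cons_self _ _
  | some_none v u _ ih =>
    rw [subst_some_none]
    refine (ih (fun b hb => hu b (List.mem_cons_of_mem _ hb)) p).trans
      (changes_sublist (List.Sublist.filter _ ?_) p)
    exact List.sublist_cons_self _ _
  | some_some c v u _ ih =>
    rw [subst_some_some]
    have hu' := fun b hb => hu b (List.mem_cons_of_mem (some c) hb)
    have hc := slot_ne ha (hu c List.mem_cons_self)
    by_cases h : c = b
    · subst h
      have := ih hu' (some i)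
      simp only [if_true] at this
      simp only [proj, List.filter_cons, or_true, decide_true, if_true, changes_cons_cons]
        at this ⊢
      have h' : (if (if p = some i then some (i + c) else some (slot m i a)) = some (i + c)
          then 0 else 1) ≤ if p = some i then 0 else 1 := by
        by_cases hp : p = some i
        · simp [hp]
        · simp only [hp, if_false]
          split_ifs <;> omega
      omega
    · simpa [proj, List.filter_cons, hc.symm, h] using ih hu' p

theorem angles_subst {m i : ℕ} {v u : Word} (h : Fits i v u)
    (hu : ∀ b, some b ∈ u → b < m) {a b : ℕ} (ha : a ≠ i) (hb : b < m) :
    angles (slot m i a) (i + b) (subst m i v u) ≤ angles a i v := by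
  have h' := changes_proj_subst h hu ha hb
  unfold angles
  change changes (proj _ _ _) ≤ changes (proj a i v)
  cases hv : proj a i v with
  | nil =>
    rw [hv] at h'
    exact (changes_le_cons _ _).trans (h' none)
  | cons x t =>
    rw [hv] at h'
    refine (changes_le_cons _ _).trans ((h' x).trans ?_)
    simp [changes_cons_cons]

theorem ComplexityLE.angles_le {c : ℕ∞} {n : ℕ} {v : Word} (hv : ComplexityLE c n v) {a b : ℕ}
    (hab : a ≠ b) (ha : a < n) (hb : b < n) : (angles a b v : ℕ∞) ≤ c := by
  rcases lt_or_gt_of_ne hab with h | h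
  · exact hv a b h hb
  · rw [angles_comm]
    exact hv b a h ha

theorem ComplexityLE.subst {c : ℕ∞} {n m r i : ℕ} {v u : Word} (hv : ComplexityLE c n v)
    (hu : ComplexityLE c m u) (h : Fits i v u) (hum : ∀ b, some b ∈ u → b < m) (hi : i < n)
    (hr : n + m = r + 1) : ComplexityLE c r (subst m i v u) := by
  have key : ∀ x < r, (∃ b < m, x = i + b) ∨ ∃ a < n, a ≠ i ∧ x = slot m i a := by
    intro x hx
    by_cases h₁ : i ≤ x ∧ x < i + m
    · exact Or.inl ⟨x - i, by omega, by omega⟩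
    · right
      by_cases h₂ : x < i
      · exact ⟨x, by omega, by omega, (if_pos h₂).symm⟩
      · exact ⟨x + 1 - m, by omega, by omega, by unfold slot; split_ifs <;> omega⟩
  intro x y hxy hy
  rcases key x (hxy.trans hy) with ⟨b, hb, rfl⟩ | ⟨a, han, ha, rfl⟩ <;>
    rcases key y hy with ⟨b', hb', rfl⟩ | ⟨a', han', ha', rfl⟩
  · refine le_trans ?_ (hu b b' (by omega) hb')
    have := changes_map (Option.map (i + ·)) (proj b b' u)
    rw [← proj_subst_add h hb hb'] at this
    exact_mod_cast this
  · rw [angles_comm]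
    refine le_trans ?_ (hv.angles_le ha' han' hi)
    exact_mod_cast angles_subst h hum ha' hb
  · refine le_trans ?_ (hv.angles_le ha han hi)
    exact_mod_cast angles_subst h hum ha hb'
  · refine le_trans ?_ (hv.angles_le (fun e => hxy.ne (by rw [e])) han han')
    have := changes_map (Option.map (slot m i)) (proj a a' v)
    rw [← proj_subst_slot h hum ha ha'] at this
    exact_mod_cast this

/-! ### Permutations of the directions -/

/-- The extension of a permutation of the directions to all numbers, fixing those that are not
directions. -/
def extendPerm {n : ℕ} (σ : Equiv.Perm (Fin n)) (a : ℕ) : ℕ :=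
  if h : a < n then (σ ⟨a, h⟩ : ℕ) else a

section Perm

variable {n : ℕ} (σ τ : Equiv.Perm (Fin n))

theorem permWord_eq (v : Word) : permWord σ v = v.map (Option.map (extendPerm σ)) := rfl

theorem extendPerm_of_lt {a : ℕ} (h : a < n) : extendPerm σ a = σ ⟨a, h⟩ := dif_pos h

theorem extendPerm_val (a : Fin n) : extendPerm σ a = σ a := extendPerm_of_lt σ a.2

theorem extendPerm_one (a : ℕ) : extendPerm (1 : Equiv.Perm (Fin n)) a = a := by
  unfold extendPerm
  split_ifs <;> simp

theorem extendPerm_mul (a : ℕ) :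
    extendPerm (σ * τ) a = extendPerm σ (extendPerm τ a) := by
  unfold extendPerm
  split_ifs with h₁ h₂
  · simp
  · exact absurd (τ _).2 h₂
  · rfl

theorem extendPerm_injective : Function.Injective (extendPerm σ) := by
  refine Function.LeftInverse.injective (g := extendPerm σ⁻¹) fun a => ?_
  rw [← extendPerm_mul, inv_mul_cancel, extendPerm_one]

theorem extendPerm_lt {a : ℕ} : extendPerm σ a < n ↔ a < n := by
  unfold extendPerm
  split_ifs with h <;> simp [h]

theorem permWord_one (v : Word) : permWord (1 : Equiv.Perm (Fin n)) v = v := by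
  have : (Option.map (extendPerm (1 : Equiv.Perm (Fin n)))) = id := by
    funext x; cases x <;> simp [extendPerm_one]
  rw [permWord_eq, this, List.map_id]

theorem permWord_mul (v : Word) : permWord (σ * τ) v = permWord σ (permWord τ v) := by
  simp only [permWord_eq, List.map_map]
  congr 1
  funext x
  cases x <;> simp [extendPerm_mul]

theorem permWord_injective : Function.Injective (Option.map (extendPerm σ)) :=
  Option.map_injective (extendPerm_injective σ)

theorem count_permWord (a : ℕ) (v : Word) :
    (permWord σ v).count (some (extendPerm σ a)) = v.count (some a) :=
  List.count_map_of_injective v _ (permWord_injective σ) (some a)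

theorem dim_permWord (a : ℕ) (v : Word) : dim (permWord σ v) (extendPerm σ a) = dim v a := by
  rw [dim, dim, count_permWord]

theorem marks_permWord (v : Word) : marks (permWord σ v) = marks v :=
  List.count_map_of_injective v _ (permWord_injective σ) none

theorem mem_permWord (a : ℕ) (v : Word) :
    some (extendPerm σ a) ∈ permWord σ v ↔ some a ∈ v := by
  rw [← List.count_pos_iff, count_permWord, List.count_pos_iff]

theorem exists_extendPerm (x : ℕ) : ∃ a, extendPerm σ a = x :=
  ⟨extendPerm σ⁻¹ x, by rw [← extendPerm_mul, mul_inv_cancel, extendPerm_one]⟩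

theorem IsPath.perm {v : Word} (hv : IsPath n v) : IsPath n (permWord σ v) := by
  intro x
  obtain ⟨a, rfl⟩ := exists_extendPerm σ x
  rw [mem_permWord, extendPerm_lt, hv]

theorem total_permWord (v : Word) : total n (permWord σ v) = total n v := by
  unfold total
  rw [Finset.sum_range, Finset.sum_range, ← Equiv.sum_comp σ]
  refine Finset.sum_congr rfl fun a _ => ?_
  rw [← extendPerm_val, dim_permWord]

theorem ComplexityLE.perm {c : ℕ∞} {v : Word} (hv : ComplexityLE c n v) :
    ComplexityLE c n (permWord σ v) := by
  intro x y hxy hy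
  have hx := hxy.trans hy
  obtain ⟨a, rfl⟩ := exists_extendPerm σ x
  obtain ⟨b, rfl⟩ := exists_extendPerm σ y
  refine le_trans ?_ (hv.angles_le (fun e => hxy.ne (by rw [e])) ((extendPerm_lt σ).1 hx)
    ((extendPerm_lt σ).1 hy))
  have h₁ := changes_map (Option.map (extendPerm σ)) (proj a b v)
  have h₂ : (proj a b v).map (Option.map (extendPerm σ)) =
      proj (extendPerm σ a) (extendPerm σ b) (permWord σ v) := by
    rw [permWord_eq, proj, proj, List.filter_map]
    congr 1
    refine List.filter_congr fun z _ => ?_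
    cases z <;> simp [(extendPerm_injective σ).eq_iff]
  rw [h₂] at h₁
  exact_mod_cast h₁

theorem mem_lat_perm {c : ℕ∞} {l : ℕ} {p : ℤ} {v : Word} (hv : v ∈ lat c n l p) :
    permWord σ v ∈ lat c n l p := by
  obtain ⟨h₁, h₂, h₃, h₄⟩ := hv
  exact ⟨h₁.perm σ, (marks_permWord σ v).trans h₂, h₃.perm σ, by rw [total_permWord, h₄]⟩

end Perm

theorem permWord_subst {n m r : ℕ} (i : Fin n) (hr : n + m = r + 1)
    (σ : Equiv.Perm (Fin n)) (τ : Equiv.Perm (Fin m)) (ρ : Equiv.Perm (Fin r))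
    (h₁ : ∀ (a : Fin n) (x y : Fin r), a ≠ i → (x : ℕ) = slot m i a →
      (y : ℕ) = slot m (σ i) (σ a) → ρ x = y)
    (h₂ : ∀ (b : Fin m) (x y : Fin r), (x : ℕ) = i + b → (y : ℕ) = σ i + τ b → ρ x = y)
    (v u : Word) (hv : ∀ a, some a ∈ v → a < n) (hu : ∀ b, some b ∈ u → b < m) :
    permWord ρ (subst m i v u) = subst m (σ i) (permWord σ v) (permWord τ u) := by
  have hσ : permWord σ [some (i : ℕ)] = [some (σ i : ℕ)] := by
    simp [permWord_eq, extendPerm_val]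
  have hcons : ∀ (k : ℕ) (φ : Equiv.Perm (Fin k)) (x : Option ℕ) (w : Word), permWord φ (x :: w) =
    x.map (extendPerm φ) :: permWord φ w := fun _ _ _ _ => rfl
  induction v, u using subst_induction (i : ℕ) with
  | nil u => rfl
  | none v u ih =>
    simp only [subst_none, hcons, Option.map_none]
    rw [ih (fun a ha => hv a (List.mem_cons_of_mem _ ha)) hu]
  | some_ne a v u ha ih =>
    have han := hv a List.mem_cons_self
    have hne : (⟨a, han⟩ : Fin n) ≠ i := fun e => ha (congrArg Fin.val e)
    have hσa : (σ ⟨a, han⟩ : ℕ) ≠ σ i := fun e => hne (σ.injective (Fin.ext e))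
    have hlt : ∀ (j b : Fin n), b ≠ j → slot m j b < r := by
      intro j b hb
      have := b.2
      have := j.2
      have : (b : ℕ) ≠ j := fun e => hb (Fin.ext e)
      unfold slot
      split_ifs <;> omega
    rw [subst_some_ne _ _ ha, hcons, hcons, Option.map_some, Option.map_some,
      extendPerm_of_lt σ han, subst_some_ne _ _ hσa,
      ih (fun a ha => hv a (List.mem_cons_of_mem _ ha)) hu]
    congr 2
    rw [extendPerm_of_lt ρ (hlt i ⟨a, han⟩ hne),
      h₁ ⟨a, han⟩ ⟨_, hlt i ⟨a, han⟩ hne⟩ ⟨slot m (σ i) (σ ⟨a, han⟩), hlt (σ i) _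
        (fun e => hne (σ.injective e))⟩ hne rfl rfl]
  | some_nil v ih =>
    have := ih (fun a ha => hv a (List.mem_cons_of_mem _ ha)) hu
    rw [subst_some_nil, hcons, Option.map_some, extendPerm_val]
    exact this.trans (subst_some_nil _ _ _).symm
  | some_none v u ih =>
    rw [subst_some_none, hcons, hcons, Option.map_some, extendPerm_val, Option.map_none,
      subst_some_none, ih (fun a ha => hv a (List.mem_cons_of_mem _ ha))
        (fun a ha => hu a (List.mem_cons_of_mem _ ha))]
  | some_some b v u ih =>
    have hb := hu b List.mem_cons_self
    have hi := i.2
    have hσi := (σ i).2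
    have hτb := (τ ⟨b, hb⟩).2
    have := ih hv (fun a ha => hu a (List.mem_cons_of_mem _ ha))
    rw [hcons, Option.map_some, extendPerm_val] at this
    rw [subst_some_some, hcons, hcons, hcons, Option.map_some, Option.map_some, Option.map_some,
      extendPerm_val, extendPerm_of_lt τ hb, subst_some_some, this]
    congr 2
    rw [extendPerm_of_lt ρ (by omega : (i : ℕ) + b < r),
      h₂ ⟨b, hb⟩ ⟨_, by omega⟩ ⟨(σ i : ℕ) + τ ⟨b, hb⟩, by omega⟩ rfl rfl]

/-! ### Marked paths in dimension one -/

/-- The word that represents the identity of the ordinal `[l + 1]`. -/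
def unitWord (l : ℕ) : Word := some 0 :: (List.replicate l [none, some 0]).flatten

theorem unitWord_zero : unitWord 0 = [some 0] := rfl

theorem unitWord_succ (l : ℕ) : unitWord (l + 1) = some 0 :: none :: unitWord l := by
  simp [unitWord, List.replicate_succ]

/-- Insertion of a mark directly after the `t`-th mark (counted from `1`), at the beginning for
`t = 0`, and at the end if there are less than `t` marks. -/
def insertMark : ℕ → Word → Word
  | 0, v => none :: v
  | _ + 1, [] => [none]
  | t + 1, none :: v => none :: insertMark t v
  | t + 1, some a :: v => some a :: insertMark (t + 1) v

theorem insertMark_nil (t : ℕ) : insertMark t [] = [none] := by cases t <;> rfl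

theorem coface_eq_insertMark (t : ℕ) (v : Word) : coface t v = insertMark t v := by
  have h₁ : ∀ t v, t < marks v → doubleNth t none v = insertMark (t + 1) v := by
    intro t v
    induction v generalizing t with
    | nil => simp [marks]
    | cons x v ih =>
      cases x with
      | none =>
        cases t with
        | zero => simp [doubleNth, insertMark]
        | succ t => intro h; simp [doubleNth, insertMark, ih t (by simpa [marks] using h)]
      | some a => intro h; simp [doubleNth, insertMark, ih t (by simpa [marks] using h)]
  have h₂ : ∀ t v, marks v ≤ t → v ++ [none] = insertMark (t + 1) v := by
    intro t v
    induction v generalizing t with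
    | nil => simp [insertMark]
    | cons x v ih =>
      cases x with
      | none =>
        cases t with
        | zero => simp [marks]
        | succ t => intro h; simp [insertMark, ih t (by simpa [marks] using h)]
      | some a => intro h; simp [insertMark, ih t (by simpa [marks] using h)]
  unfold coface
  cases t with
  | zero => simp [insertMark]
  | succ t =>
    simp only [Nat.succ_ne_zero, if_false, Nat.add_sub_cancel]
    split_ifs with h
    · exact h₁ t v h
    · exact h₂ t v (by omega)

theorem count_insertMark (t a : ℕ) (v : Word) :
    (insertMark t v).count (some a) = v.count (some a) := by
  induction v generalizing t with
  | nil => simp [insertMark_nil]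
  | cons x v ih =>
    cases t with
    | zero => simp [insertMark]
    | succ t => cases x <;> simp [insertMark, List.count_cons, ih]

theorem marks_insertMark (t : ℕ) (v : Word) : marks (insertMark t v) = marks v + 1 := by
  induction v generalizing t with
  | nil => simp [insertMark_nil, marks]
  | cons x v ih =>
    cases t with
    | zero => simp [insertMark, marks]
    | succ t => cases x <;> simp [insertMark, marks_none, marks_some, ih]

theorem insertMark_insertMark (s t : ℕ) (h : s ≤ t) (v : Word) :
    insertMark s (insertMark t v) = insertMark (t + 1) (insertMark s v) := by
  induction v generalizing s t with
  | nil => cases s <;> simp [insertMark_nil, insertMark]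
  | cons x v ih =>
    cases s with
    | zero => simp [insertMark]
    | succ s =>
      cases t with
      | zero => omega
      | succ t =>
        cases x with
        | none => simp [insertMark, ih s t (by omega)]
        | some a => simp [insertMark, ih (s + 1) (t + 1) (by omega)]

theorem count_unitWord (l : ℕ) : (unitWord l).count (some 0) = l + 1 := by
  induction l with
  | zero => rfl
  | succ l ih => simp [unitWord_succ, ih]

theorem marks_unitWord (l : ℕ) : marks (unitWord l) = l := by
  induction l with
  | zero => rfl
  | succ l ih => simp [unitWord_succ, marks_none, marks_some, ih]

theorem mem_unitWord {l a : ℕ} : some a ∈ unitWord l ↔ a = 0 := by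
  induction l with
  | zero => simp [unitWord_zero]
  | succ l ih => simp [unitWord_succ, ih]

theorem slot_one (i a : ℕ) : slot 1 i a = a := by unfold slot; split_ifs <;> omega

theorem subst_unitWord_left (m : ℕ) (u : Word) : subst m 0 (unitWord (marks u)) u = u := by
  induction u with
  | nil => rfl
  | cons x u ih =>
    cases x with
    | none => rw [marks_none, unitWord_succ, subst_some_none, subst_none, ih]
    | some b =>
      rw [marks_some]
      unfold unitWord at ih ⊢
      rw [subst_some_some, ih, zero_add]

theorem subst_of_notMem (i : ℕ) (v u : Word) (hv : some i ∉ v) : subst 1 i v u = v := by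
  induction v with
  | nil => rfl
  | cons x v ih =>
    have ih := ih fun h => hv (List.mem_cons_of_mem _ h)
    cases x with
    | none => rw [subst_none, ih]
    | some a =>
      have : a ≠ i := fun e => hv (by simp [e])
      rw [subst_some_ne _ _ this, ih, slot_one]

theorem subst_unitWord_right (i k : ℕ) (v : Word) (h : v.count (some i) = k + 1) :
    subst 1 i v (unitWord k) = v := by
  induction v generalizing k with
  | nil => simp at h
  | cons x v ih =>
    cases x with
    | none => rw [subst_none, ih k (by simpa using h)]
    | some a =>
      by_cases ha : a = i
      · subst ha
        have h' : v.count (some a) = k := by simpa using h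
        cases k with
        | zero =>
          rw [unitWord_zero, subst_some_some, subst_some_nil,
            subst_of_notMem _ _ _ (List.count_eq_zero.1 h'), add_zero]
        | succ k => rw [unitWord_succ, subst_some_some, subst_some_none, ih k h', add_zero]
      · rw [subst_some_ne _ _ ha, ih k (by simpa [ha] using h), slot_one]

theorem subst_insertMark_left (m t l : ℕ) (u : Word) (h : marks u = l) :
    subst m 0 (insertMark t (unitWord l)) u = insertMark t u := by
  induction u generalizing t l with
  | nil =>
    subst h
    cases t with
    | zero => rfl
    | succ t => simp [marks, unitWord_zero, insertMark]
  | cons x u ih =>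
    cases t with
    | zero => subst h; simp only [insertMark, subst_none, subst_unitWord_left]
    | succ t =>
      cases x with
      | none =>
        subst h
        rw [marks_none, unitWord_succ]
        simp only [insertMark, subst_some_none, subst_none]
        rw [ih t _ rfl]
      | some b =>
        have ih := ih (t + 1) l (by simpa [marks] using h)
        unfold unitWord at ih ⊢
        simp only [insertMark] at ih ⊢
        rw [subst_some_some, ih, zero_add]

theorem subst_nil_right (i : ℕ) (v : Word) (h : v.count (some i) = 1) :
    subst 1 i v [] = eraseNth 0 (some i) v := by
  induction v with
  | nil => simp at h
  | cons x v ih =>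
    cases x with
    | none => simp [eraseNth, ih (by simpa using h)]
    | some a =>
      by_cases ha : a = i
      · subst ha
        have h' : v.count (some a) = 0 := by simpa using h
        simp [eraseNth, subst_of_notMem _ _ _ (List.count_eq_zero.1 h')]
      · simp [subst_some_ne _ _ ha, slot_one, eraseNth, ha, ih (by simpa [ha] using h)]

theorem subst_insertMark_right (i k t : ℕ) (v : Word) (h : v.count (some i) = k + 2)
    (ht : t ≤ k + 1) : subst 1 i v (insertMark t (unitWord k)) = eraseNth t (some i) v := by
  induction v generalizing t k with
  | nil => simp at h
  | cons x v ih =>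
    cases x with
    | none => simp [eraseNth, ih k t (by simpa using h) ht]
    | some a =>
      by_cases ha : a = i
      · subst ha
        have h' : v.count (some a) = k + 1 := by simpa using h
        cases t with
        | zero => simp [insertMark, eraseNth, subst_unitWord_right _ _ _ h']
        | succ t =>
          cases k with
          | zero =>
            obtain rfl : t = 0 := by omega
            simp [unitWord_zero, insertMark, eraseNth, subst_nil_right _ _ h']
          | succ k =>
            simp [unitWord_succ, insertMark, eraseNth, ih k t h' (by omega)]
      · simp [subst_some_ne _ _ ha, slot_one, eraseNth, ha, ih k t (by simpa [ha] using h) ht]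

/-! ### Linear extension -/

theorem extend_eq (φ : Word → (Word →₀ ℤ)) (x : Word →₀ ℤ) :
    extend φ x = Finsupp.linearCombination ℤ φ x := rfl

theorem extend_single (φ : Word → (Word →₀ ℤ)) (v : Word) (a : ℤ) :
    extend φ (Finsupp.single v a) = a • φ v := by
  rw [extend_eq, Finsupp.linearCombination_single]

theorem extend_add (φ : Word → (Word →₀ ℤ)) (x y : Word →₀ ℤ) :
    extend φ (x + y) = extend φ x + extend φ y := map_add (Finsupp.linearCombination ℤ φ) x y

theorem extend_zero (φ : Word → (Word →₀ ℤ)) : extend φ 0 = 0 :=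
  map_zero (Finsupp.linearCombination ℤ φ)

theorem extend_smul (φ : Word → (Word →₀ ℤ)) (a : ℤ) (x : Word →₀ ℤ) :
    extend φ (a • x) = a • extend φ x := map_smul (Finsupp.linearCombination ℤ φ) a x

theorem extend_sum {ι : Type} (φ : Word → (Word →₀ ℤ)) (s : Finset ι) (x : ι → (Word →₀ ℤ)) :
    extend φ (∑ i ∈ s, x i) = ∑ i ∈ s, extend φ (x i) :=
  map_sum (Finsupp.linearCombination ℤ φ) x s

theorem extend_congr {φ ψ : Word → (Word →₀ ℤ)} {x : Word →₀ ℤ}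
    (h : ∀ v ∈ x.support, φ v = ψ v) : extend φ x = extend ψ x :=
  Finsupp.sum_congr fun v hv => by rw [h v hv]

theorem extend_add_fun (φ ψ : Word → (Word →₀ ℤ)) (x : Word →₀ ℤ) :
    extend (fun v => φ v + ψ v) x = extend φ x + extend ψ x := by
  unfold extend
  simp only [smul_add, Finsupp.sum_add]

theorem extend_smul_fun (φ : Word → (Word →₀ ℤ)) (a : ℤ) (x : Word →₀ ℤ) :
    extend (fun v => a • φ v) x = a • extend φ x := by
  unfold extend
  rw [Finsupp.smul_sum]
  simp only [smul_comm a]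

theorem extend_zero_fun (x : Word →₀ ℤ) : extend (fun _ => 0) x = 0 := by
  unfold extend
  simp

theorem extend_sum_fun {ι : Type} (s : Finset ι) (φ : ι → Word → (Word →₀ ℤ)) (x : Word →₀ ℤ) :
    extend (fun v => ∑ i ∈ s, φ i v) x = ∑ i ∈ s, extend (φ i) x := by
  classical
  induction s using Finset.induction_on with
  | empty => simp [extend_zero_fun]
  | insert a s ha ih => simp only [Finset.sum_insert ha, extend_add_fun, ih]

theorem extend_extend (φ ψ : Word → (Word →₀ ℤ)) (x : Word →₀ ℤ) :
    extend φ (extend ψ x) = extend (fun v => extend φ (ψ v)) x := by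
  induction x using Finsupp.induction_linear with
  | zero => simp only [extend_zero]
  | add x y hx hy => simp only [extend_add, hx, hy]
  | single v a => simp only [extend_single, extend_smul]

theorem extend_comm (F : Word → Word → (Word →₀ ℤ)) (x y : Word →₀ ℤ) :
    extend (fun v => extend (fun u => F v u) y) x =
      extend (fun u => extend (fun v => F v u) x) y := by
  induction x using Finsupp.induction_linear with
  | zero => simp only [extend_zero, extend_zero_fun]
  | add x x' hx hx' => simp only [extend_add, extend_add_fun, hx, hx']
  | single v a => simp only [extend_single, extend_smul_fun]

theorem extend_id (x : Word →₀ ℤ) : extend (fun v => Finsupp.single v 1) x = x := by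
  unfold extend
  simp

theorem extend_mem {φ : Word → (Word →₀ ℤ)} {S : Submodule ℤ (Word →₀ ℤ)} {x : Word →₀ ℤ}
    (h : ∀ v ∈ x.support, φ v ∈ S) : extend φ x ∈ S :=
  S.sum_mem fun v hv => S.smul_mem _ (h v hv)

theorem neg_one_pow_congr {a b : ℕ} (h : (a : ZMod 2) = b) : (-1 : ℤ) ^ a = (-1) ^ b := by
  rw [ZMod.natCast_eq_natCast_iff] at h
  rw [neg_one_pow_eq_pow_mod_two, neg_one_pow_eq_pow_mod_two (n := b), h]

theorem two_zmod : (2 : ZMod 2) = 0 := rfl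

/-! ### The graded operad of marked lattice paths -/

/-- The composition of a single path with a cochain. -/
def compWord (n m i : ℕ) (g : Cochain) (v : Word) : Word →₀ ℤ :=
  extend (fun u => Finsupp.single (subst m i v u)
    ((-1) ^ (parity m u * (parity n v + total i v)))) (g (dim v i))

theorem comp_apply (n m i : ℕ) (f g : Cochain) (l : ℕ) :
    comp n m i f g l = extend (compWord n m i g) (f l) := rfl

theorem mem_latCochains {c : ℕ∞} {n : ℕ} {p : ℤ} {f : Cochain} :
    f ∈ latCochains c n p ↔ ∀ l, ∀ v ∈ (f l).support, v ∈ lat c n l p := by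
  simp only [latCochains, Submodule.mem_pi, Set.mem_univ, forall_true_left]
  exact Iff.rfl

theorem coe_negOnePow {a : ℕ} {q : ℤ} (h : (a : ZMod 2) = (q : ZMod 2)) :
    ((q.negOnePow : ℤˣ) : ℤ) = (-1) ^ a := by
  have h' : Even (q - a) := by
    rw [even_iff_two_dvd, ← Nat.cast_ofNat, ← ZMod.intCast_zmod_eq_zero_iff_dvd (q - a) 2]
    push_cast
    rw [h, sub_self]
  rw [(Int.negOnePow_eq_iff q a).2 h', Int.negOnePow_def]
  simp

theorem parity_of_mem_lat {c : ℕ∞} {n l : ℕ} {p : ℤ} {v : Word} (hv : v ∈ lat c n l p) :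
    (parity n v : ZMod 2) = (p : ZMod 2) := by
  obtain ⟨-, h₂, -, h₄⟩ := hv
  rw [← h₄, parity, h₂]
  push_cast
  linear_combination (total n v : ZMod 2) * two_zmod

/-- The conditions under which `v` can be composed with `u` in the `i`-th direction. -/
structure Composable (n m i : ℕ) (v u : Word) : Prop where
  left : IsPath n v
  right : IsPath m u
  lt : i < n
  marks_eq : marks u = dim v i

namespace Composable

variable {n m i : ℕ} {v u : Word} (h : Composable n m i v u)
include h

theorem fits : Fits i v u := h.left.fits h.lt h.marks_eq

theorem lt_right : ∀ b, some b ∈ u → b < m := fun b hb => (h.right b).1 hb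

theorem total_subst {r : ℕ} (hr : n + m = r + 1) :
    (total r (subst m i v u) : ZMod 2) = total n v + total m u + dim v i := by
  have e := total_subst_gt h.fits h.lt_right h.lt hr
  have e' : (total r (subst m i v u) : ZMod 2) + dim v i = total n v + total m u := by
    exact_mod_cast congrArg (Nat.cast : ℕ → ZMod 2) e
  linear_combination e' - dim v i * two_zmod

theorem parity_subst {r : ℕ} (hr : n + m = r + 1) :
    (parity r (subst m i v u) : ZMod 2) = parity n v + parity m u := by
  have e := h.total_subst hr
  simp only [parity, marks_subst, Nat.cast_add, h.marks_eq]
  linear_combination e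

end Composable

section Lat

variable {c : ℕ∞}

theorem comp_mem {n m r : ℕ} {p q s : ℤ} (i : Fin n) (hr : n + m = r + 1) (hs : p + q = s)
    {f g : Cochain} (hf : f ∈ latCochains c n p) (hg : g ∈ latCochains c m q) :
    comp n m i f g ∈ latCochains c r s := by
  rw [mem_latCochains] at hf hg
  simp only [latCochains, Submodule.mem_pi, Set.mem_univ, forall_true_left]
  intro l
  rw [comp_apply]
  refine extend_mem fun v hv => extend_mem fun u hu => ?_
  refine Finsupp.single_mem_supported ℤ _ ?_
  obtain ⟨hv₁, hv₂, hv₃, hv₄⟩ := hf l v hv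
  obtain ⟨hu₁, hu₂, hu₃, hu₄⟩ := hg _ u hu
  have hc : Composable n m i v u := ⟨hv₁, hu₁, i.2, hu₂⟩
  refine ⟨hv₁.subst hu₁ i.2 hr hu₂, marks_subst.trans hv₂,
    hv₃.subst hu₃ hc.fits hc.lt_right i.2 hr, ?_⟩
  have e := total_subst_gt hc.fits hc.lt_right i.2 hr
  omega

theorem comp_assoc_seq {n m k r r' u : ℕ} {p q t : ℤ} (i : Fin n) (j : Fin m)
    (hr : n + m = r + 1) (hr' : m + k = r' + 1) (_ : r + k = u + 1)
    {f g h : Cochain} (hf : f ∈ latCochains c n p) (hg : g ∈ latCochains c m q)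
    (hh : h ∈ latCochains c k t) :
    comp r k (i + j) (comp n m i f g) h = comp n r' i f (comp m k j g h) := by
  rw [mem_latCochains] at hf hg hh
  funext l
  rw [comp_apply, comp_apply, comp_apply, extend_extend]
  refine extend_congr fun v hv => ?_
  obtain ⟨hv₁, hv₂, -, -⟩ := hf l v hv
  rw [compWord, compWord, comp_apply, extend_extend, extend_extend]
  refine extend_congr fun x hx => ?_
  obtain ⟨hx₁, hx₂, -, -⟩ := hg _ x hx
  have hvx : Composable n m i v x := ⟨hv₁, hx₁, i.2, hx₂⟩
  rw [extend_single, compWord, compWord, extend_extend, dim_subst_add hvx.fits j.2,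
    ← extend_smul_fun]
  refine extend_congr fun y hy => ?_
  obtain ⟨hy₁, hy₂, -, -⟩ := hh _ y hy
  have hxy : Composable m k j x y := ⟨hx₁, hy₁, j.2, hy₂⟩
  rw [extend_single, Finsupp.smul_single, Finsupp.smul_single, smul_eq_mul, smul_eq_mul,
    subst_assoc_seq m k i j j.2, show m + k - 1 = r' by omega, ← pow_add, ← pow_add,
    total_subst_add hvx.fits hvx.lt_right j.2.le]
  congr 1
  apply neg_one_pow_congr
  push_cast [hvx.parity_subst hr, hxy.parity_subst hr']
  ring

theorem comp_assoc_par {n m k r r' u : ℕ} {p q t : ℤ} (i j : Fin n) (hij : i < j) (x : ℕ)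
    (hx : x + 1 = j + m) (hr : n + m = r + 1) (hr' : n + k = r' + 1)
    (hu : r + k = u + 1) {f g h : Cochain} (hf : f ∈ latCochains c n p)
    (hg : g ∈ latCochains c m q) (hh : h ∈ latCochains c k t) :
    comp r k x (comp n m i f g) h =
      (q * t).negOnePow • comp r' m i (comp n k j f h) g := by
  rw [mem_latCochains] at hf hg hh
  have hij' : (i : ℕ) < j := hij
  have hsj : slot m i j = x := by unfold slot; split_ifs <;> omega
  have hsi : slot k j i = i := by unfold slot; split_ifs; omega
  funext l
  rw [Units.smul_def, Pi.smul_apply, comp_apply, comp_apply, comp_apply, comp_apply, extend_extend,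
    extend_extend, ← extend_smul_fun]
  refine extend_congr fun v hv => ?_
  obtain ⟨hv₁, hv₂, -, -⟩ := hf l v hv
  rw [compWord, compWord, extend_extend, extend_extend]
  have e₁ : ∀ w ∈ (g (dim v i)).support, extend (compWord r k x h) (Finsupp.single (subst m i v w)
      ((-1) ^ (parity m w * (parity n v + total i v)))) = extend (fun y =>
        Finsupp.single (subst k x (subst m i v w) y) ((-1) ^ (parity m w * (parity n v + total i v)
          + parity k y * (parity n v + parity m w + (total j v + parity m w))))) (h (dim v j)) := by
    intro w hw
    obtain ⟨hw₁, hw₂, -, -⟩ := hg _ w hw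
    have hvw : Composable n m i v w := ⟨hv₁, hw₁, i.2, hw₂⟩
    have hd := dim_subst_slot hvw.fits hvw.lt_right (a := j) (by omega)
    rw [hsj] at hd
    rw [extend_single, compWord, hd, ← extend_smul_fun]
    refine extend_congr fun y hy => ?_
    rw [Finsupp.smul_single, smul_eq_mul, ← pow_add]
    congr 1
    apply neg_one_pow_congr
    have e := congrArg (Nat.cast : ℕ → ZMod 2)
      (total_subst_gt hvw.fits hvw.lt_right hij' (r := x) (by omega))
    push_cast at e
    have e' : (parity m w : ZMod 2) = dim v i + total m w := by
      simp [parity, hw₂]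
    push_cast [hvw.parity_subst hr]
    rw [e']
    linear_combination (parity k y : ZMod 2) * (e - dim v i * two_zmod)
  have e₂ : ∀ y ∈ (h (dim v j)).support, extend (compWord r' m i g) (Finsupp.single (subst k j v y)
      ((-1) ^ (parity k y * (parity n v + total j v)))) = extend (fun w =>
        Finsupp.single (subst m i (subst k j v y) w) ((-1) ^ (parity k y * (parity n v + total j v)
          + parity m w * (parity n v + parity k y + total i v)))) (g (dim v i)) := by
    intro y hy
    obtain ⟨hy₁, hy₂, -, -⟩ := hh _ y hy
    have hvy : Composable n k j v y := ⟨hv₁, hy₁, j.2, hy₂⟩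
    have hd := dim_subst_slot hvy.fits hvy.lt_right (a := i) (by omega)
    rw [hsi] at hd
    rw [extend_single, compWord, hd, ← extend_smul_fun]
    refine extend_congr fun w hw => ?_
    rw [Finsupp.smul_single, smul_eq_mul, ← pow_add, total_subst_lt hvy.fits hvy.lt_right hij'.le]
    congr 1
    apply neg_one_pow_congr
    push_cast [hvy.parity_subst hr']
    ring
  rw [extend_congr e₁, extend_congr e₂, extend_comm, ← extend_smul_fun]
  refine extend_congr fun y hy => ?_
  rw [← extend_smul_fun]
  refine extend_congr fun w hw => ?_
  have hw' := hg _ w hw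
  have hy' := hh _ y hy
  rw [Finsupp.smul_single, smul_eq_mul, subst_assoc_par m k i j hij' x hx v w y
    fun b hb => (hw'.1 b).1 hb]
  congr 1
  have hsign : (((q * t).negOnePow : ℤˣ) : ℤ) = (-1) ^ (parity m w * parity k y) :=
    coe_negOnePow (by push_cast [parity_of_mem_lat hw', parity_of_mem_lat hy']; rfl)
  rw [hsign, ← pow_add]
  apply neg_one_pow_congr
  push_cast
  linear_combination (parity k y * parity m w : ZMod 2) * (two_zmod - two_zmod)

/-- Composition as a bilinear map. -/
def compLin (n m i : ℕ) : Cochain →ₗ[ℤ] Cochain →ₗ[ℤ] Cochain :=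
  LinearMap.mk₂ ℤ (comp n m i)
    (fun f f' g => by funext l; exact extend_add _ _ _)
    (fun a f g => by funext l; exact extend_smul _ _ _)
    (fun f g g' => by
      funext l
      rw [Pi.add_apply]
      simp only [comp_apply]
      rw [← extend_add_fun]
      exact extend_congr fun v _ => extend_add _ _ _)
    (fun a f g => by
      funext l
      rw [Pi.smul_apply]
      simp only [comp_apply]
      rw [← extend_smul_fun]
      exact extend_congr fun v _ => extend_smul _ _ _)

theorem comp_eq (n m i : ℕ) (f g : Cochain) : comp n m i f g = compLin n m i f g := rfl

theorem isPath_one {v : Word} (h : ∀ a, some a ∈ v ↔ a = 0) : IsPath 1 v :=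
  fun a => by rw [h]; omega

theorem complexityLE_one (c : ℕ∞) (v : Word) : ComplexityLE c 1 v :=
  fun a b _ _ => by omega

theorem dim_unitWord (l : ℕ) : dim (unitWord l) 0 = l := by rw [dim, count_unitWord]; omega

theorem total_one (v : Word) : total 1 v = dim v 0 := by simp [total]

theorem total_zero (v : Word) : total 0 v = 0 := rfl

theorem unit_apply (l : ℕ) : unit l = Finsupp.single (unitWord l) 1 := rfl

theorem unitWord_mem_lat (c : ℕ∞) (l : ℕ) : unitWord l ∈ lat c 1 l 0 :=
  ⟨isPath_one fun _ => mem_unitWord, marks_unitWord l, complexityLE_one c _, by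
    rw [total_one, dim_unitWord, sub_self]⟩

theorem parity_unitWord (l : ℕ) : parity 1 (unitWord l) = 2 * l := by
  rw [parity, marks_unitWord, total_one, dim_unitWord, two_mul]

theorem parity_insertMark (t l : ℕ) : parity 1 (insertMark t (unitWord l)) = 2 * l + 1 := by
  have h : dim (insertMark t (unitWord l)) 0 = l := by
    rw [dim, count_insertMark, count_unitWord]
    omega
  rw [parity, marks_insertMark, marks_unitWord, total_one, h]
  omega

theorem unit_mem : unit ∈ latCochains c 1 0 := by
  simp only [latCochains, Submodule.mem_pi, Set.mem_univ, forall_true_left]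
  exact fun l => Finsupp.single_mem_supported ℤ _ (unitWord_mem_lat c l)

theorem unit_comp {m : ℕ} {q : ℤ} {g : Cochain} (hg : g ∈ latCochains c m q) :
    comp 1 m 0 unit g = g := by
  rw [mem_latCochains] at hg
  funext l
  rw [comp_apply, unit_apply, extend_single, one_smul, compWord, dim_unitWord]
  conv_rhs => rw [← extend_id (g l)]
  refine extend_congr fun u hu => ?_
  obtain ⟨hu₁, hu₂, -, -⟩ := hg l u hu
  rw [← hu₂, subst_unitWord_left, parity_unitWord, total_zero, add_zero, mul_left_comm, pow_mul, neg_one_sq, one_pow]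

theorem comp_unit {n : ℕ} {p : ℤ} (i : Fin n) {f : Cochain} (hf : f ∈ latCochains c n p) :
    comp n 1 i f unit = f := by
  rw [mem_latCochains] at hf
  funext l
  rw [comp_apply]
  conv_rhs => rw [← extend_id (f l)]
  refine extend_congr fun v hv => ?_
  obtain ⟨hv₁, -, -, -⟩ := hf l v hv
  have := List.count_pos_iff.2 ((hv₁ i).2 i.2)
  rw [compWord, unit_apply, extend_single, one_smul, subst_unitWord_right _ _ _
    (by rw [dim]; omega), parity_unitWord, mul_assoc, pow_mul, neg_one_sq, one_pow]

/-! ### The differential as a commutator -/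

/-- The element of arity one and degree one whose commutator is the differential: the sum of the
cofaces of the identities of the ordinals. -/
def diffElt : Cochain
  | 0 => 0
  | l + 1 => ∑ t ∈ Finset.range (l + 2), Finsupp.single (insertMark t (unitWord l)) (-(-1) ^ t)

theorem dim_insertMark (t a : ℕ) (v : Word) : dim (insertMark t v) a = dim v a := by
  rw [dim, dim, count_insertMark]

theorem total_insertMark (t a : ℕ) (v : Word) : total a (insertMark t v) = total a v := by
  simp [total, dim_insertMark]

theorem mem_insertMark (t a : ℕ) (v : Word) : some a ∈ insertMark t v ↔ some a ∈ v := by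
  rw [← List.count_pos_iff, count_insertMark, List.count_pos_iff]

theorem diffElt_mem : diffElt ∈ latCochains c 1 1 := by
  simp only [latCochains, Submodule.mem_pi, Set.mem_univ, forall_true_left]
  intro l
  cases l with
  | zero => exact zero_mem _
  | succ l =>
    refine Submodule.sum_mem _ fun t _ => Finsupp.single_mem_supported ℤ _ ?_
    refine ⟨isPath_one fun a => by rw [mem_insertMark, mem_unitWord], ?_, complexityLE_one c _, ?_⟩
    · rw [marks_insertMark, marks_unitWord]
    · rw [total_one, dim_insertMark, dim_unitWord]
      push_cast
      ring

theorem cobdry_eq {n : ℕ} {p : ℤ} {f : Cochain} (hf : f ∈ latCochains c n p) :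
    cobdry n f = comp 1 n 0 diffElt f := by
  rw [mem_latCochains] at hf
  funext l
  cases l with
  | zero => rw [comp_apply]; exact (extend_zero _).symm
  | succ l =>
    rw [comp_apply, diffElt, extend_sum, cobdry]
    simp only [extend_single, ← extend_smul_fun, compWord, dim_insertMark, dim_unitWord]
    rw [← extend_sum_fun]
    refine extend_congr fun v hv => ?_
    obtain ⟨-, hv₂, -, -⟩ := hf l v hv
    rw [cobdryWord, hv₂, Finset.smul_sum]
    refine Finset.sum_congr rfl fun t _ => ?_
    rw [Finsupp.smul_single, Finsupp.smul_single, smul_eq_mul, smul_eq_mul,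
      subst_insertMark_left n t l v hv₂, coface_eq_insertMark, total_zero, neg_mul, neg_mul,
      ← pow_add, ← pow_add]
    congr 2
    apply neg_one_pow_congr
    rw [parity_insertMark]
    push_cast
    linear_combination -(l : ZMod 2) * parity n v * two_zmod

theorem bdry_eq {n : ℕ} {p : ℤ} {f : Cochain} (hf : f ∈ latCochains c n p) :
    bdry n f = -(p.negOnePow • ∑ i ∈ Finset.range n, comp n 1 i f diffElt) := by
  rw [mem_latCochains] at hf
  funext l
  rw [Pi.neg_apply, Units.smul_def, Pi.smul_apply, Finset.sum_apply]
  simp only [comp_apply, bdry]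
  rw [← extend_sum_fun, ← neg_smul, ← extend_smul_fun]
  refine extend_congr fun v hv => ?_
  have hv' := hf l v hv
  have hv₁ := hv'.1
  rw [bdryWord, Finset.smul_sum]
  refine Finset.sum_congr rfl fun r hr => ?_
  have hr' := List.count_pos_iff.2 ((hv₁ r).2 (Finset.mem_range.1 hr))
  rw [compWord]
  cases hk : dim v r with
  | zero => simp [diffElt, extend_zero]
  | succ k =>
    rw [if_neg (Nat.succ_ne_zero k), diffElt, extend_sum, Finset.smul_sum]
    refine Finset.sum_congr rfl fun t ht => ?_
    have ht' := Finset.mem_range.1 ht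
    rw [extend_single, Finsupp.smul_single, Finsupp.smul_single, smul_eq_mul, smul_eq_mul,
      coe_negOnePow (parity_of_mem_lat hv'), subst_insertMark_right r k t v
      (by rw [dim] at hk; omega) (by omega), neg_mul, neg_mul, mul_neg, neg_neg, ← pow_add,
      ← pow_add, face]
    congr 1
    apply neg_one_pow_congr
    rw [parity_insertMark]
    push_cast
    linear_combination -(k * (parity n v + total r v) + parity n v : ZMod 2) * two_zmod

/-- The double alternating sum that occurs in the square of a simplicial or cosimplicial
differential vanishes. -/
theorem sum_sum_alternating_eq_zero {M : Type} [AddCommGroup M] (N : ℕ) (F : ℕ → ℕ → M)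
    (hF : ∀ s t, s ≤ t → t < N → F s t = F (t + 1) s) :
    ∑ x ∈ Finset.range (N + 1) ×ˢ Finset.range N, (-1 : ℤ) ^ (x.1 + x.2) • F x.1 x.2 = 0 := by
  refine Finset.sum_involution (fun x _ => if x.1 ≤ x.2 then (x.2 + 1, x.1) else (x.2, x.1 - 1))
    ?_ ?_ ?_ ?_
  · rintro ⟨s, t⟩ hx
    simp only [Finset.mem_product, Finset.mem_range] at hx
    by_cases h : s ≤ t
    · simp only [h, if_true]
      rw [hF s t h hx.2, show t + 1 + s = s + t + 1 by ring, pow_succ]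
      simp
    · simp only [h, if_false]
      obtain ⟨s, rfl⟩ := Nat.exists_eq_add_of_lt (not_le.1 h)
      rw [show t + s + 1 - 1 = t + s by omega, hF t (t + s) (by omega) (by omega),
        show t + s + 1 + t = t + (t + s) + 1 by ring, pow_succ]
      simp
  · rintro ⟨s, t⟩ _ _
    by_cases h : s ≤ t
    · simp only [h, if_true, ne_eq, Prod.mk.injEq]; omega
    · simp only [h, if_false, ne_eq, Prod.mk.injEq]; omega
  · rintro ⟨s, t⟩ hx
    simp only [Finset.mem_product, Finset.mem_range] at hx
    by_cases h : s ≤ t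
    · simp only [h, if_true, Finset.mem_product, Finset.mem_range]; omega
    · simp only [h, if_false, Finset.mem_product, Finset.mem_range]; omega
  · rintro ⟨s, t⟩ _
    by_cases h : s ≤ t
    · have h' : ¬ t + 1 ≤ s := by omega
      simp [h, h']
    · have h' : t ≤ s - 1 := by omega
      simp only [h, if_false, h', if_true, Prod.mk.injEq, and_true]
      omega

theorem diffElt_comp_diffElt : comp 1 1 0 diffElt diffElt = 0 := by
  rw [← cobdry_eq (diffElt_mem (c := 0))]
  funext l
  match l with
  | 0 => rfl
  | 1 => exact extend_zero _
  | l + 2 =>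
    rw [cobdry, diffElt, extend_sum]
    have h : ∀ t ∈ Finset.range (l + 2), extend (fun v => -(-1 : ℤ) ^ parity 1 v • cobdryWord v)
        (Finsupp.single (insertMark t (unitWord l)) (-(-1) ^ t)) =
        ∑ s ∈ Finset.range (l + 3), -((-1 : ℤ) ^ (s + t) •
          Finsupp.single (insertMark s (insertMark t (unitWord l))) 1) := by
      intro t _
      rw [extend_single, cobdryWord, marks_insertMark, marks_unitWord, Finset.smul_sum,
        Finset.smul_sum]
      refine Finset.sum_congr rfl fun s _ => ?_
      rw [Finsupp.smul_single, Finsupp.smul_single, Finsupp.smul_single, ← Finsupp.single_neg,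
        coface_eq_insertMark]
      congr 1
      rw [parity_insertMark, pow_succ, pow_mul, neg_one_sq, one_pow]
      simp only [smul_eq_mul]
      ring
    rw [Finset.sum_congr rfl h, Finset.sum_comm, ← Finset.sum_product']
    simp only [Finset.sum_neg_distrib]
    rw [sum_sum_alternating_eq_zero (l + 2)
      (fun s t => Finsupp.single (insertMark s (insertMark t (unitWord l))) (1 : ℤ)), neg_zero]
    · rfl
    · intro s t hst _
      rw [insertMark_insertMark s t hst]

end Lat

section Lat

variable {c : ℕ∞}

/-- The differential of `|Lat_c|`. -/
def diff (n : ℕ) (f : Cochain) : Cochain := bdry n f + cobdry n f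

theorem diff_eq {n : ℕ} {p : ℤ} {f : Cochain} (hf : f ∈ latCochains c n p) :
    diff n f = compLin 1 n 0 diffElt f -
      p.negOnePow • ∑ i ∈ Finset.range n, compLin n 1 i f diffElt := by
  rw [diff, cobdry_eq hf, bdry_eq hf, add_comm, ← sub_eq_add_neg]
  rfl

theorem compLin_mem {n m r : ℕ} {p q s : ℤ} {i : ℕ} (hi : i < n) (hr : n + m = r + 1)
    (hs : p + q = s) {f g : Cochain} (hf : f ∈ latCochains c n p) (hg : g ∈ latCochains c m q) :
    compLin n m i f g ∈ latCochains c r s :=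
  comp_mem (⟨i, hi⟩ : Fin n) hr hs hf hg

theorem compLin_assoc_seq {n m k r r' u : ℕ} {p q t : ℤ} {i j : ℕ} (hi : i < n) (hj : j < m)
    (hr : n + m = r + 1) (hr' : m + k = r' + 1) (hu : r + k = u + 1)
    {f g h : Cochain} (hf : f ∈ latCochains c n p) (hg : g ∈ latCochains c m q)
    (hh : h ∈ latCochains c k t) :
    compLin r k (i + j) (compLin n m i f g) h = compLin n r' i f (compLin m k j g h) :=
  comp_assoc_seq (⟨i, hi⟩ : Fin n) (⟨j, hj⟩ : Fin m) hr hr' hu hf hg hh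

theorem diff_mem {n : ℕ} {p : ℤ} {f : Cochain} (hf : f ∈ latCochains c n p) :
    diff n f ∈ latCochains c n (p + 1) := by
  rw [diff_eq hf]
  refine sub_mem (compLin_mem Nat.zero_lt_one (by omega) (by omega) diffElt_mem hf) ?_
  exact Submodule.smul_mem _ (p.negOnePow : ℤ) (Submodule.sum_mem _ fun i hi =>
    compLin_mem (Finset.mem_range.1 hi) rfl rfl hf diffElt_mem)

/-- Compositions at different inputs, the first one with the element that gives the differential. -/
theorem compLin_slot {n m r : ℕ} {p q : ℤ} {i a : ℕ} (hi : i < n) (ha : a < n) (hai : a ≠ i)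
    (hr : n + m = r + 1) {f g : Cochain} (hf : f ∈ latCochains c n p)
    (hg : g ∈ latCochains c m q) :
    compLin r 1 (slot m i a) (compLin n m i f g) diffElt =
      q.negOnePow • compLin n m i (compLin n 1 a f diffElt) g := by
  rcases lt_or_gt_of_ne hai with h | h
  · have e := comp_assoc_par (⟨a, ha⟩ : Fin n) (⟨i, hi⟩ : Fin n) h i rfl rfl hr hr hf
      diffElt_mem hg
    have h' : slot m i a = a := if_pos h
    simp only [comp_eq, one_mul] at e
    rw [h', e, smul_smul, Int.units_mul_self, one_smul]
  · have e := comp_assoc_par (⟨i, hi⟩ : Fin n) (⟨a, ha⟩ : Fin n) h (slot m i a)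
      (by simp only [slot]; split_ifs <;> omega) hr rfl (by omega) hf hg diffElt_mem (u := r)
    simp only [comp_eq, mul_one] at e
    exact e

theorem eq_zero_of_eq_neg {S : Cochain} (h : S = -S) : S = 0 := by
  funext l
  ext v
  have := DFunLike.congr_fun (congrFun h l) v
  simp only [Pi.neg_apply, Finsupp.neg_apply] at this
  simp only [Pi.zero_apply, Finsupp.coe_zero]
  omega

theorem diff_diff {n : ℕ} {p : ℤ} {f : Cochain} (hf : f ∈ latCochains c n p) :
    diff n (diff n f) = 0 := by
  have hE : ∀ i < n, compLin n 1 i f diffElt ∈ latCochains c n (p + 1) := fun i hi =>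
    compLin_mem hi rfl rfl hf diffElt_mem
  have hEE : compLin 1 1 0 diffElt diffElt = 0 := diffElt_comp_diffElt
  have h₁ : compLin 1 n 0 diffElt (compLin 1 n 0 diffElt f) = 0 := by
    rw [← compLin_assoc_seq (r := 1) (r' := n) (u := n) (i := 0) (j := 0) Nat.zero_lt_one Nat.zero_lt_one rfl
      (by omega) (by omega) diffElt_mem diffElt_mem hf, hEE]
    simp
  have h₂ : ∀ i ∈ Finset.range n, compLin n 1 i (compLin 1 n 0 diffElt f) diffElt =
      compLin 1 n 0 diffElt (compLin n 1 i f diffElt) := fun i hi => by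
    have e := compLin_assoc_seq (r := n) (r' := n) (u := n) (i := 0) (j := i) Nat.zero_lt_one
      (Finset.mem_range.1 hi) (by omega) rfl rfl (diffElt_mem (c := c)) hf diffElt_mem
    rwa [zero_add] at e
  have h₃ : ∑ i ∈ Finset.range n, ∑ j ∈ Finset.range n,
      compLin n 1 i (compLin n 1 j f diffElt) diffElt = 0 := by
    have hanti : ∀ i ∈ Finset.range n, ∀ j ∈ Finset.range n,
        compLin n 1 i (compLin n 1 j f diffElt) diffElt =
          -compLin n 1 j (compLin n 1 i f diffElt) diffElt := by
      intro i hi j hj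
      rw [Finset.mem_range] at hi hj
      by_cases hij : i = j
      · subst hij
        have e := compLin_assoc_seq (r := n) (r' := 1) (u := n) (i := i) (j := 0) hi
          Nat.zero_lt_one rfl rfl rfl hf diffElt_mem diffElt_mem
        rw [add_zero, hEE, map_zero] at e
        rw [e, neg_zero]
      · have e := compLin_slot hj hi hij rfl hf diffElt_mem (r := n)
        rw [slot_one, Int.negOnePow_one] at e
        rw [e, Units.neg_smul, one_smul]
    apply eq_zero_of_eq_neg
    conv_lhs => rw [Finset.sum_congr rfl fun i hi => Finset.sum_congr rfl (hanti i hi)]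
    simp only [Finset.sum_neg_distrib]
    rw [Finset.sum_comm]
  rw [diff_eq (diff_mem hf), diff_eq hf, map_sub, h₁]
  simp only [map_sub, LinearMap.sub_apply, Units.smul_def, map_smul, LinearMap.smul_apply,
    map_sum, LinearMap.sum_apply, Finset.sum_sub_distrib, ← Finset.smul_sum, h₃]
  rw [Finset.sum_congr rfl h₂, Int.negOnePow_succ]
  simp

/-- The inputs of `f ∘ᵢ g` are the inputs of `g` and the other inputs of `f`. -/
theorem sum_slot {M : Type} [AddCommMonoid M] {n m r i : ℕ} (hi : i < n) (hr : n + m = r + 1)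
    (F : ℕ → M) : ∑ x ∈ Finset.range r, F x = ∑ j ∈ Finset.range m, F (i + j) +
      ∑ a ∈ (Finset.range n).erase i, F (slot m i a) := by
  have hinj : Set.InjOn (slot m i) ((Finset.range n).erase i : Finset ℕ) := by
    intro a ha b hb h
    simp only [Finset.coe_erase, Set.mem_sdiff, Set.mem_singleton_iff] at ha hb
    exact (slot_inj ha.2 hb.2).1 h
  rw [← Finset.sum_image hinj, ← Finset.sum_image (g := (i + ·)) (s := Finset.range m)
    (fun _ _ _ _ h => Nat.add_left_cancel h), ← Finset.sum_union]
  · refine Finset.sum_congr ?_ fun _ _ => rfl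
    ext x
    simp only [Finset.mem_union, Finset.mem_image, Finset.mem_range, Finset.mem_erase]
    constructor
    · intro hx
      by_cases h₁ : i ≤ x ∧ x < i + m
      · exact Or.inl ⟨x - i, by omega, by omega⟩
      · right
        by_cases h₂ : x < i
        · exact ⟨x, ⟨by omega, by omega⟩, if_pos h₂⟩
        · exact ⟨x + 1 - m, ⟨by omega, by omega⟩, by unfold slot; split_ifs <;> omega⟩
    · rintro (⟨j, hj, rfl⟩ | ⟨a, ⟨ha, han⟩, rfl⟩)
      · omega
      · unfold slot
        split_ifs <;> omega
  · rw [Finset.disjoint_left]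
    intro x hx hx'
    simp only [Finset.mem_image, Finset.mem_range, Finset.mem_erase] at hx hx'
    obtain ⟨j, hj, rfl⟩ := hx
    obtain ⟨a, ⟨ha, -⟩, e⟩ := hx'
    exact slot_ne ha hj e

theorem diff_comp {n m r : ℕ} {p q : ℤ} (i : Fin n) (hr : n + m = r + 1)
    {f g : Cochain} (hf : f ∈ latCochains c n p) (hg : g ∈ latCochains c m q) :
    diff r (comp n m i f g) = comp n m i (diff n f) g + p.negOnePow • comp n m i f (diff m g) := by
  have hi := i.2
  have hfg := comp_mem i hr rfl hf hg
  have h₁ : compLin 1 r 0 diffElt (compLin n m i f g) =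
      compLin n m i (compLin 1 n 0 diffElt f) g := by
    have e := compLin_assoc_seq (r := n) (r' := r) (u := r) (i := 0) (j := i) Nat.zero_lt_one hi
      (by omega) hr hr (diffElt_mem (c := c)) hf hg
    rw [zero_add] at e
    exact e.symm
  have h₂ : ∀ j ∈ Finset.range m, compLin r 1 (i + j) (compLin n m i f g) diffElt =
      compLin n m i f (compLin m 1 j g diffElt) := fun j hj =>
    compLin_assoc_seq hi (Finset.mem_range.1 hj) hr rfl rfl hf hg diffElt_mem
  have h₃ : ∀ a ∈ (Finset.range n).erase (i : ℕ),
      compLin r 1 (slot m i a) (compLin n m i f g) diffElt =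
      q.negOnePow • compLin n m i (compLin n 1 a f diffElt) g := fun a ha => by
    rw [Finset.mem_erase, Finset.mem_range] at ha
    exact compLin_slot hi ha.2 ha.1 hr hf hg
  have h₄ : compLin n m i (compLin n 1 i f diffElt) g =
      compLin n m i f (compLin 1 m 0 diffElt g) := by
    have e := compLin_assoc_seq (r := n) (r' := m) (u := r) (i := i) (j := 0) hi Nat.zero_lt_one
      rfl (by omega) hr hf diffElt_mem hg
    rwa [add_zero] at e
  rw [diff_eq hfg, diff_eq hf, diff_eq hg]
  simp only [comp_eq]
  rw [sum_slot hi hr, Finset.sum_congr rfl h₂, Finset.sum_congr rfl h₃, h₁,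
    ← Finset.add_sum_erase (Finset.range n) (fun i => compLin n 1 i f diffElt)
      (Finset.mem_range.2 hi)]
  simp only [map_sub, map_add, LinearMap.sub_apply, LinearMap.add_apply, Units.smul_def, map_smul,
    LinearMap.smul_apply, map_sum, LinearMap.sum_apply, ← Finset.smul_sum, h₄, Int.negOnePow_add,
    Units.val_mul]
  have hq : ((q.negOnePow : ℤˣ) : ℤ) * q.negOnePow = 1 := by
    rw [← Units.val_mul, Int.units_mul_self, Units.val_one]
  generalize ∑ a ∈ (Finset.range n).erase (i : ℕ), compLin n m i (compLin n 1 a f diffElt) g = A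
  generalize ∑ j ∈ Finset.range m, compLin n m i f (compLin m 1 j g diffElt) = B
  have hA : ((p.negOnePow : ℤˣ) * (q.negOnePow : ℤˣ) : ℤ) • ((q.negOnePow : ℤˣ) : ℤ) • A =
      ((p.negOnePow : ℤˣ) : ℤ) • A := by
    rw [smul_smul, mul_assoc, hq, mul_one]
  simp only [smul_add, smul_sub, hA, smul_smul]
  abel

theorem diff_unit : diff 1 unit = 0 := by
  rw [diff_eq (unit_mem (c := ⊤)), Finset.sum_range_one, Int.negOnePow_zero, one_smul, ← comp_eq,
    ← comp_eq, unit_comp (diffElt_mem (c := ⊤))]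
  have := comp_unit (0 : Fin 1) (diffElt_mem (c := ⊤))
  rw [Fin.val_zero] at this
  rw [this, sub_self]

end Lat

/-! ### The path-ordered signs -/

/-- The number of odd symbols of a word: the marks, and the steps that are not the last ones in
their direction. -/
def odd : Word → ℕ
  | [] => 0
  | none :: v => odd v + 1
  | some a :: v => odd v + if some a ∈ v then 1 else 0

/-- The exponent of the sign that relates a word to its path-ordered version: it counts the inversions
of the permutation that sorts the odd symbols of the word, first the steps by direction, then the
marks in the reverse order. -/
def twistExp : Word → ℕ
  | [] => 0
  | none :: v => twistExp v + odd v
  | some a :: v => twistExp v + if some a ∈ v then total a v else 0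

/-- The sign that relates a word to its path-ordered version. -/
def twist (v : Word) : ℤ := (-1) ^ twistExp v

/-- The exponent of the sign of the composition of path-ordered words: each piece of the second
word, with the mark that ends it, moves past the part of the first word that begins with the step
replaced by the piece. -/
def crossExp (i : ℕ) : Word → Word → ℕ
  | [], _ => 0
  | none :: v, u => crossExp i v u
  | some _ :: v, [] => crossExp i v []
  | some a :: v, none :: u =>
    if a = i then odd (some i :: v) + crossExp i v u else crossExp i v (none :: u)
  | some a :: v, some b :: u =>
    if a = i then odd (some i :: v) * (if some b ∈ u then 1 else 0) + crossExp i (some a :: v) u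
    else crossExp i v (some b :: u)
termination_by v u => v.length + u.length

theorem odd_none (v : Word) : odd (none :: v) = odd v + 1 := rfl

theorem odd_some (a : ℕ) (v : Word) :
    odd (some a :: v) = odd v + if some a ∈ v then 1 else 0 := rfl

theorem twistExp_none (v : Word) : twistExp (none :: v) = twistExp v + odd v := rfl

theorem twistExp_some (a : ℕ) (v : Word) :
    twistExp (some a :: v) = twistExp v + if some a ∈ v then total a v else 0 := rfl

section CrossExp

variable (i : ℕ) (v u : Word)

theorem crossExp_nil : crossExp i [] u = 0 := by rw [crossExp]

theorem crossExp_none : crossExp i (none :: v) u = crossExp i v u := by rw [crossExp]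

theorem crossExp_some_ne {a : ℕ} (ha : a ≠ i) :
    crossExp i (some a :: v) u = crossExp i v u := by
  match u with
  | [] => rw [crossExp]
  | none :: u => rw [crossExp, if_neg ha]
  | some b :: u => rw [crossExp, if_neg ha]

theorem crossExp_some_nil : crossExp i (some i :: v) [] = crossExp i v [] := by
  rw [crossExp]

theorem crossExp_some_none :
    crossExp i (some i :: v) (none :: u) = odd (some i :: v) + crossExp i v u := by
  rw [crossExp, if_pos rfl]

theorem crossExp_some_some (b : ℕ) : crossExp i (some i :: v) (some b :: u) =
    odd (some i :: v) * (if some b ∈ u then 1 else 0) + crossExp i (some i :: v) u := by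
  rw [crossExp, if_pos rfl]

end CrossExp

theorem odd_eq_parity {n : ℕ} {v : Word} (hv : ∀ a, some a ∈ v → a < n) : odd v = parity n v := by
  induction v with
  | nil => simp [odd, parity, marks, total, dim]
  | cons x v ih =>
    have ih := ih fun a ha => hv a (List.mem_cons_of_mem _ ha)
    cases x with
    | none => rw [odd_none, ih, parity, parity, marks_none, total_none]; omega
    | some a =>
      have ha := hv a List.mem_cons_self
      simp only [odd, ih, parity, marks_some, total_cons, ha, true_and]
      omega

theorem mem_subst_slot {m i : ℕ} {v u : Word} (h : Fits i v u)
    (hu : ∀ b, some b ∈ u → b < m) {a : ℕ} (ha : a ≠ i) :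
    some (slot m i a) ∈ subst m i v u ↔ some a ∈ v := by
  rw [← List.count_pos_iff, count_subst_slot h hu ha, List.count_pos_iff]

theorem mem_subst_add {m i : ℕ} {v u : Word} (h : Fits i v u) {b : ℕ} (hb : b < m) :
    some (i + b) ∈ subst m i v u ↔ some b ∈ u := by
  rw [← List.count_pos_iff, count_subst_add h hb, List.count_pos_iff]

theorem odd_subst {m i : ℕ} {v u : Word} (h : Fits i v u) (hu : ∀ b, some b ∈ u → b < m) :
    (odd (subst m i v u) : ZMod 2) = odd v + odd u := by
  induction v, u, h using fits_induction i with
  | nil => simp [odd]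
  | none v u _ ih =>
    rw [subst_none, odd_none, odd_none]
    push_cast [ih hu]
    ring
  | some_ne a v u ha h ih =>
    rw [subst_some_ne _ _ ha, odd_some, odd_some]
    simp only [mem_subst_slot h hu ha]
    push_cast [ih hu]
    ring
  | some_nil v hv ih =>
    rw [subst_some_nil, ih hu, odd_some, if_neg hv]
    simp
  | some_none v u h ih =>
    have hv : some i ∈ v := List.count_pos_iff.1 (by omega)
    rw [subst_some_none, ih fun b hb => hu b (List.mem_cons_of_mem _ hb), odd_some, odd_none, if_pos hv]
    push_cast
    linear_combination -two_zmod
  | some_some b v u h ih =>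
    have h' : Fits i (some i :: v) u := Or.inl (by simp [h])
    rw [subst_some_some, odd_some (i + b), odd_some b]
    simp only [mem_subst_add h' (hu b List.mem_cons_self)]
    push_cast [ih fun b hb => hu b (List.mem_cons_of_mem _ hb)]
    ring

theorem Fits.odd_right {m i : ℕ} {v u : Word} (h : Fits i v u) (hu : ∀ b, some b ∈ u → b < m) :
    odd u = dim v i + total m u := by
  rw [odd_eq_parity hu, parity, dim]
  rcases h with h | ⟨h, rfl⟩
  · omega
  · simp [h, marks]

/-- The twisting exponent of a composite. -/
theorem twistExp_subst {m i : ℕ} {v u : Word} (h : Fits i v u) (hu : ∀ b, some b ∈ u → b < m) :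
    (twistExp (subst m i v u) : ZMod 2) =
      twistExp v + twistExp u + crossExp i v u + odd u * (odd v + total i v) := by
  induction v, u, h using fits_induction i with
  | nil => simp [twistExp, crossExp_nil, odd]
  | none v u h ih =>
    rw [subst_none, twistExp_none, twistExp_none, crossExp_none, odd_none, total_none]
    push_cast [ih hu, odd_subst h hu]
    ring
  | some_ne a v u ha h ih =>
    rw [subst_some_ne _ _ ha, twistExp_some, twistExp_some, crossExp_some_ne _ _ _ ha, odd_some,
      total_cons]
    simp only [mem_subst_slot h hu ha]
    by_cases hav : some a ∈ v
    · simp only [hav, if_true, and_true]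
      rcases lt_or_gt_of_ne ha with hai | hai
      · rw [show slot m i a = a from if_pos hai, total_subst_lt h hu hai.le, if_pos hai]
        push_cast [ih hu]
        linear_combination -(odd u : ZMod 2) * two_zmod
      · have e := congrArg (Nat.cast : ℕ → ZMod 2) (total_subst_gt h hu hai
          (r := slot m i a) (by unfold slot; split_ifs <;> omega))
        rw [if_neg (by omega)]
        push_cast [ih hu] at e ⊢
        have e' := congrArg (Nat.cast : ℕ → ZMod 2) (h.odd_right hu)
        push_cast at e'
        linear_combination e - e' - (dim v i : ZMod 2) * two_zmod +
          (2 * dim v i - odd u + total m u - total m u : ZMod 2) * (two_zmod - two_zmod)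
    · simp [hav, ih hu]
  | some_nil v hv ih =>
    rw [subst_some_nil, ih hu, twistExp_some, if_neg hv, crossExp_some_nil]
    simp [odd]
  | some_none v u h ih =>
    have hv : some i ∈ v := List.count_pos_iff.1 (by omega)
    rw [subst_some_none, ih fun b hb => hu b (List.mem_cons_of_mem _ hb), twistExp_some,
      twistExp_none, crossExp_some_none, odd_some, odd_none, total_cons, if_pos hv, if_pos hv, if_neg (by simp)]
    push_cast
    linear_combination -(odd u + total i v + 1 + odd v : ZMod 2) * two_zmod
  | some_some b v u h ih =>
    have h' : Fits i (some i :: v) u := Or.inl (by simp [h])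
    have hu' := fun c hc => hu c (List.mem_cons_of_mem (some b) hc)
    have hb := hu b List.mem_cons_self
    rw [subst_some_some, crossExp_some_some]
    rw [twistExp_some (i + b), twistExp_some b, odd_some b, total_subst_add h' hu' hb.le]
    simp only [mem_subst_add h' hb]
    push_cast [ih hu']
    split_ifs
    · linear_combination -(odd (some i :: v) : ZMod 2) * two_zmod
    · ring

theorem twist_mul_self (v : Word) : twist v * twist v = 1 := by
  rw [twist, ← pow_add, ← two_mul, pow_mul, neg_one_sq, one_pow]

/-- The sign of a composition in terms of path-ordered words. -/
theorem Composable.sign {n m i : ℕ} {v u : Word} (h : Composable n m i v u) :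
    (-1 : ℤ) ^ (parity m u * (parity n v + total i v)) =
      twist v * twist u * twist (subst m i v u) * (-1) ^ crossExp i v u := by
  rw [twist, twist, twist, ← pow_add, ← pow_add, ← pow_add]
  apply neg_one_pow_congr
  push_cast [twistExp_subst h.fits h.lt_right, odd_eq_parity h.lt_right,
    odd_eq_parity fun a ha => (h.left a).1 ha]
  linear_combination -(twistExp v + twistExp u + crossExp i v u : ZMod 2) * two_zmod

/-! ### The action of the symmetric groups -/

/-- The exponent of the Koszul sign of a permutation of objects of degrees `k a`. -/
def koszulExp {n : ℕ} (σ : Equiv.Perm (Fin n)) (k : Fin n → ℕ) : ℕ :=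
  ∑ a : Fin n, ∑ b : Fin n, if a < b ∧ σ b < σ a then k a * k b else 0

theorem koszulExp_add_single {n : ℕ} (σ : Equiv.Perm (Fin n)) (k : Fin n → ℕ) (e : Fin n) :
    koszulExp σ (fun a => k a + if a = e then 1 else 0) = koszulExp σ k +
      ((∑ b, if e < b ∧ σ b < σ e then k b else 0) +
        ∑ b, if b < e ∧ σ e < σ b then k b else 0) := by
  have h : ∀ a b : Fin n, (if a < b ∧ σ b < σ a then
      (k a + if a = e then 1 else 0) * (k b + if b = e then 1 else 0) else 0) =
      (if a < b ∧ σ b < σ a then k a * k b else 0) +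
        ((if a = e then (if e < b ∧ σ b < σ e then k b else 0) else 0) +
          if b = e then (if a < e ∧ σ e < σ a then k a else 0) else 0) := by
    intro a b
    by_cases ha : a = e
    · subst ha
      by_cases hb : b = a
      · subst hb; simp
      · simp only [hb, if_true, if_false]
        split_ifs <;> ring
    · by_cases hb : b = e
      · subst hb
        simp only [ha, if_true, if_false]
        split_ifs <;> ring
      · simp only [ha, hb, if_false]
        split_ifs <;> ring
  unfold koszulExp
  simp only [h, Finset.sum_add_distrib]
  congr 2
  · rw [Finset.sum_comm]
    simp
  · simp

section Perm

variable {n : ℕ} (σ : Equiv.Perm (Fin n))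

theorem odd_permWord (v : Word) : odd (permWord σ v) = odd v := by
  induction v with
  | nil => rfl
  | cons x v ih =>
    have hcons : permWord σ (x :: v) = x.map (extendPerm σ) :: permWord σ v := rfl
    rw [hcons]
    cases x with
    | none => rw [Option.map_none, odd, odd, ih]
    | some a => rw [Option.map_some, odd, odd, ih]; simp only [mem_permWord]

theorem total_eq_sum_fin {a : ℕ} (ha : a ≤ n) (v : Word) :
    total a v = ∑ b : Fin n, if (b : ℕ) < a then dim v b else 0 := by
  rw [Fin.sum_univ_eq_sum_range fun b => if b < a then dim v b else 0, total, ← Finset.sum_filter]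
  congr 1
  ext b
  simp only [Finset.mem_range, Finset.mem_filter]
  omega

theorem total_permWord' (a : Fin n) (v : Word) :
    total (σ a) (permWord σ v) = ∑ b : Fin n, if σ b < σ a then dim v b else 0 := by
  rw [total_eq_sum_fin (σ a).2.le, ← Equiv.sum_comp σ]
  refine Finset.sum_congr rfl fun b _ => ?_
  rw [← extendPerm_val σ b, dim_permWord, extendPerm_val]
  rfl

theorem twistExp_permWord (v : Word) (hv : ∀ a, some a ∈ v → a < n) :
    (twistExp (permWord σ v) : ZMod 2) =
      twistExp v + koszulExp σ (fun a => dim v a) := by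
  induction v with
  | nil => simp [permWord, twistExp, koszulExp, dim]
  | cons x v ih =>
    have ih := ih fun a ha => hv a (List.mem_cons_of_mem _ ha)
    have hcons : permWord σ (x :: v) = x.map (extendPerm σ) :: permWord σ v := rfl
    rw [hcons]
    cases x with
    | none =>
      rw [Option.map_none, twistExp_none, twistExp_none, odd_permWord]
      simp only [dim_none]
      push_cast [ih]
      ring
    | some a =>
      have ha := hv a List.mem_cons_self
      rw [Option.map_some, twistExp_some, twistExp_some]
      simp only [mem_permWord, dim_cons]
      by_cases hav : some a ∈ v
      · simp only [hav, if_true, and_true]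
        have e := koszulExp_add_single σ (fun b => dim v b) ⟨a, ha⟩
        simp only [Fin.ext_iff] at e
        have hσ : extendPerm σ a = σ ⟨a, ha⟩ := extendPerm_val σ ⟨a, ha⟩
        rw [e, hσ, total_permWord', total_eq_sum_fin ha.le v]
        push_cast [ih]
        have key : ∀ b : Fin n, (((if σ b < σ ⟨a, ha⟩ then dim v b else 0 : ℕ) : ZMod 2)) =
            ((if (b : ℕ) < a then dim v b else 0 : ℕ) : ZMod 2) +
              ((if (⟨a, ha⟩ : Fin n) < b ∧ σ b < σ ⟨a, ha⟩ then dim v b else 0 : ℕ) : ZMod 2) +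
              ((if b < (⟨a, ha⟩ : Fin n) ∧ σ ⟨a, ha⟩ < σ b then dim v b else 0 : ℕ) : ZMod 2) := by
          intro b
          rcases lt_trichotomy b ⟨a, ha⟩ with hb | rfl | hb
          · have hb' : (b : ℕ) < a := hb
            rcases lt_trichotomy (σ b) (σ ⟨a, ha⟩) with h | h | h
            · simp [h, hb', hb.not_gt, h.not_gt]
            · exact absurd (σ.injective h) hb.ne
            · simp only [hb', hb, h, h.not_gt, if_true, if_false, and_false, and_self]
              push_cast
              linear_combination -(dim v b : ZMod 2) * two_zmod
          · simp
          · have hb' : ¬ (b : ℕ) < a := fun h => hb.not_gt h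
            simp [hb, hb', hb.not_gt]
        have := Finset.sum_congr rfl fun b (_ : b ∈ Finset.univ) => key b
        simp only [Finset.sum_add_distrib] at this
        push_cast at this
        linear_combination this
      · simp [hav, ih]

end Perm

section Perm

variable {n : ℕ} (σ : Equiv.Perm (Fin n))

/-- The sign of a permutation of a path. -/
def permSign (v : Word) : ℤ := (-1) ^ koszulExp σ fun a => dim v a

theorem perm_apply (f : Cochain) (l : ℕ) :
    perm n σ f l = extend (fun v => Finsupp.single (permWord σ v) (permSign σ v)) (f l) := rfl

theorem permSign_eq {v : Word} (hv : ∀ a, some a ∈ v → a < n) :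
    permSign σ v = twist v * twist (permWord σ v) := by
  rw [permSign, twist, twist, ← pow_add]
  apply neg_one_pow_congr
  push_cast [twistExp_permWord σ v hv]
  linear_combination -(twistExp v : ZMod 2) * two_zmod

theorem crossExp_permWord {m : ℕ} (τ : Equiv.Perm (Fin m)) (i : Fin n) (v u : Word) :
    crossExp (σ i) (permWord σ v) (permWord τ u) = crossExp i v u := by
  have hcons : ∀ (k : ℕ) (φ : Equiv.Perm (Fin k)) (x : Option ℕ) (w : Word), permWord φ (x :: w) =
    x.map (extendPerm φ) :: permWord φ w := fun _ _ _ _ => rfl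
  have hnil : ∀ (k : ℕ) (φ : Equiv.Perm (Fin k)), permWord φ [] = [] := fun _ _ => rfl
  have hi : extendPerm σ i = σ i := extendPerm_val σ i
  have hodd : ∀ w : Word, odd (some (σ i : ℕ) :: permWord σ w) = odd (some (i : ℕ) :: w) := by
    intro w
    rw [← odd_permWord σ (some (i : ℕ) :: w), hcons, Option.map_some, hi]
  induction v, u using subst_induction (i : ℕ) with
  | nil u => rw [hnil, crossExp_nil, crossExp_nil]
  | none v u ih => rw [hcons, Option.map_none, crossExp_none, crossExp_none, ih]
  | some_ne a v u ha ih =>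
    rw [hcons, Option.map_some, crossExp_some_ne _ _ _ ha, crossExp_some_ne, ih]
    rw [← hi]
    exact fun h => ha (extendPerm_injective σ h)
  | some_nil v ih =>
    rw [hcons, Option.map_some, hi, hnil, crossExp_some_nil, crossExp_some_nil, ← ih, hnil]
  | some_none v u ih =>
    rw [hcons, hcons, Option.map_some, Option.map_none, hi, crossExp_some_none, crossExp_some_none,
      ih, hodd]
  | some_some b v u ih =>
    rw [hcons, Option.map_some, hi] at ih ⊢
    rw [hcons m τ, Option.map_some, crossExp_some_some, crossExp_some_some, ih, hodd]
    simp only [mem_permWord]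

variable {c : ℕ∞} {p : ℤ}

theorem perm_add (f g : Cochain) : perm n σ (f + g) = perm n σ f + perm n σ g := by
  funext l
  exact extend_add _ _ _

/-- The action of a permutation as a linear map. -/
def permLin : Cochain →ₗ[ℤ] Cochain where
  toFun := perm n σ
  map_add' := perm_add σ
  map_smul' a f := by funext l; exact extend_smul _ _ _

theorem perm_eq (f : Cochain) : perm n σ f = permLin σ f := rfl

theorem perm_mem {f : Cochain} (hf : f ∈ latCochains c n p) : perm n σ f ∈ latCochains c n p := by
  rw [mem_latCochains] at hf
  simp only [latCochains, Submodule.mem_pi, Set.mem_univ, forall_true_left]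
  exact fun l => extend_mem fun v hv => Finsupp.single_mem_supported ℤ _ (mem_lat_perm σ (hf l v hv))

theorem perm_one' {f : Cochain} (hf : f ∈ latCochains c n p) : perm n 1 f = f := by
  rw [mem_latCochains] at hf
  funext l
  rw [perm_apply]
  conv_rhs => rw [← extend_id (f l)]
  refine extend_congr fun v hv => ?_
  rw [permSign_eq _ fun a ha => ((hf l v hv).1 a).1 ha, permWord_one, twist_mul_self]

theorem perm_mul' (τ : Equiv.Perm (Fin n)) {f : Cochain} (hf : f ∈ latCochains c n p) :
    perm n (σ * τ) f = perm n σ (perm n τ f) := by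
  rw [mem_latCochains] at hf
  funext l
  rw [perm_apply, perm_apply, perm_apply, extend_extend]
  refine extend_congr fun v hv => ?_
  have hv := hf l v hv
  rw [extend_single, Finsupp.smul_single, smul_eq_mul, permWord_mul,
    permSign_eq _ fun a ha => (hv.1 a).1 ha, permSign_eq _ fun a ha => (hv.1 a).1 ha,
    permSign_eq _ fun a ha => ((mem_lat_perm τ hv).1 a).1 ha, permWord_mul]
  congr 1
  linear_combination -twist v * twist (permWord σ (permWord τ v)) * twist_mul_self (permWord τ v)

theorem perm_comp' {m r : ℕ} {q : ℤ} (i : Fin n) (hr : n + m = r + 1)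
    (σ : Equiv.Perm (Fin n)) (τ : Equiv.Perm (Fin m)) (ρ : Equiv.Perm (Fin r))
    (h₁ : ∀ (a : Fin n) (x y : Fin r), a ≠ i → (x : ℕ) = slot m i a →
      (y : ℕ) = slot m (σ i) (σ a) → ρ x = y)
    (h₂ : ∀ (b : Fin m) (x y : Fin r), (x : ℕ) = i + b → (y : ℕ) = σ i + τ b → ρ x = y)
    {f g : Cochain} (hf : f ∈ latCochains c n p) (hg : g ∈ latCochains c m q) :
    comp n m (σ i) (perm n σ f) (perm m τ g) = perm r ρ (comp n m i f g) := by
  rw [mem_latCochains] at hf hg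
  funext l
  rw [comp_apply, perm_apply, perm_apply, comp_apply, extend_extend, extend_extend]
  refine extend_congr fun v hv => ?_
  have hv := hf l v hv
  have hd : dim (permWord σ v) (σ i) = dim v i := by
    rw [← extendPerm_val, dim_permWord]
  rw [extend_single, compWord, compWord, perm_apply, extend_extend, extend_extend, hd,
    ← extend_smul_fun]
  refine extend_congr fun u hu => ?_
  have hu := hg _ u hu
  have hc : Composable n m i v u := ⟨hv.1, hu.1, i.2, hu.2.1⟩
  have hc' : Composable n m (σ i) (permWord σ v) (permWord τ u) :=
    ⟨hv.1.perm σ, hu.1.perm τ, (σ i).2, by rw [marks_permWord, hd, hu.2.1]⟩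
  have hs := hv.1.subst hu.1 i.2 hr hu.2.1
  have hw := permWord_subst i hr σ τ ρ h₁ h₂ v u (fun a ha => (hv.1 a).1 ha)
    (fun a ha => (hu.1 a).1 ha)
  rw [extend_single, extend_single, Finsupp.smul_single, Finsupp.smul_single, Finsupp.smul_single,
    hc.sign, hc'.sign, hw, permSign_eq _ fun a ha => (hv.1 a).1 ha,
    permSign_eq _ fun a ha => (hu.1 a).1 ha, permSign_eq _ fun a ha => (hs a).1 ha, hw,
    crossExp_permWord]
  congr 1
  simp only [smul_eq_mul]
  generalize twist (subst m (σ i) (permWord σ v) (permWord τ u)) = A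
  generalize (-1 : ℤ) ^ crossExp i v u = B
  have e₁ := twist_mul_self (permWord σ v)
  have e₂ := twist_mul_self (permWord τ u)
  have e₃ := twist_mul_self (subst m i v u)
  linear_combination (twist v * twist u * A * B) *
    (e₁ * (twist (permWord τ u) * twist (permWord τ u)) + e₂ - e₃)

theorem diff_perm {f : Cochain} (hf : f ∈ latCochains c n p) :
    diff n (perm n σ f) = perm n σ (diff n f) := by
  have h₁ : compLin 1 n 0 diffElt (perm n σ f) = perm n σ (compLin 1 n 0 diffElt f) := by
    have e := perm_comp' (0 : Fin 1) (by omega) 1 σ σ (r := n)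
      (fun a x y ha => absurd (Subsingleton.elim _ _) ha)
      (fun b x y hx hy => by
        simp only [Fin.val_zero, zero_add, Equiv.Perm.coe_one, id] at hx hy
        rw [Fin.ext hx]; exact (Fin.ext hy).symm) (diffElt_mem (c := c)) hf
    rwa [perm_one' (diffElt_mem (c := c))] at e
  have h₂ : ∀ i : Fin n, compLin n 1 (σ i) (perm n σ f) diffElt =
      perm n σ (compLin n 1 i f diffElt) := fun i => by
    have e := perm_comp' i rfl σ 1 σ
      (fun a x y ha hx hy => by
        rw [slot_one] at hx hy
        rw [Fin.ext hx]; exact (Fin.ext hy).symm)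
      (fun b x y hx hy => by
        rw [Subsingleton.elim b 0] at hx hy
        simp only [Fin.val_zero, add_zero, Equiv.Perm.coe_one, id] at hx hy
        rw [Fin.ext hx]; exact (Fin.ext hy).symm) hf (diffElt_mem (c := c))
    rwa [perm_one' (diffElt_mem (c := c))] at e
  rw [diff_eq (perm_mem σ hf), diff_eq hf, h₁,
    ← Fin.sum_univ_eq_sum_range (fun i => compLin n 1 i (perm n σ f) diffElt),
    ← Fin.sum_univ_eq_sum_range (fun i => compLin n 1 i f diffElt), ← Equiv.sum_comp σ]
  simp only [h₂]
  simp only [perm_eq, Units.smul_def, map_sub, map_smul, map_sum]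

end Perm

/-! ### The dg-operad of marked lattice paths -/

section LatOperad

variable (c : ℕ∞)

theorem diff_add (n : ℕ) (f g : Cochain) : diff n (f + g) = diff n f + diff n g := by
  have h₁ : bdry n (f + g) = bdry n f + bdry n g := by
    funext l
    exact extend_add _ _ _
  have h₂ : cobdry n (f + g) = cobdry n f + cobdry n g := by
    funext l
    cases l with
    | zero => exact (add_zero _).symm
    | succ l => exact extend_add _ _ _
  rw [diff, diff, diff, h₁, h₂]
  abel

theorem latOperad_closed : (latOperad c).Closed where
  d_add := diff_add
  comp_add_left n m i x y z := by
    change compLin n m i (x + y) z = compLin n m i x z + compLin n m i y z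
    rw [map_add, LinearMap.add_apply]
  comp_add_right n m i x y z := map_add (compLin n m i x) y z
  perm_add _ := perm_add
  one_mem := unit_mem
  d_mem := diff_mem
  d_null {n p x} _ h := by
    rw [(Submodule.mem_bot ℤ).1 h]
    refine (Submodule.mem_bot ℤ).2 ?_
    have := diff_add n 0 0
    rw [add_zero] at this
    exact left_eq_add.1 this
  comp_mem := comp_mem
  comp_null_left {n m r p q s} i _ _ {x y} _ _ h := by
    rw [(Submodule.mem_bot ℤ).1 h]
    refine (Submodule.mem_bot ℤ).2 ?_
    change compLin n m i 0 y = 0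
    rw [map_zero, LinearMap.zero_apply]
  comp_null_right {n m r p q s} i _ _ {x y} _ _ h := by
    rw [(Submodule.mem_bot ℤ).1 h]
    exact (Submodule.mem_bot ℤ).2 (map_zero (compLin n m i x))
  perm_mem σ hx := perm_mem σ hx
  perm_null {n p x} σ _ h := by
    rw [(Submodule.mem_bot ℤ).1 h]
    exact (Submodule.mem_bot ℤ).2 (map_zero (permLin σ))

theorem latOperad_laws : (latOperad c).Laws where
  d_d hx := (Submodule.mem_bot ℤ).2 (diff_diff hx)
  d_perm σ hx := (Submodule.mem_bot ℤ).2 (sub_eq_zero.2 (diff_perm σ hx))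
  d_one := (Submodule.mem_bot ℤ).2 diff_unit
  d_comp {_ _ _ _ _ _} i hr _ {_ _} hf hg := (Submodule.mem_bot ℤ).2 (sub_eq_zero.2 (diff_comp i hr hf hg))
  one_comp hg := (Submodule.mem_bot ℤ).2 (sub_eq_zero.2 (unit_comp hg))
  comp_one {_ _} i {_} hf := (Submodule.mem_bot ℤ).2 (sub_eq_zero.2 (comp_unit i hf))
  assoc_seq {_ _ _ _ _ _ _ _ _ _ _} i j hr _ hr' hu _ {_ _ _} hf hg hh :=
    (Submodule.mem_bot ℤ).2 (sub_eq_zero.2 (comp_assoc_seq i j hr hr' hu hf hg hh))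
  assoc_par {_ _ _ _ _ _ _ _ _ _ _} i j hij x hx hr _ hr' hu _ {_ _ _} hf hg hh :=
    (Submodule.mem_bot ℤ).2 (sub_eq_zero.2 (comp_assoc_par i j hij x hx hr hr' hu hf hg hh))
  perm_one hx := (Submodule.mem_bot ℤ).2 (sub_eq_zero.2 (perm_one' hx))
  perm_mul σ τ hx := (Submodule.mem_bot ℤ).2 (sub_eq_zero.2 (perm_mul' σ τ hx))
  perm_comp {_ _ _ _ _ _} i hr _ σ τ ρ h₁ h₂ {_ _} hf hg :=
    (Submodule.mem_bot ℤ).2 (sub_eq_zero.2 (perm_comp' i hr σ τ ρ h₁ h₂ hf hg))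

end LatOperad

/-! ### The path-ordered whiskering -/

/-- Prepend a letter to all words of a linear combination. -/
def pre (x : Option ℕ) : (Word →₀ ℤ) →ₗ[ℤ] (Word →₀ ℤ) := Finsupp.lmapDomain ℤ ℤ (List.cons x)

theorem pre_single (x : Option ℕ) (v : Word) (a : ℤ) :
    pre x (Finsupp.single v a) = Finsupp.single (x :: v) a := Finsupp.mapDomain_single

theorem extend_pre (φ : Word → (Word →₀ ℤ)) (x : Option ℕ) (y : Word →₀ ℤ) :
    extend φ (pre x y) = extend (fun v => φ (x :: v)) y := by
  induction y using Finsupp.induction_linear with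
  | zero => simp only [map_zero, extend_zero]
  | add y z hy hz => simp only [map_add, extend_add, hy, hz]
  | single v a => simp only [pre_single, extend_single]

theorem map_extend (L : (Word →₀ ℤ) →ₗ[ℤ] (Word →₀ ℤ)) (φ : Word → (Word →₀ ℤ)) (y : Word →₀ ℤ) :
    L (extend φ y) = extend (fun v => L (φ v)) y := by
  unfold extend
  rw [map_finsuppSum]
  simp only [map_smul]

/-- The whiskering of path-ordered words: insert `l` new internal points marked by `1`, without
signs. -/
def pathWhisker : ℕ → Word → (Word →₀ ℤ)
  | 0, [] => Finsupp.single [] 1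
  | _ + 1, [] => 0
  | l, none :: v => pre none (pathWhisker l v)
  | 0, some a :: v => pre (some a) (pathWhisker 0 v)
  | l + 1, some a :: v => pre (some a) (pathWhisker (l + 1) v) +
      pre (some a) (pre none (pathWhisker l (some a :: v)))
termination_by l v => l + v.length

section PathWhisker

variable (l : ℕ) (v : Word) (a : ℕ)

theorem pathWhisker_zero_nil : pathWhisker 0 [] = Finsupp.single [] 1 := by rw [pathWhisker]

theorem pathWhisker_succ_nil : pathWhisker (l + 1) [] = 0 := by rw [pathWhisker]

theorem pathWhisker_none : pathWhisker l (none :: v) = pre none (pathWhisker l v) := by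
  cases l <;> rw [pathWhisker]

theorem pathWhisker_zero_some :
    pathWhisker 0 (some a :: v) = pre (some a) (pathWhisker 0 v) := by rw [pathWhisker]

theorem pathWhisker_succ_some : pathWhisker (l + 1) (some a :: v) =
    pre (some a) (pathWhisker (l + 1) v) +
      pre (some a) (pre none (pathWhisker l (some a :: v))) := by rw [pathWhisker]

theorem pathWhisker_zero : pathWhisker 0 v = Finsupp.single v 1 := by
  induction v with
  | nil => rw [pathWhisker_zero_nil]
  | cons x v ih =>
    cases x with
    | none => rw [pathWhisker_none, ih, pre_single]
    | some a => rw [pathWhisker_zero_some, ih, pre_single]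

end PathWhisker

/-- `w` arises from `v` by dividing steps by `l` new internal points marked by `1`. -/
inductive IsWhiskering : ℕ → Word → Word → Prop
  | nil : IsWhiskering 0 [] []
  | cons {l : ℕ} {v w : Word} (x : Option ℕ) : IsWhiskering l v w →
      IsWhiskering l (x :: v) (x :: w)
  | insert {l : ℕ} {v w : Word} (a : ℕ) : IsWhiskering l (some a :: v) w →
      IsWhiskering (l + 1) (some a :: v) (some a :: none :: w)

theorem mem_support_pre {x : Option ℕ} {y : Word →₀ ℤ} {w : Word} (h : w ∈ (pre x y).support) :
    ∃ v ∈ y.support, x :: v = w := by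
  classical
  have := Finsupp.mapDomain_support h
  simpa using this

theorem isWhiskering_of_mem : ∀ (l : ℕ) (v : Word), ∀ w ∈ (pathWhisker l v).support,
    IsWhiskering l v w := by
  intro l v
  induction l, v using pathWhisker.induct with
  | case1 =>
    intro w hw
    rw [pathWhisker_zero_nil] at hw
    have := Finsupp.support_single_subset hw
    rw [Finset.mem_singleton] at this
    rw [this]
    exact .nil
  | case2 l => simp [pathWhisker_succ_nil]
  | case3 l v ih =>
    intro w hw
    rw [pathWhisker_none] at hw
    obtain ⟨w', hw', rfl⟩ := mem_support_pre hw
    exact .cons _ (ih w' hw')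
  | case4 a v ih =>
    intro w hw
    rw [pathWhisker_zero_some] at hw
    obtain ⟨w', hw', rfl⟩ := mem_support_pre hw
    exact .cons _ (ih w' hw')
  | case5 l a v ih₁ ih₂ =>
    intro w hw
    classical
    rw [pathWhisker_succ_some] at hw
    rcases Finset.mem_union.1 (Finsupp.support_add hw) with hw | hw
    · obtain ⟨w', hw', rfl⟩ := mem_support_pre hw
      exact .cons _ (ih₁ w' hw')
    · obtain ⟨w', hw', rfl⟩ := mem_support_pre hw
      obtain ⟨w'', hw'', rfl⟩ := mem_support_pre hw'
      exact .insert _ (ih₂ w'' hw'')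

namespace IsWhiskering

variable {l : ℕ} {v w : Word} (h : IsWhiskering l v w)
include h

theorem marks_eq : marks w = marks v + l := by
  induction h with
  | nil => rfl
  | cons x _ ih => cases x <;> simp only [marks_none, marks_some, ih]; omega
  | insert a _ ih => simp only [marks_none, marks_some] at ih ⊢; omega

theorem mem_iff (a : ℕ) : some a ∈ w ↔ some a ∈ v := by
  induction h with
  | nil => rfl
  | cons x _ ih => simp only [List.mem_cons, ih]
  | insert b _ ih =>
    simp only [List.mem_cons, reduceCtorEq, false_or] at ih ⊢
    rw [ih]
    tauto

theorem odd_eq : (odd w : ZMod 2) = odd v := by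
  induction h with
  | nil => rfl
  | cons x h ih => cases x <;> simp only [odd_none, odd_some, h.mem_iff] <;> push_cast <;> rw [ih]
  | @insert l v w a h ih =>
    have : some a ∈ none :: w := List.mem_cons_of_mem _ ((h.mem_iff a).2 List.mem_cons_self)
    rw [odd_some, odd_none, ← ih, if_pos this]
    push_cast
    linear_combination two_zmod

theorem total_eq {n : ℕ} (hv : ∀ a, some a ∈ v → a < n) : total n w = total n v + l := by
  induction h with
  | nil => rfl
  | cons x h ih =>
    have ih := ih fun a ha => hv a (List.mem_cons_of_mem _ ha)
    cases x with
    | none => simp only [total_none, ih]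
    | some a => simp only [total_cons, h.mem_iff, ih]; omega
  | @insert l v w a h ih =>
    have : some a ∈ none :: w := List.mem_cons_of_mem _ ((h.mem_iff a).2 List.mem_cons_self)
    rw [total_cons, total_none, ih hv, if_pos ⟨hv a List.mem_cons_self, this⟩]
    omega

theorem dominated : Dominated w v := by
  induction h with
  | nil => exact .refl _
  | cons x h ih => exact ih.cons x
  | insert a h ih => exact (ih.none_cons.cons_some a).trans (.double a _)

theorem mem_lat {c : ℕ∞} {n : ℕ} {p : ℤ} (hv : v ∈ lat c n 0 p) : w ∈ lat c n l p := by
  obtain ⟨h₁, h₂, h₃, h₄⟩ := hv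
  refine ⟨h.dominated.isPath h₁, by rw [h.marks_eq, h₂, zero_add], h.dominated.complexityLE h₃, ?_⟩
  rw [h.total_eq fun a ha => (h₁ a).1 ha]
  omega

end IsWhiskering

/-! ### Comparison with the whiskering -/

theorem sum_antidiagonalTuple_succ {M : Type} [AddCommMonoid M] (k l : ℕ)
    (F : (Fin (k + 1) → ℕ) → M) : ∑ s ∈ Finset.Nat.antidiagonalTuple (k + 1) l, F s =
      ∑ x ∈ Finset.HasAntidiagonal.antidiagonal l, ∑ s ∈ Finset.Nat.antidiagonalTuple k x.2, F (Fin.cons x.1 s) := by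
  rw [Finset.sum_sigma']
  refine Finset.sum_nbij' (fun s => ⟨(s 0, ∑ i, Fin.tail s i), Fin.tail s⟩)
    (fun x => Fin.cons x.1.1 x.2) ?_ ?_ ?_ ?_ ?_
  · intro s hs
    rw [Finset.Nat.mem_antidiagonalTuple, Fin.sum_univ_succ] at hs
    simp only [Finset.mem_sigma, Finset.HasAntidiagonal.mem_antidiagonal, Finset.Nat.mem_antidiagonalTuple, and_true]
    exact hs
  · rintro ⟨⟨i, j⟩, s⟩ hs
    simp only [Finset.mem_sigma, Finset.HasAntidiagonal.mem_antidiagonal, Finset.Nat.mem_antidiagonalTuple] at hs ⊢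
    rw [Fin.sum_univ_succ]
    simp only [Fin.cons_zero, Fin.cons_succ]
    rw [hs.2, hs.1]
  · intro s _
    exact Fin.cons_self_tail s
  · rintro ⟨⟨i, j⟩, s⟩ hs
    simp only [Finset.mem_sigma, Finset.HasAntidiagonal.mem_antidiagonal, Finset.Nat.mem_antidiagonalTuple] at hs
    simp only [Fin.cons_zero, Fin.tail_cons, hs.2]
  · intro s _
    rw [Fin.cons_self_tail]

/-- Divide the first step of `a :: w` by `i` new points marked by `1`. -/
def repeatStep (a : ℕ) (w : Word) : ℕ → Word
  | 0 => some a :: w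
  | i + 1 => some a :: none :: repeatStep a w i

theorem repeatStep_eq (a : ℕ) (w : Word) (i : ℕ) :
    repeatStep a w i = some a :: ((List.replicate i [none, some a]).flatten ++ w) := by
  induction i with
  | zero => rfl
  | succ i ih => rw [repeatStep, ih, List.replicate_succ, List.flatten_cons]; rfl

theorem insertPoints_cons (a : ℕ) (v : Word) (s : Fin (v.length + 1) → ℕ) :
    insertPoints (some a :: v) s = repeatStep a (insertPoints v (Fin.tail s)) (s 0) := by
  rw [repeatStep_eq, insertPoints]
  change (List.ofFn (n := v.length + 1) _).flatten = _
  rw [List.ofFn_succ, List.flatten_cons]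
  rfl

theorem pathWhisker_some (l a : ℕ) (v : Word) : pathWhisker l (some a :: v) =
    ∑ x ∈ Finset.HasAntidiagonal.antidiagonal l,
      extend (fun w => Finsupp.single (repeatStep a w x.1) 1) (pathWhisker x.2 v) := by
  have h₀ : ∀ y : Word →₀ ℤ,
      pre (some a) y = extend (fun w => Finsupp.single (repeatStep a w 0) 1) y := fun y => by
    conv_lhs => rw [← extend_id y, map_extend]
    simp only [pre_single, repeatStep]
  induction l with
  | zero => rw [pathWhisker_zero_some, Finset.Nat.antidiagonal_zero, Finset.sum_singleton, h₀]
  | succ l ih =>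
    rw [pathWhisker_succ_some, Finset.Nat.antidiagonal_succ, Finset.sum_cons, Finset.sum_map, ih,
      map_sum, map_sum, h₀]
    simp only [map_extend, pre_single]
    rfl

theorem pathWhisker_eq_sum (l : ℕ) (v : Word) (hv : none ∉ v) : pathWhisker l v =
    ∑ s ∈ Finset.Nat.antidiagonalTuple v.length l, Finsupp.single (insertPoints v s) 1 := by
  induction v generalizing l with
  | nil =>
    change _ = ∑ s ∈ Finset.Nat.antidiagonalTuple 0 l, _
    cases l with
    | zero => rw [pathWhisker_zero_nil, Finset.Nat.antidiagonalTuple_zero_zero, Finset.sum_singleton]; rfl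
    | succ l => rw [pathWhisker_succ_nil, Finset.Nat.antidiagonalTuple_zero_succ]; rfl
  | cons x v ih =>
    obtain _ | a := x
    · simp at hv
    change _ = ∑ s ∈ Finset.Nat.antidiagonalTuple (v.length + 1) l, _
    rw [pathWhisker_some, sum_antidiagonalTuple_succ]
    refine Finset.sum_congr rfl fun x _ => ?_
    rw [ih _ fun h => hv (List.mem_cons_of_mem _ h), extend_sum]
    refine Finset.sum_congr rfl fun s _ => ?_
    rw [extend_single, one_smul, insertPoints_cons, Fin.cons_zero, Fin.tail_cons]

theorem inner_zero (x : Option ℕ) (v : Word) :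
    inner (x :: v) (0 : Fin (v.length + 1)) = if x ∈ v then 1 else 0 := by
  unfold inner
  congr 1
  rw [List.mem_iff_get, eq_iff_iff]
  constructor
  · rintro ⟨t, ht, h⟩
    obtain ⟨t, rfl⟩ := Fin.exists_succ_eq.2 ht.ne'
    exact ⟨t, h⟩
  · rintro ⟨t, h⟩
    exact ⟨t.succ, Fin.succ_pos t, h⟩

theorem inner_succ (x : Option ℕ) (v : Word) (t : Fin v.length) :
    inner (x :: v) (t.succ : Fin (v.length + 1)) = inner v t := by
  unfold inner
  congr 1
  rw [eq_iff_iff]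
  constructor
  · rintro ⟨t', ht, h⟩
    obtain ⟨t', rfl⟩ := Fin.exists_succ_eq.2 ((Fin.succ_pos t).trans ht).ne'
    exact ⟨t', Fin.succ_lt_succ_iff.1 ht, h⟩
  · rintro ⟨t', ht, h⟩
    exact ⟨t'.succ, Fin.succ_lt_succ_iff.2 ht, h⟩

theorem sum_inner (v : Word) (hv : none ∉ v) : ∑ t, inner v t = odd v := by
  induction v with
  | nil => rfl
  | cons x v ih =>
    obtain _ | a := x
    · simp at hv
    change ∑ t : Fin (v.length + 1), _ = _
    rw [Fin.sum_univ_succ, inner_zero, odd_some, ← ih fun h => hv (List.mem_cons_of_mem _ h),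
      add_comm]
    simp only [inner_succ]

theorem sum_inner_lt (v : Word) (hv : none ∉ v) (a : ℕ) :
    ∑ t, (if (v.get t).getD 0 < a then inner v t else 0) = total a v := by
  induction v with
  | nil => simp [total, dim]
  | cons x v ih =>
    obtain _ | b := x
    · simp at hv
    change ∑ t : Fin (v.length + 1), _ = _
    rw [Fin.sum_univ_succ, inner_zero, total_cons, ← ih fun h => hv (List.mem_cons_of_mem _ h),
      add_comm]
    simp only [inner_succ, ite_and]
    rfl

theorem whiskerExponent_cons (a : ℕ) (v : Word) (hv : none ∉ v) (s : Fin (v.length + 1) → ℕ) :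
    whiskerExponent (some a :: v) s = whiskerExponent v (Fin.tail s) +
      ((if some a ∈ v then s 0 else 0) + s 0 * odd v) +
      (s 0 * ∑ t, (if (v.get t).getD 0 < a then s t.succ else 0) + s 0 * total a v +
        (if some a ∈ v then 1 else 0) * ∑ t, if (v.get t).getD 0 < a then s t.succ else 0) := by
  have hI : ∀ {k : ℕ} (t : Fin k) (f : Fin k → ℕ), ∑ t' ∈ Finset.Iic t, f t' =
      ∑ t', if t' ≤ t then f t' else 0 := fun t f => by
    rw [← Finset.sum_filter]
    congr 1
    ext
    simp
  have e : whiskerExponent (some a :: v) s = (∑ t : Fin (v.length + 1), inner (some a :: v) t *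
        ∑ t' ∈ Finset.Iic t, s t') + ∑ t : Fin (v.length + 1), ∑ t' : Fin (v.length + 1),
      if t < t' ∧ ((some a :: v).get t').getD 0 < ((some a :: v).get t).getD 0 then
        s t * s t' + s t * inner (some a :: v) t' + inner (some a :: v) t * s t' else 0 := rfl
  have h₁ : ∀ t : Fin v.length, ¬ t.succ ≤ (0 : Fin (v.length + 1)) := fun t =>
    not_le.2 (Fin.succ_pos t)
  have h₂ : ∀ t : Fin v.length, (some a :: v).get (t.succ : Fin (v.length + 1)) = v.get t :=
    fun _ => rfl
  have h₃ : (some a :: v).get (0 : Fin (v.length + 1)) = some a := rfl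
  have h₄ : ∀ t : Fin v.length, (if (v.get t).getD 0 < a then s 0 * s t.succ + s 0 * inner v t +
      (if some a ∈ v then 1 else 0) * s t.succ else 0) =
      s 0 * (if (v.get t).getD 0 < a then s t.succ else 0) +
        s 0 * (if (v.get t).getD 0 < a then inner v t else 0) +
        (if some a ∈ v then 1 else 0) * if (v.get t).getD 0 < a then s t.succ else 0 := fun t => by
    by_cases h : (v.get t).getD 0 < a
    · simp only [if_pos h]
    · simp only [if_neg h, mul_zero, add_zero]
  rw [e, whiskerExponent]
  simp only [hI, Fin.sum_univ_succ, inner_zero, inner_succ, ← sum_inner v hv,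
    ← sum_inner_lt v hv a]
  simp only [h₁, h₂, h₃, Fin.succ_le_succ_iff, Fin.succ_lt_succ_iff, Fin.zero_le, Fin.succ_pos,
    Fin.not_lt_zero, if_true, if_false, true_and, false_and, le_refl, Finset.sum_const_zero,
    add_zero, zero_add, Option.getD_some, mul_add, Finset.sum_add_distrib, h₄, Fin.tail,
    Finset.mul_sum, mul_comm _ (s 0), mul_ite, mul_one, mul_zero]
  ring

theorem twistExp_repeatStep (a : ℕ) (w : Word) (i : ℕ) :
    (twistExp (repeatStep a w i) : ZMod 2) = twistExp w +
      (if some a ∈ w then total a w else 0 : ℕ) +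
        i * (odd w + (if some a ∈ w then 1 else 0 : ℕ) + total a w) ∧
    (odd (repeatStep a w i) : ZMod 2) = odd w + (if some a ∈ w then 1 else 0 : ℕ) ∧
    total a (repeatStep a w i) = total a w ∧ some a ∈ repeatStep a w i := by
  induction i with
  | zero =>
    simp [repeatStep, twistExp_some, odd_some, total_cons]
  | succ i ih =>
    obtain ⟨h₁, h₂, h₃, h₄⟩ := ih
    have h₅ : some a ∈ none :: repeatStep a w i := List.mem_cons_of_mem _ h₄
    refine ⟨?_, ?_, ?_, List.mem_cons_self⟩
    · rw [repeatStep, twistExp_some, twistExp_none, if_pos h₅, total_none, h₃]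
      push_cast [h₁, h₂]
      ring
    · rw [repeatStep, odd_some, odd_none, if_pos h₅]
      push_cast [h₂]
      linear_combination two_zmod
    · rw [repeatStep, total_cons, total_none, h₃, if_neg (by simp), add_zero]

theorem total_repeatStep (a b : ℕ) (w : Word) (i : ℕ) :
    total b (repeatStep a w i) = total b (some a :: w) + if a < b then i else 0 := by
  have hmem : ∀ j, some a ∈ repeatStep a w j := fun j => by
    cases j <;> exact List.mem_cons_self
  induction i with
  | zero => simp [repeatStep]
  | succ i ih =>
    rw [repeatStep, total_cons, total_none, ih]
    by_cases h : a < b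
    · simp [h, hmem i]
      omega
    · simp [h]

theorem mem_repeatStep (a : ℕ) (w : Word) (i b : ℕ) :
    some b ∈ repeatStep a w i ↔ b = a ∨ some b ∈ w := by
  induction i with
  | zero => simp [repeatStep]
  | succ i ih => simp [repeatStep, ih]

theorem mem_insertPoints (v : Word) (hv : none ∉ v) (s : Fin v.length → ℕ) (b : ℕ) :
    some b ∈ insertPoints v s ↔ some b ∈ v := by
  induction v with
  | nil => simp [insertPoints]
  | cons x v ih =>
    obtain _ | a := x
    · simp at hv
    rw [insertPoints_cons, mem_repeatStep, ih fun h => hv (List.mem_cons_of_mem _ h)]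
    simp

theorem total_insertPoints (v : Word) (hv : none ∉ v) (s : Fin v.length → ℕ) (a : ℕ) :
    total a (insertPoints v s) = total a v + ∑ t, if (v.get t).getD 0 < a then s t else 0 := by
  induction v with
  | nil => simp [insertPoints]
  | cons x v ih =>
    obtain _ | b := x
    · simp at hv
    have hv' : none ∉ v := fun h => hv (List.mem_cons_of_mem _ h)
    rw [insertPoints_cons, total_repeatStep, total_cons, total_cons, ih hv']
    simp only [mem_insertPoints v hv']
    change _ = _ + ∑ t : Fin (v.length + 1), _
    rw [Fin.sum_univ_succ]
    have e : (some b :: v).get (0 : Fin (v.length + 1)) = some b := rfl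
    rw [e]
    simp only [Fin.tail, Option.getD_some]
    change _ = _ + (_ + ∑ t : Fin v.length, if (v.get t).getD 0 < a then s t.succ else 0)
    omega

theorem odd_insertPoints (v : Word) (hv : none ∉ v) (s : Fin v.length → ℕ) :
    (odd (insertPoints v s) : ZMod 2) = odd v := by
  induction v with
  | nil => simp [insertPoints]
  | cons x v ih =>
    obtain _ | b := x
    · simp at hv
    have hv' : none ∉ v := fun h => hv (List.mem_cons_of_mem _ h)
    rw [insertPoints_cons, (twistExp_repeatStep _ _ _).2.1, ih hv', odd_some]
    simp only [mem_insertPoints v hv']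
    push_cast
    rfl

theorem whiskerExponent_eq (v : Word) (hv : none ∉ v) (s : Fin v.length → ℕ) :
    (whiskerExponent v s : ZMod 2) = twistExp v + twistExp (insertPoints v s) := by
  induction v with
  | nil => simp [insertPoints, whiskerExponent, twistExp]
  | cons x v ih =>
    obtain _ | a := x
    · simp at hv
    have hv' : none ∉ v := fun h => hv (List.mem_cons_of_mem _ h)
    rw [whiskerExponent_cons a v hv', insertPoints_cons, (twistExp_repeatStep _ _ _).1,
      total_insertPoints v hv', twistExp_some]
    simp only [mem_insertPoints v hv']
    push_cast [ih hv', odd_insertPoints v hv']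
    simp only [Fin.tail]
    generalize (∑ t, (if (List.get v t).getD 0 < a then s t.succ else 0) : ZMod 2) = S
    by_cases ha : some a ∈ v
    · simp only [ha, if_true]
      linear_combination -(total a v : ZMod 2) * two_zmod
    · simp only [ha, if_false]
      ring

/-- Multiply every word by the sign that relates it to its path-ordered version. -/
def twistLin : (Word →₀ ℤ) →ₗ[ℤ] (Word →₀ ℤ) :=
  Finsupp.linearCombination ℤ fun w => Finsupp.single w (twist w)

theorem twistLin_single (v : Word) (a : ℤ) :
    twistLin (Finsupp.single v a) = Finsupp.single v (a * twist v) := by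
  rw [twistLin, Finsupp.linearCombination_single, Finsupp.smul_single, smul_eq_mul]

theorem extend_twistLin (φ : Word → (Word →₀ ℤ)) (x : Word →₀ ℤ) :
    extend φ (twistLin x) = extend (fun w => twist w • φ w) x := by
  rw [twistLin, ← extend_eq, extend_extend]
  simp only [extend_single]

theorem none_notMem {v : Word} (h : marks v = 0) : none ∉ v := List.count_eq_zero.1 h

/-- Up to the signs of the path-ordered words, the whiskering inserts points without signs. -/
theorem whiskerWord_eq (l : ℕ) {v : Word} (hv : marks v = 0) :
    whiskerWord l v = twist v • twistLin (pathWhisker l v) := by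
  rw [whiskerWord, pathWhisker_eq_sum l v (none_notMem hv), map_sum, Finset.smul_sum]
  refine Finset.sum_congr rfl fun s _ => ?_
  rw [twistLin_single, Finsupp.smul_single, one_mul, smul_eq_mul, twist, twist, ← pow_add]
  congr 1
  apply neg_one_pow_congr
  rw [whiskerExponent_eq v (none_notMem hv), Nat.cast_add]

/-! ### Whiskering and composition -/

/-- The composition of path-ordered words. -/
def pathComp (m i : ℕ) (v u : Word) : Word →₀ ℤ :=
  Finsupp.single (subst m i v u) ((-1) ^ crossExp i v u)

/-- The composition of a path-ordered word with a whiskering. -/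
def pathCompWhisker (m i : ℕ) (v u : Word) : Word →₀ ℤ :=
  extend (pathComp m i v) (pathWhisker (dim v i) u)

section PathComp

variable (m i : ℕ) (v u : Word)

theorem pathCompWhisker_nil : pathCompWhisker m i [] u = Finsupp.single [] 1 := by
  rw [pathCompWhisker, show dim [] i = 0 from rfl, pathWhisker_zero, extend_single, pathComp,
    subst_nil, crossExp_nil, pow_zero, one_smul]

theorem pathCompWhisker_none :
    pathCompWhisker m i (none :: v) u = pre none (pathCompWhisker m i v u) := by
  rw [pathCompWhisker, pathCompWhisker, map_extend, dim_none]
  congr 1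
  funext w
  rw [pathComp, pathComp, pre_single, subst_none, crossExp_none]

theorem pathCompWhisker_some_ne {a : ℕ} (ha : a ≠ i) : pathCompWhisker m i (some a :: v) u =
    pre (some (slot m i a)) (pathCompWhisker m i v u) := by
  rw [pathCompWhisker, pathCompWhisker, map_extend, dim_cons, if_neg fun h => ha h.1.symm, add_zero]
  congr 1
  funext w
  rw [pathComp, pathComp, pre_single, subst_some_ne _ _ ha, crossExp_some_ne _ _ _ ha]

theorem pathCompWhisker_some_nil : pathCompWhisker m i (some i :: v) [] =
    if some i ∈ v then 0 else pathCompWhisker m i v [] := by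
  rw [pathCompWhisker, pathCompWhisker, dim_cons]
  by_cases h : some i ∈ v
  · simp only [h, if_true, and_self, pathWhisker_succ_nil, extend_zero]
  · have : dim v i = 0 := by rw [dim, List.count_eq_zero.2 h]
    simp only [h, if_false, and_false, this, add_zero, pathWhisker_zero_nil, extend_single,
      pathComp, subst_some_nil, crossExp_some_nil]

theorem pathComp_some_some (b : ℕ) (w : Word) (h : some b ∈ w ↔ some b ∈ u) :
    pathComp m i (some i :: v) (some b :: w) =
      ((-1 : ℤ) ^ (odd (some i :: v) * if some b ∈ u then 1 else 0)) •
        pre (some (i + b)) (pathComp m i (some i :: v) w) := by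
  rw [pathComp, pathComp, pre_single, subst_some_some, crossExp_some_some, Finsupp.smul_single,
    smul_eq_mul, pow_add]
  simp only [h]

theorem pathCompWhisker_some_some (b : ℕ) : pathCompWhisker m i (some i :: v) (some b :: u) =
    ((-1 : ℤ) ^ (odd (some i :: v) * if some b ∈ u then 1 else 0)) •
        pre (some (i + b)) (pathCompWhisker m i (some i :: v) u) +
      if some i ∈ v then pre (some (i + b)) (pathCompWhisker m i v (some b :: u)) else 0 := by
  have h₁ : ∀ k, extend (pathComp m i (some i :: v)) (pre (some b) (pathWhisker k u)) =
      ((-1 : ℤ) ^ (odd (some i :: v) * if some b ∈ u then 1 else 0)) •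
        pre (some (i + b)) (extend (pathComp m i (some i :: v)) (pathWhisker k u)) := fun k => by
    rw [extend_pre, map_extend, ← extend_smul_fun]
    exact extend_congr fun w hw => pathComp_some_some m i v u b w
      ((isWhiskering_of_mem k u w hw).mem_iff b)
  rw [pathCompWhisker, pathCompWhisker, dim_cons]
  by_cases h : some i ∈ v
  · simp only [h, if_true, and_self]
    rw [pathWhisker_succ_some, extend_add, h₁, extend_pre, extend_pre, pathCompWhisker,
      map_extend _ (pathComp m i v)]
    congr 1
    refine extend_congr fun w hw => ?_
    have hb : some b ∈ w := ((isWhiskering_of_mem _ _ w hw).mem_iff b).2 List.mem_cons_self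
    rw [pathComp, pathComp, pre_single, subst_some_some, subst_some_none, crossExp_some_some,
      crossExp_some_none, if_pos (List.mem_cons_of_mem _ hb), mul_one, ← add_assoc, ← two_mul,
      pow_add, pow_mul, neg_one_sq, one_pow, one_mul]
  · have : dim v i = 0 := by rw [dim, List.count_eq_zero.2 h]
    simp only [h, if_false, and_false, add_zero, this]
    rw [pathWhisker_zero_some, h₁]

end PathComp

theorem extend_pathWhisker_none (l : ℕ) (x : Word →₀ ℤ) :
    extend (pathWhisker l) (pre none x) = pre none (extend (pathWhisker l) x) := by
  rw [extend_pre, map_extend]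
  simp only [pathWhisker_none]

theorem extend_pathWhisker_zero (x : Word →₀ ℤ) : extend (pathWhisker 0) x = x := by
  have : pathWhisker 0 = fun v => Finsupp.single v 1 := funext pathWhisker_zero
  rw [this, extend_id]

theorem extend_pathWhisker_some (l a : ℕ) (x : Word →₀ ℤ) :
    extend (pathWhisker (l + 1)) (pre (some a) x) =
      pre (some a) (extend (pathWhisker (l + 1)) x) +
        pre (some a) (pre none (extend (pathWhisker l) (pre (some a) x))) := by
  rw [extend_pre, extend_pre]
  simp only [pathWhisker_succ_some]
  rw [extend_add_fun, map_extend, map_extend, map_extend]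

/-- The whiskering of a composite with a whiskering is the composite of the whiskerings: both sides
satisfy the same recursion in the two words. -/
theorem pathWhisker_pathCompWhisker (m i : ℕ) : ∀ (l : ℕ) (v u : Word), none ∉ u →
    extend (pathWhisker l) (pathCompWhisker m i v u) =
      extend (fun v' => pathCompWhisker m i v' u) (pathWhisker l v)
  | 0, v, u, _ => by
    rw [extend_pathWhisker_zero, pathWhisker_zero, extend_single, one_smul]
  | l + 1, [], u, _ => by
    rw [pathCompWhisker_nil, extend_single, pathWhisker_succ_nil, extend_zero, smul_zero]
  | l + 1, none :: v, u, hu => by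
    rw [pathCompWhisker_none, extend_pathWhisker_none, pathWhisker_none, extend_pre,
      pathWhisker_pathCompWhisker m i (l + 1) v u hu, map_extend]
    simp only [pathCompWhisker_none]
  | l + 1, some a :: v, u, hu => by
    have hR : extend (fun v' => pathCompWhisker m i v' u) (pathWhisker (l + 1) (some a :: v)) =
        extend (fun v' => pathCompWhisker m i (some a :: v') u) (pathWhisker (l + 1) v) +
        extend (fun v' => pathCompWhisker m i (some a :: none :: v') u)
          (pathWhisker l (some a :: v)) := by
      rw [pathWhisker_succ_some, extend_add, extend_pre, extend_pre, extend_pre]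
    rw [hR]
    by_cases ha : a = i
    · subst ha
      match u, hu with
      | [], hu =>
        have h₁ : ∀ v' ∈ (pathWhisker l (some a :: v)).support,
            pathCompWhisker m a (some a :: none :: v') [] = 0 := fun v' hv' => by
          rw [pathCompWhisker_some_nil, if_pos]
          exact List.mem_cons_of_mem _
            (((isWhiskering_of_mem _ _ _ hv').mem_iff a).2 List.mem_cons_self)
        have h₂ : ∀ v' ∈ (pathWhisker (l + 1) v).support,
            pathCompWhisker m a (some a :: v') [] =
              (if some a ∈ v then 0 else 1 : ℤ) • pathCompWhisker m a v' [] := fun v' hv' => by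
          rw [pathCompWhisker_some_nil]
          simp only [(isWhiskering_of_mem _ _ _ hv').mem_iff a]
          split_ifs <;> simp
        rw [extend_congr h₁, extend_congr h₂, extend_zero_fun, extend_smul_fun, add_zero,
          ← pathWhisker_pathCompWhisker m a (l + 1) v [] hu, pathCompWhisker_some_nil,
          ← extend_smul]
        split_ifs <;> simp
      | none :: u, hu => simp at hu
      | some b :: u, hu =>
        have hu' : none ∉ u := fun h => hu (List.mem_cons_of_mem _ h)
        set ε : ℤ := (-1) ^ (odd (some a :: v) * if some b ∈ u then 1 else 0) with hε
        set δ : ℤ := if some a ∈ v then 1 else 0 with hδ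
        have hG : ∀ v', (odd (some a :: v') : ZMod 2) = odd (some a :: v) →
            pathCompWhisker m a (some a :: v') (some b :: u) =
              ε • pre (some (a + b)) (pathCompWhisker m a (some a :: v') u) +
                (if some a ∈ v' then 1 else 0 : ℤ) •
                  pre (some (a + b)) (pathCompWhisker m a v' (some b :: u)) := fun v' h => by
          rw [pathCompWhisker_some_some, hε]
          congr 1
          · congr 1
            apply neg_one_pow_congr
            push_cast [h]
            rfl
          · split_ifs <;> simp
        have h₁ : ∀ v' ∈ (pathWhisker (l + 1) v).support,
            pathCompWhisker m a (some a :: v') (some b :: u) =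
              ε • pre (some (a + b)) (pathCompWhisker m a (some a :: v') u) +
                δ • pre (some (a + b)) (pathCompWhisker m a v' (some b :: u)) := fun v' hv' => by
          have h := isWhiskering_of_mem _ _ _ hv'
          rw [hG v' (h.cons _).odd_eq, hδ]
          simp only [h.mem_iff]
        have h₂ : ∀ v' ∈ (pathWhisker l (some a :: v)).support,
            pathCompWhisker m a (some a :: none :: v') (some b :: u) =
              ε • pre (some (a + b)) (pathCompWhisker m a (some a :: none :: v') u) +
                pre (some (a + b)) (pre none (pathCompWhisker m a v' (some b :: u))) :=
          fun v' hv' => by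
          have h := isWhiskering_of_mem _ _ _ hv'
          rw [hG _ (h.insert).odd_eq, if_pos (List.mem_cons_of_mem _ ((h.mem_iff a).2
            List.mem_cons_self)), one_smul, pathCompWhisker_none]
        have ih₁ := pathWhisker_pathCompWhisker m a (l + 1) (some a :: v) u hu'
        have ih₂ := pathWhisker_pathCompWhisker m a (l + 1) v (some b :: u) hu
        have ih₃ := pathWhisker_pathCompWhisker m a l (some a :: v) (some b :: u) hu
        rw [pathWhisker_succ_some, extend_add, extend_pre, extend_pre, extend_pre] at ih₁
        have hL : pathCompWhisker m a (some a :: v) (some b :: u) =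
            pre (some (a + b)) (ε • pathCompWhisker m a (some a :: v) u +
              δ • pathCompWhisker m a v (some b :: u)) := by
          rw [hG v rfl, map_add, map_smul, map_smul]
        rw [extend_congr h₁, extend_congr h₂, extend_add_fun, extend_add_fun, extend_smul_fun,
          extend_smul_fun, extend_smul_fun]
        simp only [← map_extend]
        rw [← ih₂, ← ih₃, hL, extend_pathWhisker_some, ← hL, extend_add, extend_smul, extend_smul, ih₁]
        simp only [map_add, map_smul, smul_add]
        abel
    · have h₁ : ∀ v', pathCompWhisker m i (some a :: none :: v') u =
          pre (some (slot m i a)) (pre none (pathCompWhisker m i v' u)) := fun v' => by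
        rw [pathCompWhisker_some_ne _ _ _ _ ha, pathCompWhisker_none]
      simp only [h₁, pathCompWhisker_some_ne _ _ _ _ ha]
      rw [extend_pathWhisker_some, pathWhisker_pathCompWhisker m i (l + 1) v u hu, map_extend]
      congr 1
      rw [← pathCompWhisker_some_ne _ _ _ _ ha,
        pathWhisker_pathCompWhisker m i l (some a :: v) u hu, map_extend, map_extend]
termination_by l v u => l + v.length + u.length

/-! ### The whiskering as a morphism of operads -/

theorem twist_sq_smul (v : Word) (x : Word →₀ ℤ) : twist v • twist v • x = x := by
  rw [smul_smul, twist_mul_self, one_smul]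

theorem marks_of_mem_pathCompWhisker {m i : ℕ} {v u w : Word}
    (hw : w ∈ (pathCompWhisker m i v u).support) : marks w = marks v := by
  have h : pathCompWhisker m i v u ∈ Finsupp.supported ℤ ℤ {w | marks w = marks v} :=
    extend_mem fun u _ => Finsupp.single_mem_supported ℤ _ marks_subst
  exact h hw

/-- The composition of a path with a whiskering, in terms of path-ordered words. -/
theorem compWord_whiskerWord {c : ℕ∞} {n m l : ℕ} {p q : ℤ} (i : Fin n) {v u : Word}
    (hv : v ∈ lat c n l p) (hu : u ∈ lat c m 0 q) :
    extend (fun u' => Finsupp.single (subst m i v u')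
      ((-1) ^ (parity m u' * (parity n v + total i v)))) (whiskerWord (dim v i) u) =
      (twist v * twist u) • twistLin (pathCompWhisker m i v u) := by
  rw [whiskerWord_eq _ hu.2.1, extend_smul, extend_twistLin, pathCompWhisker, map_extend, mul_comm,
    mul_smul]
  congr 1
  rw [← extend_smul_fun]
  refine extend_congr fun u' hu' => ?_
  have hw := (isWhiskering_of_mem _ _ _ hu').mem_lat hu
  have hc : Composable n m i v u' := ⟨hv.1, hw.1, i.2, hw.2.1⟩
  rw [hc.sign, pathComp, twistLin_single, Finsupp.smul_single, Finsupp.smul_single]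
  congr 1
  simp only [smul_eq_mul]
  linear_combination (twist v * twist (subst m i v u') * (-1) ^ crossExp i v u') *
    twist_mul_self u'

theorem whisker_apply (f : Cochain) (l : ℕ) : whisker f l = extend (whiskerWord l) (f 0) := rfl

theorem whisker_add (f g : Cochain) : whisker (f + g) = whisker f + whisker g := by
  funext l
  exact extend_add _ _ _

theorem whiskerWord_zero {v : Word} (hv : marks v = 0) : whiskerWord 0 v = Finsupp.single v 1 := by
  rw [whiskerWord_eq 0 hv, pathWhisker_zero, twistLin_single, Finsupp.smul_single, one_mul,
    smul_eq_mul, twist_mul_self]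

section Whisker

variable {c : ℕ∞} {n : ℕ} {p : ℤ} {f : Cochain}

theorem whisker_zero (hf : f ∈ latCochains c n p) : whisker f 0 = f 0 := by
  rw [mem_latCochains] at hf
  rw [whisker_apply]
  conv_rhs => rw [← extend_id (f 0)]
  exact extend_congr fun v hv => whiskerWord_zero (hf 0 v hv).2.1

theorem twistLin_mem {S : Set Word} {x : Word →₀ ℤ} (hx : x ∈ Finsupp.supported ℤ ℤ S) :
    twistLin x ∈ Finsupp.supported ℤ ℤ S :=
  extend_mem fun _ hv => Finsupp.single_mem_supported ℤ _ (hx hv)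

theorem whisker_mem (hf : f ∈ latCochains c n p) : whisker f ∈ latCochains c n p := by
  rw [mem_latCochains] at hf
  simp only [latCochains, Submodule.mem_pi, Set.mem_univ, forall_true_left]
  intro l
  refine extend_mem fun v hv => ?_
  rw [whiskerWord_eq l (hf 0 v hv).2.1]
  refine Submodule.smul_mem _ _ (twistLin_mem fun w hw => ?_)
  exact (isWhiskering_of_mem _ _ _ hw).mem_lat (hf 0 v hv)

theorem whisker_comp {m : ℕ} {q : ℤ} (i : Fin n) {g : Cochain}
    (hf : f ∈ latCochains c n p) (hg : g ∈ latCochains c m q) :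
    whisker (comp n m i f (whisker g)) = comp n m i (whisker f) (whisker g) := by
  rw [mem_latCochains] at hf hg
  funext l
  rw [whisker_apply, comp_apply, comp_apply, whisker_apply, extend_extend, extend_extend]
  refine extend_congr fun v hv => ?_
  have hv := hf 0 v hv
  have e₁ : compWord n m i (whisker g) = fun v' => extend (fun u =>
      extend (fun u' => Finsupp.single (subst m i v' u')
        ((-1) ^ (parity m u' * (parity n v' + total i v')))) (whiskerWord (dim v' i) u)) (g 0) :=
    funext fun v' => by rw [compWord, whisker_apply, extend_extend]
  rw [e₁, extend_extend, extend_comm]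
  refine extend_congr fun u hu => ?_
  have hu := hg 0 u hu
  rw [compWord_whiskerWord i hv hu, whiskerWord_eq l hv.2.1, extend_smul, extend_smul,
    extend_twistLin, extend_twistLin, mul_smul]
  congr 1
  have e₂ : ∀ w ∈ (pathCompWhisker m i v u).support, twist w • whiskerWord l w =
      twistLin (pathWhisker l w) := fun w hw => by
    rw [whiskerWord_eq l ((marks_of_mem_pathCompWhisker hw).trans hv.2.1), twist_sq_smul]
  have e₃ : ∀ v' ∈ (pathWhisker l v).support, twist v' •
      extend (fun u' => Finsupp.single (subst m i v' u')
        ((-1) ^ (parity m u' * (parity n v' + total i v')))) (whiskerWord (dim v' i) u) =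
      twist u • twistLin (pathCompWhisker m i v' u) := fun v' hv' => by
    rw [compWord_whiskerWord i ((isWhiskering_of_mem _ _ _ hv').mem_lat hv) hu, mul_smul,
      twist_sq_smul]
  rw [extend_congr e₂, extend_congr e₃, extend_smul_fun, ← map_extend, ← map_extend,
    pathWhisker_pathCompWhisker m i l v u (none_notMem hu.2.1)]

theorem pathWhisker_permWord (σ : Equiv.Perm (Fin n)) (l : ℕ) (v : Word) :
    pathWhisker l (permWord σ v) =
      extend (fun w => Finsupp.single (permWord σ w) 1) (pathWhisker l v) := by
  have hcons : ∀ (x : Option ℕ) (w : Word), permWord σ (x :: w) =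
    x.map (extendPerm σ) :: permWord σ w := fun _ _ => rfl
  have hpre : ∀ (x : Option ℕ) (y : Word →₀ ℤ),
      extend (fun w => Finsupp.single (permWord σ w) 1) (pre x y) =
        pre (x.map (extendPerm σ)) (extend (fun w => Finsupp.single (permWord σ w) 1) y) :=
    fun x y => by
    rw [extend_pre, map_extend]
    simp only [hcons, pre_single]
  induction l, v using pathWhisker.induct with
  | case1 =>
    rw [pathWhisker_zero_nil, extend_single, one_smul]
    exact pathWhisker_zero_nil
  | case2 l =>
    rw [pathWhisker_succ_nil, extend_zero]
    exact pathWhisker_succ_nil l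
  | case3 l v ih => rw [hcons, Option.map_none, pathWhisker_none, pathWhisker_none, hpre, ih]; rfl
  | case4 a v ih =>
    rw [hcons, Option.map_some, pathWhisker_zero_some, pathWhisker_zero_some, hpre, ih]; rfl
  | case5 l a v ih₁ ih₂ =>
    rw [hcons, Option.map_some] at ih₂ ⊢
    rw [pathWhisker_succ_some, pathWhisker_succ_some, extend_add, hpre, hpre, hpre, ih₁, ih₂]; rfl

theorem whisker_perm (σ : Equiv.Perm (Fin n)) (hf : f ∈ latCochains c n p) :
    whisker (perm n σ f) = perm n σ (whisker f) := by
  rw [mem_latCochains] at hf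
  funext l
  rw [whisker_apply, perm_apply, perm_apply, whisker_apply, extend_extend, extend_extend]
  refine extend_congr fun v hv => ?_
  have hv := hf 0 v hv
  rw [extend_single, whiskerWord_eq l (by rw [marks_permWord, hv.2.1]), whiskerWord_eq l hv.2.1,
    pathWhisker_permWord, map_extend, permSign_eq σ fun a ha => (hv.1 a).1 ha, mul_smul,
    twist_sq_smul, extend_smul, extend_twistLin]
  congr 1
  refine extend_congr fun w hw => ?_
  have hw := (isWhiskering_of_mem _ _ _ hw).mem_lat hv
  rw [twistLin_single, permSign_eq σ fun a ha => (hw.1 a).1 ha, Finsupp.smul_single, smul_eq_mul,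
    ← mul_assoc, twist_mul_self]

end Whisker

theorem pathWhisker_one (l : ℕ) : pathWhisker l [some 0] = Finsupp.single (unitWord l) 1 := by
  induction l with
  | zero => exact pathWhisker_zero _
  | succ l ih =>
    rw [pathWhisker_succ_some, pathWhisker_succ_nil, map_zero, zero_add, ih, pre_single, pre_single,
      unitWord_succ]

theorem twist_unitWord (l : ℕ) : twist (unitWord l) = 1 := by
  have h : (odd (unitWord l) : ZMod 2) = 0 := by
    rw [odd_eq_parity fun a ha => (unitWord_mem_lat ⊤ l).1 a |>.1 ha, parity_unitWord]
    push_cast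
    linear_combination (l : ZMod 2) * two_zmod
  rw [twist, ← pow_zero (-1 : ℤ)]
  apply neg_one_pow_congr
  induction l with
  | zero => rfl
  | succ l ih =>
    have h' : (odd (unitWord l) : ZMod 2) = 0 := by
      rw [odd_eq_parity fun a ha => (unitWord_mem_lat ⊤ l).1 a |>.1 ha, parity_unitWord]
      push_cast
      linear_combination (l : ZMod 2) * two_zmod
    rw [unitWord_succ, twistExp_some, twistExp_none, total_zero]
    push_cast [ih h', h']
    simp

theorem whisker_braceUnit : whisker braceUnit = unit := by
  funext l
  rw [whisker_apply, braceUnit, extend_single, one_smul, whiskerWord_eq l rfl, pathWhisker_one,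
    twistLin_single, twist_unitWord, one_mul, unit_apply]
  rw [show [some 0] = unitWord 0 from rfl, twist_unitWord, one_smul]

/-! ### The differential of path-ordered words -/

/-- The sign `-1` of an odd step: a step `a` followed by `v` is odd if it is not the last one in its
direction. -/
def stepSign (a : ℕ) (v : Word) : ℤ := if some a ∈ v then -1 else 1

/-- Remove the only step in the direction `a`; words with several such steps go to zero. -/
def dropStep (a : ℕ) : Word → (Word →₀ ℤ)
  | [] => 0
  | none :: v => pre none (dropStep a v)
  | some b :: v => if b = a then if some a ∈ v then 0 else Finsupp.single v 1
      else pre (some b) (dropStep a v)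

/-- The simplicial differential of path-ordered words. The term with `dropStep` is the last face in
the direction `a`, for words with two steps in this direction. -/
def pathBdry : Word → (Word →₀ ℤ)
  | [] => 0
  | none :: v => -pre none (pathBdry v)
  | some a :: v => if some a ∈ v
      then Finsupp.single v 1 - pre (some a) (pathBdry v + dropStep a v)
      else pre (some a) (pathBdry v)

/-- The cosimplicial differential of path-ordered words without the term that puts a mark at the
beginning. -/
def pathCobdryTail : Word → (Word →₀ ℤ)
  | [] => -Finsupp.single [none] 1
  | none :: v => -pre none (Finsupp.single (none :: v) 1 + pathCobdryTail v)
  | some a :: v => stepSign a v • pre (some a) (pathCobdryTail v)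

/-- Remove the first mark; this is the first codegeneracy of path-ordered words. -/
def dropMark : Word → (Word →₀ ℤ)
  | [] => 0
  | none :: v => Finsupp.single v 1
  | some a :: v => stepSign a v • pre (some a) (dropMark v)

/-- The contracting homotopy for the simplicial differential of marked path-ordered words: divide a
step before the first mark by a new point, and move the first mark to it. -/
def pathHomotopy : Word → (Word →₀ ℤ)
  | [] => 0
  | none :: _ => 0
  | some a :: v => stepSign a v • pre (some a) (pathHomotopy v) -
      pre (some a) (pre none (dropMark (some a :: v)))

/-- Linear extension as a linear map. -/
def lin (φ : Word → (Word →₀ ℤ)) : (Word →₀ ℤ) →ₗ[ℤ] (Word →₀ ℤ) :=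
  Finsupp.linearCombination ℤ φ

theorem lin_eq (φ : Word → (Word →₀ ℤ)) (x : Word →₀ ℤ) : lin φ x = extend φ x := rfl

theorem lin_single (φ : Word → (Word →₀ ℤ)) (v : Word) : lin φ (Finsupp.single v 1) = φ v := by
  rw [lin_eq, extend_single, one_smul]

/-- A map of linear combinations that vanishes on words vanishes. -/
theorem eq_zero_of_words {L : (Word →₀ ℤ) →ₗ[ℤ] (Word →₀ ℤ)}
    (h : ∀ v, L (Finsupp.single v 1) = 0) (x : Word →₀ ℤ) : L x = 0 := by
  have : L = 0 := Finsupp.lhom_ext' fun v => LinearMap.ext_ring (by simpa using h v)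
  rw [this, LinearMap.zero_apply]

/-- The linear combinations of words `v` before which a step `a` has the sign `s`. -/
def signed (a : ℕ) (s : ℤ) : Submodule ℤ (Word →₀ ℤ) :=
  Finsupp.supported ℤ ℤ {v | stepSign a v = s}

theorem single_mem_signed (a : ℕ) (v : Word) : Finsupp.single v 1 ∈ signed a (stepSign a v) :=
  Finsupp.single_mem_supported ℤ _ rfl

theorem stepSign_of_mem {a : ℕ} {v : Word} (h : some a ∈ v) : stepSign a v = -1 := if_pos h

theorem stepSign_of_notMem {a : ℕ} {v : Word} (h : some a ∉ v) : stepSign a v = 1 := if_neg h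

theorem stepSign_eq_neg_one {a : ℕ} {v : Word} (h : stepSign a v = -1) : some a ∈ v := by
  by_contra h'
  rw [stepSign_of_notMem h'] at h
  omega

theorem stepSign_eq_one {a : ℕ} {v : Word} (h : stepSign a v = 1) : some a ∉ v := by
  intro h'
  rw [stepSign_of_mem h'] at h
  omega

theorem stepSign_mul_self (a : ℕ) (v : Word) : stepSign a v * stepSign a v = 1 := by
  unfold stepSign
  split_ifs <;> rfl

theorem pre_mem_signed {a : ℕ} {s : ℤ} {x : Word →₀ ℤ} {y : Option ℕ} (hy : y ≠ some a)
    (hx : x ∈ signed a s) : pre y x ∈ signed a s := by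
  intro w hw
  obtain ⟨v, hv, rfl⟩ := mem_support_pre hw
  have := hx hv
  simpa [stepSign, hy.symm] using this

theorem pre_self_mem_signed (a : ℕ) (x : Word →₀ ℤ) : pre (some a) x ∈ signed a (-1) := by
  intro w hw
  obtain ⟨v, hv, rfl⟩ := mem_support_pre hw
  exact stepSign_of_mem List.mem_cons_self

theorem dropStep_mem_signed (a : ℕ) (v : Word) : dropStep a v ∈ signed a 1 := by
  induction v with
  | nil => exact zero_mem _
  | cons x v ih =>
    cases x with
    | none => exact pre_mem_signed (by simp) ih
    | some b =>
      rw [dropStep]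
      split_ifs with h₁ h₂
      · exact zero_mem _
      · exact Finsupp.single_mem_supported ℤ _ (stepSign_of_notMem h₂)
      · exact pre_mem_signed (by simpa using h₁) ih

section Recursion

variable {a : ℕ} {s : ℤ} {x : Word →₀ ℤ}

theorem lin_pre (φ : Word → (Word →₀ ℤ)) (L : (Word →₀ ℤ) →ₗ[ℤ] (Word →₀ ℤ)) (y : Option ℕ)
    (h : ∀ v ∈ x.support, φ (y :: v) = L (Finsupp.single v 1)) : lin φ (pre y x) = L x := by
  rw [lin_eq, extend_pre, extend_congr h, ← map_extend, extend_id]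

theorem bdry_pre_none : lin pathBdry (pre none x) = -pre none (lin pathBdry x) :=
  lin_pre _ (-(pre none ∘ₗ lin pathBdry)) _ fun v _ => by simp [lin_single, pathBdry]

theorem bdry_pre_mem (h : x ∈ signed a (-1)) : lin pathBdry (pre (some a) x) =
    x - pre (some a) (lin pathBdry x + lin (dropStep a) x) :=
  lin_pre _ (LinearMap.id - pre (some a) ∘ₗ (lin pathBdry + lin (dropStep a))) _ fun v hv => by
    simp [lin_single, pathBdry, stepSign_eq_neg_one (h hv)]

theorem bdry_pre_notMem (h : x ∈ signed a 1) :
    lin pathBdry (pre (some a) x) = pre (some a) (lin pathBdry x) :=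
  lin_pre _ (pre (some a) ∘ₗ lin pathBdry) _ fun v hv => by
    simp [lin_single, pathBdry, stepSign_eq_one (h hv)]

theorem cobdryTail_pre_none : lin pathCobdryTail (pre none x) =
    -pre none (pre none x + lin pathCobdryTail x) :=
  lin_pre _ (-(pre none ∘ₗ (pre none + lin pathCobdryTail))) _ fun v _ => by
    simp [lin_single, pathCobdryTail, pre_single]

theorem cobdryTail_pre_some (h : x ∈ signed a s) : lin pathCobdryTail (pre (some a) x) =
    s • pre (some a) (lin pathCobdryTail x) :=
  lin_pre _ (s • (pre (some a) ∘ₗ lin pathCobdryTail)) _ fun v hv => by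
    rw [LinearMap.smul_apply, LinearMap.comp_apply, lin_single, pathCobdryTail, show _ = _ from h hv]

theorem dropMark_pre_none : lin dropMark (pre none x) = x :=
  lin_pre _ LinearMap.id _ fun v _ => by simp [dropMark]

theorem dropMark_pre_some (h : x ∈ signed a s) : lin dropMark (pre (some a) x) =
    s • pre (some a) (lin dropMark x) :=
  lin_pre _ (s • (pre (some a) ∘ₗ lin dropMark)) _ fun v hv => by
    rw [LinearMap.smul_apply, LinearMap.comp_apply, lin_single, dropMark, show _ = _ from h hv]

theorem homotopy_pre_none : lin pathHomotopy (pre none x) = 0 :=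
  lin_pre _ 0 _ fun v _ => by simp [pathHomotopy]

theorem homotopy_pre_some (h : x ∈ signed a s) : lin pathHomotopy (pre (some a) x) =
    s • pre (some a) (lin pathHomotopy x) -
      pre (some a) (pre none (lin dropMark (pre (some a) x))) :=
  lin_pre _ (s • (pre (some a) ∘ₗ lin pathHomotopy) -
      pre (some a) ∘ₗ pre none ∘ₗ lin dropMark ∘ₗ pre (some a)) _ fun v hv => by
    simp only [LinearMap.sub_apply, LinearMap.smul_apply, LinearMap.comp_apply, pre_single,
      lin_single, pathHomotopy]
    rw [show _ = _ from h hv]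

theorem dropStep_pre_ne {y : Option ℕ} (hy : y ≠ some a) :
    lin (dropStep a) (pre y x) = pre y (lin (dropStep a) x) :=
  lin_pre _ (pre y ∘ₗ lin (dropStep a)) _ fun v hv => by
    cases y with
    | none => simp [lin_single, dropStep]
    | some b =>
      have : b ≠ a := fun h => hy (by rw [h])
      simp [lin_single, dropStep, this]

theorem dropStep_pre_mem (h : x ∈ signed a (-1)) : lin (dropStep a) (pre (some a) x) = 0 :=
  lin_pre _ 0 _ fun v hv => by simp [dropStep, stepSign_eq_neg_one (h hv)]

theorem dropStep_pre_notMem (h : x ∈ signed a 1) : lin (dropStep a) (pre (some a) x) = x :=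
  lin_pre _ LinearMap.id _ fun v hv => by simp [dropStep, stepSign_eq_one (h hv)]

end Recursion

/-! ### The words that occur in the operations -/

/-- `w` can occur in the result of an operation applied to `v` that changes the number of marks by
`k` and the total dimension by `e`, and that preserves the bound for the complexity. -/
structure Moves (k e : ℤ) (v w : Word) : Prop where
  dominated : Dominated w v
  marks_eq : (marks w : ℤ) = marks v + k
  total_eq : ∀ n, (∀ a, some a ∈ v → a < n) → (total n w : ℤ) = total n v + e

namespace Moves

theorem cons {k e : ℤ} {v w : Word} (h : Moves k e v w) (x : Option ℕ) :
    Moves k e (x :: v) (x :: w) where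
  dominated := h.dominated.cons x
  marks_eq := by
    have := h.marks_eq
    cases x <;> simp only [marks_none, marks_some] <;> push_cast <;> omega
  total_eq n hn := by
    have := h.total_eq n fun a ha => hn a (List.mem_cons_of_mem _ ha)
    cases x with
    | none => simpa only [total_none] using this
    | some a =>
      simp only [total_cons, h.dominated.mem]
      push_cast
      omega

theorem mem_lat {k e p : ℤ} {v w : Word} (h : Moves k e v w) {c : ℕ∞} {n l l' : ℕ}
    (hv : v ∈ lat c n l p) (hl : (l' : ℤ) = l + k) : w ∈ lat c n l' (p + k - e) := by
  obtain ⟨h₁, h₂, h₃, h₄⟩ := hv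
  have h₅ := h.marks_eq
  have h₆ := h.total_eq n fun a ha => (h₁ a).1 ha
  exact ⟨h.dominated.isPath h₁, by omega, h.dominated.complexityLE h₃, by omega⟩

theorem stepSign_eq {k e : ℤ} {v w : Word} (h : Moves k e v w) (a : ℕ) :
    stepSign a w = stepSign a v := by
  unfold stepSign
  simp only [h.dominated.mem]

end Moves

/-- The linear combinations of the words that an operation may produce from `v`. -/
def movesSpan (k e : ℤ) (v : Word) : Submodule ℤ (Word →₀ ℤ) :=
  Finsupp.supported ℤ ℤ {w | Moves k e v w}

section MovesSpan

variable {k e : ℤ}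

theorem pre_mem_movesSpan {v : Word} {x : Word →₀ ℤ} (h : x ∈ movesSpan k e v) (y : Option ℕ) :
    pre y x ∈ movesSpan k e (y :: v) := by
  intro w hw
  obtain ⟨u, hu, rfl⟩ := mem_support_pre hw
  exact (h hu).cons y

theorem mem_signed {φ : Word → (Word →₀ ℤ)} (hφ : ∀ v, φ v ∈ movesSpan k e v) {a : ℕ} {s : ℤ}
    {x : Word →₀ ℤ} (hx : x ∈ signed a s) : lin φ x ∈ signed a s :=
  extend_mem fun v hv _ hw => ((hφ v hw).stepSign_eq a).trans (hx hv)

theorem mem_signed_word {φ : Word → (Word →₀ ℤ)} (hφ : ∀ v, φ v ∈ movesSpan k e v) {a : ℕ} {s : ℤ}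
    {v : Word} (h : stepSign a v = s) : φ v ∈ signed a s :=
  fun _ hw => ((hφ v hw).stepSign_eq a).trans h

theorem mem_lat_of_moves {φ : Word → (Word →₀ ℤ)} (hφ : ∀ v, φ v ∈ movesSpan k e v) {c : ℕ∞}
    {n l l' : ℕ} {p : ℤ} {x : Word →₀ ℤ} (hx : x ∈ Finsupp.supported ℤ ℤ (lat c n l p))
    (hl : (l' : ℤ) = l + k) : lin φ x ∈ Finsupp.supported ℤ ℤ (lat c n l' (p + k - e)) :=
  extend_mem fun v hv _ hw => (hφ v hw).mem_lat (hx hv) hl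

end MovesSpan

theorem dropMark_mem (v : Word) : dropMark v ∈ movesSpan (-1) 0 v := by
  induction v with
  | nil => exact zero_mem _
  | cons x v ih =>
    cases x with
    | none =>
      refine Finsupp.single_mem_supported ℤ _ ⟨⟨fun a => by simp, fun a b p => by simp [proj]⟩,
        by simp [marks_none], fun n _ => by simp [total_none]⟩
    | some a => exact Submodule.smul_mem _ _ (pre_mem_movesSpan ih _)

theorem moves_mark (v : Word) : Moves 1 0 v (none :: v) where
  dominated := (Dominated.refl v).none_cons
  marks_eq := by simp [marks_none]
  total_eq n _ := by simp [total_none]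

theorem pathCobdryTail_mem (v : Word) : pathCobdryTail v ∈ movesSpan 1 0 v := by
  induction v with
  | nil => exact neg_mem (Finsupp.single_mem_supported ℤ _ (moves_mark []))
  | cons x v ih =>
    cases x with
    | none =>
      exact neg_mem (pre_mem_movesSpan
        (add_mem (Finsupp.single_mem_supported ℤ _ (moves_mark v)) ih) _)
    | some a => exact Submodule.smul_mem _ _ (pre_mem_movesSpan ih _)

theorem Moves.insert {k e : ℤ} {a : ℕ} {v w : Word} (h : Moves k e (some a :: v) w) :
    Moves (k + 1) (e + 1) (some a :: v) (some a :: none :: w) where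
  dominated := (h.dominated.none_cons.cons_some a).trans (.double a v)
  marks_eq := by
    have := h.marks_eq
    simp only [marks_none, marks_some] at this ⊢
    push_cast
    omega
  total_eq n hn := by
    have h₁ := h.total_eq n hn
    have h₂ : some a ∈ none :: w := List.mem_cons_of_mem _ ((h.dominated.mem a).2 List.mem_cons_self)
    rw [total_cons, if_pos ⟨hn a List.mem_cons_self, h₂⟩, total_none]
    push_cast
    omega

theorem pathHomotopy_mem (v : Word) : pathHomotopy v ∈ movesSpan 0 1 v := by
  induction v with
  | nil => exact zero_mem _
  | cons x v ih =>
    cases x with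
    | none => exact zero_mem _
    | some a =>
      refine sub_mem (Submodule.smul_mem _ _ (pre_mem_movesSpan ih _)) fun w hw => ?_
      obtain ⟨u, hu, rfl⟩ := mem_support_pre hw
      obtain ⟨u', hu', rfl⟩ := mem_support_pre hu
      exact (dropMark_mem _ hu').insert

/-- Removal of the only step in a direction. -/
theorem mem_dropStep (a : ℕ) (v : Word) : dropStep a v ∈ Finsupp.supported ℤ ℤ
    {w | w.Sublist v ∧ marks w = marks v ∧ v.count (some a) = 1 ∧
      ∀ b, b ≠ a → w.count (some b) = v.count (some b)} := by
  induction v with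
  | nil => exact zero_mem _
  | cons x v ih =>
    have hpre : ∀ x : Option ℕ, x ≠ some a → pre x (dropStep a v) ∈ Finsupp.supported ℤ ℤ
        {w | w.Sublist (x :: v) ∧ marks w = marks (x :: v) ∧ (x :: v).count (some a) = 1 ∧
          ∀ b, b ≠ a → w.count (some b) = (x :: v).count (some b)} := fun x hx w hw => by
      obtain ⟨u, hu, rfl⟩ := mem_support_pre hw
      obtain ⟨h₁, h₂, h₃, h₄⟩ := ih hu
      refine ⟨h₁.cons_cons x, ?_, ?_, fun b hb => ?_⟩
      · simp only [marks, List.count_cons] at h₂ ⊢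
        rw [h₂]
      · rw [List.count_cons_of_ne hx, h₃]
      · rw [List.count_cons, List.count_cons, h₄ b hb]
    cases x with
    | none => exact hpre none (by simp)
    | some b =>
      rw [dropStep]
      split_ifs with h₁ h₂
      · exact zero_mem _
      · refine Finsupp.single_mem_supported ℤ _ ⟨List.sublist_cons_self _ _, ?_, ?_, fun c hc => ?_⟩
        · rw [marks_some]
        · rw [h₁, List.count_cons_self, List.count_eq_zero.2 h₂]
        · rw [List.count_cons_of_ne]
          simpa [h₁] using hc.symm
      · exact hpre _ (by simpa using h₁)

theorem pathBdry_mem (v : Word) : pathBdry v ∈ movesSpan 0 (-1) v := by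
  induction v with
  | nil => exact zero_mem _
  | cons x v ih =>
    cases x with
    | none => exact neg_mem (pre_mem_movesSpan ih _)
    | some a =>
      rw [pathBdry]
      split_ifs with h
      · rw [map_add]
        refine sub_mem (Finsupp.single_mem_supported ℤ _ ⟨?_, ?_, fun n hn => ?_⟩)
          (add_mem (pre_mem_movesSpan ih _) fun w hw => ?_)
        · exact .of_sublist (List.sublist_cons_self _ _) fun b hb => by
            rcases List.mem_cons.1 hb with hb | hb
            · rwa [Option.some.inj hb]
            · exact hb
        · simp [marks_some]
        · rw [total_cons, if_pos ⟨hn a List.mem_cons_self, h⟩]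
          push_cast
          ring
        · obtain ⟨u, hu, rfl⟩ := mem_support_pre hw
          obtain ⟨h₁, h₂, h₃, h₄⟩ := mem_dropStep a v hu
          refine ⟨.of_sublist (h₁.cons_cons _) fun b hb => ?_, ?_, fun n hn => ?_⟩
          · by_cases hba : b = a
            · rw [hba]; exact List.mem_cons_self
            · have hb' : some b ∈ v := by simpa [hba] using hb
              refine List.mem_cons_of_mem _ (List.count_pos_iff.1 ?_)
              rw [h₄ b hba]
              exact List.count_pos_iff.2 hb'
          · simp [marks_some, h₂]
          · have h₅ : some a ∉ u := by
              intro h₅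
              have h₆ := dropStep_mem_signed a v hu
              exact stepSign_eq_one h₆ h₅
            have h₆ : total n u = total n v := Finset.sum_congr rfl fun b _ => by
              by_cases hba : b = a
              · subst hba
                rw [dim, dim, h₃, List.count_eq_zero.2 h₅]
              · rw [dim, dim, h₄ b hba]
            rw [total_cons, if_neg fun h => h₅ h.2, total_cons,
              if_pos ⟨hn a List.mem_cons_self, h⟩, h₆]
            push_cast
            ring
      · exact pre_mem_movesSpan ih _

/-! ### The identities between the operations -/

section Identities

theorem lin_dropStep_mem_signed (a : ℕ) (x : Word →₀ ℤ) : lin (dropStep a) x ∈ signed a 1 :=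
  extend_mem fun v _ => dropStep_mem_signed a v

theorem stepSign_cases (a : ℕ) (v : Word) :
    some a ∈ v ∧ Finsupp.single v 1 ∈ signed a (-1) ∧ stepSign a v = -1 ∨
      some a ∉ v ∧ Finsupp.single v 1 ∈ signed a 1 ∧ stepSign a v = 1 := by
  have h := single_mem_signed a v
  by_cases ha : some a ∈ v
  · rw [stepSign_of_mem ha] at h
    exact Or.inl ⟨ha, h, stepSign_of_mem ha⟩
  · rw [stepSign_of_notMem ha] at h
    exact Or.inr ⟨ha, h, stepSign_of_notMem ha⟩

theorem dropStep_dropMark (a : ℕ) (x : Word →₀ ℤ) :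
    lin (dropStep a) (lin dropMark x) = lin dropMark (lin (dropStep a) x) := by
  rw [← sub_eq_zero]
  refine eq_zero_of_words
    (L := lin (dropStep a) ∘ₗ lin dropMark - lin dropMark ∘ₗ lin (dropStep a)) (fun v => ?_) x
  simp only [LinearMap.sub_apply, LinearMap.comp_apply, sub_eq_zero]
  induction v with
  | nil => simp [lin_single, dropMark, dropStep]
  | cons y v ih =>
    rw [← pre_single]
    cases y with
    | none => rw [dropMark_pre_none, dropStep_pre_ne (by simp), dropMark_pre_none]
    | some b =>
      rw [dropMark_pre_some (single_mem_signed b v), map_smul]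
      by_cases hb : b = a
      · subst hb
        rcases stepSign_cases b v with ⟨-, h, -⟩ | ⟨-, h, h'⟩
        · rw [dropStep_pre_mem h, dropStep_pre_mem (mem_signed dropMark_mem h), map_zero, smul_zero]
        · rw [dropStep_pre_notMem h, dropStep_pre_notMem (mem_signed dropMark_mem h), h', one_smul]
      · have hba : some b ≠ some a := by simpa using hb
        have hs : lin (dropStep a) (Finsupp.single v 1) ∈ signed b (stepSign b v) := by
          rw [lin_single]
          intro w hw
          obtain ⟨-, -, -, h⟩ := mem_dropStep a v hw
          have := h b hb
          change stepSign b w = _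
          unfold stepSign
          simp only [← List.count_pos_iff, this]
        rw [dropStep_pre_ne hba, dropStep_pre_ne hba, dropMark_pre_some hs, ih]

theorem dropStep_mem_signed_ne {a b : ℕ} (hb : b ≠ a) {s : ℤ} {x : Word →₀ ℤ}
    (hx : x ∈ signed b s) : lin (dropStep a) x ∈ signed b s := by
  refine extend_mem fun v hv w hw => ?_
  obtain ⟨-, -, -, h⟩ := mem_dropStep a v hw
  have h' := h b hb
  refine Eq.trans ?_ (hx hv)
  unfold stepSign
  simp only [← List.count_pos_iff, h']

theorem dropStep_homotopy (a : ℕ) (x : Word →₀ ℤ) :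
    lin (dropStep a) (lin pathHomotopy x) = lin pathHomotopy (lin (dropStep a) x) := by
  rw [← sub_eq_zero]
  refine eq_zero_of_words
    (L := lin (dropStep a) ∘ₗ lin pathHomotopy - lin pathHomotopy ∘ₗ lin (dropStep a))
    (fun v => ?_) x
  simp only [LinearMap.sub_apply, LinearMap.comp_apply, sub_eq_zero]
  induction v with
  | nil => simp [lin_single, pathHomotopy, dropStep]
  | cons y v ih =>
    rw [← pre_single]
    cases y with
    | none => rw [homotopy_pre_none, dropStep_pre_ne (by simp), homotopy_pre_none, map_zero]
    | some b =>
      rw [homotopy_pre_some (single_mem_signed b v), map_sub, map_smul]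
      by_cases hb : b = a
      · subst hb
        have h₀ : pre none (lin dropMark (pre (some b) (Finsupp.single v 1))) ∈ signed b (-1) :=
          pre_mem_signed (by simp) (mem_signed dropMark_mem (pre_self_mem_signed b _))
        rw [dropStep_pre_mem h₀, sub_zero]
        rcases stepSign_cases b v with ⟨-, h, -⟩ | ⟨-, h, h'⟩
        · rw [dropStep_pre_mem h, dropStep_pre_mem (mem_signed pathHomotopy_mem h), map_zero,
            smul_zero]
        · rw [dropStep_pre_notMem h, dropStep_pre_notMem (mem_signed pathHomotopy_mem h), h',
            one_smul]
      · have hba : some b ≠ some a := by simpa using hb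
        rw [dropStep_pre_ne hba, dropStep_pre_ne hba, dropStep_pre_ne hba, dropStep_pre_ne (by simp),
          homotopy_pre_some (dropStep_mem_signed_ne hb (single_mem_signed b v)), ih,
          dropStep_dropMark, dropStep_pre_ne hba]

/-- Removal of the first mark anticommutes with the simplicial differential. -/
theorem bdry_dropMark (x : Word →₀ ℤ) :
    lin pathBdry (lin dropMark x) + lin dropMark (lin pathBdry x) = 0 := by
  refine eq_zero_of_words
    (L := lin pathBdry ∘ₗ lin dropMark + lin dropMark ∘ₗ lin pathBdry) (fun v => ?_) x
  simp only [LinearMap.add_apply, LinearMap.comp_apply]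
  induction v with
  | nil => simp [lin_single, pathBdry, dropMark]
  | cons y v ih =>
    rw [← pre_single]
    cases y with
    | none => rw [dropMark_pre_none, bdry_pre_none, map_neg, dropMark_pre_none, add_neg_cancel]
    | some a =>
      rw [dropMark_pre_some (single_mem_signed a v), map_smul]
      rcases stepSign_cases a v with ⟨-, h, h'⟩ | ⟨-, h, h'⟩
      · rw [h', bdry_pre_mem h, bdry_pre_mem (mem_signed dropMark_mem h), map_sub, map_add, map_add,
          map_add, dropMark_pre_some (mem_signed pathBdry_mem h),
          dropMark_pre_some (lin_dropStep_mem_signed a _), dropStep_dropMark]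
        have e := congrArg (pre (some a)) ih
        rw [map_add, map_zero] at e
        rw [← e]
        simp only [neg_smul, one_smul]
        abel
      · rw [h', bdry_pre_notMem h, bdry_pre_notMem (mem_signed dropMark_mem h),
          dropMark_pre_some (mem_signed pathBdry_mem h), one_smul, one_smul, ← map_add, ih, map_zero]

/-- `pathHomotopy` contracts the simplicial differential of marked words to the words that begin
with a mark. -/
theorem bdry_homotopy_of_marked {v : Word} (hv : 0 < marks v) :
    lin pathBdry (lin pathHomotopy (Finsupp.single v 1)) +
      lin pathHomotopy (lin pathBdry (Finsupp.single v 1)) =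
      Finsupp.single v 1 - pre none (lin dropMark (Finsupp.single v 1)) := by
  induction v with
  | nil => simp [marks] at hv
  | cons y v ih =>
    rw [← pre_single]
    cases y with
    | none =>
      rw [homotopy_pre_none, dropMark_pre_none, bdry_pre_none, map_neg, homotopy_pre_none]
      simp
    | some a =>
      have ih := ih (by simpa [marks_some] using hv)
      have hR := bdry_dropMark (Finsupp.single v 1)
      have e₁ := congrArg (pre (some a)) ih
      have e₂ := congrArg (fun z => pre (some a) (pre none (pre (some a) z))) hR
      simp only [map_add, map_sub, map_zero] at e₁ e₂
      rw [homotopy_pre_some (single_mem_signed a v), dropMark_pre_some (single_mem_signed a v)]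
      rcases stepSign_cases a v with ⟨-, h, h'⟩ | ⟨-, h, h'⟩
      · have hm := mem_signed dropMark_mem h
        have hh := mem_signed pathHomotopy_mem h
        have hb := mem_signed pathBdry_mem h
        have hd := lin_dropStep_mem_signed a (Finsupp.single v 1)
        have h₀ : pre none (pre (some a) (lin dropMark (Finsupp.single v 1))) ∈ signed a (-1) :=
          pre_mem_signed (by simp) (pre_self_mem_signed a _)
        rw [h', bdry_pre_mem h]
        simp only [map_sub, map_add, neg_smul, one_smul, map_neg]
        rw [bdry_pre_mem hh, bdry_pre_mem h₀, bdry_pre_none, bdry_pre_mem hm,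
          dropStep_pre_ne (by simp), dropStep_pre_mem hm, homotopy_pre_some hb,
          homotopy_pre_some hd, dropMark_pre_some hb, dropMark_pre_some hd, dropStep_homotopy,
          dropStep_dropMark]
        simp only [map_sub, map_add, neg_smul, one_smul, map_neg, map_zero]
        linear_combination (norm := abel) e₁ - e₂
      · have hm := mem_signed dropMark_mem h
        have hh := mem_signed pathHomotopy_mem h
        have hb := mem_signed pathBdry_mem h
        have h₀ : pre none (pre (some a) (lin dropMark (Finsupp.single v 1))) ∈ signed a (-1) :=
          pre_mem_signed (by simp) (pre_self_mem_signed a _)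
        rw [h', bdry_pre_notMem h]
        simp only [map_sub, one_smul]
        rw [bdry_pre_notMem hh, bdry_pre_mem h₀, bdry_pre_none, bdry_pre_notMem hm,
          dropStep_pre_ne (by simp), dropStep_pre_notMem hm, homotopy_pre_some hb,
          dropMark_pre_some hb]
        simp only [map_add, one_smul, map_neg]
        linear_combination (norm := abel) e₁ - e₂

/-- The cosimplicial differential of path-ordered words. -/
def pathCobdry : (Word →₀ ℤ) →ₗ[ℤ] (Word →₀ ℤ) := pre none + lin pathCobdryTail

theorem pathCobdry_apply (x : Word →₀ ℤ) : pathCobdry x = pre none x + lin pathCobdryTail x := rfl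

theorem cobdryTail_dropMark (x : Word →₀ ℤ) :
    lin dropMark (lin pathCobdryTail x) + lin pathCobdryTail (lin dropMark x) = -x := by
  rw [← add_eq_zero_iff_eq_neg]
  refine eq_zero_of_words (L := lin dropMark ∘ₗ lin pathCobdryTail +
    lin pathCobdryTail ∘ₗ lin dropMark + LinearMap.id) (fun v => ?_) x
  simp only [LinearMap.add_apply, LinearMap.comp_apply, LinearMap.id_apply]
  induction v with
  | nil => simp [lin_single, pathCobdryTail, dropMark]
  | cons y v ih =>
    rw [← pre_single]
    cases y with
    | none =>
      rw [cobdryTail_pre_none, dropMark_pre_none, map_neg, dropMark_pre_none]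
      abel
    | some a =>
      have h := single_mem_signed a v
      rw [cobdryTail_pre_some h, dropMark_pre_some h, map_smul, map_smul,
        dropMark_pre_some (mem_signed pathCobdryTail_mem h),
        cobdryTail_pre_some (mem_signed dropMark_mem h), smul_smul, smul_smul, stepSign_mul_self,
        one_smul, one_smul, ← map_add, ← map_add, ih, map_zero]

/-- Removal of the first mark anticommutes with the cosimplicial differential, except for the term
that puts a mark at the beginning. -/
theorem cobdry_dropMark (x : Word →₀ ℤ) :
    pathCobdry (lin dropMark x) + lin dropMark (pathCobdry x) = pre none (lin dropMark x) := by
  have := cobdryTail_dropMark x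
  rw [pathCobdry_apply, pathCobdry_apply, map_add, dropMark_pre_none]
  linear_combination (norm := abel) this

end Identities

/-! ### The path-ordered whiskering is a chain map -/

theorem whisker_mem_movesSpan (l : ℕ) (v : Word) : pathWhisker l v ∈ movesSpan l l v := by
  intro w hw
  have h := isWhiskering_of_mem l v w hw
  exact ⟨h.dominated, by rw [h.marks_eq]; push_cast; ring,
    fun n hn => by rw [h.total_eq hn]; push_cast; ring⟩

theorem whisker_pre_none {l : ℕ} {x : Word →₀ ℤ} :
    lin (pathWhisker l) (pre none x) = pre none (lin (pathWhisker l) x) :=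
  extend_pathWhisker_none l x

theorem whisker_pre_some {l a : ℕ} {x : Word →₀ ℤ} : lin (pathWhisker (l + 1)) (pre (some a) x) =
    pre (some a) (lin (pathWhisker (l + 1)) x) +
      pre (some a) (pre none (lin (pathWhisker l) (pre (some a) x))) :=
  extend_pathWhisker_some l a x

theorem lin_whisker_zero (x : Word →₀ ℤ) : lin (pathWhisker 0) x = x := extend_pathWhisker_zero x

theorem dropStep_whisker (a l : ℕ) (v : Word) :
    lin (dropStep a) (lin (pathWhisker l) (Finsupp.single v 1)) =
      lin (pathWhisker l) (lin (dropStep a) (Finsupp.single v 1)) := by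
  induction l generalizing v with
  | zero => rw [lin_whisker_zero, lin_whisker_zero]
  | succ l ihl =>
    induction v with
    | nil => simp [lin_single, pathWhisker_succ_nil, dropStep]
    | cons y v ih =>
      rw [← pre_single]
      cases y with
      | none => 
        rw [whisker_pre_none, dropStep_pre_ne (by simp), dropStep_pre_ne (by simp), ih,
          whisker_pre_none]
      | some b =>
        have hl := ihl (some b :: v)
        rw [← pre_single] at hl
        rw [whisker_pre_some, map_add]
        by_cases hb : b = a
        · subst hb
          have h₀ : pre none (lin (pathWhisker l) (pre (some b) (Finsupp.single v 1))) ∈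
              signed b (-1) := pre_mem_signed (by simp)
            (mem_signed (whisker_mem_movesSpan l) (pre_self_mem_signed b _))
          rw [dropStep_pre_mem h₀, add_zero]
          rcases stepSign_cases b v with ⟨-, h, -⟩ | ⟨-, h, -⟩
          · rw [dropStep_pre_mem h, map_zero,
              dropStep_pre_mem (mem_signed (whisker_mem_movesSpan _) h)]
          · rw [dropStep_pre_notMem h, dropStep_pre_notMem (mem_signed (whisker_mem_movesSpan _) h)]
        · have hba : some b ≠ some a := by simpa using hb
          rw [dropStep_pre_ne hba, dropStep_pre_ne hba, dropStep_pre_ne (by simp), hl, ih,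
            dropStep_pre_ne hba, whisker_pre_some]

/-- The sum of all path-ordered whiskerings commutes with the differentials. -/
theorem bdry_whisker (l : ℕ) (v : Word) (hv : marks v = 0) :
    lin pathBdry (lin (pathWhisker (l + 1)) (Finsupp.single v 1)) -
        pathCobdry (lin (pathWhisker l) (Finsupp.single v 1)) =
      lin (pathWhisker (l + 1)) (lin pathBdry (Finsupp.single v 1)) := by
  -- strengthened to all `l`, where the term with `l - 1` is absent for `l = 0`
  have key : ∀ (l : ℕ) (v : Word), marks v = 0 →
      lin pathBdry (lin (pathWhisker l) (Finsupp.single v 1)) -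
        (if l = 0 then 0 else pathCobdry (lin (pathWhisker (l - 1)) (Finsupp.single v 1))) =
      lin (pathWhisker l) (lin pathBdry (Finsupp.single v 1)) := by
    intro l
    induction l with
    | zero => intro v _; rw [lin_whisker_zero, lin_whisker_zero, if_pos rfl, sub_zero]
    | succ l ihl =>
      intro v hv
      simp only [Nat.succ_ne_zero, if_false, Nat.add_sub_cancel]
      induction v with
      | nil =>
        cases l with
        | zero =>
          simp [lin_single, pathWhisker_succ_nil, pathWhisker_zero_nil, pathBdry, pathCobdry_apply,
            pathCobdryTail, pre_single]
        | succ l => simp [lin_single, pathWhisker_succ_nil, pathBdry]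
      | cons y v ih =>
        cases y with
        | none => simp [marks_none] at hv
        | some a =>
          have hv' : marks v = 0 := by simpa [marks_some] using hv
          have ih := ih hv'
          have ihl := ihl (some a :: v) hv
          rw [← pre_single] at ihl ⊢
          set x : Word →₀ ℤ := Finsupp.single v 1 with hx
          have hC : ∀ s, x ∈ signed a s → lin pathCobdryTail (lin (pathWhisker l) (pre (some a) x)) =
              s • pre (some a) (lin pathCobdryTail (lin (pathWhisker l) x)) +
                pre (some a) (pre none (if l = 0 then 0 else
                  pathCobdry (lin (pathWhisker (l - 1)) (pre (some a) x)))) := by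
            intro s h
            cases l with
            | zero =>
              rw [lin_whisker_zero, lin_whisker_zero, cobdryTail_pre_some h, if_pos rfl, map_zero,
                map_zero, add_zero]
            | succ l =>
              have hw := mem_signed (whisker_mem_movesSpan l) (pre_self_mem_signed a x)
              rw [whisker_pre_some, map_add,
                cobdryTail_pre_some (mem_signed (whisker_mem_movesSpan _) h),
                cobdryTail_pre_some (pre_mem_signed (by simp) hw), cobdryTail_pre_none]
              simp [pathCobdry_apply, add_comm]
          generalize (if l = 0 then 0 else
            pathCobdry (lin (pathWhisker (l - 1)) (pre (some a) x)) : Word →₀ ℤ) = K at ihl hC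
          have hw := mem_signed (whisker_mem_movesSpan l) (pre_self_mem_signed a x)
          have hw' : pre none (lin (pathWhisker l) (pre (some a) x)) ∈ signed a (-1) :=
            pre_mem_signed (by simp) hw
          have hd : lin (dropStep a) (lin (pathWhisker l) (pre (some a) x)) =
              lin (pathWhisker l) (lin (dropStep a) (pre (some a) x)) := by
            rw [hx, pre_single, dropStep_whisker]
          rw [whisker_pre_some, map_add, bdry_pre_mem hw', bdry_pre_none, dropStep_pre_ne (by simp), hd,
            pathCobdry_apply]
          have e₂ := congrArg (fun z => pre (some a) (pre none z)) ihl
          have e₁ := congrArg (pre (some a)) ih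
          simp only [map_add, map_sub, pathCobdry_apply] at e₁ e₂
          rcases stepSign_cases a v with ⟨-, h, -⟩ | ⟨-, h, -⟩
          · rw [hC _ h, bdry_pre_mem h, bdry_pre_mem (mem_signed (whisker_mem_movesSpan _) h),
              dropStep_pre_mem h, dropStep_whisker]
            rw [bdry_pre_mem h] at e₂
            simp only [map_sub, map_add, map_neg, map_zero, neg_smul, one_smul,
              whisker_pre_some] at e₁ e₂ ⊢
            linear_combination (norm := abel) e₂ - e₁
          · rw [hC _ h, bdry_pre_notMem h, bdry_pre_notMem (mem_signed (whisker_mem_movesSpan _) h),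
              dropStep_pre_notMem h]
            rw [bdry_pre_notMem h] at e₂
            simp only [map_add, map_neg, one_smul, whisker_pre_some] at e₁ e₂ ⊢
            linear_combination (norm := abel) e₁ + e₂
  have := key (l + 1) v hv
  simpa using this

/-! ### Comparison with the differential of marked lattice paths -/

section Signs

theorem neg_single_neg_one_pow {a b : ℕ} (w : Word) (h : (a : ZMod 2) + 1 = b) :
    -Finsupp.single w ((-1 : ℤ) ^ a) = Finsupp.single w ((-1) ^ b) := by
  rw [← Finsupp.single_neg, ← neg_one_mul ((-1 : ℤ) ^ a), ← pow_succ']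
  congr 1
  exact neg_one_pow_congr (by push_cast; exact h)

theorem stepSign_smul_single {a : ℕ} {v : Word} {b d : ℕ} (w : Word)
    (h : (b : ZMod 2) + (if some a ∈ v then 1 else 0 : ℕ) = d) :
    stepSign a v • Finsupp.single w ((-1 : ℤ) ^ b) = Finsupp.single w ((-1) ^ d) := by
  unfold stepSign
  split_ifs at h ⊢ with h'
  · rw [neg_smul, one_smul, neg_single_neg_one_pow w (by simpa using h)]
  · rw [one_smul]
    congr 1
    exact neg_one_pow_congr (by simpa using h)

theorem odd_insertMark (t : ℕ) (v : Word) : odd (insertMark t v) = odd v + 1 := by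
  induction v generalizing t with
  | nil => rw [insertMark_nil]; rfl
  | cons x v ih =>
    cases t with
    | zero => rfl
    | succ t =>
      cases x with
      | none => rw [insertMark, odd_none, odd_none, ih]
      | some a =>
        rw [insertMark, odd_some, odd_some, ih]
        simp only [mem_insertMark]
        omega

/-- The exponent of the sign of a coface of path-ordered words. -/
def cofaceExp (t : ℕ) (v : Word) : ℕ := twistExp v + twistExp (insertMark t v) + odd v + t

theorem pathCobdryTail_eq (v : Word) : pathCobdryTail v = ∑ t ∈ Finset.range (marks v + 1),
    Finsupp.single (insertMark (t + 1) v) ((-1) ^ cofaceExp (t + 1) v) := by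
  induction v with
  | nil =>
    simp only [marks, List.count_nil, zero_add, Finset.sum_range_one]
    rw [pathCobdryTail, ← Finsupp.single_neg]
    rfl
  | cons x v ih =>
    cases x with
    | none =>
      rw [pathCobdryTail, ih, marks_none, Finset.sum_range_succ' _ (marks v + 1), map_add, map_sum,
        pre_single]
      simp only [pre_single]
      rw [neg_add, add_comm, ← Finset.sum_neg_distrib]
      congr 1
      · refine Finset.sum_congr rfl fun t _ => ?_
        rw [insertMark]
        apply neg_single_neg_one_pow
        simp only [cofaceExp, insertMark, twistExp_none, odd_none, odd_insertMark]
        push_cast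
        linear_combination -(odd v + 1 : ZMod 2) * two_zmod
      · rw [insertMark, insertMark, ← pow_zero (-1 : ℤ)]
        apply neg_single_neg_one_pow
        simp only [cofaceExp, insertMark, twistExp_none, odd_none]
        push_cast
        linear_combination -(twistExp v + 2 * odd v + 1 : ZMod 2) * two_zmod
    | some a =>
      rw [pathCobdryTail, ih, marks_some, map_sum, Finset.smul_sum]
      refine Finset.sum_congr rfl fun t _ => ?_
      rw [pre_single, insertMark]
      apply stepSign_smul_single
      simp only [cofaceExp, insertMark, twistExp_some, odd_some, mem_insertMark, total_insertMark]
      push_cast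
      split_ifs
      · linear_combination -(total a v : ZMod 2) * two_zmod
      · ring

theorem twistLin_pathCobdry (v : Word) :
    twist v • twistLin (pathCobdry (Finsupp.single v 1)) = (-1 : ℤ) ^ odd v • cobdryWord v := by
  have h : pathCobdry (Finsupp.single v 1) = ∑ t ∈ Finset.range (marks v + 2),
      Finsupp.single (insertMark t v) ((-1) ^ cofaceExp t v) := by
    rw [Finset.sum_range_succ', ← pathCobdryTail_eq, pathCobdry_apply, lin_single, pre_single,
      add_comm]
    congr 1
    rw [insertMark, ← pow_zero (-1 : ℤ)]
    congr 1
    apply neg_one_pow_congr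
    simp only [cofaceExp, insertMark, twistExp_none]
    push_cast
    linear_combination -(twistExp v + odd v : ZMod 2) * two_zmod
  rw [h, cobdryWord, map_sum, Finset.smul_sum, Finset.smul_sum]
  refine Finset.sum_congr rfl fun t _ => ?_
  rw [twistLin_single, Finsupp.smul_single, Finsupp.smul_single, coface_eq_insertMark, twist, twist,
    smul_eq_mul, smul_eq_mul, ← pow_add, ← pow_add, ← pow_add]
  congr 1
  apply neg_one_pow_congr
  simp only [cofaceExp]
  push_cast
  linear_combination (twistExp v + twistExp (insertMark t v) : ZMod 2) * two_zmod

end Signs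

section Face

variable (r : ℕ)

theorem count_eraseNth_self (i : ℕ) (x : Option ℕ) (v : Word) (h : i < v.count x) :
    (eraseNth i x v).count x + 1 = v.count x := by
  induction v generalizing i with
  | nil => simp at h
  | cons y v ih =>
    by_cases hy : y = x
    · subst hy
      cases i with
      | zero => simp [eraseNth]
      | succ i => simp [eraseNth, ih i (by simpa using h)]
    · simp [eraseNth, hy, ih i (by simpa [hy] using h)]

theorem count_eraseNth_ne (i : ℕ) {x y : Option ℕ} (hxy : y ≠ x) (v : Word) :
    (eraseNth i x v).count y = v.count y := by
  induction v generalizing i with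
  | nil => rfl
  | cons z v ih =>
    by_cases hz : z = x
    · subst hz
      cases i with
      | zero => simp [eraseNth, hxy.symm]
      | succ i => simp [eraseNth, List.count_cons, ih i]
    · simp [eraseNth, hz, List.count_cons, ih i]

theorem mem_eraseNth_ne (i : ℕ) {x y : Option ℕ} (hxy : y ≠ x) (v : Word) :
    y ∈ eraseNth i x v ↔ y ∈ v := by
  rw [← List.count_pos_iff, count_eraseNth_ne i hxy, List.count_pos_iff]

theorem dim_face {i : ℕ} {v : Word} (h : i < v.count (some r)) (a : ℕ) :
    dim (face r i v) a + (if a = r ∧ 2 ≤ v.count (some r) then 1 else 0) = dim v a := by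
  unfold dim face
  by_cases ha : a = r
  · subst ha
    have := count_eraseNth_self i _ v h
    simp only [true_and]
    split_ifs <;> omega
  · rw [count_eraseNth_ne i (by simpa using ha)]
    simp [ha]

theorem total_face {i : ℕ} {v : Word} (h : i < v.count (some r)) (n : ℕ) :
    total n (face r i v) + (if r < n ∧ 2 ≤ v.count (some r) then 1 else 0) = total n v := by
  unfold total
  simp only [← dim_face r h, Finset.sum_add_distrib, ite_and]
  congr 1
  simp

theorem odd_face {n i : ℕ} {v : Word} (hv : ∀ a, some a ∈ v → a < n) (h : i < v.count (some r)) :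
    odd (face r i v) + (if 2 ≤ v.count (some r) then 1 else 0) = odd v := by
  have hr : r < n := hv r (List.count_pos_iff.1 (by omega))
  have hf : ∀ a, some a ∈ face r i v → a < n := fun a ha => by
    by_cases har : a = r
    · rwa [har]
    · exact hv a ((mem_eraseNth_ne i (by simpa using har) v).1 ha)
  have := total_face r h n
  rw [odd_eq_parity hv, odd_eq_parity hf, parity, parity,
    show marks (face r i v) = marks v from count_eraseNth_ne i (by simp) v]
  simp only [hr, true_and] at this
  omega

theorem face_none (i : ℕ) (v : Word) : face r i (none :: v) = none :: face r i v := by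
  simp [face, eraseNth]

theorem face_ne {a : ℕ} (ha : a ≠ r) (i : ℕ) (v : Word) :
    face r i (some a :: v) = some a :: face r i v := by
  simp [face, eraseNth, ha]

theorem face_zero (v : Word) : face r 0 (some r :: v) = v := by simp [face, eraseNth]

theorem face_succ (i : ℕ) (v : Word) : face r (i + 1) (some r :: v) = some r :: face r i v := by
  simp [face, eraseNth]

theorem twistExp_face_of_count_eq_one {n : ℕ} {v : Word} (hv : ∀ a, some a ∈ v → a < n)
    (h : v.count (some r) = 1) : twistExp (face r 0 v) = twistExp v := by
  induction v with
  | nil => simp at h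
  | cons x v ih =>
    have hv' := fun a ha => hv a (List.mem_cons_of_mem x ha)
    cases x with
    | none =>
      have h' : v.count (some r) = 1 := by simpa using h
      have := odd_face r (i := 0) hv' (by omega)
      rw [h'] at this
      rw [face_none, twistExp_none, twistExp_none, ih hv' h', ← this]
      simp
    | some a =>
      by_cases ha : a = r
      · subst ha
        rw [face_zero, twistExp_some, if_neg, add_zero]
        rw [List.count_cons_self] at h
        exact List.count_eq_zero.1 (by omega)
      · have hne : some a ≠ some r := by simpa using ha
        have h' : v.count (some r) = 1 := by rwa [List.count_cons_of_ne hne] at h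
        have := total_face r (i := 0) (v := v) (by omega) a
        rw [h'] at this
        rw [face_ne r ha, twistExp_some, twistExp_some, ih hv' h', ← this]
        have hm : some a ∈ face r 0 v ↔ some a ∈ v := mem_eraseNth_ne 0 hne v
        simp [hm]

/-- The exponent of the sign of a face of path-ordered words. -/
def faceExp (i : ℕ) (v : Word) : ℕ := twistExp v + twistExp (face r i v) + total r v + i

/-- The part of the simplicial differential of path-ordered words in the direction `r`. -/
def pathBdryDir (v : Word) : Word →₀ ℤ := if dim v r = 0 then 0 else
  ∑ i ∈ Finset.range (dim v r + 1), Finsupp.single (face r i v) ((-1) ^ faceExp r i v)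

theorem pathBdryDir_none {n : ℕ} {v : Word} (hv : ∀ a, some a ∈ v → a < n) :
    pathBdryDir r (none :: v) = -pre none (pathBdryDir r v) := by
  unfold pathBdryDir
  rw [dim_none]
  split_ifs with h
  · simp
  · rw [map_sum, ← Finset.sum_neg_distrib]
    refine Finset.sum_congr rfl fun i hi => ?_
    have hc : 2 ≤ v.count (some r) := by rw [dim] at h; omega
    have := odd_face r (i := i) hv (by rw [Finset.mem_range, dim] at hi; omega)
    rw [if_pos hc] at this
    rw [pre_single, ← face_none]
    symm
    apply neg_single_neg_one_pow
    simp only [faceExp, face_none, twistExp_none, total_none, ← this]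
    push_cast
    linear_combination -(odd (face r i v) : ZMod 2) * two_zmod

theorem pathBdryDir_ne {a : ℕ} (ha : a ≠ r) (v : Word) :
    pathBdryDir r (some a :: v) = stepSign a v • pre (some a) (pathBdryDir r v) := by
  have hne : some a ≠ some r := by simpa using ha
  unfold pathBdryDir
  rw [show dim (some a :: v) r = dim v r by rw [dim, dim, List.count_cons_of_ne hne]]
  split_ifs with h
  · simp
  · rw [map_sum, Finset.smul_sum]
    refine Finset.sum_congr rfl fun i hi => ?_
    have hc : 2 ≤ v.count (some r) := by rw [dim] at h; omega
    have := total_face r (i := i) (v := v) (by rw [Finset.mem_range, dim] at hi; omega) a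
    simp only [hc, and_true] at this
    have hm : some a ∈ face r i v ↔ some a ∈ v := mem_eraseNth_ne i hne v
    rw [pre_single, ← face_ne r ha]
    symm
    apply stepSign_smul_single
    simp only [faceExp, face_ne r ha, twistExp_some, total_cons, hm, ← this]
    by_cases hav : some a ∈ v
    · rcases lt_or_gt_of_ne ha with h' | h'
      · simp only [hav, h', h'.not_gt, if_true, if_false, true_and]
        push_cast
        linear_combination -(total a (face r i v) : ZMod 2) * two_zmod
      · simp only [hav, h', h'.not_gt, if_true, if_false, false_and]
        push_cast
        linear_combination -(total a (face r i v) : ZMod 2) * two_zmod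
    · simp [hav]

theorem pathBdryDir_of_notMem {v : Word} (h : some r ∉ v) : pathBdryDir r v = 0 := by
  rw [pathBdryDir, dim, List.count_eq_zero.2 h]
  rfl

theorem dropStep_eq (v : Word) : dropStep r v =
    if v.count (some r) = 1 then Finsupp.single (face r 0 v) 1 else 0 := by
  induction v with
  | nil => rfl
  | cons x v ih =>
    cases x with
    | none =>
      rw [dropStep, ih, List.count_cons_of_ne (by simp), face_none]
      split_ifs
      · rw [pre_single]
      · rw [map_zero]
    | some a =>
      rw [dropStep]
      by_cases ha : a = r
      · subst ha
        rw [if_pos rfl, List.count_cons_self, face_zero]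
        simp only [Nat.add_eq_right, List.count_eq_zero]
        split_ifs <;> simp_all
      · rw [if_neg ha, ih, List.count_cons_of_ne (by simpa using ha), face_ne r ha]
        split_ifs
        · rw [pre_single]
        · rw [map_zero]

theorem pathBdryDir_self {n : ℕ} {v : Word} (hv : ∀ a, some a ∈ v → a < n) (h : some r ∈ v) :
    pathBdryDir r (some r :: v) =
      Finsupp.single v 1 - pre (some r) (pathBdryDir r v + dropStep r v) := by
  have hd : dim (some r :: v) r = dim v r + 1 := by rw [dim_cons, if_pos ⟨rfl, h⟩]
  have hpos := List.count_pos_iff.2 h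
  rw [pathBdryDir, hd, if_neg (Nat.succ_ne_zero _), Finset.sum_range_succ', face_zero, add_comm,
    sub_eq_add_neg]
  congr 1
  · rw [← pow_zero (-1 : ℤ)]
    congr 1
    apply neg_one_pow_congr
    simp only [faceExp, face_zero, twistExp_some, total_cons, if_pos h]
    simp only [lt_irrefl, false_and, if_false]
    push_cast
    linear_combination (twistExp v + total r v : ZMod 2) * two_zmod
  · rw [dropStep_eq, pathBdryDir]
    by_cases hc : v.count (some r) = 1
    · have hd₀ : dim v r = 0 := by rw [dim, hc]
      have hm : some r ∉ face r 0 v := by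
        have := count_eraseNth_self 0 (some r) v (by omega)
        exact List.count_eq_zero.1 (by unfold face; omega)
      rw [hd₀, if_pos rfl, if_pos hc, zero_add, Finset.sum_range_one, face_succ, zero_add,
        zero_add, pre_single, ← pow_zero (-1 : ℤ)]
      symm
      apply neg_single_neg_one_pow
      simp only [faceExp, face_succ, twistExp_some, total_cons, if_pos h, if_neg hm,
        twistExp_face_of_count_eq_one r hv hc]
      simp only [lt_irrefl, false_and, if_false]
      push_cast
      linear_combination -(twistExp v + total r v : ZMod 2) * two_zmod
    · have hd₀ : dim v r ≠ 0 := by rw [dim]; omega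
      rw [if_neg hd₀, if_neg hc, add_zero, map_sum, ← Finset.sum_neg_distrib]
      refine Finset.sum_congr rfl fun i hi => ?_
      have hi' : i < v.count (some r) := by rw [Finset.mem_range, dim] at hi; omega
      have hm : some r ∈ face r i v := by
        have := count_eraseNth_self i (some r) v hi'
        exact List.count_pos_iff.1 (by unfold face; omega)
      have ht := total_face r hi' r
      simp only [lt_irrefl, false_and, if_false, add_zero] at ht
      rw [face_succ, pre_single]
      symm
      apply neg_single_neg_one_pow
      simp only [faceExp, face_succ, twistExp_some, total_cons, if_pos h, if_pos hm, ht]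
      simp only [lt_irrefl, false_and, if_false]
      push_cast
      linear_combination -(total r v : ZMod 2) * two_zmod

theorem pathBdry_eq {n : ℕ} {v : Word} (hv : ∀ a, some a ∈ v → a < n) :
    pathBdry v = ∑ r ∈ Finset.range n, pathBdryDir r v := by
  induction v with
  | nil => simp [pathBdry, pathBdryDir, dim]
  | cons x v ih =>
    have hv' := fun a ha => hv a (List.mem_cons_of_mem x ha)
    cases x with
    | none =>
      rw [pathBdry, ih hv', map_sum, ← Finset.sum_neg_distrib]
      exact Finset.sum_congr rfl fun r _ => (pathBdryDir_none r hv').symm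
    | some a =>
      have ha : a ∈ Finset.range n := Finset.mem_range.2 (hv a List.mem_cons_self)
      have h₁ : ∀ r ∈ (Finset.range n).erase a, pathBdryDir r (some a :: v) =
          stepSign a v • pre (some a) (pathBdryDir r v) := fun r hr =>
        pathBdryDir_ne r (Finset.mem_erase.1 hr).1.symm v
      rw [pathBdry, ih hv', ← Finset.add_sum_erase _ _ ha, ← Finset.add_sum_erase _ _ ha,
        Finset.sum_congr rfl h₁, ← Finset.smul_sum, ← map_sum]
      split_ifs with h
      · rw [pathBdryDir_self a hv' h, stepSign_of_mem h]
        simp only [map_add, neg_smul, one_smul]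
        abel
      · rw [pathBdryDir_of_notMem a h, stepSign_of_notMem h, pathBdryDir, dim,
          List.count_cons_self, List.count_eq_zero.2 h]
        simp

theorem twistLin_pathBdry {n : ℕ} {v : Word} (hv : ∀ a, some a ∈ v → a < n) :
    twist v • twistLin (pathBdry v) = bdryWord n v := by
  rw [pathBdry_eq hv, bdryWord, map_sum, Finset.smul_sum]
  refine Finset.sum_congr rfl fun r _ => ?_
  rw [pathBdryDir]
  split_ifs
  · simp
  · rw [map_sum, Finset.smul_sum]
    refine Finset.sum_congr rfl fun i _ => ?_
    rw [twistLin_single, Finsupp.smul_single, twist, twist, smul_eq_mul, ← pow_add, ← pow_add]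
    congr 1
    apply neg_one_pow_congr
    simp only [faceExp]
    push_cast
    linear_combination (twistExp v + twistExp (face r i v) : ZMod 2) * two_zmod

end Face

theorem twistLin_twistLin (x : Word →₀ ℤ) : twistLin (twistLin x) = x := by
  rw [← sub_eq_zero]
  refine eq_zero_of_words (L := twistLin ∘ₗ twistLin - LinearMap.id) (fun v => ?_) x
  simp only [LinearMap.sub_apply, LinearMap.comp_apply, LinearMap.id_apply]
  rw [twistLin_single, twistLin_single, one_mul, twist_mul_self, sub_self]

theorem twistLin_extend_bdryWord {n : ℕ} {x : Word →₀ ℤ}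
    (hx : ∀ v ∈ x.support, ∀ a, some a ∈ v → a < n) :
    twistLin (extend (bdryWord n) x) = lin pathBdry (twistLin x) := by
  rw [lin_eq, extend_twistLin, map_extend]
  refine extend_congr fun v hv => ?_
  rw [← twistLin_pathBdry (hx v hv), map_smul, twistLin_twistLin]

theorem twistLin_extend_cobdryWord {n : ℕ} {x : Word →₀ ℤ}
    (hx : ∀ v ∈ x.support, ∀ a, some a ∈ v → a < n) :
    twistLin (extend (fun v => -(-1 : ℤ) ^ parity n v • cobdryWord v) x) =
      -pathCobdry (twistLin x) := by
  have e : pathCobdry (twistLin x) = extend (fun v => twist v • pathCobdry (Finsupp.single v 1)) x := by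
    rw [← extend_twistLin, ← map_extend, extend_id]
  rw [e, map_extend, ← neg_one_smul ℤ (extend _ x), ← extend_smul_fun]
  refine extend_congr fun v hv => ?_
  rw [← odd_eq_parity (hx v hv), neg_smul, ← twistLin_pathCobdry, map_neg, map_smul,
    twistLin_twistLin, neg_one_smul]

section Diff

variable {c : ℕ∞} {n : ℕ} {p : ℤ} {f : Cochain}

theorem twistLin_diff_succ (hf : f ∈ latCochains c n p) (l : ℕ) :
    twistLin (diff n f (l + 1)) =
      lin pathBdry (twistLin (f (l + 1))) - pathCobdry (twistLin (f l)) := by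
  rw [mem_latCochains] at hf
  rw [diff, Pi.add_apply, map_add, bdry, cobdry,
    twistLin_extend_bdryWord fun v hv a ha => ((hf _ v hv).1 a).1 ha,
    twistLin_extend_cobdryWord fun v hv a ha => ((hf _ v hv).1 a).1 ha, sub_eq_add_neg]

theorem twistLin_bdry (hf : f ∈ latCochains c n p) (l : ℕ) :
    twistLin (bdry n f l) = lin pathBdry (twistLin (f l)) := by
  rw [mem_latCochains] at hf
  exact twistLin_extend_bdryWord fun v hv a ha => ((hf _ v hv).1 a).1 ha

theorem diff_zero (n : ℕ) (f : Cochain) : diff n f 0 = bdry n f 0 := add_zero _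

theorem twistLin_injective : Function.Injective twistLin :=
  Function.LeftInverse.injective twistLin_twistLin

theorem twistLin_whisker (hf : f ∈ latCochains c n p) (l : ℕ) :
    twistLin (whisker f l) = lin (pathWhisker l) (twistLin (f 0)) := by
  rw [mem_latCochains] at hf
  rw [whisker_apply, lin_eq, extend_twistLin, map_extend]
  refine extend_congr fun v hv => ?_
  rw [whiskerWord_eq l (hf 0 v hv).2.1, map_smul, twistLin_twistLin]

theorem bdry_mem (hf : f ∈ latCochains c n p) : bdry n f ∈ latCochains c n (p + 1) := by
  have hf' := hf
  simp only [latCochains, Submodule.mem_pi, Set.mem_univ, forall_true_left] at hf' ⊢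
  intro l
  rw [← twistLin_twistLin (bdry n f l), twistLin_bdry hf]
  have := mem_lat_of_moves pathBdry_mem (twistLin_mem (hf' l)) (l' := l) (by simp)
  rw [show p + 0 - -1 = p + 1 by ring] at this
  exact twistLin_mem this

/-- The whiskering is a chain map. -/
theorem whisker_bdry (hf : f ∈ latCochains c n p) : whisker (bdry n f) = diff n (whisker f) := by
  funext l
  apply twistLin_injective
  rw [twistLin_whisker (bdry_mem hf), twistLin_bdry hf]
  have hw := whisker_mem hf
  cases l with
  | zero =>
    rw [diff_zero, twistLin_bdry hw, whisker_zero hf, lin_whisker_zero]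
  | succ l =>
    rw [twistLin_diff_succ hw, twistLin_whisker hf, twistLin_whisker hf]
    have hf' := mem_latCochains.1 hf 0
    have e : ∀ L : (Word →₀ ℤ) →ₗ[ℤ] (Word →₀ ℤ), L (twistLin (f 0)) =
        extend (fun v => twist v • L (Finsupp.single v 1)) (f 0) := fun L => by
      rw [← extend_twistLin, ← map_extend, extend_id]
    have e₁ := e (lin (pathWhisker (l + 1)) ∘ₗ lin pathBdry)
    have e₂ := e (lin pathBdry ∘ₗ lin (pathWhisker (l + 1)) - pathCobdry ∘ₗ lin (pathWhisker l))
    simp only [LinearMap.sub_apply, LinearMap.comp_apply] at e₁ e₂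
    rw [e₁, e₂]
    refine extend_congr fun v hv => ?_
    rw [bdry_whisker l v (hf' v hv).2.1]

end Diff

/-! ### Closed families are boundaries -/

section Homotopy

theorem dropStep_cobdryTail (a : ℕ) (x : Word →₀ ℤ) :
    lin (dropStep a) (lin pathCobdryTail x) = lin pathCobdryTail (lin (dropStep a) x) := by
  rw [← sub_eq_zero]
  refine eq_zero_of_words
    (L := lin (dropStep a) ∘ₗ lin pathCobdryTail - lin pathCobdryTail ∘ₗ lin (dropStep a))
    (fun v => ?_) x
  simp only [LinearMap.sub_apply, LinearMap.comp_apply, sub_eq_zero]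
  induction v with
  | nil => simp [lin_single, pathCobdryTail, dropStep]
  | cons y v ih =>
    rw [← pre_single]
    cases y with
    | none =>
      rw [cobdryTail_pre_none, map_neg, dropStep_pre_ne (by simp), dropStep_pre_ne (by simp),
        map_add, dropStep_pre_ne (by simp), cobdryTail_pre_none, ih]
    | some b =>
      rw [cobdryTail_pre_some (single_mem_signed b v), map_smul]
      by_cases hb : b = a
      · subst hb
        rcases stepSign_cases b v with ⟨-, h, -⟩ | ⟨-, h, h'⟩
        · rw [dropStep_pre_mem h, dropStep_pre_mem (mem_signed pathCobdryTail_mem h), map_zero,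
            smul_zero]
        · rw [dropStep_pre_notMem h, dropStep_pre_notMem (mem_signed pathCobdryTail_mem h), h',
            one_smul]
      · have hba : some b ≠ some a := by simpa using hb
        rw [dropStep_pre_ne hba, dropStep_pre_ne hba,
          cobdryTail_pre_some (dropStep_mem_signed_ne hb (single_mem_signed b v)), ih]

theorem bdry_cobdryTail (x : Word →₀ ℤ) :
    lin pathBdry (lin pathCobdryTail x) + lin pathCobdryTail (lin pathBdry x) = 0 := by
  refine eq_zero_of_words
    (L := lin pathBdry ∘ₗ lin pathCobdryTail + lin pathCobdryTail ∘ₗ lin pathBdry) (fun v => ?_) x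
  simp only [LinearMap.add_apply, LinearMap.comp_apply]
  induction v with
  | nil => simp [lin_single, pathBdry, pathCobdryTail]
  | cons y v ih =>
    rw [← pre_single]
    cases y with
    | none =>
      have e := congrArg (pre none) ih
      simp only [map_add, map_zero] at e
      rw [cobdryTail_pre_none, bdry_pre_none, map_neg, map_neg, cobdryTail_pre_none, bdry_pre_none,
        map_add, bdry_pre_none]
      simp only [map_add, map_neg]
      linear_combination (norm := abel) e
    | some a =>
      have e := congrArg (pre (some a)) ih
      simp only [map_add, map_zero] at e
      rw [cobdryTail_pre_some (single_mem_signed a v), map_smul]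
      rcases stepSign_cases a v with ⟨-, h, h'⟩ | ⟨-, h, h'⟩
      · rw [h', bdry_pre_mem h, bdry_pre_mem (mem_signed pathCobdryTail_mem h), map_sub, map_add,
          map_add, map_add, cobdryTail_pre_some (mem_signed pathBdry_mem h),
          cobdryTail_pre_some (lin_dropStep_mem_signed a _), dropStep_cobdryTail]
        simp only [neg_smul, one_smul]
        linear_combination (norm := abel) e
      · rw [h', bdry_pre_notMem h, bdry_pre_notMem (mem_signed pathCobdryTail_mem h),
          cobdryTail_pre_some (mem_signed pathBdry_mem h), one_smul, one_smul, e]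

theorem cobdryTail_cobdryTail (x : Word →₀ ℤ) :
    lin pathCobdryTail (lin pathCobdryTail x) = 0 := by
  refine eq_zero_of_words (L := lin pathCobdryTail ∘ₗ lin pathCobdryTail) (fun v => ?_) x
  simp only [LinearMap.comp_apply]
  induction v with
  | nil =>
    simp only [lin_single, pathCobdryTail, map_neg]
    simp
  | cons y v ih =>
    rw [← pre_single]
    cases y with
    | none =>
      simp only [cobdryTail_pre_none, map_neg, map_add, ih, map_zero]
      abel
    | some a =>
      have h := single_mem_signed a v
      rw [cobdryTail_pre_some h, map_smul, cobdryTail_pre_some (mem_signed pathCobdryTail_mem h),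
        ih, map_zero, smul_zero, smul_zero]

theorem cobdry_pre_none (x : Word →₀ ℤ) :
    pathCobdry (pre none x) = -pre none (lin pathCobdryTail x) := by
  rw [pathCobdry_apply, cobdryTail_pre_none, map_add]
  abel

theorem bdry_cobdry (x : Word →₀ ℤ) :
    lin pathBdry (pathCobdry x) = -pathCobdry (lin pathBdry x) := by
  have := bdry_cobdryTail x
  rw [pathCobdry_apply, pathCobdry_apply, map_add, bdry_pre_none]
  linear_combination (norm := abel) this

theorem cobdry_cobdry (x : Word →₀ ℤ) : pathCobdry (pathCobdry x) = 0 := by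
  rw [pathCobdry_apply x, map_add, cobdry_pre_none, pathCobdry_apply, cobdryTail_cobdryTail,
    add_zero, neg_add_cancel]

/-- The linear combinations of words with `l` marks. -/
def withMarks (l : ℕ) : Submodule ℤ (Word →₀ ℤ) := Finsupp.supported ℤ ℤ {v | marks v = l}

theorem bdry_homotopy {l : ℕ} {x : Word →₀ ℤ} (hx : x ∈ withMarks (l + 1)) :
    lin pathBdry (lin pathHomotopy x) + lin pathHomotopy (lin pathBdry x) =
      x - pre none (lin dropMark x) := by
  have e : ∀ L : (Word →₀ ℤ) →ₗ[ℤ] (Word →₀ ℤ), L x = extend (fun v => L (Finsupp.single v 1)) x :=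
    fun L => by rw [← map_extend, extend_id]
  have e₁ := e (lin pathBdry ∘ₗ lin pathHomotopy + lin pathHomotopy ∘ₗ lin pathBdry)
  have e₂ := e (LinearMap.id - pre none ∘ₗ lin dropMark)
  simp only [LinearMap.sub_apply, LinearMap.add_apply, LinearMap.comp_apply,
    LinearMap.id_apply] at e₁ e₂
  rw [e₁, e₂]
  refine extend_congr fun v hv => bdry_homotopy_of_marked ?_
  have h : marks v = l + 1 := hx hv
  omega

/-- The obstruction for `pathHomotopy` to be a homotopy for the total differential. -/
def defect : (Word →₀ ℤ) →ₗ[ℤ] (Word →₀ ℤ) :=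
  pathCobdry ∘ₗ lin pathHomotopy + lin pathHomotopy ∘ₗ pathCobdry

theorem defect_apply (x : Word →₀ ℤ) :
    defect x = pathCobdry (lin pathHomotopy x) + lin pathHomotopy (pathCobdry x) := rfl

theorem mem_withMarks {φ : Word → (Word →₀ ℤ)} {k e : ℤ} (hφ : ∀ v, φ v ∈ movesSpan k e v)
    {l l' : ℕ} (hl : (l' : ℤ) = l + k) {x : Word →₀ ℤ} (hx : x ∈ withMarks l) :
    lin φ x ∈ withMarks l' :=
  extend_mem fun v hv _ hw => by
    have h₁ := (hφ v hw).marks_eq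
    have h₂ : marks v = l := hx hv
    change marks _ = l'
    omega

theorem cobdry_mem_withMarks {l : ℕ} {x : Word →₀ ℤ} (hx : x ∈ withMarks l) :
    pathCobdry x ∈ withMarks (l + 1) := by
  refine add_mem (fun w hw => ?_) (mem_withMarks pathCobdryTail_mem (by simp) hx)
  obtain ⟨v, hv, rfl⟩ := mem_support_pre hw
  have h : marks v = l := hx hv
  simp [marks_none, h]

theorem bdry_defect {l : ℕ} {x : Word →₀ ℤ} (hx : x ∈ withMarks (l + 1)) :
    lin pathBdry (defect x) = defect (lin pathBdry x) := by
  have e₁ := congrArg pathCobdry (bdry_homotopy hx)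
  have e₂ := bdry_homotopy (cobdry_mem_withMarks hx)
  have e₃ := congrArg (pre none) (cobdry_dropMark x)
  rw [defect_apply, defect_apply, map_add, bdry_cobdry]
  have e₄ := congrArg (lin pathHomotopy) (bdry_cobdry x)
  simp only [map_add, map_sub, map_neg, cobdry_pre_none, pathCobdry_apply (lin dropMark x)]
    at e₁ e₂ e₃ e₄
  linear_combination (norm := abel) e₂ - e₁ - e₃ - e₄

theorem cobdry_defect (x : Word →₀ ℤ) : pathCobdry (defect x) = defect (pathCobdry x) := by
  rw [defect_apply, defect_apply, map_add, cobdry_cobdry, cobdry_cobdry, map_zero, zero_add,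
    add_zero]

/-- The solution `S` of the equation `S = y + N S`, where `N` is the obstruction. -/
def neumann (y : ℕ → (Word →₀ ℤ)) : ℕ → (Word →₀ ℤ)
  | 0 => 0
  | l + 1 => y (l + 1) + defect (neumann y l)

/-- A family of path-ordered cochains that begins with one mark, and that is closed up to `W`, is a
boundary up to `W`. Here `V p l` are the admissible components of degree `p` with `l` marks, and `W`
consists of negligible elements. -/
theorem exists_boundary_of_closed (V : ℤ → ℕ → Submodule ℤ (Word →₀ ℤ))
    (W : Submodule ℤ (Word →₀ ℤ)) (hVm : ∀ p l, V p l ≤ withMarks l)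
    (hVr : ∀ p l x, x ∈ V p (l + 1) → lin dropMark x ∈ V (p - 1) l)
    (hVh : ∀ p l x, x ∈ V p l → lin pathHomotopy x ∈ V (p - 1) l)
    (hVi : ∀ p l x, x ∈ V p l → pathCobdry x ∈ V (p + 1) (l + 1))
    (hWr : ∀ x ∈ W, lin dropMark x ∈ W) (hWh : ∀ x ∈ W, lin pathHomotopy x ∈ W)
    (hWi : ∀ x ∈ W, pathCobdry x ∈ W) {p : ℤ} (y : ℕ → (Word →₀ ℤ)) (hy : ∀ l, y l ∈ V (p + 1) l)
    (hy₀ : y 0 = 0) (hd : ∀ l, lin pathBdry (y (l + 1)) - pathCobdry (y l) ∈ W) :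
    ∃ z : ℕ → (Word →₀ ℤ), (∀ l, z l ∈ V p l) ∧ lin pathBdry (z 0) ∈ W ∧
      ∀ l, lin pathBdry (z (l + 1)) - pathCobdry (z l) - y (l + 1) ∈ W := by
  have hS : ∀ l, neumann y l ∈ V (p + 1) l := by
    intro l
    induction l with
    | zero => exact zero_mem _
    | succ l ih =>
      refine add_mem (hy _) (add_mem ?_ ?_)
      · have := hVi _ _ _ (hVh _ _ _ ih)
        rwa [sub_add_cancel] at this
      · have := hVh _ _ _ (hVi _ _ _ ih)
        rwa [add_sub_cancel_right] at this
  have hWN : ∀ x ∈ W, defect x ∈ W := fun x hx =>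
    add_mem (hWi _ (hWh _ hx)) (hWh _ (hWi _ hx))
  -- the differential of `S` is negligible, since it satisfies the same kind of equation
  have hE : ∀ l, lin pathBdry (neumann y (l + 1)) - pathCobdry (neumann y l) ∈ W := by
    intro l
    induction l with
    | zero =>
      have := hd 0
      rw [hy₀, map_zero, sub_zero] at this
      simpa [neumann] using this
    | succ l ih =>
      have h₁ := bdry_defect (hVm _ _ (hS (l + 1)))
      have h₂ := cobdry_defect (neumann y l)
      have h₃ : lin pathBdry (neumann y (l + 1 + 1)) - pathCobdry (neumann y (l + 1)) =
          (lin pathBdry (y (l + 1 + 1)) - pathCobdry (y (l + 1))) +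
            defect (lin pathBdry (neumann y (l + 1)) - pathCobdry (neumann y l)) := by
        have h₄ : neumann y (l + 1 + 1) = y (l + 1 + 1) + defect (neumann y (l + 1)) := rfl
        have h₅ : pathCobdry (neumann y (l + 1)) =
            pathCobdry (y (l + 1)) + pathCobdry (defect (neumann y l)) := map_add _ _ _
        rw [h₄, h₅, map_add, h₁, h₂, map_sub]
        abel
      rw [h₃]
      exact add_mem (hd _) (hWN _ ih)
  -- `pathHomotopy - dropMark` is a homotopy for the total differential up to the obstruction
  refine ⟨fun l => lin pathHomotopy (neumann y l) - lin dropMark (neumann y (l + 1)), fun l => ?_,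
    ?_, fun l => ?_⟩
  · have h₁ := hVh _ _ _ (hS l)
    have h₂ := hVr _ _ _ (hS (l + 1))
    rw [add_sub_cancel_right] at h₁ h₂
    exact sub_mem h₁ h₂
  · have h₁ := bdry_dropMark (neumann y (0 + 1))
    have h₂ := hWr _ (hE 0)
    have h₃ : neumann y 0 = 0 := rfl
    rw [h₃, map_zero, sub_zero] at h₂
    simp only [h₃, map_zero, zero_sub, map_neg]
    rwa [← eq_neg_iff_add_eq_zero.2 (by rwa [add_comm] at h₁)]
  · have h₁ := bdry_homotopy (hVm _ _ (hS (l + 1)))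
    have h₂ := bdry_dropMark (neumann y (l + 1 + 1))
    have h₃ := cobdry_dropMark (neumann y (l + 1))
    have h₄ : neumann y (l + 1) =
        y (l + 1) + (pathCobdry (lin pathHomotopy (neumann y l)) +
          lin pathHomotopy (pathCobdry (neumann y l))) := rfl
    have h₅ := sub_mem (hWr _ (hE (l + 1))) (hWh _ (hE l))
    convert h₅ using 1
    simp only [map_sub]
    linear_combination (norm := abel) h₁ - h₂ + h₃ + h₄

end Homotopy

/-! ### Degenerate paths -/

/-- A path is degenerate if it has two consecutive steps in the same direction. -/
inductive IsDegenerate : Word → Prop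
  | pair (a : ℕ) (w : Word) : IsDegenerate (some a :: some a :: w)
  | cons (x : Option ℕ) {w : Word} : IsDegenerate w → IsDegenerate (x :: w)

theorem isDegenerate_doubleNth (r : ℕ) : ∀ (i : ℕ) (u : Word), i < u.count (some r) →
    IsDegenerate (doubleNth i (some r) u)
  | _, [], h => by simp at h
  | i, y :: u, h => by
    by_cases hy : y = some r
    · subst hy
      cases i with
      | zero => simpa [doubleNth] using IsDegenerate.pair r u
      | succ i =>
        simp only [doubleNth, if_true]
        exact .cons _ (isDegenerate_doubleNth r i u (by simpa using h))
    · simp only [doubleNth, if_neg hy]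
      exact .cons _ (isDegenerate_doubleNth r i u (by
        rwa [List.count_cons_of_ne hy] at h))

theorem mem_degenerateWords {v : Word} : v ∈ degenerateWords ↔ IsDegenerate v := by
  constructor
  · rintro ⟨u, r, i, hi, rfl⟩
    exact isDegenerate_doubleNth r i u hi
  · intro h
    induction h with
    | pair a w => exact ⟨some a :: w, a, 0, by simp, by simp [degeneracy, doubleNth]⟩
    | @cons x w _ ih =>
      obtain ⟨u, r, i, hi, rfl⟩ := ih
      by_cases hx : x = some r
      · subst hx
        exact ⟨some r :: u, r, i + 1, by simpa using hi, by simp [degeneracy, doubleNth]⟩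
      · refine ⟨x :: u, r, i, ?_, by simp [degeneracy, doubleNth, hx]⟩
        rwa [List.count_cons_of_ne hx]

/-- The linear combinations of degenerate paths. -/
def degSpan : Submodule ℤ (Word →₀ ℤ) := Finsupp.supported ℤ ℤ degenerateWords

theorem mem_degSpan {x : Word →₀ ℤ} : x ∈ degSpan ↔ ∀ v ∈ x.support, IsDegenerate v :=
  forall₂_congr fun _ _ => mem_degenerateWords

theorem single_mem_degSpan {v : Word} (h : IsDegenerate v) (a : ℤ) :
    Finsupp.single v a ∈ degSpan :=
  Finsupp.single_mem_supported ℤ a (mem_degenerateWords.2 h)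

theorem mem_degenerate {f : Cochain} : f ∈ degenerate ↔ ∀ l, f l ∈ degSpan := by
  simp [degenerate, degSpan, Submodule.mem_pi]

theorem lin_mem_degSpan {φ : Word → (Word →₀ ℤ)} (hφ : ∀ v, IsDegenerate v → φ v ∈ degSpan)
    {x : Word →₀ ℤ} (hx : x ∈ degSpan) : lin φ x ∈ degSpan :=
  extend_mem fun v hv => hφ v (mem_degSpan.1 hx v hv)

theorem pre_mem_degSpan (y : Option ℕ) {x : Word →₀ ℤ} (hx : x ∈ degSpan) : pre y x ∈ degSpan :=
  mem_degSpan.2 fun w hw => by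
    obtain ⟨v, hv, rfl⟩ := mem_support_pre hw
    exact .cons _ (mem_degSpan.1 hx v hv)

theorem pre_pre_mem_degSpan (a : ℕ) (x : Word →₀ ℤ) :
    pre (some a) (pre (some a) x) ∈ degSpan :=
  mem_degSpan.2 fun w hw => by
    obtain ⟨v, hv, rfl⟩ := mem_support_pre hw
    obtain ⟨v, -, rfl⟩ := mem_support_pre hv
    exact .pair a v

theorem twistLin_mem_degSpan {x : Word →₀ ℤ} : twistLin x ∈ degSpan ↔ x ∈ degSpan :=
  ⟨fun h => by
    have := twistLin_mem h
    rwa [twistLin_twistLin] at this, fun h => twistLin_mem h⟩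

section Stability

theorem dropStep_mem_degSpan (b : ℕ) {v : Word} (h : IsDegenerate v) : dropStep b v ∈ degSpan := by
  induction h with
  | pair a w =>
    by_cases hb : a = b
    · subst hb
      simp [dropStep]
    · simpa [dropStep, hb] using pre_pre_mem_degSpan a _
  | @cons x w h ih =>
    cases x with
    | none => exact pre_mem_degSpan _ ih
    | some a =>
      rw [dropStep]
      split_ifs
      · exact zero_mem _
      · exact single_mem_degSpan h 1
      · exact pre_mem_degSpan _ ih

theorem pathBdry_mem_degSpan {v : Word} (h : IsDegenerate v) : pathBdry v ∈ degSpan := by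
  induction h with
  | pair a w =>
    rw [pathBdry, if_pos List.mem_cons_self, pathBdry, dropStep, if_pos rfl]
    by_cases ha : some a ∈ w
    · rw [if_pos ha, if_pos ha, add_zero, map_sub, pre_single, sub_sub_cancel]
      exact pre_pre_mem_degSpan _ _
    · rw [if_neg ha, if_neg ha, map_add, pre_single, ← sub_sub, sub_right_comm, sub_self, zero_sub]
      exact neg_mem (pre_pre_mem_degSpan _ _)
  | @cons x w h ih =>
    cases x with
    | none => exact neg_mem (pre_mem_degSpan _ ih)
    | some a =>
      rw [pathBdry]
      split_ifs
      · exact sub_mem (single_mem_degSpan h 1)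
          (pre_mem_degSpan _ (add_mem ih (dropStep_mem_degSpan a h)))
      · exact pre_mem_degSpan _ ih

theorem pathCobdryTail_mem_degSpan {v : Word} (h : IsDegenerate v) :
    pathCobdryTail v ∈ degSpan := by
  induction h with
  | pair a w =>
    rw [pathCobdryTail, pathCobdryTail, map_smul]
    exact Submodule.smul_mem _ _ (Submodule.smul_mem _ _ (pre_pre_mem_degSpan _ _))
  | @cons x w h ih =>
    cases x with
    | none =>
      exact neg_mem (pre_mem_degSpan _ (add_mem (single_mem_degSpan (.cons _ h) 1) ih))
    | some a => exact Submodule.smul_mem _ _ (pre_mem_degSpan _ ih)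

theorem pathCobdry_mem_degSpan {x : Word →₀ ℤ} (hx : x ∈ degSpan) : pathCobdry x ∈ degSpan :=
  add_mem (pre_mem_degSpan _ hx) (lin_mem_degSpan (fun _ => pathCobdryTail_mem_degSpan) hx)

theorem dropMark_mem_degSpan {v : Word} (h : IsDegenerate v) : dropMark v ∈ degSpan := by
  induction h with
  | pair a w =>
    rw [dropMark, dropMark, map_smul]
    exact Submodule.smul_mem _ _ (Submodule.smul_mem _ _ (pre_pre_mem_degSpan _ _))
  | @cons x w h ih =>
    cases x with
    | none => exact single_mem_degSpan h 1
    | some a => exact Submodule.smul_mem _ _ (pre_mem_degSpan _ ih)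

theorem pathHomotopy_mem_degSpan {v : Word} (h : IsDegenerate v) : pathHomotopy v ∈ degSpan := by
  induction h with
  | pair a w =>
    rw [pathHomotopy]
    refine sub_mem (Submodule.smul_mem _ _ ?_)
      (pre_mem_degSpan _ (pre_mem_degSpan _ (dropMark_mem_degSpan (.pair a w))))
    rw [pathHomotopy, ← map_smul, ← map_sub]
    exact pre_pre_mem_degSpan _ _
  | @cons x w h ih =>
    cases x with
    | none => exact zero_mem _
    | some a =>
      exact sub_mem (Submodule.smul_mem _ _ (pre_mem_degSpan _ ih))
        (pre_mem_degSpan _ (pre_mem_degSpan _ (dropMark_mem_degSpan (.cons _ h))))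

theorem pre_pathWhisker_mem_degSpan (a l : ℕ) (v : Word) :
    pre (some a) (pathWhisker l (some a :: v)) ∈ degSpan := by
  cases l with
  | zero =>
    rw [pathWhisker_zero_some]
    exact pre_pre_mem_degSpan _ _
  | succ l =>
    rw [pathWhisker_succ_some, ← map_add]
    exact pre_pre_mem_degSpan _ _

theorem pathWhisker_mem_degSpan (l : ℕ) {v : Word} (h : IsDegenerate v) :
    pathWhisker l v ∈ degSpan := by
  induction l generalizing v with
  | zero =>
    rw [pathWhisker_zero]
    exact single_mem_degSpan h 1
  | succ l ihl =>
    induction h with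
    | pair a w =>
      rw [pathWhisker_succ_some]
      exact add_mem (pre_pathWhisker_mem_degSpan a _ w)
        (pre_mem_degSpan _ (pre_mem_degSpan _ (ihl (.pair a w))))
    | @cons x w h ih =>
      cases x with
      | none =>
        rw [pathWhisker_none]
        exact pre_mem_degSpan _ ih
      | some a =>
        rw [pathWhisker_succ_some]
        exact add_mem (pre_mem_degSpan _ ih)
          (pre_mem_degSpan _ (pre_mem_degSpan _ (ihl (.cons _ h))))

theorem IsDegenerate.permWord {n : ℕ} (σ : Equiv.Perm (Fin n)) {v : Word} (h : IsDegenerate v) :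
    IsDegenerate (permWord σ v) := by
  rw [permWord_eq]
  induction h with
  | pair a w => exact .pair _ _
  | cons x _ ih => exact .cons _ ih

theorem IsDegenerate.insertMark (t : ℕ) {v : Word} (h : IsDegenerate v) :
    IsDegenerate (insertMark t v) := by
  induction h generalizing t with
  | pair a w =>
    cases t with
    | zero => exact .cons _ (.pair a w)
    | succ t => exact .pair a _
  | @cons x w h ih =>
    cases t with
    | zero => exact .cons _ (.cons _ h)
    | succ t =>
      cases x with
      | none => exact .cons _ (ih t)
      | some a => exact .cons _ (ih (t + 1))

end Stability

/-! ### Codegeneracies -/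

section Codegeneracy

theorem codegeneracy_zero_none (v : Word) : codegeneracy 0 (none :: v) = v := by
  simp [codegeneracy, eraseNth]

theorem codegeneracy_succ_none (i : ℕ) (v : Word) :
    codegeneracy (i + 1) (none :: v) = none :: codegeneracy i v := by
  simp [codegeneracy, eraseNth]

theorem codegeneracy_some (i a : ℕ) (v : Word) :
    codegeneracy i (some a :: v) = some a :: codegeneracy i v := by
  simp [codegeneracy, eraseNth]

theorem marks_codegeneracy {i : ℕ} {v : Word} (h : i < marks v) :
    marks (codegeneracy i v) + 1 = marks v :=
  count_eraseNth_self i none v h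

theorem mem_codegeneracy (i a : ℕ) (v : Word) : some a ∈ codegeneracy i v ↔ some a ∈ v :=
  mem_eraseNth_ne i (by simp) v

theorem count_codegeneracy (i a : ℕ) (v : Word) :
    (codegeneracy i v).count (some a) = v.count (some a) :=
  count_eraseNth_ne i (by simp) v

theorem dim_codegeneracy (i a : ℕ) (v : Word) : dim (codegeneracy i v) a = dim v a := by
  rw [dim, dim, count_codegeneracy]

theorem total_codegeneracy (i n : ℕ) (v : Word) : total n (codegeneracy i v) = total n v :=
  Finset.sum_congr rfl fun a _ => dim_codegeneracy i a v

theorem codegeneracy_insertMark_self {j : ℕ} {v : Word} (h : j ≤ marks v) :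
    codegeneracy j (insertMark j v) = v := by
  induction v generalizing j with
  | nil =>
    obtain rfl : j = 0 := by simpa [marks] using h
    exact codegeneracy_zero_none _
  | cons x v ih =>
    cases j with
    | zero => exact codegeneracy_zero_none _
    | succ j =>
      cases x with
      | none =>
        rw [marks_none] at h
        rw [insertMark, codegeneracy_succ_none, ih (by omega)]
      | some a =>
        rw [marks_some] at h
        rw [insertMark, codegeneracy_some, ih h]

theorem codegeneracy_insertMark_succ {j : ℕ} {v : Word} (h : j ≤ marks v) :
    codegeneracy j (insertMark (j + 1) v) = v := by
  induction v generalizing j with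
  | nil =>
    obtain rfl : j = 0 := by simpa [marks] using h
    exact codegeneracy_zero_none _
  | cons x v ih =>
    cases x with
    | none =>
      rw [marks_none] at h
      cases j with
      | zero => rw [insertMark, codegeneracy_zero_none, insertMark]
      | succ j => rw [insertMark, codegeneracy_succ_none, ih (by omega)]
    | some a =>
      rw [marks_some] at h
      rw [insertMark, codegeneracy_some, ih h]

theorem codegeneracy_insertMark_of_le {j t : ℕ} (ht : t ≤ j) {v : Word} (h : j < marks v) :
    codegeneracy (j + 1) (insertMark t v) = insertMark t (codegeneracy j v) := by
  induction v generalizing j t with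
  | nil => simp [marks] at h
  | cons x v ih =>
    cases t with
    | zero => rw [insertMark, insertMark, codegeneracy_succ_none]
    | succ t =>
      cases x with
      | none =>
        rw [marks_none] at h
        obtain ⟨j, rfl⟩ := Nat.exists_eq_add_of_le' (Nat.one_le_of_lt ht)
        rw [insertMark, codegeneracy_succ_none, ih (by omega) (by omega), codegeneracy_succ_none,
          insertMark]
      | some a =>
        rw [marks_some] at h
        rw [insertMark, codegeneracy_some, ih ht h, codegeneracy_some, insertMark]

theorem codegeneracy_insertMark_of_lt {j t : ℕ} (ht : j < t) {v : Word} (h : j < marks v) :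
    codegeneracy j (insertMark (t + 1) v) = insertMark t (codegeneracy j v) := by
  induction v generalizing j t with
  | nil => simp [marks] at h
  | cons x v ih =>
    obtain ⟨t, rfl⟩ := Nat.exists_eq_add_of_le' (Nat.one_le_of_lt ht)
    cases x with
    | none =>
      rw [marks_none] at h
      cases j with
      | zero => rw [insertMark, codegeneracy_zero_none, codegeneracy_zero_none]
      | succ j =>
        rw [insertMark, codegeneracy_succ_none, ih (by omega) (by omega), codegeneracy_succ_none,
          insertMark]
    | some a =>
      rw [marks_some] at h
      rw [insertMark, codegeneracy_some, ih ht h, codegeneracy_some, insertMark]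

theorem codegeneracy_subst (m i j : ℕ) (v u : Word) :
    codegeneracy j (subst m i v u) = subst m i (codegeneracy j v) u := by
  refine subst_induction i (P := fun v u => ∀ j, codegeneracy j (subst m i v u) =
    subst m i (codegeneracy j v) u) ?_ ?_ ?_ ?_ ?_ ?_ v u j
  · intro u j
    rw [subst_nil, show codegeneracy j [] = [] by simp [codegeneracy, eraseNth], subst_nil]
  · intro v u ih j
    cases j with
    | zero => rw [subst_none, codegeneracy_zero_none, codegeneracy_zero_none]
    | succ j => rw [subst_none, codegeneracy_succ_none, codegeneracy_succ_none, subst_none, ih]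
  · intro a v u ha ih j
    rw [subst_some_ne _ _ ha, codegeneracy_some, codegeneracy_some, subst_some_ne _ _ ha, ih]
  · intro v ih j
    rw [subst_some_nil, codegeneracy_some, subst_some_nil, ih]
  · intro v u ih j
    rw [subst_some_none, codegeneracy_some, subst_some_none, ih]
  · intro b v u ih j
    rw [subst_some_some, codegeneracy_some, ih, codegeneracy_some, subst_some_some]

theorem codegeneracy_permWord {n : ℕ} (σ : Equiv.Perm (Fin n)) (j : ℕ) (v : Word) :
    codegeneracy j (permWord σ v) = permWord σ (codegeneracy j v) := by
  simp only [permWord_eq]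
  induction v generalizing j with
  | nil => simp [codegeneracy, eraseNth]
  | cons x v ih =>
    cases x with
    | none =>
      cases j with
      | zero => simp only [List.map_cons, Option.map_none, codegeneracy_zero_none]
      | succ j => simp only [List.map_cons, Option.map_none, codegeneracy_succ_none, ih]
    | some a => simp only [List.map_cons, Option.map_some, codegeneracy_some, ih]

/-- The linear extension of a codegeneracy. -/
def codegLin (j : ℕ) : (Word →₀ ℤ) →ₗ[ℤ] (Word →₀ ℤ) :=
  lin fun v => Finsupp.single (codegeneracy j v) 1

theorem codegLin_single (j : ℕ) (v : Word) (a : ℤ) :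
    codegLin j (Finsupp.single v a) = Finsupp.single (codegeneracy j v) a := by
  rw [codegLin, lin_eq, extend_single, Finsupp.smul_single, smul_eq_mul, mul_one]

theorem codegLin_extend (j : ℕ) (φ : Word → (Word →₀ ℤ)) (x : Word →₀ ℤ) :
    codegLin j (extend φ x) = extend (fun v => codegLin j (φ v)) x :=
  map_extend _ _ _

theorem extend_codegLin (j : ℕ) (φ : Word → (Word →₀ ℤ)) (x : Word →₀ ℤ) :
    extend φ (codegLin j x) = extend (fun v => φ (codegeneracy j v)) x := by
  rw [codegLin, lin_eq, extend_extend]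
  simp only [extend_single, one_smul]

theorem mem_conormal {f : Cochain} :
    f ∈ conormal ↔ ∀ l, ∀ i ≤ l, codegLin i (f (l + 1)) ∈ degSpan := by
  have h : ∀ i (x : Word →₀ ℤ), Finsupp.mapDomain (codegeneracy i) x = codegLin i x := fun i x => by
    rw [codegLin, lin_eq, extend, Finsupp.mapDomain]
    simp only [Finsupp.smul_single, smul_eq_mul, mul_one]
  simp [conormal, degSpan, Submodule.mem_iInf, h]

/-- The alternating sum of the cofaces of conormal elements is conormal. -/
theorem codegLin_cobdryWord {l j : ℕ} (hj : j ≤ l) {x : Word →₀ ℤ} (hx : x ∈ withMarks l)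
    (hc : ∀ i < l, codegLin i x ∈ degSpan) : codegLin j (extend cobdryWord x) ∈ degSpan := by
  have h₀ : codegLin j (extend cobdryWord x) = ∑ t ∈ Finset.range (l + 2), (-1 : ℤ) ^ t •
      extend (fun v => Finsupp.single (codegeneracy j (insertMark t v)) 1) x := by
    rw [codegLin_extend]
    simp only [← extend_smul_fun]
    rw [← extend_sum_fun]
    refine extend_congr fun v hv => ?_
    have h : marks v = l := hx hv
    simp only [cobdryWord, map_sum, codegLin_single, coface_eq_insertMark, h, Finsupp.smul_single,
      smul_eq_mul, mul_one]
  have h₁ : ∀ t, t = j ∨ t = j + 1 →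
      extend (fun v => Finsupp.single (codegeneracy j (insertMark t v)) 1) x = x := fun t ht => by
    conv_rhs => rw [← extend_id x]
    refine extend_congr fun v hv => ?_
    have h : marks v = l := hx hv
    rcases ht with rfl | rfl
    · rw [codegeneracy_insertMark_self (by omega)]
    · rw [codegeneracy_insertMark_succ (by omega)]
  have hins : ∀ t i, i < l →
      extend (fun v => Finsupp.single (insertMark t (codegeneracy i v)) 1) x ∈ degSpan :=
    fun t i hi => by
      rw [← extend_codegLin i fun v => Finsupp.single (insertMark t v) 1, ← lin_eq]
      exact lin_mem_degSpan (fun v hv => single_mem_degSpan (hv.insertMark t) 1) (hc i hi)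
  -- the cofaces `j` and `j + 1` cancel, the other ones commute with a codegeneracy
  rw [h₀, ← Finset.add_sum_erase _ _ (Finset.mem_range.2 (by omega : j < l + 2)),
    ← Finset.add_sum_erase _ _ (Finset.mem_erase.2 ⟨(by omega : j + 1 ≠ j),
      Finset.mem_range.2 (by omega : j + 1 < l + 2)⟩), h₁ j (Or.inl rfl), h₁ (j + 1) (Or.inr rfl),
    pow_succ, mul_neg_one, neg_smul, add_neg_cancel_left]
  refine sum_mem fun t ht => Submodule.smul_mem _ _ ?_
  simp only [Finset.mem_erase, Finset.mem_range] at ht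
  rcases Nat.lt_or_gt_of_ne ht.2.1 with h | h
  · obtain ⟨i, rfl⟩ : ∃ i, j = i + 1 := ⟨j - 1, by omega⟩
    convert hins t i (by omega) using 1
    refine extend_congr fun v hv => ?_
    have hm : marks v = l := hx hv
    rw [codegeneracy_insertMark_of_le (by omega) (by omega)]
  · obtain ⟨s, rfl⟩ : ∃ s, t = s + 1 := ⟨t - 1, by omega⟩
    convert hins s j (by omega) using 1
    refine extend_congr fun v hv => ?_
    have hm : marks v = l := hx hv
    rw [codegeneracy_insertMark_of_lt (by omega) (by omega)]

theorem eraseNth_comm {x y : Option ℕ} (hxy : x ≠ y) (v : Word) : ∀ i j : ℕ,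
    eraseNth i x (eraseNth j y v) = eraseNth j y (eraseNth i x v) := by
  induction v with
  | nil => simp [eraseNth]
  | cons z v ih =>
    intro i j
    by_cases h₁ : z = x
    · subst h₁
      cases i <;> simp [eraseNth, hxy, ih]
    · by_cases h₂ : z = y
      · subst h₂
        cases j <;> simp [eraseNth, h₁, ih]
      · simp [eraseNth, h₁, h₂, ih]

theorem codegLin_bdryWord (n j : ℕ) (v : Word) :
    codegLin j (bdryWord n v) = bdryWord n (codegeneracy j v) := by
  rw [bdryWord, bdryWord, map_sum]
  refine Finset.sum_congr rfl fun r _ => ?_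
  rw [apply_ite (codegLin j), map_zero, map_sum, dim_codegeneracy, total_codegeneracy]
  refine if_congr Iff.rfl rfl (Finset.sum_congr rfl fun i _ => ?_)
  rw [codegLin_single, face, face, codegeneracy, codegeneracy, eraseNth_comm (by simp)]

end Codegeneracy

/-! ### Codegeneracies of path-ordered words -/

section PathCodegeneracy

/-- The codegeneracies of path-ordered words. -/
def pathCodeg : ℕ → Word → (Word →₀ ℤ)
  | _, [] => 0
  | 0, none :: v => Finsupp.single v 1
  | i + 1, none :: v => -pre none (pathCodeg i v)
  | i, some a :: v => stepSign a v • pre (some a) (pathCodeg i v)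

theorem pathCodeg_zero_none (v : Word) : pathCodeg 0 (none :: v) = Finsupp.single v 1 := by
  rw [pathCodeg]

theorem pathCodeg_succ_none (i : ℕ) (v : Word) :
    pathCodeg (i + 1) (none :: v) = -pre none (pathCodeg i v) := by
  rw [pathCodeg]

theorem pathCodeg_some (i a : ℕ) (v : Word) :
    pathCodeg i (some a :: v) = stepSign a v • pre (some a) (pathCodeg i v) := by
  cases i <;> rw [pathCodeg]

theorem pathCodeg_zero : pathCodeg 0 = dropMark := by
  funext v
  induction v with
  | nil => rw [pathCodeg, dropMark]
  | cons x v ih =>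
    cases x with
    | none => rw [pathCodeg_zero_none, dropMark]
    | some a => rw [pathCodeg_some, dropMark, ih]

theorem codeg_pre_none (i : ℕ) (x : Word →₀ ℤ) :
    lin (pathCodeg (i + 1)) (pre none x) = -pre none (lin (pathCodeg i) x) :=
  lin_pre (pathCodeg (i + 1)) (-(pre none ∘ₗ lin (pathCodeg i))) none (fun v _ => by
    rw [pathCodeg_succ_none, LinearMap.neg_apply, LinearMap.comp_apply, lin_single])

theorem pathCodeg_mem (i : ℕ) (v : Word) : pathCodeg i v ∈ movesSpan (-1) 0 v := by
  induction v generalizing i with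
  | nil => exact zero_mem _
  | cons x v ih =>
    cases x with
    | none =>
      cases i with
      | zero => exact dropMark_mem (none :: v)
      | succ i =>
        rw [pathCodeg_succ_none]
        exact neg_mem (pre_mem_movesSpan (ih i) none)
    | some a =>
      rw [pathCodeg_some]
      exact Submodule.smul_mem _ _ (pre_mem_movesSpan (ih i) _)

theorem codeg_pre_some (i : ℕ) {a : ℕ} {s : ℤ} {x : Word →₀ ℤ} (h : x ∈ signed a s) :
    lin (pathCodeg i) (pre (some a) x) = s • pre (some a) (lin (pathCodeg i) x) :=
  lin_pre _ (s • (pre (some a) ∘ₗ lin (pathCodeg i))) _ fun v hv => by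
    rw [LinearMap.smul_apply, LinearMap.comp_apply, lin_single, pathCodeg_some,
      show _ = _ from h hv]

theorem pathCodeg_mem_degSpan (i : ℕ) {v : Word} (h : IsDegenerate v) :
    pathCodeg i v ∈ degSpan := by
  induction h generalizing i with
  | pair a w =>
    rw [pathCodeg_some, pathCodeg_some, map_smul]
    exact Submodule.smul_mem _ _ (Submodule.smul_mem _ _ (pre_pre_mem_degSpan _ _))
  | @cons x w h ih =>
    cases x with
    | none =>
      cases i with
      | zero => exact single_mem_degSpan h 1
      | succ i =>
        rw [pathCodeg_succ_none]
        exact neg_mem (pre_mem_degSpan _ (ih i))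
    | some a =>
      rw [pathCodeg_some]
      exact Submodule.smul_mem _ _ (pre_mem_degSpan _ (ih i))

theorem codeg_dropMark (i : ℕ) (x : Word →₀ ℤ) :
    lin (pathCodeg i) (lin dropMark x) + lin dropMark (lin (pathCodeg (i + 1)) x) = 0 := by
  refine eq_zero_of_words (L := lin (pathCodeg i) ∘ₗ lin dropMark +
    lin dropMark ∘ₗ lin (pathCodeg (i + 1))) (fun v => ?_) x
  simp only [LinearMap.add_apply, LinearMap.comp_apply]
  induction v with
  | nil => simp [lin_single, pathCodeg, dropMark]
  | cons y v ih =>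
    rw [← pre_single]
    cases y with
    | none => rw [dropMark_pre_none, codeg_pre_none, map_neg, dropMark_pre_none, add_neg_cancel]
    | some a =>
      have h := single_mem_signed a v
      rw [dropMark_pre_some h, codeg_pre_some _ h, map_smul, map_smul,
        codeg_pre_some _ (mem_signed dropMark_mem h),
        dropMark_pre_some (mem_signed (pathCodeg_mem _) h), ← smul_add, ← smul_add, ← map_add, ih,
        map_zero, smul_zero, smul_zero]

theorem pre_none_dropMark_mem_signed (a : ℕ) (x : Word →₀ ℤ) :
    pre none (lin dropMark (pre (some a) x)) ∈ signed a (-1) :=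
  pre_mem_signed (by simp) (mem_signed dropMark_mem (pre_self_mem_signed a x))

/-- The contracting homotopy sends conormal elements to conormal ones, since removing the point to
which it moves the first mark leaves a doubled step. -/
theorem dropMark_homotopy (v : Word) : lin dropMark (pathHomotopy v) ∈ degSpan := by
  induction v with
  | nil => exact (map_zero (lin dropMark)).symm ▸ zero_mem _
  | cons y v ih =>
    cases y with
    | none => exact (map_zero (lin dropMark)).symm ▸ zero_mem _
    | some a =>
      have h := single_mem_signed a v
      rw [← lin_single pathHomotopy, ← pre_single, homotopy_pre_some h, map_sub, map_smul,
        dropMark_pre_some (mem_signed pathHomotopy_mem h),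
        dropMark_pre_some (pre_none_dropMark_mem_signed a _), dropMark_pre_none,
        dropMark_pre_some h, lin_single, map_smul]
      exact sub_mem (Submodule.smul_mem _ _ (Submodule.smul_mem _ _ (pre_mem_degSpan _ ih)))
        (Submodule.smul_mem _ _ (Submodule.smul_mem _ _ (pre_pre_mem_degSpan _ _)))

theorem codeg_homotopy (i : ℕ) (x : Word →₀ ℤ) : lin (pathCodeg (i + 1)) (lin pathHomotopy x) +
    lin pathHomotopy (lin (pathCodeg (i + 1)) x) = 0 := by
  refine eq_zero_of_words (L := lin (pathCodeg (i + 1)) ∘ₗ lin pathHomotopy +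
    lin pathHomotopy ∘ₗ lin (pathCodeg (i + 1))) (fun v => ?_) x
  simp only [LinearMap.add_apply, LinearMap.comp_apply]
  induction v with
  | nil => simp [lin_single, pathCodeg, pathHomotopy]
  | cons y v ih =>
    rw [← pre_single]
    cases y with
    | none => rw [homotopy_pre_none, codeg_pre_none, map_neg, homotopy_pre_none, map_zero, neg_zero,
        add_zero]
    | some a =>
      have h := single_mem_signed a v
      have e := congrArg (fun z => pre (some a) z) ih
      have e' := congrArg (fun z => pre (some a) (pre none z))
        (codeg_dropMark i (pre (some a) (Finsupp.single v 1)))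
      simp only [map_add, map_zero] at e e'
      rw [homotopy_pre_some h, map_sub, map_smul, codeg_pre_some _ (mem_signed pathHomotopy_mem h),
        codeg_pre_some _ (pre_none_dropMark_mem_signed a _), codeg_pre_none]
      rw [codeg_pre_some _ h] at e' ⊢
      rw [map_smul, homotopy_pre_some (mem_signed (pathCodeg_mem _) h)]
      simp only [smul_sub, smul_smul, stepSign_mul_self, one_smul, map_neg, map_smul] at e' ⊢
      linear_combination (norm := module) e - e'

theorem odd_codegeneracy {i : ℕ} {v : Word} (h : i < marks v) :
    odd (codegeneracy i v) + 1 = odd v := by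
  induction v generalizing i with
  | nil => simp [marks] at h
  | cons x v ih =>
    cases x with
    | none =>
      rw [marks_none] at h
      cases i with
      | zero => rw [codegeneracy_zero_none, odd_none]
      | succ i => rw [codegeneracy_succ_none, odd_none, odd_none, ih (by omega)]
    | some a =>
      rw [marks_some] at h
      rw [codegeneracy_some, odd_some, odd_some, ← ih h]
      simp only [mem_codegeneracy]
      omega

/-- The codegeneracies of path-ordered words agree with those of words up to sign. -/
theorem pathCodeg_eq {i : ℕ} {v : Word} (h : i < marks v) :
    pathCodeg i v = Finsupp.single (codegeneracy i v)
      ((-1) ^ (twistExp v + twistExp (codegeneracy i v) + odd v + i + 1)) := by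
  induction v generalizing i with
  | nil => simp [marks] at h
  | cons x v ih =>
    cases x with
    | none =>
      rw [marks_none] at h
      cases i with
      | zero =>
        rw [codegeneracy_zero_none, pathCodeg_zero_none, twistExp_none, odd_none,
          Even.neg_one_pow ⟨twistExp v + odd v + 1, by ring⟩]
      | succ i =>
        have h' := odd_codegeneracy (i := i) (v := v) (by omega)
        rw [codegeneracy_succ_none, pathCodeg_succ_none, ih (by omega), pre_single,
          neg_single_neg_one_pow]
        rw [twistExp_none, twistExp_none, odd_none, ← h']
        push_cast
        linear_combination (-((odd (codegeneracy i v) : ZMod 2)) - 1) * two_zmod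
    | some a =>
      rw [marks_some] at h
      rw [codegeneracy_some, pathCodeg_some, ih h, pre_single, stepSign_smul_single]
      rw [twistExp_some, twistExp_some, odd_some, total_codegeneracy]
      simp only [mem_codegeneracy]
      push_cast
      split_ifs
      · linear_combination (-(total a v : ZMod 2)) * two_zmod
      · ring

theorem codeg_twistLin {c : ℕ∞} {n l i : ℕ} {p : ℤ} (hi : i ≤ l) {x : Word →₀ ℤ}
    (hx : x ∈ Finsupp.supported ℤ ℤ (lat c n (l + 1) p)) :
    twistLin (lin (pathCodeg i) (twistLin x)) = ((p + i + 1).negOnePow : ℤ) • codegLin i x := by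
  rw [lin_eq, extend_twistLin, codegLin, lin_eq, ← extend_smul_fun, map_extend]
  refine extend_congr fun v hv => ?_
  have hv' := hx hv
  have hp := parity_of_mem_lat hv'
  rw [← odd_eq_parity fun a ha => (hv'.1 a).1 ha] at hp
  have hm : marks v = l + 1 := hv'.2.1
  rw [pathCodeg_eq (by omega), Finsupp.smul_single, twistLin_single, Finsupp.smul_single,
    coe_negOnePow (a := odd v + i + 1) (by push_cast; rw [hp]), smul_eq_mul, smul_eq_mul, mul_one,
    twist, twist, ← pow_add, ← pow_add]
  congr 1
  apply neg_one_pow_congr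
  push_cast
  linear_combination (twistExp v + twistExp (codegeneracy i v) : ZMod 2) * two_zmod

theorem codeg_twistLin_mem {c : ℕ∞} {n l i : ℕ} {p : ℤ} (hi : i ≤ l) {x : Word →₀ ℤ}
    (hx : x ∈ Finsupp.supported ℤ ℤ (lat c n (l + 1) p)) :
    lin (pathCodeg i) (twistLin x) ∈ degSpan ↔ codegLin i x ∈ degSpan := by
  rw [← twistLin_mem_degSpan, codeg_twistLin hi hx]
  rcases Int.units_eq_one_or (p + i + 1).negOnePow with h | h <;> simp [h]

end PathCodegeneracy

/-! ### Conormal elements -/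

section Conormal

variable {c : ℕ∞} {n : ℕ}

/-- The path-ordered linear combinations of paths of degree `p` with `l` marks that all
codegeneracies send to combinations of degenerate paths. -/
def conormalPaths (c : ℕ∞) (n : ℕ) (p : ℤ) (l : ℕ) : Submodule ℤ (Word →₀ ℤ) :=
  Finsupp.supported ℤ ℤ (lat c n l p) ⊓ ⨅ (i : ℕ) (_ : i < l), degSpan.comap (lin (pathCodeg i))

theorem mem_conormalPaths {p : ℤ} {l : ℕ} {x : Word →₀ ℤ} : x ∈ conormalPaths c n p l ↔
    x ∈ Finsupp.supported ℤ ℤ (lat c n l p) ∧ ∀ i < l, lin (pathCodeg i) x ∈ degSpan := by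
  simp [conormalPaths, Submodule.mem_iInf]

theorem supported_lat_le_withMarks (p : ℤ) (l : ℕ) :
    Finsupp.supported ℤ ℤ (lat c n l p) ≤ withMarks l :=
  fun _ hx _ hv => (hx hv).2.1

theorem pathCobdry_mem_lat {p : ℤ} {l : ℕ} {x : Word →₀ ℤ}
    (hx : x ∈ Finsupp.supported ℤ ℤ (lat c n l p)) :
    pathCobdry x ∈ Finsupp.supported ℤ ℤ (lat c n (l + 1) (p + 1)) := by
  have h := mem_lat_of_moves pathCobdryTail_mem hx (l' := l + 1) (by simp)
  rw [sub_zero] at h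
  refine add_mem (fun w hw => ?_) h
  obtain ⟨v, hv, rfl⟩ := mem_support_pre hw
  have := (moves_mark v).mem_lat (hx hv) (l' := l + 1) (by simp)
  rwa [sub_zero] at this

theorem dropMark_mem_lat {p : ℤ} {l : ℕ} {x : Word →₀ ℤ}
    (hx : x ∈ Finsupp.supported ℤ ℤ (lat c n (l + 1) p)) :
    lin dropMark x ∈ Finsupp.supported ℤ ℤ (lat c n l (p - 1)) := by
  have h := mem_lat_of_moves dropMark_mem hx (l' := l) (by simp)
  rwa [sub_zero, ← sub_eq_add_neg] at h

theorem pathHomotopy_mem_lat {p : ℤ} {l : ℕ} {x : Word →₀ ℤ}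
    (hx : x ∈ Finsupp.supported ℤ ℤ (lat c n l p)) :
    lin pathHomotopy x ∈ Finsupp.supported ℤ ℤ (lat c n l (p - 1)) := by
  have h := mem_lat_of_moves pathHomotopy_mem hx (l' := l) (by simp)
  rwa [add_zero] at h

theorem lt_of_mem_supported_lat {p : ℤ} {l : ℕ} {x : Word →₀ ℤ}
    (hx : x ∈ Finsupp.supported ℤ ℤ (lat c n l p)) : ∀ v ∈ x.support, ∀ a, some a ∈ v → a < n :=
  fun _ hv a ha => ((hx hv).1 a).1 ha

theorem dropMark_mem_conormalPaths {p : ℤ} {l : ℕ} {x : Word →₀ ℤ}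
    (hx : x ∈ conormalPaths c n p (l + 1)) : lin dropMark x ∈ conormalPaths c n (p - 1) l := by
  rw [mem_conormalPaths] at hx ⊢
  have h := hx.2 0 (Nat.succ_pos l)
  rw [pathCodeg_zero] at h
  exact ⟨dropMark_mem_lat hx.1, fun i _ => lin_mem_degSpan (fun _ => pathCodeg_mem_degSpan i) h⟩

theorem pathHomotopy_mem_conormalPaths {p : ℤ} {l : ℕ} {x : Word →₀ ℤ}
    (hx : x ∈ conormalPaths c n p l) : lin pathHomotopy x ∈ conormalPaths c n (p - 1) l := by
  rw [mem_conormalPaths] at hx ⊢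
  refine ⟨pathHomotopy_mem_lat hx.1, fun i hi => ?_⟩
  cases i with
  | zero =>
    rw [pathCodeg_zero, lin_eq pathHomotopy, map_extend]
    exact extend_mem fun v _ => dropMark_homotopy v
  | succ i =>
    rw [eq_neg_of_add_eq_zero_left (codeg_homotopy i x)]
    exact neg_mem (lin_mem_degSpan (fun _ => pathHomotopy_mem_degSpan) (hx.2 _ hi))

theorem extend_parity_smul {p : ℤ} {l : ℕ} {x : Word →₀ ℤ} (φ : Word → (Word →₀ ℤ))
    (hx : x ∈ Finsupp.supported ℤ ℤ (lat c n l p)) :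
    extend (fun v => -(-1 : ℤ) ^ parity n v • φ v) x = -(p.negOnePow : ℤ) • extend φ x := by
  rw [← extend_smul_fun]
  exact extend_congr fun v hv => by
    rw [coe_negOnePow (parity_of_mem_lat (hx hv))]

theorem pathCobdry_mem_conormalPaths {p : ℤ} {l : ℕ} {x : Word →₀ ℤ}
    (hx : x ∈ conormalPaths c n p l) : pathCobdry x ∈ conormalPaths c n (p + 1) (l + 1) := by
  rw [mem_conormalPaths] at hx ⊢
  refine ⟨pathCobdry_mem_lat hx.1, fun j hj => ?_⟩
  have hy := twistLin_mem hx.1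
  have h := twistLin_extend_cobdryWord (lt_of_mem_supported_lat hy)
  rw [twistLin_twistLin] at h
  have hz : twistLin (pathCobdry x) = (p.negOnePow : ℤ) • extend cobdryWord (twistLin x) := by
    rw [extend_parity_smul _ hy] at h
    rw [← neg_neg (pathCobdry x), ← h, map_neg, twistLin_twistLin, neg_smul, neg_neg]
  rw [← twistLin_twistLin (pathCobdry x),
    codeg_twistLin_mem (Nat.le_of_lt_succ hj) (twistLin_mem (pathCobdry_mem_lat hx.1)), hz, map_smul]
  refine Submodule.smul_mem _ _ (codegLin_cobdryWord (Nat.le_of_lt_succ hj)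
    (supported_lat_le_withMarks p l hy) fun i hi => ?_)
  obtain ⟨k, rfl⟩ := Nat.exists_eq_add_of_le' (Nat.one_le_of_lt hi)
  rw [← codeg_twistLin_mem (by omega) hy, twistLin_twistLin]
  exact hx.2 i hi

theorem mem_conormal_iff {p : ℤ} {f : Cochain} (hf : f ∈ latCochains c n p) :
    f ∈ conormal ↔ ∀ l, twistLin (f l) ∈ conormalPaths c n p l := by
  have hf' : ∀ l, f l ∈ Finsupp.supported ℤ ℤ (lat c n l p) := mem_latCochains.1 hf
  rw [mem_conormal]
  constructor
  · intro h l
    refine mem_conormalPaths.2 ⟨twistLin_mem (hf' l), fun i hi => ?_⟩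
    obtain ⟨k, rfl⟩ := Nat.exists_eq_add_of_le' (Nat.one_le_of_lt hi)
    exact (codeg_twistLin_mem (by omega) (hf' _)).2 (h k i (by omega))
  · intro h l i hi
    exact (codeg_twistLin_mem hi (hf' _)).1 ((mem_conormalPaths.1 (h (l + 1))).2 i (by omega))

theorem mem_degenerate_iff {f : Cochain} :
    f ∈ degenerate ↔ ∀ l, twistLin (f l) ∈ degSpan := by
  simp only [mem_degenerate, twistLin_mem_degSpan]

theorem pathBdry_mem_lat {p : ℤ} {l : ℕ} {x : Word →₀ ℤ}
    (hx : x ∈ Finsupp.supported ℤ ℤ (lat c n l p)) :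
    lin pathBdry x ∈ Finsupp.supported ℤ ℤ (lat c n l (p + 1)) := by
  have h := mem_lat_of_moves pathBdry_mem hx (l' := l) (by simp)
  rwa [add_zero, sub_neg_eq_add] at h

theorem codegLin_bdry (j : ℕ) (x : Word →₀ ℤ) :
    codegLin j (extend (bdryWord n) x) = extend (bdryWord n) (codegLin j x) := by
  rw [codegLin_extend, extend_codegLin]
  simp only [codegLin_bdryWord]

theorem extend_bdryWord_mem_degSpan {x : Word →₀ ℤ} (hx : x ∈ degSpan)
    (hn : ∀ v ∈ x.support, ∀ a, some a ∈ v → a < n) : extend (bdryWord n) x ∈ degSpan := by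
  rw [← twistLin_mem_degSpan, twistLin_extend_bdryWord hn]
  exact lin_mem_degSpan (fun _ => pathBdry_mem_degSpan) (twistLin_mem_degSpan.2 hx)

theorem codegLin_lt {j : ℕ} {x : Word →₀ ℤ} (hn : ∀ v ∈ x.support, ∀ a, some a ∈ v → a < n) :
    ∀ v ∈ (codegLin j x).support, ∀ a, some a ∈ v → a < n :=
  (extend_mem (S := Finsupp.supported ℤ ℤ {v : Word | ∀ a, some a ∈ v → a < n}) fun v hv =>
    Finsupp.single_mem_supported ℤ 1 fun a ha => hn v hv a ((mem_codegeneracy j a v).1 ha) :)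

theorem bdry_mem_conormal {p : ℤ} {f : Cochain} (hf : f ∈ latCochains c n p) (h : f ∈ conormal) :
    bdry n f ∈ conormal := by
  rw [mem_conormal] at h ⊢
  intro l i hi
  rw [bdry, codegLin_bdry]
  exact extend_bdryWord_mem_degSpan (h l i hi)
    (codegLin_lt (lt_of_mem_supported_lat (mem_latCochains.1 hf (l + 1))))

theorem diff_mem_conormal {p : ℤ} {f : Cochain} (hf : f ∈ latCochains c n p) (h : f ∈ conormal) :
    diff n f ∈ conormal := by
  refine add_mem (bdry_mem_conormal hf h) (mem_conormal.2 fun l i hi => ?_)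
  rw [mem_conormal] at h
  have hf' := mem_latCochains.1 hf l
  rw [cobdry, extend_parity_smul _ hf', map_smul]
  refine Submodule.smul_mem _ _ (codegLin_cobdryWord hi (supported_lat_le_withMarks p l hf')
    fun j hj => ?_)
  obtain ⟨k, rfl⟩ := Nat.exists_eq_add_of_le' (Nat.one_le_of_lt hj)
  exact h k j (by omega)

theorem bdry_mem_degenerate {p : ℤ} {f : Cochain} (hf : f ∈ latCochains c n p)
    (h : f ∈ degenerate) : bdry n f ∈ degenerate := by
  rw [mem_degenerate] at h ⊢
  exact fun l => extend_bdryWord_mem_degSpan (h l)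
    (lt_of_mem_supported_lat (mem_latCochains.1 hf l))

theorem diff_mem_degenerate {p : ℤ} {f : Cochain} (hf : f ∈ latCochains c n p)
    (h : f ∈ degenerate) : diff n f ∈ degenerate := by
  have h' := mem_degenerate.1 h
  refine mem_degenerate_iff.2 fun l => ?_
  cases l with
  | zero =>
    rw [diff_zero, twistLin_mem_degSpan]
    exact mem_degenerate.1 (bdry_mem_degenerate hf h) 0
  | succ l =>
    rw [twistLin_diff_succ hf]
    exact sub_mem (lin_mem_degSpan (fun _ => pathBdry_mem_degSpan) (twistLin_mem_degSpan.2 (h' _)))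
      (pathCobdry_mem_degSpan (twistLin_mem_degSpan.2 (h' _)))

/-! ### Whiskerings of normalized elements -/

/-- Removing a mark from the new internal points of a whiskering leaves a doubled step. -/
theorem codeg_pathWhisker (i l : ℕ) {v : Word} (hv : marks v = 0) :
    lin (pathCodeg i) (pathWhisker l v) ∈ degSpan := by
  induction l generalizing v i with
  | zero =>
    rw [pathWhisker_zero, lin_single]
    have : pathCodeg i v = 0 := by
      induction v with
      | nil => rw [pathCodeg]
      | cons x v ih =>
        cases x with
        | none => simp [marks_none] at hv
        | some a => rw [pathCodeg_some, ih hv, map_zero, smul_zero]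
    rw [this]
    exact zero_mem _
  | succ l ihl =>
    induction v generalizing i with
    | nil =>
      rw [pathWhisker_succ_nil, map_zero]
      exact zero_mem _
    | cons x v ih =>
      cases x with
      | none => simp [marks_none] at hv
      | some a =>
        have h : pre none (pathWhisker l (some a :: v)) ∈ signed a (-1) :=
          pre_mem_signed (by simp) (mem_signed_word (whisker_mem_movesSpan l)
            (stepSign_of_mem List.mem_cons_self))
        rw [pathWhisker_succ_some, map_add,
          codeg_pre_some i (mem_signed_word (whisker_mem_movesSpan (l + 1)) rfl), codeg_pre_some i h]
        refine add_mem (Submodule.smul_mem _ _ (pre_mem_degSpan _ (ih i hv)))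
          (Submodule.smul_mem _ _ ?_)
        cases i with
        | zero =>
          rw [pathCodeg_zero, dropMark_pre_none]
          exact pre_pathWhisker_mem_degSpan a l v
        | succ i =>
          rw [codeg_pre_none]
          exact pre_mem_degSpan _ (neg_mem (pre_mem_degSpan _ (ihl i hv)))

theorem whisker_mem_conormal {p : ℤ} {f : Cochain} (hf : f ∈ latCochains c n p) :
    whisker f ∈ conormal := by
  have hw := whisker_mem hf
  refine (mem_conormal_iff hw).2 fun l => mem_conormalPaths.2
    ⟨twistLin_mem (mem_latCochains.1 hw l), fun i _ => ?_⟩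
  rw [twistLin_whisker hf, lin_eq (pathWhisker l), map_extend]
  exact extend_mem fun v hv => codeg_pathWhisker i l
    ((twistLin_mem (mem_latCochains.1 hf 0) : _) hv).2.1

theorem whisker_mem_degenerate {p : ℤ} {f : Cochain} (hf : f ∈ latCochains c n p)
    (h : f ∈ degenerate) : whisker f ∈ degenerate := by
  refine mem_degenerate_iff.2 fun l => ?_
  rw [twistLin_whisker hf]
  exact lin_mem_degSpan (fun _ => pathWhisker_mem_degSpan l)
    (twistLin_mem_degSpan.2 (mem_degenerate.1 h 0))

end Conormal

/-! ### Composition and degenerate paths -/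

section CompDegenerate

theorem IsDegenerate.exists_eq {v : Word} (h : IsDegenerate v) :
    ∃ (a : ℕ) (s t : Word), v = s ++ some a :: some a :: t := by
  induction h with
  | pair a w => exact ⟨a, [], w, rfl⟩
  | cons x _ ih =>
    obtain ⟨a, s, t, rfl⟩ := ih
    exact ⟨a, x :: s, t, rfl⟩

theorem isDegenerate_subst_of_ne (m : ℕ) {i a : ℕ} (ha : a ≠ i) (s t u : Word) :
    IsDegenerate (subst m i (s ++ some a :: some a :: t) u) := by
  refine subst_induction i (P := fun v u => ∀ s, v = s ++ some a :: some a :: t →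
    IsDegenerate (subst m i v u)) ?_ ?_ ?_ ?_ ?_ ?_ _ u s rfl
  · intro u s hs
    simp at hs
  · intro v u ih s hs
    rcases List.cons_eq_append_iff.1 hs with ⟨rfl, h⟩ | ⟨s', rfl, h⟩
    · simp at h
    · rw [subst_none]
      exact .cons _ (ih s' h)
  · intro b v u hb ih s hs
    rcases List.cons_eq_append_iff.1 hs with ⟨rfl, h⟩ | ⟨s', rfl, h⟩
    · simp only [List.cons.injEq, Option.some.injEq] at h
      obtain ⟨rfl, rfl⟩ := h
      rw [subst_some_ne _ _ hb, subst_some_ne _ _ hb]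
      exact .pair _ _
    · rw [subst_some_ne _ _ hb]
      exact .cons _ (ih s' h)
  · intro v ih s hs
    rcases List.cons_eq_append_iff.1 hs with ⟨rfl, h⟩ | ⟨s', rfl, h⟩
    · simp [ha] at h
    · rw [subst_some_nil]
      exact ih s' h
  · intro v u ih s hs
    rcases List.cons_eq_append_iff.1 hs with ⟨rfl, h⟩ | ⟨s', rfl, h⟩
    · simp [ha] at h
    · rw [subst_some_none]
      exact ih s' h
  · intro b v u ih s hs
    rw [subst_some_some]
    exact .cons _ (ih s hs)

/-- Substitution into a doubled step joins two consecutive parts of the substituted path. -/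
theorem subst_double (m i : ℕ) (s t u : Word) (h : s.count (some i) < marks u) :
    subst m i (s ++ some i :: some i :: t) u =
      subst m i (s ++ some i :: t) (codegeneracy (s.count (some i)) u) := by
  refine subst_induction i (P := fun v u => ∀ s, v = s ++ some i :: some i :: t →
    s.count (some i) < marks u → subst m i v u =
      subst m i (s ++ some i :: t) (codegeneracy (s.count (some i)) u)) ?_ ?_ ?_ ?_ ?_ ?_ _ u s rfl h
  · intro u s hs
    simp at hs
  · intro v u ih s hs hu
    rcases List.cons_eq_append_iff.1 hs with ⟨rfl, h⟩ | ⟨s', rfl, h⟩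
    · simp at h
    · rw [List.count_cons_of_ne (by simp)] at hu ⊢
      rw [subst_none, List.cons_append, subst_none, ih s' h hu]
  · intro b v u hb ih s hs hu
    rcases List.cons_eq_append_iff.1 hs with ⟨rfl, h⟩ | ⟨s', rfl, h⟩
    · simp [Ne.symm hb] at h
    · rw [List.count_cons_of_ne (by simpa using hb)] at hu ⊢
      rw [subst_some_ne _ _ hb, List.cons_append, subst_some_ne _ _ hb, ih s' h hu]
  · intro v ih s hs hu
    simp [marks] at hu
  · intro v u ih s hs hu
    rw [marks_none] at hu
    rcases List.cons_eq_append_iff.1 hs with ⟨rfl, h⟩ | ⟨s', rfl, h⟩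
    · simp only [List.cons.injEq, true_and] at h
      rw [subst_some_none, List.count_nil, codegeneracy_zero_none, ← h, List.nil_append]
    · rw [List.count_cons_self] at hu ⊢
      rw [subst_some_none, codegeneracy_succ_none, List.cons_append, subst_some_none,
        ih s' h (by omega)]
  · intro b v u ih s hs hu
    rw [marks_some] at hu
    rw [subst_some_some, codegeneracy_some, ih s hs hu]
    rcases List.cons_eq_append_iff.1 hs with ⟨rfl, h⟩ | ⟨s', rfl, h⟩
    · rw [List.nil_append, subst_some_some]
    · rw [List.cons_append, subst_some_some]

theorem Fits.isDegenerate_subst {i : ℕ} (m : ℕ) {v u : Word} (h : Fits i v u)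
    (hu : IsDegenerate u) : IsDegenerate (subst m i v u) := by
  refine fits_induction i (P := fun v u _ => IsDegenerate u → IsDegenerate (subst m i v u))
    ?_ ?_ ?_ ?_ ?_ ?_ v u h hu
  · intro h
    nomatch h
  · intro v u _ ih hu
    rw [subst_none]
    exact .cons _ (ih hu)
  · intro a v u ha _ ih hu
    rw [subst_some_ne _ _ ha]
    exact .cons _ (ih hu)
  · intro v _ _ h
    nomatch h
  · intro v u _ ih hu
    rw [subst_some_none]
    cases hu with
    | cons _ hu => exact ih hu
  · intro b v u _ ih hu
    rw [subst_some_some]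
    cases hu with
    | pair _ w =>
      rw [subst_some_some]
      exact .pair _ _
    | cons _ hu => exact .cons _ (ih hu)

variable {c : ℕ∞} {n m r i : ℕ} {p q : ℤ} {f g : Cochain}

theorem compWord_eq (hg : g ∈ latCochains c m q) (v : Word) : compWord n m i g v =
    ((q * (parity n v + total i v : ℕ)).negOnePow : ℤ) •
      extend (fun u => Finsupp.single (subst m i v u) 1) (g (dim v i)) := by
  rw [compWord, ← extend_smul_fun]
  refine extend_congr fun u hu => ?_
  rw [Finsupp.smul_single, smul_eq_mul, mul_one,
    coe_negOnePow (a := parity m u * (parity n v + total i v))]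
  push_cast
  rw [parity_of_mem_lat (mem_latCochains.1 hg _ u hu)]

/-- The composites of a degenerate path with conormal elements are degenerate: if the doubled step
is not replaced, it remains, and otherwise the composite depends only on a codegeneracy of the
element that replaces it. -/
theorem compWord_mem_degSpan_left (hg : g ∈ latCochains c m q) (hg' : g ∈ conormal) {v : Word}
    (hv : IsDegenerate v) : compWord n m i g v ∈ degSpan := by
  rw [compWord_eq hg]
  refine Submodule.smul_mem _ _ ?_
  obtain ⟨a, s, t, rfl⟩ := hv.exists_eq
  by_cases ha : a = i
  · subst ha
    obtain ⟨l, hl⟩ : ∃ l, l + 1 = dim (s ++ some a :: some a :: t) a :=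
      ⟨dim (s ++ some a :: t) a, by simp [dim]; omega⟩
    have hc : s.count (some a) ≤ l := by
      simp only [dim, List.count_append, List.count_cons_self] at hl
      omega
    have hd := mem_conormal.1 hg' l _ hc
    rw [← hl, show extend (fun u => Finsupp.single (subst m a (s ++ some a :: some a :: t) u) 1)
        (g (l + 1)) = extend (fun u => Finsupp.single (subst m a (s ++ some a :: t) u) 1)
          (codegLin (s.count (some a)) (g (l + 1))) by
      rw [extend_codegLin]
      refine extend_congr fun u hu => ?_
      have hm : marks u = l + 1 := (mem_latCochains.1 hg _ u hu).2.1
      rw [subst_double m a s t u (by omega)]]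
    have hm : codegLin (s.count (some a)) (g (l + 1)) ∈ withMarks l :=
      extend_mem fun u hu => by
        have hm : marks u = l + 1 := (mem_latCochains.1 hg _ u hu).2.1
        have := marks_codegeneracy (i := s.count (some a)) (v := u) (by omega)
        exact Finsupp.single_mem_supported ℤ 1 (show marks _ = l by omega)
    refine extend_mem fun u hu => single_mem_degSpan
      (Fits.isDegenerate_subst m (Or.inl ?_) (mem_degSpan.1 hd u hu)) 1
    have : marks u = l := hm hu
    simp only [dim, List.count_append, List.count_cons_self] at hl ⊢
    omega
  · exact extend_mem fun u _ => single_mem_degSpan (isDegenerate_subst_of_ne m ha s t u) 1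

theorem comp_mem_degenerate_left (hg : g ∈ latCochains c m q) (hg' : g ∈ conormal)
    (hf : f ∈ degenerate) : comp n m i f g ∈ degenerate := by
  rw [mem_degenerate] at hf ⊢
  intro l
  rw [comp_apply]
  exact extend_mem fun v hv => compWord_mem_degSpan_left hg hg' (mem_degSpan.1 (hf l) v hv)

theorem comp_mem_degenerate_right (hi : i < n) (hf : f ∈ latCochains c n p)
    (hg : g ∈ latCochains c m q) (hg' : g ∈ degenerate) : comp n m i f g ∈ degenerate := by
  rw [mem_degenerate] at hg' ⊢
  intro l
  rw [comp_apply]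
  refine extend_mem fun v hv => ?_
  rw [compWord_eq hg]
  refine Submodule.smul_mem _ _ (extend_mem fun u hu => single_mem_degSpan ?_ 1)
  exact ((mem_latCochains.1 hf l v hv).1.fits hi
    (mem_latCochains.1 hg _ u hu).2.1).isDegenerate_subst m (mem_degSpan.1 (hg' _) u hu)

theorem comp_mem_conormal (hf : f ∈ latCochains c n p) (hf' : f ∈ conormal)
    (hg : g ∈ latCochains c m q) (hg' : g ∈ conormal) : comp n m i f g ∈ conormal := by
  rw [mem_conormal]
  intro l j hj
  have h : codegLin j (comp n m i f g (l + 1)) =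
      (q.negOnePow : ℤ) • extend (compWord n m i g) (codegLin j (f (l + 1))) := by
    rw [comp_apply, codegLin_extend, extend_codegLin, ← extend_smul_fun]
    refine extend_congr fun v hv => ?_
    have hm : marks v = l + 1 := (mem_latCochains.1 hf _ v hv).2.1
    have hm' := marks_codegeneracy (i := j) (v := v) (by omega)
    have e : q * (parity n v + total i v : ℕ) =
        q + q * (parity n (codegeneracy j v) + total i (codegeneracy j v) : ℕ) := by
      rw [parity, parity, total_codegeneracy, total_codegeneracy, ← hm']
      push_cast
      ring
    rw [compWord_eq hg, compWord_eq hg, map_smul, codegLin_extend, dim_codegeneracy, smul_smul, e,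
      Int.negOnePow_add, Units.val_mul]
    simp only [codegLin_single, codegeneracy_subst]
  rw [h]
  exact Submodule.smul_mem _ _ (extend_mem fun v hv =>
    compWord_mem_degSpan_left hg hg' (mem_degSpan.1 (mem_conormal.1 hf' l j hj) v hv))

theorem perm_mem_degenerate (σ : Equiv.Perm (Fin n)) (hf : f ∈ degenerate) :
    perm n σ f ∈ degenerate := by
  rw [mem_degenerate] at hf ⊢
  intro l
  rw [perm_apply]
  exact extend_mem fun v hv => single_mem_degSpan ((mem_degSpan.1 (hf l) v hv).permWord σ) _

theorem perm_mem_conormal (σ : Equiv.Perm (Fin n)) (hf : f ∈ conormal) :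
    perm n σ f ∈ conormal := by
  rw [mem_conormal] at hf ⊢
  intro l j hj
  have h : codegLin j (perm n σ f (l + 1)) =
      extend (fun v => Finsupp.single (permWord σ v) (permSign σ v)) (codegLin j (f (l + 1))) := by
    rw [perm_apply, codegLin_extend, extend_codegLin]
    simp only [codegLin_single, codegeneracy_permWord, permSign, dim_codegeneracy]
  rw [h]
  exact extend_mem fun v hv =>
    single_mem_degSpan ((mem_degSpan.1 (hf l j hj) v hv).permWord σ) _

end CompDegenerate

/-! ### The operads and the morphisms -/

section Operads

variable {c : ℕ∞} {n : ℕ} {p : ℤ} {f : Cochain}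

theorem mem_braceCochains :
    f ∈ braceCochains c n p ↔ f ∈ latCochains c n p ∧ ∀ l, l ≠ 0 → f l = 0 := by
  simp [braceCochains, Submodule.mem_pi]

theorem bdry_mem_brace (hf : f ∈ braceCochains c n p) : bdry n f ∈ braceCochains c n (p + 1) := by
  rw [mem_braceCochains] at hf ⊢
  exact ⟨bdry_mem hf.1, fun l hl => by rw [bdry, hf.2 l hl, extend_zero]⟩

theorem perm_mem_brace (σ : Equiv.Perm (Fin n)) (hf : f ∈ braceCochains c n p) :
    perm n σ f ∈ braceCochains c n p := by
  rw [mem_braceCochains] at hf ⊢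
  exact ⟨perm_mem σ hf.1, fun l hl => by rw [perm_apply, hf.2 l hl, extend_zero]⟩

theorem comp_mem_brace {m r : ℕ} {q s : ℤ} (i : Fin n) (hr : n + m = r + 1) (hs : p + q = s)
    {g : Cochain} (hf : f ∈ braceCochains c n p) (hg : g ∈ latCochains c m q) :
    comp n m i f g ∈ braceCochains c r s := by
  rw [mem_braceCochains] at hf ⊢
  exact ⟨comp_mem i hr hs hf.1 hg, fun l hl => by rw [comp_apply, hf.2 l hl, extend_zero]⟩

theorem braceUnit_mem (c : ℕ∞) : braceUnit ∈ braceCochains c 1 0 := by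
  refine mem_braceCochains.2 ⟨mem_latCochains.2 fun l => ?_, fun l hl => ?_⟩
  · cases l with
    | zero =>
      have h := mem_latCochains.1 (unit_mem (c := c)) 0
      rwa [unit_apply, unitWord_zero] at h
    | succ l => simp [braceUnit]
  · obtain ⟨l, rfl⟩ := Nat.exists_eq_succ_of_ne_zero hl
    rfl

theorem bdry_add (n : ℕ) (f g : Cochain) : bdry n (f + g) = bdry n f + bdry n g :=
  funext fun _ => extend_add _ _ _

theorem unit_mem_conormal : unit ∈ conormal := by
  rw [← whisker_braceUnit]
  exact whisker_mem_conormal (mem_braceCochains.1 (braceUnit_mem ⊤)).1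

theorem whisker_injOn (hf : f ∈ braceCochains c n p) (h : whisker f = 0) : f = 0 := by
  rw [mem_braceCochains] at hf
  funext l
  by_cases hl : l = 0
  · rw [hl, ← whisker_zero hf.1, h]
  · exact hf.2 l hl

theorem braceOperad_closed (c : ℕ∞) : (braceOperad c).Closed where
  d_add := bdry_add
  comp_add_left n m i x y z := by
    change comp n m i (x + y) (whisker z) = comp n m i x (whisker z) + comp n m i y (whisker z)
    simp only [comp_eq, map_add, LinearMap.add_apply]
  comp_add_right n m i x y z := by
    change comp n m i x (whisker (y + z)) = comp n m i x (whisker y) + comp n m i x (whisker z)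
    simp only [comp_eq, whisker_add, map_add]
  perm_add n σ := perm_add σ
  one_mem := braceUnit_mem c
  d_mem := bdry_mem_brace
  d_null {n p x} _ hx := by
    obtain rfl := (Submodule.mem_bot ℤ).1 hx
    exact (Submodule.mem_bot ℤ).2 (funext fun _ => extend_zero (bdryWord n))
  comp_mem i hr hs _ _ hx hy :=
    comp_mem_brace i hr hs hx (whisker_mem (mem_braceCochains.1 hy).1)
  comp_null_left {n m r p q s} i _ _ x y _ _ hx := by
    obtain rfl := (Submodule.mem_bot ℤ).1 hx
    refine (Submodule.mem_bot ℤ).2 ?_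
    change comp n m i 0 (whisker y) = 0
    rw [comp_eq, map_zero, LinearMap.zero_apply]
  comp_null_right {n m r p q s} i _ _ x y _ _ hy := by
    obtain rfl := (Submodule.mem_bot ℤ).1 hy
    refine (Submodule.mem_bot ℤ).2 ?_
    have h : whisker 0 = 0 := funext fun _ => extend_zero _
    change comp n m i x (whisker 0) = 0
    rw [h, comp_eq, map_zero]
  perm_mem := perm_mem_brace
  perm_null {n p x} σ _ hx := by
    obtain rfl := (Submodule.mem_bot ℤ).1 hx
    refine (Submodule.mem_bot ℤ).2 ?_
    change perm n σ 0 = 0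
    rw [perm_eq, map_zero]

theorem braceOperad_laws (c : ℕ∞) : (braceOperad c).Laws :=
  (latOperad_laws c).pullback (braceOperad_closed c) (AddMonoidHom.mk' whisker whisker_add)
    (fun hx => whisker_mem (mem_braceCochains.1 hx).1)
    (fun hx h => (Submodule.mem_bot ℤ).2 (whisker_injOn hx ((Submodule.mem_bot ℤ).1 h)))
    (fun hx => whisker_bdry (mem_braceCochains.1 hx).1) whisker_braceUnit
    (fun i _ _ _ _ hf hg => whisker_comp i (mem_braceCochains.1 hf).1 (mem_braceCochains.1 hg).1)
    (fun σ hx => whisker_perm σ (mem_braceCochains.1 hx).1)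

theorem normalizedBraceOperad_closed (c : ℕ∞) : (normalizedBraceOperad c).Closed :=
  { braceOperad_closed c with
    d_null := fun hx h => bdry_mem_degenerate (mem_braceCochains.1 hx).1 h
    comp_null_left := fun i _ _ _ _ _ hy h => by
      have hy' := (mem_braceCochains.1 hy).1
      exact comp_mem_degenerate_left (whisker_mem hy') (whisker_mem_conormal hy') h
    comp_null_right := fun i _ _ _ _ hx hy h => by
      have hy' := (mem_braceCochains.1 hy).1
      exact comp_mem_degenerate_right i.2 (mem_braceCochains.1 hx).1 (whisker_mem hy')
        (whisker_mem_degenerate hy' h)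
    perm_null := fun σ _ h => perm_mem_degenerate σ h }

theorem normalizedBraceOperad_laws (c : ℕ∞) : (normalizedBraceOperad c).Laws :=
  (braceOperad_laws c).pullback (normalizedBraceOperad_closed c) (AddMonoidHom.id _)
    (fun hx => hx) (fun _ h => by
      obtain rfl := (Submodule.mem_bot ℤ).1 h
      exact zero_mem _) (fun _ => rfl) rfl
    (fun _ _ _ _ _ _ _ => rfl) (fun _ _ => rfl)

theorem normalizedLatOperad_closed (c : ℕ∞) : (normalizedLatOperad c).Closed :=
  { latOperad_closed c with
    one_mem := ⟨unit_mem, unit_mem_conormal⟩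
    d_mem := fun hx => ⟨diff_mem hx.1, diff_mem_conormal hx.1 hx.2⟩
    d_null := fun hx h => diff_mem_degenerate hx.1 h
    comp_mem := fun i hr hs _ _ hx hy =>
      ⟨comp_mem i hr hs hx.1 hy.1, comp_mem_conormal hx.1 hx.2 hy.1 hy.2⟩
    comp_null_left := fun _ _ _ _ _ _ hy h => comp_mem_degenerate_left hy.1 hy.2 h
    comp_null_right := fun i _ _ _ _ hx hy h => comp_mem_degenerate_right i.2 hx.1 hy.1 h
    perm_mem := fun σ hx => ⟨perm_mem σ hx.1, perm_mem_conormal σ hx.2⟩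
    perm_null := fun σ _ h => perm_mem_degenerate σ h }

theorem normalizedLatOperad_laws (c : ℕ∞) : (normalizedLatOperad c).Laws :=
  (latOperad_laws c).pullback (normalizedLatOperad_closed c) (AddMonoidHom.id _)
    (fun hx => hx.1) (fun _ h => by
      obtain rfl := (Submodule.mem_bot ℤ).1 h
      exact zero_mem _) (fun _ => rfl) rfl
    (fun _ _ _ _ _ _ _ => rfl) (fun _ _ => rfl)

theorem sub_mem_of_eq {S : Submodule ℤ Cochain} {x y : Cochain} (h : x = y) : x - y ∈ S := by
  rw [h, sub_self]
  exact zero_mem _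

theorem whisker_compatible (c : ℕ∞) : (braceOperad c).Compatible (latOperad c) whisker where
  map_add := whisker_add
  mem hx := whisker_mem (mem_braceCochains.1 hx).1
  null _ hx := by
    rw [(Submodule.mem_bot ℤ).1 hx]
    exact (Submodule.mem_bot ℤ).2 (funext fun _ => extend_zero _)
  map_d hx := sub_mem_of_eq (whisker_bdry (mem_braceCochains.1 hx).1)
  map_one := sub_mem_of_eq whisker_braceUnit
  map_comp i _ _ _ _ hf hg :=
    sub_mem_of_eq (whisker_comp i (mem_braceCochains.1 hf).1 (mem_braceCochains.1 hg).1)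
  map_perm σ hx := sub_mem_of_eq (whisker_perm σ (mem_braceCochains.1 hx).1)

theorem projection_compatible (c : ℕ∞) :
    (braceOperad c).Compatible (normalizedBraceOperad c) id where
  map_add _ _ := rfl
  mem hx := hx
  null _ h := (Submodule.mem_bot ℤ).1 h ▸ zero_mem _
  map_d _ := sub_mem_of_eq rfl
  map_one := sub_mem_of_eq rfl
  map_comp _ _ _ _ _ _ _ := sub_mem_of_eq rfl
  map_perm _ _ := sub_mem_of_eq rfl

theorem normalized_whisker_compatible (c : ℕ∞) :
    (normalizedBraceOperad c).Compatible (normalizedLatOperad c) whisker where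
  map_add := whisker_add
  mem hx := ⟨whisker_mem (mem_braceCochains.1 hx).1,
    whisker_mem_conormal (mem_braceCochains.1 hx).1⟩
  null hx h := whisker_mem_degenerate (mem_braceCochains.1 hx).1 h
  map_d hx := sub_mem_of_eq (whisker_bdry (mem_braceCochains.1 hx).1)
  map_one := sub_mem_of_eq whisker_braceUnit
  map_comp i _ _ _ _ hf hg :=
    sub_mem_of_eq (whisker_comp i (mem_braceCochains.1 hf).1 (mem_braceCochains.1 hg).1)
  map_perm σ hx := sub_mem_of_eq (whisker_perm σ (mem_braceCochains.1 hx).1)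

end Operads

/-! ### The whiskerings are weak equivalences -/

section Whiskering

variable {c : ℕ∞} {n : ℕ} {p : ℤ} {f : Cochain}

/-- The part of a cochain without marks. -/
def unmarkedPart (f : Cochain) : Cochain := fun l => if l = 0 then f 0 else 0

theorem unmarkedPart_mem (hf : f ∈ latCochains c n p) : unmarkedPart f ∈ braceCochains c n p := by
  refine mem_braceCochains.2 ⟨mem_latCochains.2 fun l => ?_, fun l hl => if_neg hl⟩
  by_cases hl : l = 0
  · subst hl
    exact mem_latCochains.1 hf 0
  · rw [unmarkedPart, if_neg hl]
    simp

theorem bdry_unmarkedPart (n : ℕ) (f : Cochain) :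
    bdry n (unmarkedPart f) = unmarkedPart (diff n f) := by
  funext l
  by_cases hl : l = 0
  · subst hl
    exact (diff_zero n f).symm
  · simp only [bdry, unmarkedPart, if_neg hl, extend_zero]

theorem whisker_unmarkedPart_zero (hf : f ∈ latCochains c n p) :
    whisker (unmarkedPart f) 0 = f 0 :=
  whisker_zero (mem_braceCochains.1 (unmarkedPart_mem hf)).1

/-- Up to `W`, a cocycle is cohomologous to the whiskering of its part without marks. -/
theorem exists_whisker_sub_eq_diff (V : ℤ → ℕ → Submodule ℤ (Word →₀ ℤ))
    (W : Submodule ℤ (Word →₀ ℤ)) (hV : ∀ p l, V p l ≤ Finsupp.supported ℤ ℤ (lat c n l p))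
    (hVr : ∀ p l x, x ∈ V p (l + 1) → lin dropMark x ∈ V (p - 1) l)
    (hVh : ∀ p l x, x ∈ V p l → lin pathHomotopy x ∈ V (p - 1) l)
    (hVi : ∀ p l x, x ∈ V p l → pathCobdry x ∈ V (p + 1) (l + 1))
    (hWr : ∀ x ∈ W, lin dropMark x ∈ W) (hWh : ∀ x ∈ W, lin pathHomotopy x ∈ W)
    (hWi : ∀ x ∈ W, pathCobdry x ∈ W) (hWw : ∀ l, ∀ x ∈ W, lin (pathWhisker l) x ∈ W)
    (hy : f ∈ latCochains c n (p + 1)) (hyV : ∀ l, twistLin (f l) ∈ V (p + 1) l)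
    (hwV : ∀ l, twistLin (whisker (unmarkedPart f) l) ∈ V (p + 1) l)
    (hd : ∀ l, twistLin (diff n f l) ∈ W) :
    ∃ z ∈ latCochains c n p, (∀ l, twistLin (z l) ∈ V p l) ∧
      ∀ l, twistLin ((whisker (unmarkedPart f) - (f + diff n z)) l) ∈ W := by
  have hx := (mem_braceCochains.1 (unmarkedPart_mem hy)).1
  have hw := whisker_mem hx
  obtain ⟨z, hz, hz₀, hz₁⟩ := exists_boundary_of_closed V W
    (fun p l => (hV p l).trans (supported_lat_le_withMarks p l)) hVr hVh hVi hWr hWh hWi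
    (fun l => twistLin ((f - whisker (unmarkedPart f)) l))
    (fun l => by
      rw [Pi.sub_apply, map_sub]
      exact sub_mem (hyV l) (hwV l))
    (by rw [Pi.sub_apply, whisker_unmarkedPart_zero hy, sub_self, map_zero])
    (fun l => by
      rw [← twistLin_diff_succ (sub_mem hy hw)]
      have h : diff n (f - whisker (unmarkedPart f)) =
          diff n f - whisker (unmarkedPart (diff n f)) := by
        rw [eq_sub_iff_add_eq, ← bdry_unmarkedPart, whisker_bdry hx, ← diff_add, sub_add_cancel]
      rw [h, Pi.sub_apply, map_sub, twistLin_whisker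
        (mem_braceCochains.1 (unmarkedPart_mem (diff_mem hy))).1]
      exact sub_mem (hd _) (hWw _ _ (hd 0)))
  have hZ : (fun l => -twistLin (z l)) ∈ latCochains c n p :=
    mem_latCochains.2 fun l => neg_mem (twistLin_mem (hV p l (hz l)))
  refine ⟨fun l => -twistLin (z l), hZ, fun l => ?_, fun l => ?_⟩
  · rw [map_neg, twistLin_twistLin]
    exact neg_mem (hz l)
  · cases l with
    | zero =>
      rw [Pi.sub_apply, Pi.add_apply, whisker_unmarkedPart_zero hy, sub_add_cancel_left, diff_zero,
        map_neg, twistLin_bdry hZ, map_neg, map_neg, twistLin_twistLin, neg_neg]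
      exact hz₀
    | succ l =>
      have h := hz₁ l
      rw [Pi.sub_apply, map_sub] at h
      rw [Pi.sub_apply, Pi.add_apply, map_sub, map_add, twistLin_diff_succ hZ, map_neg, map_neg,
        map_neg, map_neg, twistLin_twistLin, twistLin_twistLin]
      convert h using 1
      abel

theorem whisker_isWeakEquivalence (c : ℕ∞) : (OperadData.toHom (braceOperad_closed c)
    (braceOperad_laws c) (latOperad_closed c) (latOperad_laws c)
    (whisker_compatible c)).IsWeakEquivalence := by
  refine OperadData.toHom_isWeakEquivalence _ _ _ _ _ ?_ ?_
  · intro n j x z hx hz _ h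
    have hx' := mem_braceCochains.1 hx
    refine ⟨unmarkedPart z, unmarkedPart_mem hz, (Submodule.mem_bot ℤ).2 ?_⟩
    have h' : whisker x = diff n z := sub_eq_zero.1 ((Submodule.mem_bot ℤ).1 h)
    change bdry n (unmarkedPart z) - x = 0
    rw [bdry_unmarkedPart, ← h', sub_eq_zero]
    funext l
    by_cases hl : l = 0
    · subst hl
      exact whisker_zero hx'.1
    · rw [hx'.2 l hl]
      exact if_neg hl
  · intro n j y hy h
    have h' : diff n y = 0 := (Submodule.mem_bot ℤ).1 h
    obtain ⟨z, hz, -, hz'⟩ := exists_whisker_sub_eq_diff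
      (fun p l => Finsupp.supported ℤ ℤ (lat c n l p)) ⊥ (fun _ _ => le_rfl)
      (fun _ _ _ => dropMark_mem_lat) (fun _ _ _ => pathHomotopy_mem_lat)
      (fun _ _ _ => pathCobdry_mem_lat) (fun x hx => by simp_all) (fun x hx => by simp_all)
      (fun x hx => by simp_all) (fun l x hx => by simp_all) hy
      (fun l => twistLin_mem (mem_latCochains.1 hy l))
      (fun l => twistLin_mem (mem_latCochains.1
        (whisker_mem (mem_braceCochains.1 (unmarkedPart_mem hy)).1) l))
      (fun l => by rw [h', Pi.zero_apply, map_zero]; exact zero_mem _)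
    refine ⟨unmarkedPart y, unmarkedPart_mem hy, z, hz, (Submodule.mem_bot ℤ).2 ?_,
      (Submodule.mem_bot ℤ).2 (funext fun l => twistLin_injective ?_)⟩
    · change bdry n (unmarkedPart y) = 0
      rw [bdry_unmarkedPart, h']
      exact funext fun l => ite_self _
    · rw [Pi.zero_apply, map_zero]
      exact (Submodule.mem_bot ℤ).1 (hz' l)

theorem unmarkedPart_mem_degenerate (hf : f ∈ degenerate) : unmarkedPart f ∈ degenerate := by
  rw [mem_degenerate] at hf ⊢
  intro l
  rw [unmarkedPart]
  split_ifs
  · exact hf 0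
  · exact zero_mem _

theorem normalized_whisker_isWeakEquivalence (c : ℕ∞) :
    (OperadData.toHom (normalizedBraceOperad_closed c) (normalizedBraceOperad_laws c)
      (normalizedLatOperad_closed c) (normalizedLatOperad_laws c)
      (normalized_whisker_compatible c)).IsWeakEquivalence := by
  refine OperadData.toHom_isWeakEquivalence _ _ _ _ _ ?_ ?_
  · intro n j x z hx hz _ h
    have hx' := mem_braceCochains.1 hx
    refine ⟨unmarkedPart z, unmarkedPart_mem hz.1, ?_⟩
    change bdry n (unmarkedPart z) - x ∈ degenerate
    have h' : bdry n (unmarkedPart z) - x = -unmarkedPart (whisker x - diff n z) := by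
      rw [bdry_unmarkedPart]
      funext l
      by_cases hl : l = 0
      · subst hl
        simp [unmarkedPart, whisker_zero hx'.1]
      · simp [unmarkedPart, hl, hx'.2 l hl]
    rw [h']
    exact neg_mem (unmarkedPart_mem_degenerate h)
  · intro n j y hy h
    obtain ⟨hy, hyc⟩ := hy
    have hx := (mem_braceCochains.1 (unmarkedPart_mem hy)).1
    obtain ⟨z, hz, hzV, hz'⟩ := exists_whisker_sub_eq_diff (conormalPaths c n) degSpan
      (fun _ _ => inf_le_left) (fun _ _ _ => dropMark_mem_conormalPaths)
      (fun _ _ _ => pathHomotopy_mem_conormalPaths) (fun _ _ _ => pathCobdry_mem_conormalPaths)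
      (fun _ => lin_mem_degSpan fun _ => dropMark_mem_degSpan)
      (fun _ => lin_mem_degSpan fun _ => pathHomotopy_mem_degSpan)
      (fun _ => pathCobdry_mem_degSpan)
      (fun l _ => lin_mem_degSpan fun _ => pathWhisker_mem_degSpan l) hy
      ((mem_conormal_iff hy).1 hyc)
      ((mem_conormal_iff (whisker_mem hx)).1 (whisker_mem_conormal hx))
      (mem_degenerate_iff.1 h)
    refine ⟨unmarkedPart y, unmarkedPart_mem hy, z, ⟨hz, (mem_conormal_iff hz).2 hzV⟩, ?_,
      mem_degenerate_iff.2 hz'⟩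
    change bdry n (unmarkedPart y) ∈ degenerate
    rw [bdry_unmarkedPart]
    exact unmarkedPart_mem_degenerate h

end Whiskering

/-! ### The degenerate subcomplex is acyclic -/

section Acyclic

/-- The step number `k`, counted from `0`, is followed by a step in the same direction. -/
inductive DegenerateAt : ℕ → Word → Prop
  | pair (a : ℕ) (w : Word) : DegenerateAt 0 (some a :: some a :: w)
  | cons (x : Option ℕ) {k : ℕ} {w : Word} : DegenerateAt k w → DegenerateAt (k + 1) (x :: w)

theorem DegenerateAt.isDegenerate {k : ℕ} {v : Word} (h : DegenerateAt k v) : IsDegenerate v := by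
  induction h with
  | pair a w => exact .pair a w
  | cons x _ ih => exact .cons x ih

theorem IsDegenerate.exists_degenerateAt {v : Word} (h : IsDegenerate v) :
    ∃ k < v.length, DegenerateAt k v := by
  induction h with
  | pair a w => exact ⟨0, by simp, .pair a w⟩
  | cons x _ ih =>
    obtain ⟨k, hk, h⟩ := ih
    exact ⟨k + 1, by simpa using hk, .cons x h⟩

/-- The filtration of the degenerate linear combinations by the position of a doubled step. -/
def degFiltration (k : ℕ) : Submodule ℤ (Word →₀ ℤ) :=
  Finsupp.supported ℤ ℤ {v | ∃ j < k, DegenerateAt j v}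

theorem degFiltration_mono {k l : ℕ} (h : k ≤ l) : degFiltration k ≤ degFiltration l :=
  fun _ hx _ hv => let ⟨j, hj, hv'⟩ := hx hv; ⟨j, hj.trans_le h, hv'⟩

theorem pre_mem_degFiltration (y : Option ℕ) {k : ℕ} {x : Word →₀ ℤ} (hx : x ∈ degFiltration k) :
    pre y x ∈ degFiltration (k + 1) := fun w hw => by
  obtain ⟨v, hv, rfl⟩ := mem_support_pre hw
  obtain ⟨j, hj, hv'⟩ := hx hv
  exact ⟨j + 1, Nat.succ_lt_succ hj, .cons y hv'⟩

theorem pre_pre_mem_degFiltration (a : ℕ) (x : Word →₀ ℤ) :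
    pre (some a) (pre (some a) x) ∈ degFiltration 1 := fun w hw => by
  obtain ⟨v, hv, rfl⟩ := mem_support_pre hw
  obtain ⟨v, -, rfl⟩ := mem_support_pre hv
  exact ⟨0, Nat.zero_lt_one, .pair a v⟩

/-- Repeat once more the first step that is followed by a step in the same direction. This is the
extra degeneracy that contracts the degenerate subcomplex. -/
def tripleStep : Word → (Word →₀ ℤ)
  | [] => 0
  | none :: v => -pre none (tripleStep v)
  | some a :: v => if v.head? = some (some a) then Finsupp.single (some a :: some a :: v) 1
      else stepSign a v • pre (some a) (tripleStep v)

theorem tripleStep_pair (a : ℕ) (v : Word) : tripleStep (some a :: some a :: v) =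
    Finsupp.single (some a :: some a :: some a :: v) 1 := by
  rw [tripleStep, List.head?_cons, if_pos rfl]

theorem triple_pre_pre (a : ℕ) (x : Word →₀ ℤ) : lin tripleStep (pre (some a) (pre (some a) x)) =
    pre (some a) (pre (some a) (pre (some a) x)) := by
  rw [lin_eq, extend_pre, extend_pre]
  simp only [tripleStep_pair, ← pre_single]
  rw [← map_extend, ← map_extend, ← map_extend, extend_id]

theorem triple_pre_none (x : Word →₀ ℤ) :
    lin tripleStep (pre none x) = -pre none (lin tripleStep x) :=
  lin_pre _ (-(pre none ∘ₗ lin tripleStep)) _ fun v _ => by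
    rw [LinearMap.neg_apply, LinearMap.comp_apply, lin_single, tripleStep]

theorem exists_tripleStep_eq_pre (a : ℕ) (v : Word) :
    ∃ x, tripleStep (some a :: v) = pre (some a) x := by
  rw [tripleStep]
  split_ifs
  · exact ⟨Finsupp.single (some a :: v) 1, (pre_single _ _ _).symm⟩
  · exact ⟨stepSign a v • tripleStep v, (map_smul _ _ _).symm⟩

theorem head_eq_cons {a : ℕ} {v : Word} (h : v.head? = some (some a)) : ∃ w, v = some a :: w := by
  cases v with
  | nil => simp at h
  | cons y w => exact ⟨w, by simpa using h⟩

/-- `tripleStep` commutes with prepending a step up to words that begin with a doubled step. -/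
theorem triple_pre_some_sub_mem {a : ℕ} {s : ℤ} {x : Word →₀ ℤ} (h : x ∈ signed a s) :
    lin tripleStep (pre (some a) x) - s • pre (some a) (lin tripleStep x) ∈ degFiltration 1 := by
  have e : lin tripleStep (pre (some a) x) - s • pre (some a) (lin tripleStep x) =
      extend (fun v => tripleStep (some a :: v) - s • pre (some a) (tripleStep v)) x := by
    have e := map_extend (lin tripleStep ∘ₗ pre (some a) - s • (pre (some a) ∘ₗ lin tripleStep))
      (fun v => Finsupp.single v 1) x
    rw [extend_id] at e
    simpa only [LinearMap.sub_apply, LinearMap.comp_apply, LinearMap.smul_apply, pre_single,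
      lin_single] using e
  rw [e]
  refine extend_mem fun v hv => ?_
  have hs : stepSign a v = s := h hv
  by_cases hh : v.head? = some (some a)
  · obtain ⟨w, rfl⟩ := head_eq_cons hh
    obtain ⟨y, hy⟩ := exists_tripleStep_eq_pre a w
    rw [tripleStep_pair, hy, ← pre_single, ← pre_single]
    exact sub_mem (pre_pre_mem_degFiltration _ _)
      (Submodule.smul_mem _ _ (pre_pre_mem_degFiltration _ _))
  · rw [tripleStep, if_neg hh, hs, sub_self]
    exact zero_mem _

theorem moves_double (a : ℕ) {v : Word} : Moves 0 1 (some a :: v) (some a :: some a :: v) where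
  dominated := .double a v
  marks_eq := by simp [marks_some]
  total_eq n hn := by
    rw [total_cons n (some a :: v), if_pos ⟨hn a List.mem_cons_self, List.mem_cons_self⟩]
    push_cast
    ring

theorem tripleStep_mem (v : Word) : tripleStep v ∈ movesSpan 0 1 v := by
  induction v with
  | nil => exact zero_mem _
  | cons x v ih =>
    cases x with
    | none => exact neg_mem (pre_mem_movesSpan ih none)
    | some a =>
      rw [tripleStep]
      split_ifs
      · exact Finsupp.single_mem_supported ℤ 1 (moves_double a)
      · exact Submodule.smul_mem _ _ (pre_mem_movesSpan ih _)

theorem tripleStep_mem_degSpan {v : Word} (h : IsDegenerate v) : tripleStep v ∈ degSpan := by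
  induction h with
  | pair a w =>
    rw [tripleStep_pair]
    exact single_mem_degSpan (.pair a _) 1
  | @cons x w h ih =>
    cases x with
    | none => exact neg_mem (pre_mem_degSpan _ ih)
    | some a =>
      rw [tripleStep]
      split_ifs
      · exact single_mem_degSpan (.cons _ (.cons _ h)) 1
      · exact Submodule.smul_mem _ _ (pre_mem_degSpan _ ih)

theorem exists_bdry_pair_eq (a : ℕ) (w : Word) :
    ∃ x, pathBdry (some a :: some a :: w) = pre (some a) (pre (some a) x) := by
  rw [pathBdry, if_pos List.mem_cons_self, pathBdry, dropStep, if_pos rfl]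
  by_cases ha : some a ∈ w
  · refine ⟨pathBdry w + dropStep a w, ?_⟩
    rw [if_pos ha, if_pos ha, add_zero, map_sub, pre_single, sub_sub_cancel]
  · refine ⟨-pathBdry w, ?_⟩
    rw [if_neg ha, if_neg ha, map_add, pre_single, ← sub_sub, sub_right_comm, sub_self, zero_sub,
      map_neg, map_neg]

theorem bdry_triple_pair (a : ℕ) (w : Word) :
    lin pathBdry (tripleStep (some a :: some a :: w)) +
      lin tripleStep (pathBdry (some a :: some a :: w)) =
        Finsupp.single (some a :: some a :: w) 1 := by
  obtain ⟨x, hx⟩ := exists_bdry_pair_eq a w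
  have hd : dropStep a (some a :: some a :: w) = 0 := by simp [dropStep]
  rw [tripleStep_pair, lin_single, pathBdry, if_pos List.mem_cons_self, hd, add_zero, hx,
    triple_pre_pre, sub_add_cancel]

theorem dropStep_triple {k : ℕ} {v : Word} (b : ℕ) (h : DegenerateAt k v) :
    lin (dropStep b) (tripleStep v) - lin tripleStep (dropStep b v) ∈ degFiltration k := by
  have pair : ∀ a w, lin (dropStep b) (tripleStep (some a :: some a :: w)) -
      lin tripleStep (dropStep b (some a :: some a :: w)) = 0 := fun a w => by
    rw [tripleStep_pair, lin_single]
    by_cases hb : a = b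
    · subst hb
      simp [dropStep]
    · simp only [dropStep, if_neg hb]
      rw [triple_pre_pre, sub_self]
  induction h with
  | pair a w =>
    rw [pair]
    exact zero_mem _
  | @cons x k w h ih =>
    cases x with
    | none =>
      rw [tripleStep, map_neg, dropStep_pre_ne (by simp), dropStep, triple_pre_none, neg_sub_neg,
        ← map_sub, ← neg_sub, map_neg]
      exact neg_mem (pre_mem_degFiltration _ ih)
    | some a =>
      by_cases hh : w.head? = some (some a)
      · obtain ⟨w, rfl⟩ := head_eq_cons hh
        rw [pair]
        exact zero_mem _
      · have hs := mem_signed_word (a := a) tripleStep_mem (v := w) rfl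
        rw [tripleStep, if_neg hh, map_smul]
        by_cases hb : a = b
        · subst hb
          rcases stepSign_cases a w with ⟨ha, h₁, h₂⟩ | ⟨ha, h₁, h₂⟩
          · rw [h₂] at hs
            rw [dropStep_pre_mem hs, dropStep, if_pos rfl, if_pos ha, map_zero, smul_zero, sub_zero]
            exact zero_mem _
          · rw [h₂] at hs
            rw [dropStep_pre_notMem hs, dropStep, if_pos rfl, if_neg ha, lin_single, h₂, one_smul,
              sub_self]
            exact zero_mem _
        · have h₁ := dropStep_mem_signed_ne hb (single_mem_signed a w)
          rw [lin_single] at h₁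
          have h₂ := triple_pre_some_sub_mem h₁
          rw [dropStep_pre_ne (by simpa using hb), dropStep, if_neg hb]
          have h₃ := sub_mem (Submodule.smul_mem _ (stepSign a w) (pre_mem_degFiltration (some a) ih))
            (degFiltration_mono (Nat.le_add_left 1 k) h₂)
          convert h₃ using 1
          rw [map_sub, smul_sub]
          abel

/-- Repeating a step is a contracting homotopy for degenerate paths, up to paths with an earlier
doubled step. -/
theorem bdry_triple {k : ℕ} {v : Word} (h : DegenerateAt k v) :
    lin pathBdry (tripleStep v) + lin tripleStep (pathBdry v) - Finsupp.single v 1 ∈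
      degFiltration k := by
  induction h with
  | pair a w =>
    rw [bdry_triple_pair, sub_self]
    exact zero_mem _
  | @cons x k w h ih =>
    cases x with
    | none =>
      have := pre_mem_degFiltration none ih
      rw [map_sub, map_add, pre_single] at this
      rwa [tripleStep, map_neg, bdry_pre_none, neg_neg, pathBdry, map_neg, triple_pre_none, neg_neg]
    | some a =>
      by_cases hh : w.head? = some (some a)
      · obtain ⟨w, rfl⟩ := head_eq_cons hh
        rw [bdry_triple_pair, sub_self]
        exact zero_mem _
      · have hs := mem_signed_word (a := a) tripleStep_mem (v := w) rfl
        have hb := mem_signed_word (a := a) pathBdry_mem (v := w) rfl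
        have ih' := pre_mem_degFiltration (some a) ih
        have hm := degFiltration_mono (Nat.le_add_left 1 k)
        rw [map_sub, map_add, pre_single] at ih'
        rw [tripleStep, if_neg hh, map_smul, pathBdry]
        rcases stepSign_cases a w with ⟨ha, h₁, h₂⟩ | ⟨ha, h₁, h₂⟩
        · rw [h₂] at hs hb
          rw [if_pos ha, h₂, bdry_pre_mem hs, map_sub, lin_single, map_add, map_add, map_add]
          have h₃ := hm (triple_pre_some_sub_mem hb)
          have h₄ := hm (triple_pre_some_sub_mem (dropStep_mem_signed a w))
          have h₅ := pre_mem_degFiltration (some a) (dropStep_triple a h)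
          rw [map_sub] at h₅
          rw [one_smul] at h₄
          convert sub_mem (sub_mem (add_mem ih' h₅) h₃) h₄ using 1
          module
        · rw [h₂] at hs hb
          rw [if_neg ha, h₂, bdry_pre_notMem hs]
          have h₃ := hm (triple_pre_some_sub_mem hb)
          convert add_mem ih' h₃ using 1
          module

theorem exists_mem_degFiltration {x : Word →₀ ℤ} (hx : x ∈ degSpan) :
    ∃ k, x ∈ degFiltration k := by
  refine ⟨x.support.sup List.length, fun v hv => ?_⟩
  obtain ⟨j, hj, h⟩ := (mem_degSpan.1 hx v hv).exists_degenerateAt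
  exact ⟨j, hj.trans_le (Finset.le_sup (f := List.length) hv), h⟩

theorem degFiltration_le (k : ℕ) : degFiltration k ≤ degSpan := fun _ hx =>
  mem_degSpan.2 fun _ hv => let ⟨_, _, h⟩ := hx hv; h.isDegenerate

variable {c : ℕ∞} {n : ℕ} {p : ℤ}

theorem single_mem_brace {x : Word →₀ ℤ} (hx : x ∈ Finsupp.supported ℤ ℤ (lat c n 0 p)) :
    (Pi.single 0 x : Cochain) ∈ braceCochains c n p := by
  refine mem_braceCochains.2 ⟨mem_latCochains.2 fun l => ?_, fun l hl => by
    rw [Pi.single_eq_of_ne hl]⟩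
  by_cases hl : l = 0
  · subst hl
    rw [Pi.single_eq_same]
    exact hx
  · rw [Pi.single_eq_of_ne hl]
    simp

theorem pathBdry_pathBdry {x : Word →₀ ℤ} (hx : x ∈ Finsupp.supported ℤ ℤ (lat c n 0 p)) :
    lin pathBdry (lin pathBdry x) = 0 := by
  have hf := single_mem_brace (twistLin_mem hx)
  have hf' := (mem_braceCochains.1 hf).1
  have h : bdry n (bdry n (Pi.single 0 (twistLin x))) = 0 :=
    (Submodule.mem_bot ℤ).1 ((braceOperad_laws c).d_d hf)
  have h₀ := congrArg twistLin (congrFun h 0)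
  rwa [twistLin_bdry (bdry_mem hf'), twistLin_bdry hf', Pi.single_eq_same, twistLin_twistLin,
    Pi.zero_apply, map_zero] at h₀

/-- Degenerate cycles bound degenerate elements, by induction on the filtration. -/
theorem exists_degenerate_boundary (k : ℕ) {x : Word →₀ ℤ}
    (hx : x ∈ Finsupp.supported ℤ ℤ (lat c n 0 (p + 1))) (hk : x ∈ degFiltration k)
    (hd : lin pathBdry x = 0) :
    ∃ y ∈ Finsupp.supported ℤ ℤ (lat c n 0 p), y ∈ degSpan ∧ lin pathBdry y = x := by
  induction k generalizing x with
  | zero =>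
    have : x = 0 := by
      rw [← Finsupp.support_eq_empty, Finset.eq_empty_iff_forall_notMem]
      intro v hv
      obtain ⟨j, hj, -⟩ := hk hv
      omega
    exact ⟨0, zero_mem _, zero_mem _, by rw [this, map_zero]⟩
  | succ k ih =>
    have hg := mem_lat_of_moves tripleStep_mem hx (l' := 0) (by simp)
    rw [show p + 1 + 0 - 1 = p by ring] at hg
    have hgd : lin tripleStep x ∈ degSpan :=
      lin_mem_degSpan (fun _ => tripleStep_mem_degSpan) (degFiltration_le _ hk)
    have hb : lin pathBdry (lin tripleStep x) - x ∈ degFiltration k := by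
      have e := map_extend (lin pathBdry ∘ₗ lin tripleStep + lin tripleStep ∘ₗ lin pathBdry -
        LinearMap.id) (fun v => Finsupp.single v 1) x
      rw [extend_id] at e
      simp only [LinearMap.sub_apply, LinearMap.add_apply, LinearMap.comp_apply, hd, map_zero,
        add_zero, LinearMap.id_apply, lin_single] at e
      rw [e]
      refine extend_mem fun v hv => ?_
      obtain ⟨j, hj, h⟩ := hk hv
      exact degFiltration_mono (Nat.le_of_lt_succ hj) (bdry_triple h)
    have hbb : lin pathBdry (lin pathBdry (lin tripleStep x)) = 0 := pathBdry_pathBdry hg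
    obtain ⟨y, hy, hyd, hxy⟩ := ih (sub_mem (pathBdry_mem_lat hg) hx) hb
      (by rw [map_sub, hd, hbb, sub_zero])
    exact ⟨lin tripleStep x - y, sub_mem hg hy, sub_mem hgd hyd, by
      rw [map_sub, hxy, sub_sub_cancel]⟩

theorem exists_degenerate_bdry_eq {f : Cochain} (hf : f ∈ braceCochains c n (p + 1))
    (hf' : f ∈ degenerate) (hd : bdry n f = 0) :
    ∃ t ∈ braceCochains c n p, t ∈ degenerate ∧ bdry n t = f := by
  have hb := mem_braceCochains.1 hf
  obtain ⟨k, hk⟩ := exists_mem_degFiltration (mem_degenerate_iff.1 hf' 0)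
  obtain ⟨y, hy, hyd, hxy⟩ := exists_degenerate_boundary k
    (twistLin_mem (mem_latCochains.1 hb.1 0)) hk
    (by rw [← twistLin_bdry hb.1, hd, Pi.zero_apply, map_zero])
  have ht := single_mem_brace (twistLin_mem hy)
  refine ⟨Pi.single 0 (twistLin y), ht, mem_degenerate.2 fun l => ?_, funext fun l => ?_⟩
  · by_cases hl : l = 0
    · subst hl
      rw [Pi.single_eq_same]
      exact twistLin_mem_degSpan.2 hyd
    · rw [Pi.single_eq_of_ne hl]
      exact zero_mem _
  · by_cases hl : l = 0
    · subst hl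
      refine twistLin_injective ?_
      rw [twistLin_bdry (mem_braceCochains.1 ht).1, Pi.single_eq_same, twistLin_twistLin, hxy]
    · rw [(mem_braceCochains.1 (bdry_mem_brace ht)).2 l hl, hb.2 l hl]

theorem projection_isWeakEquivalence (c : ℕ∞) : (OperadData.toHom (braceOperad_closed c)
    (braceOperad_laws c) (normalizedBraceOperad_closed c) (normalizedBraceOperad_laws c)
    (projection_compatible c)).IsWeakEquivalence := by
  refine OperadData.toHom_isWeakEquivalence _ _ _ _ _ ?_ ?_
  · intro n j x z hx hz hd h
    have hd' : bdry n x = 0 := (Submodule.mem_bot ℤ).1 hd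
    have hbb : bdry n (bdry n z) = 0 := (Submodule.mem_bot ℤ).1 ((braceOperad_laws c).d_d hz)
    obtain ⟨t, ht, -, hxt⟩ := exists_degenerate_bdry_eq (sub_mem hx (bdry_mem_brace hz)) h (by
      have e := bdry_add n (x - bdry n z) (bdry n z)
      rwa [sub_add_cancel, hd', hbb, add_zero, eq_comm] at e)
    refine ⟨z + t, add_mem hz ht, (Submodule.mem_bot ℤ).2 ?_⟩
    change bdry n (z + t) - x = 0
    rw [bdry_add, hxt]
    abel
  · intro n j y hy h
    have hbb : bdry n (bdry n y) = 0 := (Submodule.mem_bot ℤ).1 ((braceOperad_laws c).d_d hy)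
    obtain ⟨t, ht, htd, hyt⟩ := exists_degenerate_bdry_eq (bdry_mem_brace hy) h hbb
    refine ⟨y - t, sub_mem hy ht, 0, zero_mem _, (Submodule.mem_bot ℤ).2 ?_, ?_⟩
    · change bdry n (y - t) = 0
      have e := bdry_add n (y - t) t
      rwa [sub_add_cancel, hyt, right_eq_add] at e
    · change y - t - (y + bdry n 0) ∈ degenerate
      have h₀ : bdry n 0 = 0 := funext fun _ => extend_zero (bdryWord n)
      rw [h₀, add_zero, sub_sub_cancel_left]
      exact neg_mem htd

end Acyclic

end LatticePaths

end

theorem theorem3 (c : ℕ∞) :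
    ∃ (L B NB NL : LatticePaths.DGOperad)
      (hL : (LatticePaths.latOperad c).Realization L)
      (hB : (LatticePaths.braceOperad c).Realization B)
      (hNB : (LatticePaths.normalizedBraceOperad c).Realization NB)
      (hNL : (LatticePaths.normalizedLatOperad c).Realization NL)
      (w : B.Hom L) (π : B.Hom NB) (w' : NB.Hom NL),
      w.IsInducedBy hB hL LatticePaths.whisker ∧
      π.IsInducedBy hB hNB id ∧
      w'.IsInducedBy hNB hNL LatticePaths.whisker ∧
      w.IsWeakEquivalence ∧ π.IsWeakEquivalence ∧ w'.IsWeakEquivalence :=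
  ⟨_, _, _, _, _, _, _, _, _, _, _,
    LatticePaths.OperadData.toHom_isInducedBy (LatticePaths.braceOperad_closed c)
      (LatticePaths.braceOperad_laws c) (LatticePaths.latOperad_closed c)
      (LatticePaths.latOperad_laws c) (LatticePaths.whisker_compatible c),
    LatticePaths.OperadData.toHom_isInducedBy _ _ (LatticePaths.normalizedBraceOperad_closed c)
      (LatticePaths.normalizedBraceOperad_laws c) (LatticePaths.projection_compatible c),
    LatticePaths.OperadData.toHom_isInducedBy _ _ (LatticePaths.normalizedLatOperad_closed c)
      (LatticePaths.normalizedLatOperad_laws c) (LatticePaths.normalized_whisker_compatible c),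
    LatticePaths.whisker_isWeakEquivalence c, LatticePaths.projection_isWeakEquivalence c,
    LatticePaths.normalized_whisker_isWeakEquivalence c⟩
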